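/- Let $\lambda, c\in\mathbb{R}$ be constants and let $f(x)=\dfrac{\exp(\lambda x)}{x+c}$ for $x\in\mathbb{R}\setminus\{-c\}$. Time is the number of steps of a uniform real RAM (unit-cost exact real operations $+,-,\times,/,\sqrt{\cdot},\exp$ and comparisons, unit-cost addition, subtraction, halving and comparison of integers used as indices, random-access arrays; one program for inputs of all sizes). Then the following hold. (1) Let $x_1,\dots,x_a$ and $y_1,\dots,y_b$ be reals with $x_i+y_j\neq -c$ for all $i,j$, and let $\mathbf{M}=[f(x_i+y_j)]_{i=1,\dots,a}^{j=1,\dots,b}$. Then $\mathbf{M}$ is Cauchy-like of displacement rank at most $1$ with respect to the nodes $s_i=x_i+\frac c2$ and $t_j=-(y_j+\frac c2)$: we have $s_i\ne t_j$ for all $i,j$, and $\mathrm{diag}(s)\,\mathbf{M}-\mathbf{M}\,\mathrm{diag}(t)$ has rank at most $1$. (2) $f$ is $2$-cordial: there is an algorithm that, given any $a,b\ge 1$, any reals $x_1,\dots,x_a$, $y_1,\dots,y_b$ with $x_i+y_j\neq -c$ for all $i,j$, and any $\mathbf{v}\in\mathbb{R}^b$, computes the product $\mathbf{M}\mathbf{v}$,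 where $\mathbf{M}=[f(x_i+y_j)]_{i=1,\dots,a}^{j=1,\dots,b}$, in time $O((a+b)\log^2(a+b))$. (3) $f$-integration on $N$-vertex weighted trees takes $O(N\log^3 N)$ time: for all fixed $d_1,\dots,d_s\in\mathbb{N}$ ($s\ge 0$) there is an algorithm that, given a tree with vertex set $\{1,\dots,N\}$ and arbitrary positive real edge weights (as a list of weighted edges) in which no two (possibly equal) vertices are at shortest-path distance exactly $-c$, and a tensor field $\mathbf{X}\in\mathbb{R}^{N\times d_1\times\cdots\times d_s}$, computes the field $i\mapsto\sum_{j=1}^N f(\mathrm{dist}(i,j))\,\mathbf{X}[j]$ in time $O(N\log^3 N)$, all preprocessing of the tree included. Here $\mathrm{dist}$ is the shortest-path distance in the tree. The constants in the $O(\cdot)$ depend only on $\lambda$, $c$ and, in (3), on $d_1,\dots,d_s$. -/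

import Mathlib

open scoped Asymptotics

/-! ### The real RAM

A uniform-cost real RAM, presented as a structured programming language.  A machine has finitely many
(those that its program mentions) natural-number registers, real registers, natural-number arrays
and real arrays; arrays are random access and of unbounded length.  Unit-cost operations are:
addition, truncated subtraction, halving and comparison of natural numbers (used for indices and
loop counters); `+ - * /`, square root, exponential and comparison of real numbers; reading and
writing of a register or array cell.  A program is a finite text, the same for inputs of all sizes;
it may contain finitely many real constants.  There is no conversion from reals to integers. -/

namespace RealRAM

/-- The memory of the machine: `nreg k` and `rreg k` are scalar registers, `narr k i` and `rarr k i`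
are the cells number `i` of the array number `k`. -/
structure State where
  nreg : ℕ → ℕ
  rreg : ℕ → ℝ
  narr : ℕ → ℕ → ℕ
  rarr : ℕ → ℕ → ℝ

/-- Natural-number expressions. The register or array number is part of the program text; array
indices are computed. -/
inductive NExpr where
  | const (n : ℕ)
  | reg (k : ℕ)
  | get (k : ℕ) (i : NExpr)
  | add (e₁ e₂ : NExpr)
  | sub (e₁ e₂ : NExpr)
  | half (e : NExpr)

/-- Real expressions. -/
inductive RExpr where
  | const (r : ℝ)
  | reg (k : ℕ)
  | get (k : ℕ) (i : NExpr)
  | add (e₁ e₂ : RExpr)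
  | sub (e₁ e₂ : RExpr)
  | mul (e₁ e₂ : RExpr)
  | div (e₁ e₂ : RExpr)
  | sqrt (e : RExpr)
  | exp (e : RExpr)

/-- Tests. -/
inductive Test where
  | nlt (e₁ e₂ : NExpr)
  | neq (e₁ e₂ : NExpr)
  | rlt (e₁ e₂ : RExpr)
  | req (e₁ e₂ : RExpr)
  | not (b : Test)
  | and (b₁ b₂ : Test)

/-- Programs. -/
inductive Prog where
  | skip
  | nset (k : ℕ) (e : NExpr)
  | rset (k : ℕ) (e : RExpr)
  | nput (k : ℕ) (i : NExpr) (e : NExpr)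
  | rput (k : ℕ) (i : NExpr) (e : RExpr)
  | seq (p q : Prog)
  | cond (b : Test) (p q : Prog)
  | loop (b : Test) (p : Prog)

/-- Value of a natural-number expression. -/
def NExpr.eval (σ : State) : NExpr → ℕ
  | .const n => n
  | .reg k => σ.nreg k
  | .get k i => σ.narr k (i.eval σ)
  | .add e₁ e₂ => e₁.eval σ + e₂.eval σ
  | .sub e₁ e₂ => e₁.eval σ - e₂.eval σ
  | .half e => e.eval σ / 2

/-- Number of operations performed to evaluate a natural-number expression. -/
def NExpr.cost : NExpr → ℕ
  | .const _ => 1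
  | .reg _ => 1
  | .get _ i => i.cost + 1
  | .add e₁ e₂ => e₁.cost + e₂.cost + 1
  | .sub e₁ e₂ => e₁.cost + e₂.cost + 1
  | .half e => e.cost + 1

/-- Value of a real expression. Division by `0` and the square root of a negative number return `0`;
as tests against `0` have unit cost, this changes running times by a constant factor at most. -/
noncomputable def RExpr.eval (σ : State) : RExpr → ℝ
  | .const r => r
  | .reg k => σ.rreg k
  | .get k i => σ.rarr k (i.eval σ)
  | .add e₁ e₂ => e₁.eval σ + e₂.eval σ
  | .sub e₁ e₂ => e₁.eval σ - e₂.eval σ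
  | .mul e₁ e₂ => e₁.eval σ * e₂.eval σ
  | .div e₁ e₂ => e₁.eval σ / e₂.eval σ
  | .sqrt e => Real.sqrt (e.eval σ)
  | .exp e => Real.exp (e.eval σ)

/-- Number of operations performed to evaluate a real expression. -/
def RExpr.cost : RExpr → ℕ
  | .const _ => 1
  | .reg _ => 1
  | .get _ i => i.cost + 1
  | .add e₁ e₂ => e₁.cost + e₂.cost + 1
  | .sub e₁ e₂ => e₁.cost + e₂.cost + 1
  | .mul e₁ e₂ => e₁.cost + e₂.cost + 1
  | .div e₁ e₂ => e₁.cost + e₂.cost + 1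
  | .sqrt e => e.cost + 1
  | .exp e => e.cost + 1

/-- Truth of a test. -/
def Test.Holds (σ : State) : Test → Prop
  | .nlt e₁ e₂ => e₁.eval σ < e₂.eval σ
  | .neq e₁ e₂ => e₁.eval σ = e₂.eval σ
  | .rlt e₁ e₂ => e₁.eval σ < e₂.eval σ
  | .req e₁ e₂ => e₁.eval σ = e₂.eval σ
  | .not b => ¬ b.Holds σ
  | .and b₁ b₂ => b₁.Holds σ ∧ b₂.Holds σ

/-- Number of operations performed to evaluate a test. -/
def Test.cost : Test → ℕ
  | .nlt e₁ e₂ => e₁.cost + e₂.cost + 1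
  | .neq e₁ e₂ => e₁.cost + e₂.cost + 1
  | .rlt e₁ e₂ => e₁.cost + e₂.cost + 1
  | .req e₁ e₂ => e₁.cost + e₂.cost + 1
  | .not b => b.cost + 1
  | .and b₁ b₂ => b₁.cost + b₂.cost + 1

/-- `u` with its `k`-th entry replaced by `a`. -/
def upd {α : Type} (u : ℕ → α) (k : ℕ) (a : α) : ℕ → α :=
  fun m => if m = k then a else u m

/-- `Exec p σ t σ'`: the program `p`, started in the state `σ`, halts after `t` steps in the
state `σ'`. -/
inductive Exec : Prog → State → ℕ → State → Prop where
  | skip (σ : State) : Exec .skip σ 1 σ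
  | nset (σ : State) (k : ℕ) (e : NExpr) :
      Exec (.nset k e) σ (e.cost + 1) { σ with nreg := upd σ.nreg k (e.eval σ) }
  | rset (σ : State) (k : ℕ) (e : RExpr) :
      Exec (.rset k e) σ (e.cost + 1) { σ with rreg := upd σ.rreg k (e.eval σ) }
  | nput (σ : State) (k : ℕ) (i e : NExpr) :
      Exec (.nput k i e) σ (i.cost + e.cost + 1)
        { σ with narr := upd σ.narr k (upd (σ.narr k) (i.eval σ) (e.eval σ)) }
  | rput (σ : State) (k : ℕ) (i : NExpr) (e : RExpr) :
      Exec (.rput k i e) σ (i.cost + e.cost + 1)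
        { σ with rarr := upd σ.rarr k (upd (σ.rarr k) (i.eval σ) (e.eval σ)) }
  | seq {p q : Prog} {σ σ' σ'' : State} {t t' : ℕ} :
      Exec p σ t σ' → Exec q σ' t' σ'' → Exec (.seq p q) σ (t + t') σ''
  | cond_true {b : Test} {p q : Prog} {σ σ' : State} {t : ℕ} :
      b.Holds σ → Exec p σ t σ' → Exec (.cond b p q) σ (b.cost + t + 1) σ'
  | cond_false {b : Test} {p q : Prog} {σ σ' : State} {t : ℕ} :
      ¬ b.Holds σ → Exec q σ t σ' → Exec (.cond b p q) σ (b.cost + t + 1) σ'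
  | loop_stop {b : Test} {p : Prog} {σ : State} :
      ¬ b.Holds σ → Exec (.loop b p) σ (b.cost + 1) σ
  | loop_step {b : Test} {p : Prog} {σ σ' σ'' : State} {t t' : ℕ} :
      b.Holds σ → Exec p σ t σ' → Exec (.loop b p) σ' t' σ'' →
      Exec (.loop b p) σ (b.cost + t + t' + 1) σ''

/-- The program `p`, started in the state `σ`, halts after at most `T` steps in a state with the
property `Q`. (The machine is deterministic.) -/
def RunsWithin (p : Prog) (σ : State) (T : ℕ) (Q : State → Prop) : Prop :=
  ∃ t σ', Exec p σ t σ' ∧ t ≤ T ∧ Q σ'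

/-- The contents of an array in which a vector is stored, filled up with a default value. -/
def store {α : Type} [Zero α] {n : ℕ} (u : Fin n → α) : ℕ → α :=
  fun m => if h : m < n then u ⟨m, h⟩ else 0

/-- Memory in which all registers and arrays are zero. -/
def zeroState : State := ⟨fun _ => 0, fun _ => 0, fun _ _ => 0, fun _ _ => 0⟩

end RealRAM

/-! ### Matrices `[f (xᵢ + yⱼ)]`, Cauchy-like matrices, cordial functions -/

/-- The matrix `[f (xᵢ + yⱼ)]`. -/
def sumMatrix (f : ℝ → ℝ) {a b : ℕ} (x : Fin a → ℝ) (y : Fin b → ℝ) :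
    Matrix (Fin a) (Fin b) ℝ :=
  Matrix.of fun i j => f (x i + y j)

/-- `M` is Cauchy-like of displacement rank at most `r` with respect to the nodes `s`, `t`:
no `sᵢ` equals a `tⱼ`, and `diag s * M - M * diag t` has rank at most `r`. -/
def IsCauchyLike {a b : ℕ} (s : Fin a → ℝ) (t : Fin b → ℝ) (r : ℕ)
    (M : Matrix (Fin a) (Fin b) ℝ) : Prop :=
  (∀ i j, s i ≠ t j) ∧ (Matrix.diagonal s * M - M * Matrix.diagonal t).rank ≤ r

open RealRAM in
/-- Input of the multiplication of `[f (xᵢ + yⱼ)]` by a vector `v`: the sizes and `x`, `y`, `v`. -/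
def mulVecInput {a b : ℕ} (x : Fin a → ℝ) (y v : Fin b → ℝ) : State :=
  { zeroState with
    nreg := store ![a, b]
    rarr := fun k => match k with
      | 0 => store x
      | 1 => store y
      | 2 => store v
      | _ => fun _ => 0 }

open RealRAM in
/-- A function `f`, defined on `D ⊆ ℝ`, is `d`-cordial: some real RAM program, given any
`x₁, …, x_a`, `y₁, …, y_b` (`a, b ≥ 1`) with all `xᵢ + yⱼ` in `D` and any `v ∈ ℝᵇ`, computes the
product of the matrix `[f (xᵢ + yⱼ)]` and `v` (into the real array number `3`) in time
`O ((a + b) log ^ d (a + b))`. -/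
def IsCordialOn (f : ℝ → ℝ) (D : Set ℝ) (d : ℕ) : Prop :=
  ∃ (p : Prog) (T : ℕ → ℕ),
    (fun n => (T n : ℝ)) =O[Filter.atTop] (fun n : ℕ => (n : ℝ) * Real.log n ^ d) ∧
    ∀ (a b : ℕ), 1 ≤ a → 1 ≤ b → ∀ (x : Fin a → ℝ) (y v : Fin b → ℝ),
      (∀ i j, x i + y j ∈ D) →
      RunsWithin p (mulVecInput x y v) (T (a + b))
        (fun σ => ∀ i : Fin a, σ.rarr 3 i = (sumMatrix f x y).mulVec v i)

/-! ### Integration of tensor fields on weighted trees -/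

/-- A tree with vertices `0, …, N - 1` and positive edge weights. -/
structure WeightedTree (N : ℕ) where
  graph : SimpleGraph (Fin N)
  isTree : graph.IsTree
  weight : Sym2 (Fin N) → ℝ
  weight_pos : ∀ e ∈ graph.edgeSet, 0 < weight e

/-- Shortest-path distance: the least total weight of a walk. -/
noncomputable def WeightedTree.dist {N : ℕ} (G : WeightedTree N) (i j : Fin N) : ℝ :=
  sInf (Set.range fun p : G.graph.Walk i j => (p.edges.map G.weight).sum)

/-- `E` lists every edge of the tree exactly once, in any order and with any orientation. -/
def WeightedTree.IsEdgeList {N : ℕ} (G : WeightedTree N) (E : List (Fin N × Fin N)) : Prop :=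
  (E.map fun e => s(e.1, e.2)).Nodup ∧
    ∀ e, e ∈ (E.map fun e => s(e.1, e.2)) ↔ e ∈ G.graph.edgeSet

/-- A tensor field of shape `N × d₁ × ⋯ × dₛ`. -/
abbrev TensorField (N : ℕ) {s : ℕ} (d : Fin s → ℕ) : Type :=
  Fin N → ((k : Fin s) → Fin (d k)) → ℝ

/-- The `f`-integration of a tensor field `X` on a weighted tree: the product of the `f`-distance
matrix `[f (dist i j)]` and `X`. -/
noncomputable def fIntegral (f : ℝ → ℝ) {N s : ℕ} {d : Fin s → ℕ} (G : WeightedTree N)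
    (X : TensorField N d) : TensorField N d :=
  fun i q => ∑ j, f (G.dist i j) * X j q

/-- A tensor field as a linear array, in which the entries of `X i` stand in the consecutive places
`i * D, …, i * D + D - 1`, where `D = d₁ ⋯ dₛ`. -/
def TensorField.flatten {N s : ℕ} {d : Fin s → ℕ} (X : TensorField N d) :
    Fin (N * ∏ k, d k) → ℝ :=
  fun m => X (finProdFinEquiv.symm m).1 (finPiFinEquiv.symm (finProdFinEquiv.symm m).2)

open RealRAM in
/-- Input of the integration of `X`: the number of vertices, the list `E` of the edges with
their weights, and the field. -/
def integrationInput {N s : ℕ} {d : Fin s → ℕ} (G : WeightedTree N)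
    (E : List (Fin N × Fin N)) (X : TensorField N d) : State :=
  { zeroState with
    nreg := store ![N]
    narr := fun k => match k with
      | 0 => store fun m : Fin E.length => ((E.get m).1 : ℕ)
      | 1 => store fun m : Fin E.length => ((E.get m).2 : ℕ)
      | _ => fun _ => 0
    rarr := fun k => match k with
      | 0 => store fun m : Fin E.length => G.weight s((E.get m).1, (E.get m).2)
      | 1 => store X.flatten
      | _ => fun _ => 0 }

open RealRAM in
/-- For `f` defined on `D ⊆ ℝ`, `f`-integration on weighted trees with `N` vertices takes time
`O (g N)`: for every shape `d₁ × ⋯ × dₛ` some real RAM program, given any `N`-vertex weighted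
tree all whose distances are in `D`, as a list of weighted edges, and any tensor field of shape
`N × d₁ × ⋯ × dₛ`, computes the `f`-integration of the field (into the real array number `2`) in
time `O (g N)`. All preprocessing of the tree is included in the time. -/
def IntegrationInTimeOn (f : ℝ → ℝ) (D : Set ℝ) (g : ℕ → ℝ) : Prop :=
  ∀ (s : ℕ) (d : Fin s → ℕ), ∃ (p : Prog) (T : ℕ → ℕ),
    (fun N => (T N : ℝ)) =O[Filter.atTop] g ∧
    ∀ (N : ℕ) (G : WeightedTree N) (E : List (Fin N × Fin N)) (X : TensorField N d),
      G.IsEdgeList E → (∀ i j, G.dist i j ∈ D) →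
      RunsWithin p (integrationInput G E X) (T N)
        (fun σ => ∀ m : Fin (N * ∏ k, d k), σ.rarr 2 m = (fIntegral f G X).flatten m)

/-! ### Reasoning about programs -/

namespace RealRAM

/-! Because `exp (λ (x + y)) = exp (λ x) exp (λ y)`, the matrix is a Cauchy matrix `1 / (sᵢ - tⱼ)`
scaled from both sides. Multiplying its entries by `sᵢ - tⱼ` leaves a matrix of rank one
(`isCauchyLike_sumMatrix`), and the product with `v` is `exp (λ xᵢ)` times the rational function `∑
wⱼ / (z - tⱼ)`, with `wⱼ = vⱼ exp (λ yⱼ)`, evaluated at `z = sᵢ`.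

The fractions are added along a binary tree, which gives one numerator and one denominator
(`eval_num_div_den`). Both are then evaluated at all `sᵢ` by passing residues down the product tree
of the linear factors `X - sᵢ`. Each of the logarithmically many levels costs a bounded number of
transforms of linear size, and a transform takes time `n log n`; this gives `n log² n`
(`runsWithin_mulProg`).

The transform has to be real, as the machine has square roots but neither complex numbers nor
trigonometric functions. Roots of unity are replaced by the iterated preimages of `0` under `z ^ 2 -
2`. They form a binary tree inside `(-2, 2)`, and the `k`-th iterate is constant on the descendants
`k` levels below a node (`eval_node_iter`). In the basis of products of iterates, reduction to one
of the two children of a node is a single butterfly, so evaluation and interpolation run in `k`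
stages (`eval_fwd_stages`, `Rep.inv_of_eval`).

Division with remainder is avoided as well. If `F` has degree less than `2 ^ (k + 1)` and `G` has
degree `2 ^ k`, interpolate `κ = F / G` at the nodes below `2`. Then `F - κ G` is divisible by `iter
k - node 2`, and the quotient carries the values of `F` at the roots of `G` up to a factor
independent of `F` (`Rep.residues`). The factors collected on the way down depend only on the point
`sᵢ`; they are nonzero because all points are shifted beyond `2`, and they cancel between numerator
and denominator.

On a tree, a vertex `p` and a union `M` of branches below it separate a subtree `S` into `S \ M` and
`M ∪ {p}`, which share only `p`. The distance of `i ∉ M` and `j ∈ M` is `D p i + D p j`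
(`RootedTree.dist_branch`), so the sums across the cut are two products of the kind above. The
remaining pairs lie in exactly one of the parts (`rest_split`). Take for `p` the last vertex whose
branch has more than half of the vertices and add child branches greedily until they contain a
quarter: each part then has at most `4 / 5` of the edges (`MarkInv.balanced`). With logarithmic
depth and total size linear at every depth, a potential of edges times remaining height
(`StackInv.split`) yields `N log³ N`.

The parents come from stripping leaves. Each vertex keeps only its degree, the sum of its neighbours
and the sum of its edge weights; once one neighbour is left, the sums are that neighbour and that
weight (`StripInv.nbrs_eq`). The reverse of the order of removal numbers parents before children,
and `IsOrdering.rootedTree` turns this numbering into the recursion for shortest-path distances. -/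

@[simp] theorem upd_same {α : Type} (u : ℕ → α) (k : ℕ) (a : α) : upd u k a k = a := if_pos rfl

theorem upd_ne {α : Type} (u : ℕ → α) {k m : ℕ} (a : α) (h : m ≠ k) : upd u k a m = u m := if_neg h

/-- The natural-number registers a program writes to. -/
def Prog.wn : Prog → List ℕ
  | .nset k _ => [k]
  | .seq p q => p.wn ++ q.wn
  | .cond _ p q => p.wn ++ q.wn
  | .loop _ p => p.wn
  | _ => []

/-- The real registers a program writes to. -/
def Prog.wr : Prog → List ℕ
  | .rset k _ => [k]
  | .seq p q => p.wr ++ q.wr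
  | .cond _ p q => p.wr ++ q.wr
  | .loop _ p => p.wr
  | _ => []

/-- The natural-number arrays a program writes to. -/
def Prog.wna : Prog → List ℕ
  | .nput k _ _ => [k]
  | .seq p q => p.wna ++ q.wna
  | .cond _ p q => p.wna ++ q.wna
  | .loop _ p => p.wna
  | _ => []

/-- The real arrays a program writes to. -/
def Prog.wra : Prog → List ℕ
  | .rput k _ _ => [k]
  | .seq p q => p.wra ++ q.wra
  | .cond _ p q => p.wra ++ q.wra
  | .loop _ p => p.wra
  | _ => []

/-- The states `σ` and `τ` agree on everything the program `p` does not write to. -/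
structure Frame (p : Prog) (σ τ : State) : Prop where
  nreg : ∀ k, k ∉ p.wn → τ.nreg k = σ.nreg k
  rreg : ∀ k, k ∉ p.wr → τ.rreg k = σ.rreg k
  narr : ∀ k, k ∉ p.wna → τ.narr k = σ.narr k
  rarr : ∀ k, k ∉ p.wra → τ.rarr k = σ.rarr k

/-- The written registers and arrays are read off the program text, so everything outside these
lists is preserved without a separate argument for each program. -/
theorem Exec.frame {p : Prog} {σ τ : State} {t : ℕ} (h : Exec p σ t τ) : Frame p σ τ := by
  induction h with
  | skip σ => exact ⟨fun _ _ => rfl, fun _ _ => rfl, fun _ _ => rfl, fun _ _ => rfl⟩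
  | nset σ k e =>
    exact ⟨fun m hm => upd_ne _ _ (by simpa [Prog.wn] using hm), fun _ _ => rfl, fun _ _ => rfl,
      fun _ _ => rfl⟩
  | rset σ k e =>
    exact ⟨fun _ _ => rfl, fun m hm => upd_ne _ _ (by simpa [Prog.wr] using hm), fun _ _ => rfl,
      fun _ _ => rfl⟩
  | nput σ k i e =>
    exact ⟨fun _ _ => rfl, fun _ _ => rfl, fun m hm => upd_ne _ _ (by simpa [Prog.wna] using hm),
      fun _ _ => rfl⟩
  | rput σ k i e =>
    exact ⟨fun _ _ => rfl, fun _ _ => rfl, fun _ _ => rfl,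
      fun m hm => upd_ne _ _ (by simpa [Prog.wra] using hm)⟩
  | seq _ _ h₁ h₂ =>
    refine ⟨fun m hm => ?_, fun m hm => ?_, fun m hm => ?_, fun m hm => ?_⟩
    · simp only [Prog.wn, List.mem_append, not_or] at hm
      rw [h₂.nreg m hm.2, h₁.nreg m hm.1]
    · simp only [Prog.wr, List.mem_append, not_or] at hm
      rw [h₂.rreg m hm.2, h₁.rreg m hm.1]
    · simp only [Prog.wna, List.mem_append, not_or] at hm
      rw [h₂.narr m hm.2, h₁.narr m hm.1]
    · simp only [Prog.wra, List.mem_append, not_or] at hm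
      rw [h₂.rarr m hm.2, h₁.rarr m hm.1]
  | cond_true _ _ h =>
    refine ⟨fun m hm => h.nreg m ?_, fun m hm => h.rreg m ?_, fun m hm => h.narr m ?_,
      fun m hm => h.rarr m ?_⟩ <;>
    simp only [Prog.wn, Prog.wr, Prog.wna, Prog.wra, List.mem_append, not_or] at hm
    exacts [hm.1, hm.1, hm.1, hm.1]
  | cond_false _ _ h =>
    refine ⟨fun m hm => h.nreg m ?_, fun m hm => h.rreg m ?_, fun m hm => h.narr m ?_,
      fun m hm => h.rarr m ?_⟩ <;>
    simp only [Prog.wn, Prog.wr, Prog.wna, Prog.wra, List.mem_append, not_or] at hm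
    exacts [hm.2, hm.2, hm.2, hm.2]
  | loop_stop _ => exact ⟨fun _ _ => rfl, fun _ _ => rfl, fun _ _ => rfl, fun _ _ => rfl⟩
  | loop_step _ _ _ h₁ h₂ =>
    exact ⟨fun m hm => by rw [h₂.nreg m hm, h₁.nreg m hm],
      fun m hm => by rw [h₂.rreg m hm, h₁.rreg m hm],
      fun m hm => by rw [h₂.narr m hm, h₁.narr m hm],
      fun m hm => by rw [h₂.rarr m hm, h₁.rarr m hm]⟩

namespace RunsWithin

variable {p q : Prog} {σ : State} {T T' : ℕ} {Q R : State → Prop}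

theorem frame (h : RunsWithin p σ T Q) : RunsWithin p σ T fun τ => Q τ ∧ Frame p σ τ := by
  obtain ⟨t, τ, h₁, h₂, h₃⟩ := h
  exact ⟨t, τ, h₁, h₂, h₃, h₁.frame⟩

theorem mono (h : RunsWithin p σ T Q) (hT : T ≤ T') (hQ : ∀ τ, Q τ → R τ) :
    RunsWithin p σ T' R := by
  obtain ⟨t, τ, h₁, h₂, h₃⟩ := h
  exact ⟨t, τ, h₁, h₂.trans hT, hQ _ h₃⟩

theorem imp (h : RunsWithin p σ T Q) (hQ : ∀ τ, Q τ → R τ) : RunsWithin p σ T R :=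
  h.mono le_rfl hQ

theorem le (h : RunsWithin p σ T Q) (hT : T ≤ T') : RunsWithin p σ T' Q :=
  h.mono hT fun _ => id

theorem seq (h : RunsWithin p σ T R) (h' : ∀ τ, R τ → RunsWithin q τ T' Q) :
    RunsWithin (.seq p q) σ (T + T') Q := by
  obtain ⟨t, τ, h₁, h₂, h₃⟩ := h
  obtain ⟨t', τ', h₁', h₂', h₃'⟩ := h' τ h₃
  exact ⟨t + t', τ', .seq h₁ h₁', by omega, h₃'⟩

/-- Composition in which the frame of the first program is available to the second. -/
theorem seqf (h : RunsWithin p σ T R) (h' : ∀ τ, R τ → Frame p σ τ → RunsWithin q τ T' Q) :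
    RunsWithin (.seq p q) σ (T + T') Q :=
  h.frame.seq fun τ hτ => h' τ hτ.1 hτ.2

theorem cond {b : Test} (h : b.Holds σ → RunsWithin p σ T Q)
    (h' : ¬ b.Holds σ → RunsWithin q σ T Q) : RunsWithin (.cond b p q) σ (b.cost + T + 1) Q := by
  by_cases hb : b.Holds σ
  · obtain ⟨t, τ, h₁, h₂, h₃⟩ := h hb
    exact ⟨_, τ, .cond_true hb h₁, by omega, h₃⟩
  · obtain ⟨t, τ, h₁, h₂, h₃⟩ := h' hb
    exact ⟨_, τ, .cond_false hb h₁, by omega, h₃⟩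

/-- A loop with an invariant that depends on a ghost variable, whose potential pays for the time. -/
theorem loop {b : Test} {G : Type} (Inv : G → State → Prop) (Φ : G → ℕ)
    (hstep : ∀ g τ, Inv g τ → b.Holds τ → ∃ C, RunsWithin p τ C fun τ' =>
      ∃ g', Inv g' τ' ∧ Φ g' + C + b.cost + 1 ≤ Φ g) (g : G) (h : Inv g σ) :
    RunsWithin (.loop b p) σ (Φ g + b.cost + 1) fun τ => ∃ g', Inv g' τ ∧ ¬ b.Holds τ := by
  -- The potential strictly decreases in every iteration, since it pays at least for the loop step
  -- itself; this also proves termination.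
  induction hn : Φ g using Nat.strong_induction_on generalizing g σ with
  | _ n ih =>
    by_cases hb : b.Holds σ
    · obtain ⟨C, t, τ, h₁, h₂, g', h₃, h₄⟩ := hstep g σ h hb
      obtain ⟨t', τ', h₁', h₂', h₃'⟩ := ih (Φ g') (by omega) g' h₃ rfl
      exact ⟨_, τ', .loop_step hb h₁ h₁', by omega, h₃'⟩
    · exact ⟨_, σ, Exec.loop_stop hb, by omega, g, h, hb⟩

/-- A loop whose body is executed exactly `n` times. -/
theorem loop_count {b : Test} {n C : ℕ} (Inv : ℕ → State → Prop)
    (hb : ∀ j τ, j ≤ n → Inv j τ → (b.Holds τ ↔ j < n))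
    (hstep : ∀ j τ, j < n → Inv j τ → RunsWithin p τ C (Inv (j + 1))) (h : Inv 0 σ) :
    RunsWithin (.loop b p) σ (n * (C + b.cost + 1) + b.cost + 1) (Inv n) := by
  have := loop (p := p) (b := b) (σ := σ) (fun j τ => j ≤ n ∧ Inv j τ)
    (fun j => (n - j) * (C + b.cost + 1)) (fun j τ hj hbt => ?_) 0 ⟨Nat.zero_le _, h⟩
  · refine this.mono (by simp) ?_
    rintro τ ⟨j, ⟨hj, hI⟩, hn⟩
    rw [hb j τ hj hI] at hn
    obtain rfl : j = n := by omega
    exact hI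
  · have hlt := (hb j τ hj.1 hj.2).1 hbt
    refine ⟨C, (hstep j τ hlt hj.2).imp fun τ' h' => ⟨j + 1, ⟨hlt, h'⟩, ?_⟩⟩
    obtain ⟨k, rfl⟩ : ∃ k, n = j + 1 + k := ⟨n - (j + 1), by omega⟩
    have e₁ : j + 1 + k - (j + 1) = k := by omega
    have e₂ : j + 1 + k - j = k + 1 := by omega
    simp only [e₁, e₂]
    nlinarith

end RunsWithin

/-! #### Programs without loops -/

/-- The program contains no loop. -/
def Prog.loopFree : Prog → Bool
  | .loop _ _ => false
  | .seq p q => p.loopFree && q.loopFree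
  | .cond _ p q => p.loopFree && q.loopFree
  | _ => true

open Classical in
/-- The final state of a program without loops. -/
noncomputable def Prog.run : Prog → State → State
  | .skip, σ => σ
  | .nset k e, σ => { σ with nreg := upd σ.nreg k (e.eval σ) }
  | .rset k e, σ => { σ with rreg := upd σ.rreg k (e.eval σ) }
  | .nput k i e, σ => { σ with narr := upd σ.narr k (upd (σ.narr k) (i.eval σ) (e.eval σ)) }
  | .rput k i e, σ => { σ with rarr := upd σ.rarr k (upd (σ.rarr k) (i.eval σ) (e.eval σ)) }
  | .seq p q, σ => q.run (p.run σ)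
  | .cond b p q, σ => if b.Holds σ then p.run σ else q.run σ
  | .loop _ _, σ => σ

/-- A bound for the running time of a program without loops. -/
def Prog.wcost : Prog → ℕ
  | .skip => 1
  | .nset _ e => e.cost + 1
  | .rset _ e => e.cost + 1
  | .nput _ i e => i.cost + e.cost + 1
  | .rput _ i e => i.cost + e.cost + 1
  | .seq p q => p.wcost + q.wcost
  | .cond b p q => b.cost + max p.wcost q.wcost + 1
  | .loop _ _ => 0

/-- A loop-free program is a function on states. Goals about such a program become goals about
`Prog.run`, which `simp` unfolds. -/
theorem Prog.runsWithin_run (p : Prog) (hp : p.loopFree = true) (σ : State) :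
    RunsWithin p σ p.wcost (fun τ => τ = p.run σ) := by
  induction p generalizing σ with
  | skip => exact ⟨_, _, .skip σ, le_rfl, rfl⟩
  | nset k e => exact ⟨_, _, .nset σ k e, le_rfl, rfl⟩
  | rset k e => exact ⟨_, _, .rset σ k e, le_rfl, rfl⟩
  | nput k i e => exact ⟨_, _, .nput σ k i e, le_rfl, rfl⟩
  | rput k i e => exact ⟨_, _, .rput σ k i e, le_rfl, rfl⟩
  | seq p q hp' hq' =>
    simp only [Prog.loopFree, Bool.and_eq_true] at hp
    refine (hp' hp.1 σ).seq fun τ hτ => ?_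
    subst hτ
    exact hq' hp.2 _
  | cond b p q hp' hq' =>
    simp only [Prog.loopFree, Bool.and_eq_true] at hp
    refine RunsWithin.cond (fun h => ?_) (fun h => ?_)
    · exact (hp' hp.1 σ).mono (le_max_left _ _) fun τ hτ => by rw [hτ]; exact (if_pos h).symm
    · exact (hq' hp.2 σ).mono (le_max_right _ _) fun τ hτ => by rw [hτ]; exact (if_neg h).symm
  | loop b p _ => simp [Prog.loopFree] at hp

theorem RunsWithin.straight {p : Prog} {σ : State} {Q : State → Prop} (C : ℕ)
    (hp : p.loopFree = true) (hC : p.wcost ≤ C) (h : Q (p.run σ)) : RunsWithin p σ C Q :=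
  (p.runsWithin_run hp σ).mono hC fun _ hτ => hτ ▸ h

theorem RunsWithin.straight_seq {p q : Prog} {σ : State} {T : ℕ} {Q : State → Prop} (C : ℕ)
    (hp : p.loopFree = true) (hC : p.wcost ≤ C)
    (h : ∀ τ, τ = p.run σ → Frame p σ τ → RunsWithin q τ T Q) :
    RunsWithin (.seq p q) σ (C + T) Q :=
  ((p.runsWithin_run hp σ).le hC).seqf h

/-! #### Counting loops -/

/-- `for J = 0, …, L - 1 do p`, for registers `J` and `L`. -/
def forLoop (J L : ℕ) (p : Prog) : Prog :=
  .seq (.nset J (.const 0))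
    (.loop (.nlt (.reg J) (.reg L)) (.seq p (.nset J (.add (.reg J) (.const 1)))))

/-- The overhead `8` of an iteration is `4` for the increment, `3` for the test and `1` for the
loop; the constant `6` is `2` for the initialisation and `4` for the failing test. -/
theorem RunsWithin.forLoop {J L : ℕ} {p : Prog} {σ : State} {n C : ℕ} (Inv : ℕ → State → Prop)
    (h : Inv 0 { σ with nreg := upd σ.nreg J 0 })
    (hreg : ∀ j τ, Inv j τ → τ.nreg J = j ∧ τ.nreg L = n)
    (hstep : ∀ j τ, j < n → Inv j τ → RunsWithin p τ C fun τ' =>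
      Inv (j + 1) { τ' with nreg := upd τ'.nreg J (τ'.nreg J + 1) }) :
    RunsWithin (forLoop J L p) σ (n * (C + 8) + 6) (Inv n) := by
  have h₁ : RunsWithin (.nset J (.const 0)) σ 2
      (fun τ => τ = { σ with nreg := upd σ.nreg J 0 }) := ⟨_, _, .nset σ J (.const 0), le_rfl, rfl⟩
  refine (h₁.seq (T' := n * (C + 8) + 4) fun τ hτ => ?_).le (by omega)
  subst hτ
  refine (RunsWithin.loop_count (C := C + 4) Inv (fun j τ _ hj => ?_) (fun j τ hj hI => ?_) h).le ?_
  · obtain ⟨h₁, h₂⟩ := hreg j τ hj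
    simp [Test.Holds, NExpr.eval, h₁, h₂]
  · exact (hstep j τ hj hI).seq fun τ' h' => ⟨_, _, .nset _ _ _, le_rfl, h'⟩
  · simp [Test.cost, NExpr.cost]

theorem notMem_of_elem {k : ℕ} {l : List ℕ} (h : l.elem k = false) : k ∉ l := by
  intro hk
  rw [List.elem_eq_true_of_mem hk] at h
  exact absurd h (by simp)

namespace Frame

variable {p : Prog} {σ τ ρ : State}

/-- The side condition is a Boolean computation on the program text, which the default argument
`rfl` settles. -/
theorem n (h : Frame p σ τ) (k : ℕ) (hk : p.wn.elem k = false := by rfl) : τ.nreg k = σ.nreg k :=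
  h.nreg k (notMem_of_elem hk)

theorem r (h : Frame p σ τ) (k : ℕ) (hk : p.wr.elem k = false := by rfl) : τ.rreg k = σ.rreg k :=
  h.rreg k (notMem_of_elem hk)

theorem na (h : Frame p σ τ) (k : ℕ) (hk : p.wna.elem k = false := by rfl) :
    τ.narr k = σ.narr k := h.narr k (notMem_of_elem hk)

theorem ra (h : Frame p σ τ) (k : ℕ) (hk : p.wra.elem k = false := by rfl) :
    τ.rarr k = σ.rarr k := h.rarr k (notMem_of_elem hk)

theorem trans (h : Frame p σ τ) (h' : Frame p τ ρ) : Frame p σ ρ :=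
  ⟨fun k hk => (h'.nreg k hk).trans (h.nreg k hk), fun k hk => (h'.rreg k hk).trans (h.rreg k hk),
    fun k hk => (h'.narr k hk).trans (h.narr k hk), fun k hk => (h'.rarr k hk).trans (h.rarr k hk)⟩

end Frame

/-- A counting loop whose invariant is supplemented by the frame. -/
theorem RunsWithin.forLoopF {J L : ℕ} {p : Prog} {σ : State} {n C : ℕ} (Inv : ℕ → State → Prop)
    (hL : σ.nreg L = n) (h : Inv 0 { σ with nreg := upd σ.nreg J 0 })
    (hstep : ∀ j τ, j < n → τ.nreg J = j → Frame (RealRAM.forLoop J L p) σ τ → Inv j τ →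
      RunsWithin p τ C fun τ' => Inv (j + 1) { τ' with nreg := upd τ'.nreg J (j + 1) })
    (hJw : p.wn.elem J = false := by rfl) (hLw : (J :: p.wn).elem L = false := by rfl) :
    RunsWithin (RealRAM.forLoop J L p) σ (n * (C + 8) + 6) fun τ => Inv n τ ∧ τ.nreg J = n := by
  have hLw' := notMem_of_elem hLw
  rw [List.mem_cons, not_or] at hLw'
  have hL2 : L ∉ (RealRAM.forLoop J L p).wn := by
    simp [RealRAM.forLoop, Prog.wn, hLw'.1, hLw'.2]
  refine (RunsWithin.forLoop (fun j τ => (Inv j τ ∧ τ.nreg J = j) ∧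
    Frame (RealRAM.forLoop J L p) σ τ) ⟨⟨h, by simp⟩, ?_⟩ (fun j τ hj => ⟨hj.1.2, ?_⟩)
    fun j τ hj hI => ?_).imp fun τ hτ => hτ.1
  · refine ⟨fun k hk => upd_ne _ _ ?_, fun _ _ => rfl, fun _ _ => rfl, fun _ _ => rfl⟩
    simp only [RealRAM.forLoop, Prog.wn, List.mem_append, List.mem_singleton, not_or] at hk
    exact hk.1
  · rw [hj.2.nreg L hL2, hL]
  · refine (hstep j τ hj hI.1.2 hI.2 hI.1.1).frame.imp fun τ' hτ' => ?_
    have hJ : τ'.nreg J = j := by rw [hτ'.2.nreg J (notMem_of_elem hJw), hI.1.2]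
    rw [hJ]
    refine ⟨⟨hτ'.1, by simp⟩, hI.2.trans ⟨fun k hk => ?_, fun k hk => ?_, fun k hk => ?_,
      fun k hk => ?_⟩⟩ <;>
    simp only [RealRAM.forLoop, Prog.wn, Prog.wr, Prog.wna, Prog.wra, List.mem_append,
      List.mem_singleton, not_or, List.nil_append, List.append_nil] at hk
    · exact (upd_ne _ _ hk.1).trans (hτ'.2.nreg k hk.2.1)
    · exact hτ'.2.rreg k hk
    · exact hτ'.2.narr k hk
    · exact hτ'.2.rarr k hk

/-- `for J = 0, …, L - 1` write the value of `e` to the cell `i` of the real array `d`. -/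
def mapR (J L d : ℕ) (i : NExpr) (e : RExpr) : Prog := forLoop J L (.rput d i e)

/-- `for J = 0, …, L - 1` write the value of `e` to the cell `i` of the natural-number array `d`. -/
def mapN (J L d : ℕ) (i e : NExpr) : Prog := forLoop J L (.nput d i e)

/-- The hypothesis `he` lets `e` read the array that is being written, at cells that have not been
overwritten so far: these still have their initial contents. The window written starts at the offset
`o`. -/
theorem RunsWithin.mapR {J L d : ℕ} {i : NExpr} {e : RExpr} {σ : State} (n o : ℕ) (f : ℕ → ℝ)
    (hJL : L ≠ J) (hL : σ.nreg L = n)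
    (hi : ∀ j X, i.eval { σ with nreg := upd σ.nreg J j, rarr := upd σ.rarr d X } = o + j)
    (he : ∀ j X, j < n → (∀ m, m < o ∨ o + j ≤ m → X m = σ.rarr d m) →
      e.eval { σ with nreg := upd σ.nreg J j, rarr := upd σ.rarr d X } = f j) :
    RunsWithin (mapR J L d i e) σ (n * (i.cost + e.cost + 9) + 6) fun τ =>
      (∀ j, j < n → τ.rarr d (o + j) = f j) ∧
      (∀ m, m < o ∨ o + n ≤ m → τ.rarr d m = σ.rarr d m) ∧
      (∀ k, k ≠ d → τ.rarr k = σ.rarr k) ∧ (∀ k, k ≠ J → τ.nreg k = σ.nreg k) ∧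
      τ.narr = σ.narr ∧ τ.rreg = σ.rreg := by
  refine (RunsWithin.forLoop (n := n) (C := i.cost + e.cost + 1) (fun j τ =>
    ∃ X : ℕ → ℝ, τ = { σ with nreg := upd σ.nreg J j, rarr := upd σ.rarr d X } ∧
      (∀ k, k < j → X (o + k) = f k) ∧ (∀ m, m < o ∨ o + j ≤ m → X m = σ.rarr d m))
    ?_ ?_ ?_).mono (by ring_nf; omega) ?_
  · refine ⟨σ.rarr d, ?_, by simp, by simp⟩
    congr 1
    funext k
    by_cases hk : k = d <;> simp [upd, hk]
  · rintro j τ ⟨X, rfl, -, -⟩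
    simp [upd, hJL, hL]
  · rintro j τ hj ⟨X, rfl, h₁, h₂⟩
    refine ⟨_, _, .rput _ _ _ _, le_rfl, upd X (o + j) (f j), ?_, ?_, ?_⟩
    · rw [hi, he j X hj h₂]
      simp only [upd_same]
      congr 1
      · funext k
        by_cases hk : k = J <;> simp [upd, hk]
      · funext k
        by_cases hk : k = d <;> simp [upd, hk]
    · intro k hk
      by_cases hkj : k = j
      · subst hkj; simp
      · rw [upd_ne _ _ (by omega)]
        exact h₁ k (by omega)
    · intro m hm
      rw [upd_ne _ _ (by omega)]
      exact h₂ m (by omega)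
  · rintro τ ⟨X, rfl, h₁, h₂⟩
    refine ⟨by simpa using h₁, by simpa using h₂, fun k hk => ?_, fun k hk => ?_, rfl, rfl⟩ <;>
    simp [upd, hk]

theorem RunsWithin.mapN {J L d : ℕ} {i e : NExpr} {σ : State} (n o : ℕ) (f : ℕ → ℕ)
    (hJL : L ≠ J) (hL : σ.nreg L = n)
    (hi : ∀ j X, i.eval { σ with nreg := upd σ.nreg J j, narr := upd σ.narr d X } = o + j)
    (he : ∀ j X, j < n → (∀ m, m < o ∨ o + j ≤ m → X m = σ.narr d m) →
      e.eval { σ with nreg := upd σ.nreg J j, narr := upd σ.narr d X } = f j) :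
    RunsWithin (mapN J L d i e) σ (n * (i.cost + e.cost + 9) + 6) fun τ =>
      (∀ j, j < n → τ.narr d (o + j) = f j) ∧
      (∀ m, m < o ∨ o + n ≤ m → τ.narr d m = σ.narr d m) ∧
      (∀ k, k ≠ d → τ.narr k = σ.narr k) ∧ (∀ k, k ≠ J → τ.nreg k = σ.nreg k) ∧
      τ.rarr = σ.rarr ∧ τ.rreg = σ.rreg := by
  refine (RunsWithin.forLoop (n := n) (C := i.cost + e.cost + 1) (fun j τ =>
    ∃ X : ℕ → ℕ, τ = { σ with nreg := upd σ.nreg J j, narr := upd σ.narr d X } ∧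
      (∀ k, k < j → X (o + k) = f k) ∧ (∀ m, m < o ∨ o + j ≤ m → X m = σ.narr d m))
    ?_ ?_ ?_).mono (by ring_nf; omega) ?_
  · refine ⟨σ.narr d, ?_, by simp, by simp⟩
    congr 1
    funext k
    by_cases hk : k = d <;> simp [upd, hk]
  · rintro j τ ⟨X, rfl, -, -⟩
    simp [upd, hJL, hL]
  · rintro j τ hj ⟨X, rfl, h₁, h₂⟩
    refine ⟨_, _, .nput _ _ _ _, le_rfl, upd X (o + j) (f j), ?_, ?_, ?_⟩
    · rw [hi, he j X hj h₂]
      simp only [upd_same]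
      congr 1
      · funext k
        by_cases hk : k = J <;> simp [upd, hk]
      · funext k
        by_cases hk : k = d <;> simp [upd, hk]
    · intro k hk
      by_cases hkj : k = j
      · subst hkj; simp
      · rw [upd_ne _ _ (by omega)]
        exact h₁ k (by omega)
    · intro m hm
      rw [upd_ne _ _ (by omega)]
      exact h₂ m (by omega)
  · rintro τ ⟨X, rfl, h₁, h₂⟩
    refine ⟨by simpa using h₁, by simpa using h₂, fun k hk => ?_, fun k hk => ?_, rfl, rfl⟩ <;>
    simp [upd, hk]

end RealRAM

/-! ### A real fast transform

The nodes form a binary tree: the children of `i ≥ 1` are `2 i` and `2 i + 1`, their values are the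
two solutions of `z ^ 2 - 2 = node i`.  Polynomials of degree less than `2 ^ k` are given by their
coordinates in the basis of products of the iterates of `z ^ 2 - 2`. -/

namespace FastCauchy

open Polynomial

/-- The values at the nodes. -/
noncomputable def node : ℕ → ℝ
  | 0 => 0
  | 1 => 0
  | n + 2 =>
    if n % 2 = 0 then Real.sqrt (2 + node ((n + 2) / 2)) else -Real.sqrt (2 + node ((n + 2) / 2))

theorem node_one : node 1 = 0 := by rw [node]

theorem node_two_mul {i : ℕ} (hi : 1 ≤ i) : node (2 * i) = Real.sqrt (2 + node i) := by
  obtain ⟨j, rfl⟩ : ∃ j, i = j + 1 := ⟨i - 1, by omega⟩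
  rw [show 2 * (j + 1) = 2 * j + 2 by ring, node, if_pos (by omega)]
  congr 3
  omega

theorem node_two_mul_add_one {i : ℕ} (hi : 1 ≤ i) : node (2 * i + 1) = -node (2 * i) := by
  rw [node_two_mul hi]
  obtain ⟨j, rfl⟩ : ∃ j, i = j + 1 := ⟨i - 1, by omega⟩
  rw [show 2 * (j + 1) + 1 = (2 * j + 1) + 2 by ring, node, if_neg (by omega)]
  congr 4
  omega

/-- If `|z| < 2` then `0 < 2 + z < 4`, so both `± √(2 + z)` stay in `(-2, 2)`. It follows that
radicands and twiddle factors do not vanish, and that points beyond `2` are never nodes. -/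
theorem abs_node_lt (i : ℕ) : |node i| < 2 := by
  induction i using Nat.strong_induction_on with
  | _ i ih =>
    rcases Nat.lt_or_ge i 2 with h | h
    · interval_cases i <;> simp [node]
    · have key : Real.sqrt (2 + node (i / 2)) < 2 := by
        rw [Real.sqrt_lt' two_pos]
        linarith [(abs_lt.1 (ih (i / 2) (by omega))).2]
      have h0 := Real.sqrt_nonneg (2 + node (i / 2))
      rcases Nat.even_or_odd' i with ⟨j, rfl | rfl⟩
      · rw [node_two_mul (by omega), abs_of_nonneg (Real.sqrt_nonneg _)]
        rwa [show 2 * j / 2 = j by omega] at key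
      · rw [node_two_mul_add_one (by omega), abs_neg, node_two_mul (by omega),
          abs_of_nonneg (Real.sqrt_nonneg _)]
        rwa [show (2 * j + 1) / 2 = j by omega] at key

theorem node_two_mul_pos {i : ℕ} (hi : 1 ≤ i) : 0 < node (2 * i) := by
  rw [node_two_mul hi]
  exact Real.sqrt_pos.2 (by linarith [(abs_lt.1 (abs_node_lt i)).1])

theorem node_sq {i : ℕ} (hi : 2 ≤ i) : node i ^ 2 - 2 = node (i / 2) := by
  have h : ∀ j, 1 ≤ j → node (2 * j) ^ 2 - 2 = node j := fun j hj => by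
    rw [node_two_mul hj, Real.sq_sqrt (by linarith [(abs_lt.1 (abs_node_lt j)).1])]
    ring
  rcases Nat.even_or_odd' i with ⟨j, rfl | rfl⟩
  · rw [h j (by omega)]; congr 1; omega
  · rw [node_two_mul_add_one (by omega), neg_sq, h j (by omega)]; congr 1; omega

/-- The iterates of `z ^ 2 - 2`. -/
noncomputable def iter : ℕ → ℝ[X]
  | 0 => X
  | k + 1 => iter k ^ 2 - C 2

theorem iter_monic_natDegree (k : ℕ) : (iter k).Monic ∧ (iter k).natDegree = 2 ^ k := by
  induction k with
  | zero => simp [iter, monic_X]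
  | succ k ih =>
    have hd : (iter k ^ 2).natDegree = 2 ^ (k + 1) := by rw [ih.1.natDegree_pow, ih.2]; ring
    have hlt : (C (2 : ℝ)).degree < (iter k ^ 2).degree := by
      refine degree_C_le.trans_lt ?_
      rw [degree_eq_natDegree (ih.1.pow 2).ne_zero, hd]
      exact_mod_cast Nat.pos_of_ne_zero (by positivity)
    exact ⟨(ih.1.pow 2).sub_of_left hlt, by rw [iter, natDegree_sub_C, hd]⟩

theorem iter_monic (k : ℕ) : (iter k).Monic := (iter_monic_natDegree k).1

theorem degree_iter (k : ℕ) : (iter k).degree = ((2 ^ k : ℕ) : WithBot ℕ) := by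
  rw [degree_eq_natDegree (iter_monic k).ne_zero, (iter_monic_natDegree k).2]

/-- Every application of `z ^ 2 - 2` goes one generation up, and the numbers `2 ^ k * j + r` with `r
< 2 ^ k` are the descendants of `j` in generation `k`. -/
theorem eval_node_iter {k j r : ℕ} (hj : 1 ≤ j) (hr : r < 2 ^ k) :
    (iter k).eval (node (2 ^ k * j + r)) = node j := by
  induction k generalizing j r with
  | zero =>
    obtain rfl : r = 0 := by simpa using hr
    simp [iter]
  | succ k ih =>
    have h : ∀ j r, 1 ≤ j → r < 2 ^ k →
        (iter (k + 1)).eval (node (2 ^ k * j + r)) = node j ^ 2 - 2 := fun j r hj hr => by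
      simp [iter, ih hj hr]
    -- The two halves of the range of `r` descend from the children `2 * j` and `2 * j + 1`.
    rcases Nat.lt_or_ge r (2 ^ k) with hr' | hr'
    · rw [show 2 ^ (k + 1) * j + r = 2 ^ k * (2 * j) + r by ring, h _ _ (by omega) hr',
        node_sq (by omega)]
      congr 1; omega
    · rw [show 2 ^ (k + 1) * j + r = 2 ^ k * (2 * j + 1) + (r - 2 ^ k) by
        rw [pow_succ]; zify [hr']; ring, h _ _ (by omega) (by rw [pow_succ] at hr; omega),
        node_sq (by omega)]
      congr 1; omega

/-- The half-line `(2, ∞)` is invariant under `z ^ 2 - 2`. This keeps the factors collected in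
`scale` away from zero. -/
theorem two_lt_eval_iter {z : ℝ} (hz : 2 < z) (k : ℕ) : 2 < (iter k).eval z := by
  induction k with
  | zero => simpa [iter] using hz
  | succ k ih =>
    simp only [iter, eval_sub, eval_pow, eval_C]
    nlinarith

/-- The polynomial with given coordinates. -/
noncomputable def expand : ℕ → (ℕ → ℝ) → ℝ[X]
  | 0, c => C (c 0)
  | k + 1, c => expand k c + iter k * expand k fun m => c (2 ^ k + m)

theorem expand_congr {k : ℕ} {c c' : ℕ → ℝ} (h : ∀ m, m < 2 ^ k → c m = c' m) :
    expand k c = expand k c' := by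
  induction k generalizing c c' with
  | zero => simp [expand, h 0 (by simp)]
  | succ k ih =>
    rw [pow_succ] at h
    simp only [expand]
    rw [ih (c := c) (c' := c') fun m hm => h m (by omega),
      ih (c := fun m => c (2 ^ k + m)) (c' := fun m => c' (2 ^ k + m))
        fun m hm => h _ (by omega)]

theorem expand_linear (k : ℕ) (x y : ℝ) (c c' : ℕ → ℝ) :
    expand k (fun m => x * c m + y * c' m) = C x * expand k c + C y * expand k c' := by
  induction k generalizing c c' with
  | zero => simp [expand]
  | succ k ih =>
    simp only [expand]
    rw [ih, ih (fun m => c (2 ^ k + m))]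
    ring

theorem expand_add_mul (k : ℕ) (y : ℝ) (c c' : ℕ → ℝ) :
    expand k (fun m => c m + y * c' m) = expand k c + C y * expand k c' := by
  simpa using expand_linear k 1 y c c'

theorem degree_expand_lt (k : ℕ) (c : ℕ → ℝ) :
    (expand k c).degree < ((2 ^ k : ℕ) : WithBot ℕ) := by
  induction k generalizing c with
  | zero => exact degree_C_le.trans_lt (by simp)
  | succ k ih =>
    refine (degree_add_le _ _).trans_lt (max_lt ((ih c).trans ?_) ?_)
    · exact_mod_cast Nat.pow_lt_pow_right one_lt_two (Nat.lt_succ_self k)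
    · rw [degree_mul, degree_iter, pow_succ, mul_two, Nat.cast_add]
      exact WithBot.add_lt_add_left WithBot.coe_ne_bot (ih _)

/-- Division with remainder by the monic `iter k` produces the two halves of the coordinates. -/
theorem exists_expand {k : ℕ} {p : ℝ[X]} (hp : p.degree < ((2 ^ k : ℕ) : WithBot ℕ)) :
    ∃ c, expand k c = p := by
  induction k generalizing p with
  | zero =>
    rw [pow_zero, Nat.cast_one, Nat.WithBot.lt_one_iff_le_zero] at hp
    exact ⟨fun _ => p.coeff 0, (eq_C_of_degree_le_zero hp).symm⟩
  | succ k ih =>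
    have hm := iter_monic k
    have hdiv : (p /ₘ iter k).degree < ((2 ^ k : ℕ) : WithBot ℕ) := by
      by_cases h0 : p /ₘ iter k = 0
      · rw [h0, degree_zero]; exact WithBot.bot_lt_coe _
      · have hp0 : p ≠ 0 := fun h => h0 (by rw [h, zero_divByMonic])
        rw [degree_eq_natDegree h0, natDegree_divByMonic _ hm, (iter_monic_natDegree k).2]
        rw [degree_eq_natDegree hp0] at hp
        have : p.natDegree < 2 ^ (k + 1) := by exact_mod_cast hp
        have h2 := Nat.two_pow_pos k
        rw [pow_succ] at this
        exact_mod_cast (by omega : p.natDegree - 2 ^ k < 2 ^ k)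
    obtain ⟨c₁, h₁⟩ := ih (p := p %ₘ iter k) (by
      rw [← degree_iter]; exact degree_modByMonic_lt _ hm)
    obtain ⟨c₂, h₂⟩ := ih hdiv
    refine ⟨fun m => if m < 2 ^ k then c₁ m else c₂ (m - 2 ^ k), ?_⟩
    have e₁ : expand k (fun m => if m < 2 ^ k then c₁ m else c₂ (m - 2 ^ k)) = expand k c₁ :=
      expand_congr fun m hm => if_pos hm
    have e₂ : (expand k fun m => if 2 ^ k + m < 2 ^ k then c₁ (2 ^ k + m)
        else c₂ (2 ^ k + m - 2 ^ k)) = expand k c₂ := expand_congr fun m _ => by simp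
    rw [expand, e₁, e₂, h₁, h₂, modByMonic_add_div]

/-! #### The transform and its inverse -/

/-- One stage of the transform of `2 h` numbers. -/
noncomputable def fwdStage (i h s : ℕ) (a : ℕ → ℝ) (m : ℕ) : ℝ :=
  a (m / 2) + node (2 ^ (s + 1) * i + m % 2 ^ (s + 1)) * a (m / 2 + h)

/-- The inverse of a stage. -/
noncomputable def invStage (i h s : ℕ) (a : ℕ → ℝ) (m : ℕ) : ℝ :=
  if m < h then (a (2 * m) + a (2 * m + 1)) / 2
  else (a (2 * (m - h)) - a (2 * (m - h) + 1)) /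
    (2 * node (2 ^ (s + 1) * i + 2 * (m - h) % 2 ^ (s + 1)))

/-- The transform of `2 h` numbers, in `k` stages, below the node `i`. -/
noncomputable def fwd (i h : ℕ) : ℕ → (ℕ → ℝ) → ℕ → ℝ
  | 0, a => a
  | k + 1, a => fwdStage i h k (fwd i h k a)

/-- The inverse transform. -/
noncomputable def inv (i h : ℕ) : ℕ → (ℕ → ℝ) → ℕ → ℝ
  | 0, a => a
  | k + 1, a => inv i h k (invStage i h k a)

theorem fwdStage_congr {i h s : ℕ} {a b : ℕ → ℝ} (hab : ∀ m, m < 2 * h → a m = b m) (m : ℕ)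
    (hm : m < 2 * h) : fwdStage i h s a m = fwdStage i h s b m := by
  simp only [fwdStage]
  rw [hab _ (by omega), hab _ (by omega)]

theorem invStage_congr {i h s : ℕ} {a b : ℕ → ℝ} (hab : ∀ m, m < 2 * h → a m = b m) (m : ℕ)
    (hm : m < 2 * h) : invStage i h s a m = invStage i h s b m := by
  simp only [invStage]
  split_ifs with hmh
  · rw [hab _ (by omega), hab _ (by omega)]
  · rw [hab (2 * (m - h)) (by omega), hab (2 * (m - h) + 1) (by omega)]

theorem fwd_congr {i h k : ℕ} {a b : ℕ → ℝ} (hab : ∀ m, m < 2 * h → a m = b m) (m : ℕ)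
    (hm : m < 2 * h) : fwd i h k a m = fwd i h k b m := by
  induction k generalizing m with
  | zero => exact hab m hm
  | succ k ih => exact fwdStage_congr ih m hm

theorem inv_congr {i h k : ℕ} {a b : ℕ → ℝ} (hab : ∀ m, m < 2 * h → a m = b m) (m : ℕ)
    (hm : m < 2 * h) : inv i h k a m = inv i h k b m := by
  induction k generalizing a b with
  | zero => exact hab m hm
  | succ k ih => exact ih (invStage_congr hab)

theorem two_mul_mod_two_pow (s j : ℕ) : 2 * j % 2 ^ (s + 1) = 2 * (j % 2 ^ s) := by
  rw [pow_succ', Nat.mul_mod_mul_left]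

theorem two_mul_add_one_mod_two_pow (s j : ℕ) :
    (2 * j + 1) % 2 ^ (s + 1) = 2 * (j % 2 ^ s) + 1 := by
  have h := Nat.mod_lt j (Nat.two_pow_pos s)
  rw [Nat.add_mod, two_mul_mod_two_pow, Nat.mod_eq_of_lt (b := 2 ^ (s + 1))]
  · rw [Nat.mod_eq_of_lt (a := 1)]
    rw [pow_succ]; have := Nat.two_pow_pos s; omega
  · rw [Nat.mod_eq_of_lt (a := 1)] <;> rw [pow_succ] <;> omega

theorem twiddle_even (i s j : ℕ) : node (2 ^ (s + 1) * i + 2 * j % 2 ^ (s + 1)) =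
    node (2 * (2 ^ s * i + j % 2 ^ s)) := by
  rw [two_mul_mod_two_pow]; congr 1; ring

theorem twiddle_odd {i : ℕ} (hi : 1 ≤ i) (s j : ℕ) :
    node (2 ^ (s + 1) * i + (2 * j + 1) % 2 ^ (s + 1)) =
    -node (2 * (2 ^ s * i + j % 2 ^ s)) := by
  have := Nat.mul_pos (Nat.two_pow_pos s) hi
  rw [← node_two_mul_add_one (by omega), two_mul_add_one_mod_two_pow]; congr 1; ring

theorem twiddle_ne_zero {i : ℕ} (hi : 1 ≤ i) (s j : ℕ) :
    node (2 * (2 ^ s * i + j % 2 ^ s)) ≠ 0 := by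
  have := Nat.mul_pos (Nat.two_pow_pos s) hi
  exact (node_two_mul_pos (by omega)).ne'

/-- The entries `2 * j` and `2 * j + 1` of a stage are `a ± ν b`, where `± ν` are the values at two
siblings; half sums and scaled differences recover `a` and `b` because `ν ≠ 0`. -/
theorem invStage_fwdStage {i h s : ℕ} (hi : 1 ≤ i) (a : ℕ → ℝ) (m : ℕ) (_hm : m < 2 * h) :
    invStage i h s (fwdStage i h s a) m = a m := by
  simp only [invStage, fwdStage, twiddle_even, twiddle_odd hi]
  split_ifs with hmh
  · rw [show 2 * m / 2 = m by omega, show (2 * m + 1) / 2 = m by omega]; ring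
  · have := twiddle_ne_zero hi s (m - h)
    rw [show 2 * (m - h) / 2 = m - h by omega, show (2 * (m - h) + 1) / 2 = m - h by omega,
      show m - h + h = m by omega]
    field_simp
    ring

theorem fwdStage_invStage {i h s : ℕ} (hi : 1 ≤ i) (a : ℕ → ℝ) (m : ℕ) (hm : m < 2 * h) :
    fwdStage i h s (invStage i h s a) m = a m := by
  rcases Nat.even_or_odd' m with ⟨j, rfl | rfl⟩ <;>
  · have := twiddle_ne_zero hi s j
    simp only [invStage, fwdStage, twiddle_even, twiddle_odd hi]
    rw [if_pos (by omega), if_neg (by omega)]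
    first
    | rw [show 2 * j / 2 = j by omega]
    | rw [show (2 * j + 1) / 2 = j by omega]
    rw [show j + h - h = j by omega]
    field_simp
    ring

theorem inv_fwd {i h : ℕ} (hi : 1 ≤ i) (k : ℕ) (a : ℕ → ℝ) (m : ℕ) (hm : m < 2 * h) :
    inv i h k (fwd i h k a) m = a m := by
  induction k generalizing m with
  | zero => rfl
  | succ k ih =>
    rw [inv, fwd, inv_congr (invStage_fwdStage hi _) m hm, ih m hm]

theorem fwd_inv {i h : ℕ} (hi : 1 ≤ i) (k : ℕ) (a : ℕ → ℝ) (m : ℕ) (hm : m < 2 * h) :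
    fwd i h k (inv i h k a) m = a m := by
  induction k generalizing a m with
  | zero => rfl
  | succ k ih =>
    rw [inv, fwd, fwdStage_congr (ih _) m hm, fwdStage_invStage hi a m hm]

/-- The entries of `a` are the coordinates of the polynomials `p 0, …, p (B - 1)` of degree less
than `2 ^ k`. -/
def Rep (k B : ℕ) (a : ℕ → ℝ) (p : ℕ → ℝ[X]) : Prop :=
  ∀ q, q < B → expand k (fun m => a (m * B + q)) = p q

theorem Rep.degree_lt {k B : ℕ} {a : ℕ → ℝ} {p : ℕ → ℝ[X]} (hr : Rep k B a p) {q : ℕ}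
    (hq : q < B) : (p q).degree < ((2 ^ k : ℕ) : WithBot ℕ) := hr q hq ▸ degree_expand_lt _ _

theorem index_lt {k B m q : ℕ} (hm : m < 2 ^ k) (hq : q < B) : m * B + q < 2 ^ k * B := by
  calc m * B + q < m * B + B := by omega
    _ = (m + 1) * B := by ring
    _ ≤ 2 ^ k * B := Nat.mul_le_mul_right _ hm

theorem index_lt' {k B b q : ℕ} (hb : b < 2 ^ k) (hq : q < B) : q * 2 ^ k + b < 2 ^ k * B := by
  calc q * 2 ^ k + b < q * 2 ^ k + 2 ^ k := by omega
    _ = 2 ^ k * (q + 1) := by ring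
    _ ≤ 2 ^ k * B := Nat.mul_le_mul_left _ hq

theorem Rep.congr {k B : ℕ} {a b : ℕ → ℝ} {p : ℕ → ℝ[X]} (hr : Rep k B a p)
    (h : ∀ m, m < 2 ^ k * B → b m = a m) : Rep k B b p := fun q hq => by
  rw [← hr q hq]
  exact expand_congr fun m hm => h _ (index_lt hm hq)

/-- After `s` stages the array contains, for each polynomial `q` and each node `2 ^ s * i + b`, the
coordinates of a polynomial of degree less than `2 ^ l` that agrees with polynomial `q` at all
descendants of this node `l` generations below. One further stage replaces the next iterate by the
constant which it is on the descendants of a child. The position `(m * B + q) * 2 ^ s + b` makes the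
transform self-sorting, so no bit reversal is needed. -/
theorem eval_fwd_stages {i h B : ℕ} (hi : 1 ≤ i) (a : ℕ → ℝ) (s l : ℕ)
    (hh : 2 * h = 2 ^ (s + l) * B) (q b r : ℕ) (hb : b < 2 ^ s) (hr : r < 2 ^ l) :
    (expand l (fun m => fwd i h s a ((m * B + q) * 2 ^ s + b))).eval
      (node (2 ^ l * (2 ^ s * i + b) + r)) =
    (expand (s + l) (fun m => a (m * B + q))).eval (node (2 ^ l * (2 ^ s * i + b) + r)) := by
  induction s generalizing l b r with
  | zero =>
    obtain rfl : b = 0 := by simpa using hb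
    simp [fwd]
  | succ s ih =>
    -- The node `2 ^ (s + 1) * i + b` is the child number `e` of the node `2 ^ s * i + b'`.
    set e := b % 2 with he
    set b' := b / 2 with hb'
    have hbb : b = 2 * b' + e := by omega
    have hb2 : b' < 2 ^ s := by rw [pow_succ] at hb; omega
    have hpos := Nat.mul_pos (Nat.two_pow_pos s) hi
    have hh' : h = 2 ^ l * B * 2 ^ s := by
      have : 2 * h = 2 * (2 ^ l * B * 2 ^ s) := by rw [hh]; ring
      omega
    have hx : 2 ^ l * (2 ^ (s + 1) * i + b) + r =
        2 ^ (l + 1) * (2 ^ s * i + b') + (2 ^ l * e + r) := by rw [hbb]; ring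
    have hr' : 2 ^ l * e + r < 2 ^ (l + 1) := by
      have : e ≤ 1 := by omega
      calc 2 ^ l * e + r < 2 ^ l * e + 2 ^ l := by omega
        _ ≤ 2 ^ l * 1 + 2 ^ l := by gcongr
        _ = 2 ^ (l + 1) := by ring
    have key := ih (l + 1) (by rw [hh]; ring_nf) b' (2 ^ l * e + r) hb2 hr'
    rw [← hx] at key
    rw [show s + 1 + l = s + (l + 1) by ring, ← key]
    -- The coordinates `m` and `2 ^ l + m` of the parent stand exactly `h` cells apart.
    have hidx : ∀ m, fwd i h (s + 1) a ((m * B + q) * 2 ^ (s + 1) + b) =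
        fwd i h s a ((m * B + q) * 2 ^ s + b') + node (2 ^ (s + 1) * i + b) *
          fwd i h s a (((2 ^ l + m) * B + q) * 2 ^ s + b') := fun m => by
      have e1 : ((m * B + q) * 2 ^ (s + 1) + b) / 2 = (m * B + q) * 2 ^ s + b' := by
        rw [pow_succ, ← mul_assoc]; omega
      have e2 : ((m * B + q) * 2 ^ (s + 1) + b) % 2 ^ (s + 1) = b := by
        rw [Nat.mul_add_mod_self_right, Nat.mod_eq_of_lt hb]
      rw [fwd, fwdStage, e1, e2]
      congr 3
      rw [hh']; ring
    rw [expand_congr fun m _ => hidx m, expand_add_mul, expand]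
    simp only [eval_add, eval_mul, eval_C]
    rw [eval_node_iter (by rw [pow_succ]; nlinarith) hr]

theorem Rep.fwd_eq {i h k B : ℕ} (hi : 1 ≤ i) {a : ℕ → ℝ} {p : ℕ → ℝ[X]} (hr : Rep k B a p)
    (hh : 2 * h = 2 ^ k * B) {q b : ℕ} (hq : q < B) (hb : b < 2 ^ k) :
    fwd i h k a (q * 2 ^ k + b) = (p q).eval (node (2 ^ k * i + b)) := by
  have := eval_fwd_stages hi a k 0 (by simpa using hh) q b 0 hb (by simp)
  simpa [expand, hr q hq] using this

theorem Rep.exists_of_degree_lt {k B : ℕ} {p : ℕ → ℝ[X]}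
    (hp : ∀ q, q < B → (p q).degree < ((2 ^ k : ℕ) : WithBot ℕ)) : ∃ a, Rep k B a p := by
  have : ∀ q, ∃ c, q < B → expand k c = p q := fun q => by
    by_cases hq : q < B
    · obtain ⟨c, hc⟩ := exists_expand (hp q hq)
      exact ⟨c, fun _ => hc⟩
    · exact ⟨fun _ => 0, fun h => absurd h hq⟩
  choose c hc using this
  refine ⟨fun m => c (m % B) (m / B), fun q hq => ?_⟩
  rw [← hc q hq]
  refine expand_congr fun m _ => ?_
  change c ((m * B + q) % B) ((m * B + q) / B) = c q m
  rw [Nat.mul_add_mod_self_right, Nat.mod_eq_of_lt hq, mul_comm, Nat.mul_add_div (by omega),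
    Nat.div_eq_of_lt hq, add_zero]

/-- Coordinates of the polynomials exist, and their transform agrees with `v` on the cells in use.
Hence the inverse transform of `v` is these coordinates, and the inverse needs no analysis of its
own. -/
theorem Rep.inv_of_eval {i h k B : ℕ} (hi : 1 ≤ i) {v : ℕ → ℝ} {p : ℕ → ℝ[X]}
    (hh : 2 * h = 2 ^ k * B) (hp : ∀ q, q < B → (p q).degree < ((2 ^ k : ℕ) : WithBot ℕ))
    (hv : ∀ q b, q < B → b < 2 ^ k → v (q * 2 ^ k + b) = (p q).eval (node (2 ^ k * i + b))) :
    Rep k B (inv i h k v) p := by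
  obtain ⟨a, ha⟩ := Rep.exists_of_degree_lt hp
  refine ha.congr fun m hm => ?_
  rw [← inv_fwd (h := h) hi k a m (by omega)]
  refine inv_congr (h := h) (fun m hm => ?_) m (by omega)
  have h1 : m / 2 ^ k < B := by
    rw [Nat.div_lt_iff_lt_mul (Nat.two_pow_pos k)]; rw [mul_comm]; omega
  have h2 := Nat.mod_lt m (Nat.two_pow_pos k)
  have h3 : m = m / 2 ^ k * 2 ^ k + m % 2 ^ k := (Nat.div_add_mod' m (2 ^ k)).symm
  rw [h3, hv _ _ h1 h2, ha.fwd_eq hi hh h1 h2]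

/-- Interpolation at the nodes below `i`. -/
theorem eq_zero_of_eval_node {i k : ℕ} (hi : 1 ≤ i) {p : ℝ[X]}
    (hp : p.degree < ((2 ^ k : ℕ) : WithBot ℕ))
    (h : ∀ b, b < 2 ^ k → p.eval (node (2 ^ k * i + b)) = 0) : p = 0 := by
  -- Two equal copies are transformed, because the size must be even even for `k = 0`.
  have hh : 2 * 2 ^ k = 2 ^ k * 2 := by ring
  have h₁ := Rep.inv_of_eval (v := fun _ => 0) (p := fun _ => p) hi hh (fun _ _ => hp)
    fun q b _ hb => (h b hb).symm
  have h₂ := Rep.inv_of_eval (v := fun _ => 0) (p := fun _ => 0) hi hh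
    (fun _ _ => by rw [degree_zero]; exact WithBot.bot_lt_coe _) fun q b _ hb => by simp
  exact (h₁ 0 two_pos).symm.trans (h₂ 0 two_pos)

theorem Rep.of_fwd_inv {i h k B : ℕ} (hi : 1 ≤ i) (v : ℕ → ℝ) (hh : 2 * h = 2 ^ k * B) :
    ∃ p : ℕ → ℝ[X], Rep k B (inv i h k v) p ∧
      ∀ q b, q < B → b < 2 ^ k → (p q).eval (node (2 ^ k * i + b)) = v (q * 2 ^ k + b) := by
  refine ⟨fun q => expand k fun m => inv i h k v (m * B + q), fun _ _ => rfl, fun q b hq hb => ?_⟩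
  rw [← Rep.fwd_eq hi (p := fun q => expand k fun m => inv i h k v (m * B + q)) (fun _ _ => rfl)
    hh hq hb, fwd_inv hi k v _ (by rw [hh]; exact index_lt' hb hq)]

end FastCauchy

namespace FastCauchy

open Polynomial

/-! #### Products and partial fractions along a binary tree -/

/-- On the descendants of `i` the polynomial `iter k` is the constant `node i`, so a polynomial of
degree less than `2 ^ (k + 1)` reduces there to half as many coordinates, and a transform of half
the size evaluates it. -/
theorem Rep.eval_half {i h k B : ℕ} (hi : 1 ≤ i) {a : ℕ → ℝ} {p : ℕ → ℝ[X]}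
    (hr : Rep (k + 1) B a p) (hh : 2 * h = 2 ^ k * B) {q b : ℕ} (hq : q < B) (hb : b < 2 ^ k) :
    fwd i h k (fun j => a j + node i * a (2 * h + j)) (q * 2 ^ k + b) =
      (p q).eval (node (2 ^ k * i + b)) := by
  rw [Rep.fwd_eq hi (p := fun q => expand k fun m =>
      a (m * B + q) + node i * a (2 * h + (m * B + q))) (fun _ _ => rfl) hh hq hb, ← hr q hq,
    expand_add_mul, expand, hh]
  simp only [eval_add, eval_mul, eval_C]
  rw [eval_node_iter hi hb, expand_congr (k := k) (c := fun m => a (2 ^ k * B + (m * B + q)))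
    (c' := fun m => a ((2 ^ k + m) * B + q)) fun m _ => by congr 1; ring]

theorem node_three : node 3 = -node 2 := node_two_mul_add_one (i := 1) le_rfl

theorem node_two_pos : 0 < node 2 := node_two_mul_pos (i := 1) le_rfl

theorem node_ne_of_two_lt {z : ℝ} (hz : 2 < z) (i : ℕ) : node i ≠ z :=
  fun h => by linarith [(abs_lt.1 (abs_node_lt i)).2]

/-- Polynomials are recovered from the values in the two halves below the root. -/
theorem Rep.merge {h k B : ℕ} (hh : 2 * h = 2 ^ k * B) {p : ℕ → ℝ[X]} {a v₂ v₃ : ℕ → ℝ}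
    (hp : ∀ q, q < B → (p q).degree < ((2 ^ (k + 1) : ℕ) : WithBot ℕ))
    (h₂ : ∀ q b, q < B → b < 2 ^ k → v₂ (q * 2 ^ k + b) = (p q).eval (node (2 ^ k * 2 + b)))
    (h₃ : ∀ q b, q < B → b < 2 ^ k → v₃ (q * 2 ^ k + b) = (p q).eval (node (2 ^ k * 3 + b)))
    (hlo : ∀ j, j < 2 * h → a j = (inv 2 h k v₂ j + inv 3 h k v₃ j) / 2)
    (hhi : ∀ j, j < 2 * h → a (2 * h + j) = (inv 2 h k v₂ j - inv 3 h k v₃ j) / (2 * node 2)) :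
    Rep (k + 1) B a p := by
  obtain ⟨c, hc⟩ := Rep.exists_of_degree_lt hp
  have hν := node_two_pos.ne'
  have hdeg : ∀ (y : ℝ) q, (expand k (fun m => c (m * B + q)) +
      C y * expand k fun m => c ((2 ^ k + m) * B + q)).degree < ((2 ^ k : ℕ) : WithBot ℕ) :=
    fun y q => by rw [← expand_add_mul]; exact degree_expand_lt _ _
  -- With `lo`, `hi` the halves of the coordinates and `ν = node 2`, the polynomial reduces to `lo +
  -- ν hi` below node `2` and to `lo - ν hi` below node `3`. The half sum of the interpolants is
  -- `lo`, their difference divided by `2 ν` is `hi`.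
  have hval : ∀ i q b, 1 ≤ i → q < B → b < 2 ^ k → (p q).eval (node (2 ^ k * i + b)) =
      (expand k (fun m => c (m * B + q)) +
      C (node i) * expand k fun m => c ((2 ^ k + m) * B + q)).eval (node (2 ^ k * i + b)) := by
    intro i q b hi hq hb
    rw [← hc q hq, expand]
    simp only [eval_add, eval_mul, eval_C]
    rw [eval_node_iter hi hb]
  have r₂ := Rep.inv_of_eval (i := 2) (v := v₂) (by norm_num) hh (fun q _ => hdeg (node 2) q)
    fun q b hq hb => by rw [h₂ q b hq hb, hval 2 q b (by norm_num) hq hb]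
  have r₃ := Rep.inv_of_eval (i := 3) (v := v₃) (by norm_num) hh (fun q _ => hdeg (node 3) q)
    fun q b hq hb => by rw [h₃ q b hq hb, hval 3 q b (by norm_num) hq hb]
  intro q hq
  rw [← hc q hq]
  have e₁ : expand k (fun m => a (m * B + q)) = expand k fun m => c (m * B + q) := by
    rw [expand_congr (c' := fun m => (1 / 2) * inv 2 h k v₂ (m * B + q) +
      (1 / 2) * inv 3 h k v₃ (m * B + q)) fun m hm => by
        rw [hlo _ (by rw [hh]; exact index_lt hm hq)]; ring, expand_linear, r₂ q hq, r₃ q hq,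
      node_three]
    have : (C (1 / 2) : ℝ[X]) * 2 = 1 := by
      rw [show (2 : ℝ[X]) = C 2 from rfl, ← C_mul]; norm_num
    rw [C_neg]
    linear_combination (expand k fun m => c (m * B + q)) * this
  have e₂ : expand k (fun m => a ((2 ^ k + m) * B + q)) =
      expand k fun m => c ((2 ^ k + m) * B + q) := by
    rw [expand_congr (c' := fun m => (1 / (2 * node 2)) * inv 2 h k v₂ (m * B + q) +
      (-(1 / (2 * node 2))) * inv 3 h k v₃ (m * B + q)) fun m hm => by
        rw [show (2 ^ k + m) * B + q = 2 * h + (m * B + q) by rw [hh]; ring,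
          hhi _ (by rw [hh]; exact index_lt hm hq)]; ring, expand_linear, r₂ q hq, r₃ q hq,
      node_three]
    have : (C (1 / (2 * node 2)) : ℝ[X]) * 2 * C (node 2) = 1 := by
      rw [show (2 : ℝ[X]) = C 2 from rfl, ← C_mul, ← C_mul, ← C_1]
      congr 1
      field_simp
    rw [C_neg, C_neg]
    linear_combination (expand k fun m => c ((2 ^ k + m) * B + q)) * this
  rw [expand, expand, e₁, e₂]

/-- The product of the linear factors `X - t j` for the leaves `j` below a node of the tree. -/
noncomputable def den (K : ℕ) (t : ℕ → ℝ) : ℕ → ℕ → ℝ[X]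
  | 0, q => X - C (t q)
  | k + 1, q => den K t k q * den K t k (2 ^ (K - (k + 1)) + q)

/-- The numerator of the sum of the fractions `w j / (X - t j)` for the leaves below a node. -/
noncomputable def num (K : ℕ) (t w : ℕ → ℝ) : ℕ → ℕ → ℝ[X]
  | 0, q => C (w q)
  | k + 1, q => num K t w k q * den K t k (2 ^ (K - (k + 1)) + q) +
      num K t w k (2 ^ (K - (k + 1)) + q) * den K t k q

theorem den_monic_natDegree (K : ℕ) (t : ℕ → ℝ) (k q : ℕ) :
    (den K t k q).Monic ∧ (den K t k q).natDegree = 2 ^ k := by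
  induction k generalizing q with
  | zero => exact ⟨monic_X_sub_C _, natDegree_X_sub_C _⟩
  | succ k ih =>
    refine ⟨(ih q).1.mul (ih _).1, ?_⟩
    rw [den, (ih q).1.natDegree_mul (ih _).1, (ih q).2, (ih _).2]; ring

theorem degree_den (K : ℕ) (t : ℕ → ℝ) (k q : ℕ) :
    (den K t k q).degree = ((2 ^ k : ℕ) : WithBot ℕ) := by
  rw [degree_eq_natDegree (den_monic_natDegree K t k q).1.ne_zero, (den_monic_natDegree K t k q).2]

/-- A monic polynomial of degree `2 ^ k` does not fit into `2 ^ k` coordinates. Subtracting the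
monic `iter k` removes the leading term and changes the values at the nodes in a known way. -/
theorem degree_den_sub_iter (K : ℕ) (t : ℕ → ℝ) (k q : ℕ) :
    (den K t k q - iter k).degree < ((2 ^ k : ℕ) : WithBot ℕ) := by
  rw [← degree_den K t k q]
  refine degree_sub_lt_left (by rw [degree_den, degree_iter]) (den_monic_natDegree K t k q).1.ne_zero ?_
  rw [(den_monic_natDegree K t k q).1.leadingCoeff, (iter_monic k).leadingCoeff]

theorem degree_num (K : ℕ) (t w : ℕ → ℝ) (k q : ℕ) :
    (num K t w k q).degree < ((2 ^ k : ℕ) : WithBot ℕ) := by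
  induction k generalizing q with
  | zero => exact degree_C_le.trans_lt (by simp)
  | succ k ih =>
    have h : ∀ q q', (num K t w k q * den K t k q').degree < ((2 ^ (k + 1) : ℕ) : WithBot ℕ) := by
      intro q q'
      rw [degree_mul, degree_den, pow_succ, mul_two, Nat.cast_add]
      exact WithBot.add_lt_add_right WithBot.coe_ne_bot (ih _)
    exact (degree_add_le _ _).trans_lt (max_lt (h _ _) (h _ _))

theorem eval_den_ne_zero {K : ℕ} {t : ℕ → ℝ} {z : ℝ} (h : ∀ j, z ≠ t j) (k q : ℕ) :
    (den K t k q).eval z ≠ 0 := by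
  induction k generalizing q with
  | zero => simpa [den, sub_eq_zero] using h q
  | succ k ih => simpa [den] using ⟨ih _, ih _⟩

theorem sum_range_two_mul {M : Type*} [AddCommMonoid M] (f : ℕ → M) (m : ℕ) :
    ∑ r ∈ Finset.range (2 * m), f r = ∑ r ∈ Finset.range m, (f (2 * r) + f (2 * r + 1)) := by
  induction m with
  | zero => simp
  | succ m ih =>
    rw [show 2 * (m + 1) = 2 * m + 1 + 1 by ring, Finset.sum_range_succ, Finset.sum_range_succ, ih,
      Finset.sum_range_succ, add_assoc]

/-- Addition of fractions along the tree. The leaves below node `q` of level `k` are the indices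
congruent to `q` modulo `2 ^ (K - k)`; passing to the two children separates even and odd `r`. -/
theorem eval_num_div_den {K : ℕ} {t w : ℕ → ℝ} {z : ℝ} (h : ∀ j, z ≠ t j) {k q : ℕ} (hk : k ≤ K) :
    (num K t w k q).eval z / (den K t k q).eval z =
      ∑ r ∈ Finset.range (2 ^ k), w (r * 2 ^ (K - k) + q) / (z - t (r * 2 ^ (K - k) + q)) := by
  induction k generalizing q with
  | zero => simp [num, den]
  | succ k ih =>
    have h₁ := eval_den_ne_zero (K := K) h k q
    have h₂ := eval_den_ne_zero (K := K) h k (2 ^ (K - (k + 1)) + q)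
    have e : (num K t w (k + 1) q).eval z / (den K t (k + 1) q).eval z =
        (num K t w k q).eval z / (den K t k q).eval z +
        (num K t w k (2 ^ (K - (k + 1)) + q)).eval z /
          (den K t k (2 ^ (K - (k + 1)) + q)).eval z := by
      simp only [num, den, eval_add, eval_mul]
      field_simp
    rw [e, ih (by omega), ih (by omega), pow_succ', sum_range_two_mul, ← Finset.sum_add_distrib]
    have e2 : 2 ^ (K - k) = 2 * 2 ^ (K - (k + 1)) := by
      rw [← pow_succ']; congr 1; omega
    refine Finset.sum_congr rfl fun r _ => ?_
    rw [e2, show r * (2 * 2 ^ (K - (k + 1))) + q = 2 * r * 2 ^ (K - (k + 1)) + q by ring,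
      show r * (2 * 2 ^ (K - (k + 1))) + (2 ^ (K - (k + 1)) + q) =
        (2 * r + 1) * 2 ^ (K - (k + 1)) + q by ring]

theorem eval_den_leaf {K : ℕ} (s : ℕ → ℝ) {k j : ℕ} (hk : k ≤ K) (hj : j < 2 ^ K) :
    (den K s k (j % 2 ^ (K - k))).eval (s j) = 0 := by
  induction k with
  | zero => simp [den, Nat.mod_eq_of_lt hj]
  | succ k ih =>
    have ih := ih (by omega)
    have e2 : 2 ^ (K - k) = 2 * 2 ^ (K - (k + 1)) := by
      rw [← pow_succ']; congr 1; omega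
    set B := 2 ^ (K - (k + 1)) with hB
    have hB0 : 0 < B := Nat.two_pow_pos _
    rw [e2] at ih
    have hlt := Nat.mod_lt j hB0
    rw [mul_comm 2 B, Nat.mod_mul] at ih
    simp only [den, eval_mul, ← hB]
    -- The next binary digit of `j` decides which of the two factors has the root `s j`.
    rcases Nat.mod_two_eq_zero_or_one (j / B) with h | h
    · rw [h, mul_zero, add_zero] at ih
      rw [ih, zero_mul]
    · rw [h, mul_one, add_comm] at ih
      rw [ih, mul_zero]

/-! #### Simultaneous residues -/

/-- One step from the residues of polynomials modulo the products at one level to residues at the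
level below: division in which the value at a root is divided by a known factor. -/
theorem Rep.residues {h k B : ℕ} (hh : h = 2 ^ k * B) {a u r F₂ F₃ V₂ V₃ : ℕ → ℝ} {F G : ℕ → ℝ[X]}
    (hF : ∀ q, q < B → (F q).degree < ((2 ^ (k + 1) : ℕ) : WithBot ℕ))
    (hG : ∀ q, (G q).degree = ((2 ^ k : ℕ) : WithBot ℕ))
    (hG0 : ∀ q i, q < 2 * B → (G q).eval (node i) ≠ 0)
    (hF₂ : ∀ q b, q < B → b < 2 ^ k → F₂ (q * 2 ^ k + b) = (F q).eval (node (2 ^ k * 2 + b)))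
    (hF₃ : ∀ q b, q < B → b < 2 ^ k → F₃ (q * 2 ^ k + b) = (F q).eval (node (2 ^ k * 3 + b)))
    (hV₂ : ∀ q b, q < 2 * B → b < 2 ^ k →
      V₂ (q * 2 ^ k + b) = (G q).eval (node (2 ^ k * 2 + b)))
    (hV₃ : ∀ q b, q < 2 * B → b < 2 ^ k →
      V₃ (q * 2 ^ k + b) = (G q).eval (node (2 ^ k * 3 + b)))
    (hu₁ : ∀ j, j < h → u j = F₂ j / V₂ j) (hu₂ : ∀ j, j < h → u (h + j) = F₂ j / V₂ (h + j))
    (hr₁ : ∀ j, j < h → r j = F₃ j - fwd 3 h k (inv 2 h k u) j * V₃ j)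
    (hr₂ : ∀ j, j < h → r (h + j) = F₃ j - fwd 3 h k (inv 2 h k u) (h + j) * V₃ (h + j))
    (ha : ∀ j, j < 2 * h → a j = inv 3 h k r j) :
    ∃ F' : ℕ → ℝ[X], Rep k (2 * B) a F' ∧ ∀ q z, q < 2 * B → (G q).eval z = 0 →
      (F (q % B)).eval z = ((iter k).eval z - node 2) / (-2 * node 2) * (F' q).eval z := by
  have hh2 : 2 * h = 2 ^ k * (2 * B) := by rw [hh]; ring
  have hν := node_two_pos.ne'
  -- `κ` interpolates `F / G` at the nodes below `2`. At a root of `G` the correction `κ * G` drops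
  -- out, whereas `F - κ * G` vanishes at all nodes below `2`.
  obtain ⟨κ, hκ, hκv⟩ := Rep.of_fwd_inv (i := 2) (by norm_num) u hh2
  have hsplit : ∀ q b, q < 2 * B → b < 2 ^ k → q % B < B ∧ (q % B) * 2 ^ k + b < h ∧
      (q * 2 ^ k + b = (q % B) * 2 ^ k + b ∨ q * 2 ^ k + b = h + ((q % B) * 2 ^ k + b)) := by
    intro q b hq hb
    have hm : q % B < B := Nat.mod_lt _ (by omega)
    refine ⟨hm, by rw [hh]; exact index_lt' hb hm, ?_⟩
    rcases Nat.lt_or_ge q B with h' | h'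
    · left; rw [Nat.mod_eq_of_lt h']
    · right
      rw [Nat.mod_eq_sub_mod h', Nat.mod_eq_of_lt (by omega), hh]
      zify [h']; ring
  have hu : ∀ q b, q < 2 * B → b < 2 ^ k → u (q * 2 ^ k + b) =
      (F (q % B)).eval (node (2 ^ k * 2 + b)) / (G q).eval (node (2 ^ k * 2 + b)) := by
    intro q b hq hb
    obtain ⟨hm, hlt, hc⟩ := hsplit q b hq hb
    rw [← hV₂ q b hq hb, ← hF₂ _ b hm hb]
    rcases hc with hc | hc <;> rw [hc]
    exacts [hu₁ _ hlt, hu₂ _ hlt]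
  have hr : ∀ q b, q < 2 * B → b < 2 ^ k → r (q * 2 ^ k + b) =
      (F (q % B) - κ q * G q).eval (node (2 ^ k * 3 + b)) := by
    intro q b hq hb
    obtain ⟨hm, hlt, hc⟩ := hsplit q b hq hb
    rw [eval_sub, eval_mul, ← hV₃ q b hq hb, ← hF₃ _ b hm hb,
      ← hκ.fwd_eq (i := 3) (by norm_num) hh2 hq hb]
    rcases hc with hc | hc <;> rw [hc]
    exacts [hr₁ _ hlt, hr₂ _ hlt]
  have hdeg : ∀ q, q < 2 * B → (F (q % B) - κ q * G q).degree < ((2 ^ (k + 1) : ℕ) : WithBot ℕ) := by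
    intro q hq
    refine (degree_sub_le _ _).trans_lt (max_lt (hF _ (Nat.mod_lt _ (by omega))) ?_)
    rw [degree_mul, hG, pow_succ, mul_two, Nat.cast_add]
    exact WithBot.add_lt_add_right WithBot.coe_ne_bot (hκ.degree_lt hq)
  -- With coordinate halves `lo`, `hi` of `F - κ * G`, its residue modulo `iter k - node 2` is `lo +
  -- node 2 * hi`. This has degree less than `2 ^ k` and vanishes at the `2 ^ k` nodes below `2`, so
  -- it is zero and the quotient is `hi`.
  have hex : ∀ q, ∃ H : ℝ[X], q < 2 * B → H.degree < ((2 ^ k : ℕ) : WithBot ℕ) ∧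
      F (q % B) - κ q * G q = (iter k - C (node 2)) * H := by
    intro q
    by_cases hq : q < 2 * B
    · obtain ⟨c, hc⟩ := exists_expand (hdeg q hq)
      rw [expand] at hc
      refine ⟨expand k fun m => c (2 ^ k + m), fun _ => ⟨degree_expand_lt _ _, ?_⟩⟩
      have h0 : expand k c + C (node 2) * expand k (fun m => c (2 ^ k + m)) = 0 := by
        refine eq_zero_of_eval_node (i := 2) (by norm_num)
          (by rw [← expand_add_mul]; exact degree_expand_lt _ _) fun b hb => ?_
        have : (F (q % B) - κ q * G q).eval (node (2 ^ k * 2 + b)) = 0 := by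
          rw [eval_sub, eval_mul, hκv q b hq hb, hu q b hq hb, div_mul_cancel₀ _ (hG0 q _ hq),
            sub_self]
        rw [← hc] at this
        simp only [eval_add, eval_mul, eval_C] at this ⊢
        rwa [eval_node_iter (by norm_num) hb] at this
      rw [← hc]
      linear_combination h0
    · exact ⟨0, fun h => absurd h hq⟩
  choose H hH using hex
  -- Below node `3` the factor `iter k - node 2` is `-2 * node 2`. With this normalisation the
  -- values of the new polynomials there are those of `F - κ * G`, without a division.
  refine ⟨fun q => C (-2 * node 2) * H q, ?_, fun q z hq hz => ?_⟩
  · refine (Rep.inv_of_eval (i := 3) (v := r) (by norm_num) hh2 (fun q hq => ?_)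
      fun q b hq hb => ?_).congr fun m hm => ha m (by omega)
    · rw [degree_C_mul (mul_ne_zero (by norm_num) hν)]
      exact (hH q hq).1
    · rw [hr q b hq hb, (hH q hq).2]
      simp only [eval_mul, eval_sub, eval_C]
      rw [eval_node_iter (by norm_num) hb, node_three]
      ring
  · have := congrArg (eval z) (hH q hq).2
    simp only [eval_mul, eval_sub, eval_C, hz, mul_zero, sub_zero] at this ⊢
    rw [this]
    field_simp

/-- The product of the factors divided out of the value at `z` from level `K` down to level `k`. -/
noncomputable def scale (K k : ℕ) (z : ℝ) : ℝ :=
  ∏ l ∈ Finset.Ico k K, ((iter l).eval z - node 2) / (-2 * node 2)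

theorem scale_ne_zero {z : ℝ} (hz : 2 < z) (K k : ℕ) : scale K k z ≠ 0 := by
  refine Finset.prod_ne_zero_iff.2 fun l _ => div_ne_zero ?_ ?_
  · linarith [two_lt_eval_iter hz l, (abs_lt.1 (abs_node_lt 2)).2]
  · linarith [node_two_pos]

theorem scale_eq {K k : ℕ} (hk : k < K) (z : ℝ) :
    scale K k z = scale K (k + 1) z * (((iter k).eval z - node 2) / (-2 * node 2)) := by
  rw [scale, scale, Finset.prod_eq_prod_Ico_succ_bot hk, mul_comm]

end FastCauchy

/-! ### The program for the products with Cauchy matrices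

Registers: `20`, `21` sizes, `22` the padded size `n = 2 ^ K`, `23` its half, `34` its quarter,
`24` the exponent `K`, `25` the level `k`, `26` the number `k * n`, `35` the number `2 ^ k`,
`29`, `30` the size of a transform and its half, `31`, `32` positions of twiddle factors,
`27`, `33` and `36` loop counters.
Real arrays: `20`, `21`, `22` input, `23` output, `24` transform, `25` buffer, `26` nodes,
`27`, `28` denominators and numerators, `30`, `31` values of denominators at all levels,
`32`, `33` values of numerators, `34`, `35` scratch, `36` residues.
The array `20` of natural numbers holds remainders modulo powers of two. -/

namespace FastCauchy

open RealRAM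

/-- The tables the transforms use. -/
structure Tables (K : ℕ) (σ : State) : Prop where
  size : σ.nreg 22 = 2 ^ (K + 2)
  half : σ.nreg 23 = 2 ^ (K + 1)
  quarter : σ.nreg 34 = 2 ^ K
  nodes : ∀ m, 1 ≤ m → m < 2 ^ (K + 3) → σ.rarr 26 m = node m
  rems : ∀ s m, s ≤ K + 2 → m < 2 ^ (K + 2) → σ.narr 20 (s * 2 ^ (K + 2) + m) = m % 2 ^ s

/-- The tables, and the registers of level `k`. -/
structure Level (K k : ℕ) (σ : State) : Prop extends Tables K σ where
  level : σ.nreg 25 = k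
  offset : σ.nreg 26 = k * 2 ^ (K + 2)
  pow : σ.nreg 35 = 2 ^ k

theorem Tables.congr {K : ℕ} {σ τ : State} (h : Tables K σ) (h22 : τ.nreg 22 = σ.nreg 22)
    (h23 : τ.nreg 23 = σ.nreg 23) (h34 : τ.nreg 34 = σ.nreg 34) (hr : τ.rarr 26 = σ.rarr 26)
    (hn : τ.narr 20 = σ.narr 20) : Tables K τ :=
  ⟨by rw [h22, h.size], by rw [h23, h.half], by rw [h34, h.quarter],
    by rw [hr]; exact h.nodes, by rw [hn]; exact h.rems⟩

theorem Level.congr {K k : ℕ} {σ τ : State} (h : Level K k σ)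
    (hreg : ∀ r ∈ [22, 23, 34, 25, 26, 35], τ.nreg r = σ.nreg r) (hr : τ.rarr 26 = σ.rarr 26)
    (hn : τ.narr 20 = σ.narr 20) : Level K k τ :=
  ⟨h.toTables.congr (hreg _ (by simp)) (hreg _ (by simp)) (hreg _ (by simp)) hr hn,
    by rw [hreg _ (by simp), h.level], by rw [hreg _ (by simp), h.offset],
    by rw [hreg _ (by simp), h.pow]⟩

theorem Level.frame {K k : ℕ} {p : Prog} {σ τ : State} (h : Level K k σ) (hf : Frame p σ τ)
    (hn : ([22, 23, 34, 25, 26, 35].all fun r => !p.wn.elem r) = true := by rfl)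
    (hr : p.wra.elem 26 = false := by rfl) (hna : p.wna.elem 20 = false := by rfl) :
    Level K k τ :=
  h.congr (fun r hr => hf.nreg r (notMem_of_elem (by
    rw [List.all_eq_true] at hn; simpa using hn r hr))) (hf.ra 26 hr) (hf.na 20 hna)

/-- The body of the loop over the stages of the transform. -/
def fwdBody : Prog :=
  .seq (mapR 33 29 25 (.reg 33) (.add (.get 24 (.half (.reg 33)))
    (.mul (.get 26 (.add (.reg 31) (.get 20 (.add (.reg 32) (.reg 33)))))
      (.get 24 (.add (.half (.reg 33)) (.reg 30))))))
  (.seq (mapR 33 29 24 (.reg 33) (.get 25 (.reg 33)))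
  (.seq (.nset 31 (.add (.reg 31) (.reg 31))) (.nset 32 (.add (.reg 32) (.reg 22)))))

/-- The transform below the node `i`. -/
def fwdProg (i : ℕ) : Prog :=
  .seq (.nset 31 (.const (2 * i))) (.seq (.nset 32 (.reg 22)) (forLoop 27 25 fwdBody))

theorem twiddle_index_lt {K k i s x : ℕ} (hk : k < K + 2) (hs : s < k) (hi : i ≤ 3) :
    2 ^ (s + 1) * i + x % 2 ^ (s + 1) < 2 ^ (K + 3) := by
  have h1 := Nat.mod_lt x (Nat.two_pow_pos (s + 1))
  have h2 : (2 : ℕ) ^ (s + 1) ≤ 2 ^ (K + 1) := Nat.pow_le_pow_right two_pos (by omega)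
  have h3 : (2 : ℕ) ^ (K + 3) = 4 * 2 ^ (K + 1) := by ring
  have h4 : 2 ^ (s + 1) * i ≤ 2 ^ (s + 1) * 3 := Nat.mul_le_mul_left _ hi
  omega

/-- Indices can only be added, subtracted and halved: the base `2 ^ (s + 1) * i` of the twiddle
factors is doubled from stage to stage, the row of the table of remainders advances by its length,
and a stage is computed in a buffer and copied back. -/
theorem runsWithin_fwdProg {K k i h : ℕ} {σ : State} (hσ : Level K k σ) (hk : k < K + 2)
    (hi : 1 ≤ i) (hi3 : i ≤ 3)
    (h29 : σ.nreg 29 = 2 * h) (h30 : σ.nreg 30 = h) (hh : 2 * h ≤ 2 ^ (K + 2)) :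
    RunsWithin (fwdProg i) σ (k * (90 * h + 40) + 20) fun τ =>
      ∀ m, m < 2 * h → τ.rarr 24 m = fwd i h k (σ.rarr 24) m := by
  refine (RunsWithin.straight_seq (T := 2 + (k * (90 * h + 40) + 6)) 2 rfl le_rfl fun τ hτ _ =>
    RunsWithin.straight_seq 2 rfl le_rfl fun τ' hτ' _ => ?_).le (by omega)
  have hlev : Level K k τ' := hσ.congr (by subst hτ' hτ; simp [Prog.run, upd])
    (by subst hτ' hτ; rfl) (by subst hτ' hτ; rfl)
  have e31 : τ'.nreg 31 = 2 * i := by subst hτ' hτ; simp [Prog.run, upd, NExpr.eval]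
  have e32 : τ'.nreg 32 = 2 ^ (K + 2) := by
    subst hτ' hτ; simp [Prog.run, upd, NExpr.eval, hσ.size]
  have e29 : τ'.nreg 29 = 2 * h := by subst hτ' hτ; simp [Prog.run, upd, h29]
  have e30 : τ'.nreg 30 = h := by subst hτ' hτ; simp [Prog.run, upd, h30]
  have e24 : τ'.rarr 24 = σ.rarr 24 := by subst hτ' hτ; rfl
  rw [← e24]
  clear hτ hτ' h29 h30 e24
  refine (RunsWithin.forLoopF (n := k) (C := 90 * h + 32) (fun s ρ =>
    ρ.nreg 31 = 2 ^ (s + 1) * i ∧ ρ.nreg 32 = (s + 1) * 2 ^ (K + 2) ∧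
    ∀ m, m < 2 * h → ρ.rarr 24 m = fwd i h s (τ'.rarr 24) m) hlev.level ?_ ?_).mono
    (by ring_nf; omega) fun ρ hρ => hρ.1.2.2
  · simp [upd, e31, e32, fwd]
  rintro s ρ hs - hf ⟨h31, h32, hA⟩
  have hlevρ : Level K k ρ := hlev.frame hf
  have e29' : ρ.nreg 29 = 2 * h := (hf.n 29).trans e29
  have e30' : ρ.nreg 30 = h := (hf.n 30).trans e30
  refine ((RunsWithin.mapR (2 * h) 0 (fwdStage i h s (ρ.rarr 24)) (by decide) e29'
    (fun j X => by simp [NExpr.eval]) fun j X hj _ => ?_).seqf (T' := 24 * h + 6 + 8)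
    fun ρ₁ h₁ hf₁ => ((RunsWithin.mapR (2 * h) 0 (ρ₁.rarr 25) (by decide)
    ((hf₁.n 29).trans e29') (fun j X => by simp [NExpr.eval]) fun j X hj _ => ?_).seqf (T' := 8)
    fun ρ₂ h₂ hf₂ => ?_).le ?_).le ?_
  · have e := hlevρ.rems (s + 1) j (by omega) (by omega)
    have e' := hlevρ.nodes (2 ^ (s + 1) * i + j % 2 ^ (s + 1)) (by
      have := Nat.mul_pos (Nat.two_pow_pos (s + 1)) hi; omega) (twiddle_index_lt hk hs hi3)
    simp [RExpr.eval, NExpr.eval, upd, fwdStage, h31, h32, e, e', e30']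
  · simp [RExpr.eval, NExpr.eval, upd]
  · refine RunsWithin.straight 8 rfl (by decide) ⟨?_, ?_, fun m hm => ?_⟩
    · simp [Prog.run, upd, NExpr.eval, hf₂.n 31, hf₁.n 31, h31]; ring
    · simp [Prog.run, upd, NExpr.eval, hf₂.n 32, hf₁.n 32, h32, hf₂.n 22, hf₁.n 22, hlevρ.size]
      ring
    · have a₂ := h₂.1 m hm
      have a₁ := h₁.1 m hm
      rw [Nat.zero_add] at a₁ a₂
      simp only [Prog.run]
      rw [a₂, a₁, fwd]
      exact fwdStage_congr hA m hm
  · simp [NExpr.cost, RExpr.cost]; omega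
  · simp [NExpr.cost, RExpr.cost]; omega

/-- The body of the loop over the stages of the inverse transform. -/
noncomputable def invBody : Prog :=
  .seq (mapR 33 30 25 (.reg 33) (.div (.add (.get 24 (.add (.reg 33) (.reg 33)))
    (.get 24 (.add (.add (.reg 33) (.reg 33)) (.const 1)))) (.const 2)))
  (.seq (mapR 33 30 25 (.add (.reg 30) (.reg 33))
    (.div (.sub (.get 24 (.add (.reg 33) (.reg 33)))
      (.get 24 (.add (.add (.reg 33) (.reg 33)) (.const 1))))
      (.mul (.const 2) (.get 26 (.add (.reg 31)
        (.get 20 (.add (.reg 32) (.add (.reg 33) (.reg 33)))))))))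
  (.seq (mapR 33 29 24 (.reg 33) (.get 25 (.reg 33)))
  (.seq (.nset 31 (.half (.reg 31))) (.nset 32 (.sub (.reg 32) (.reg 22))))))

/-- The inverse transform below the node `i`; the value of `e` is `2 ^ k * i`. -/
noncomputable def invProg (e : NExpr) : Prog :=
  .seq (.nset 31 e) (.seq (.nset 32 (.reg 26)) (forLoop 27 25 invBody))

/-- The stages are undone from the last to the first. The invariant states that the inverse stages
still to come, applied to the present contents, give the final result. -/
theorem runsWithin_invProg {K k i h : ℕ} {σ : State} {e : NExpr} (hσ : Level K k σ)
    (hk : k < K + 2) (hi : 1 ≤ i) (hi3 : i ≤ 3) (he : e.eval σ = 2 ^ k * i) (hec : e.cost ≤ 5) (h29 : σ.nreg 29 = 2 * h)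
    (h30 : σ.nreg 30 = h) (hh : 2 * h ≤ 2 ^ (K + 2)) :
    RunsWithin (invProg e) σ (k * (90 * h + 40) + 20) fun τ =>
      ∀ m, m < 2 * h → τ.rarr 24 m = inv i h k (σ.rarr 24) m := by
  refine (RunsWithin.straight_seq (T := 2 + (k * (90 * h + 40) + 6)) 6 rfl
    (by simp [Prog.wcost]; omega) fun τ hτ _ =>
    RunsWithin.straight_seq 2 rfl le_rfl fun τ' hτ' _ => ?_).le (by omega)
  have hlev : Level K k τ' := hσ.congr (by subst hτ' hτ; simp [Prog.run, upd])
    (by subst hτ' hτ; rfl) (by subst hτ' hτ; rfl)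
  have e31 : τ'.nreg 31 = 2 ^ k * i := by subst hτ' hτ; simp [Prog.run, upd, he]
  have e32 : τ'.nreg 32 = k * 2 ^ (K + 2) := by
    subst hτ' hτ; simp [Prog.run, upd, NExpr.eval, hσ.offset]
  have e29 : τ'.nreg 29 = 2 * h := by subst hτ' hτ; simp [Prog.run, upd, h29]
  have e30 : τ'.nreg 30 = h := by subst hτ' hτ; simp [Prog.run, upd, h30]
  have e24 : τ'.rarr 24 = σ.rarr 24 := by subst hτ' hτ; rfl
  rw [← e24]
  clear hτ hτ' h29 h30 e24
  refine (RunsWithin.forLoopF (n := k) (C := 90 * h + 32) (fun t ρ =>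
    ρ.nreg 31 = 2 ^ (k - t) * i ∧ ρ.nreg 32 = (k - t) * 2 ^ (K + 2) ∧
    ∀ m, m < 2 * h → inv i h (k - t) (ρ.rarr 24) m = inv i h k (τ'.rarr 24) m) hlev.level
    ?_ ?_).mono (by ring_nf; omega) fun ρ hρ m hm => by simpa [inv] using hρ.1.2.2 m hm
  · simp [upd, e31, e32]
  rintro t ρ ht - hf ⟨h31, h32, hA⟩
  obtain ⟨s, hs⟩ : ∃ s, k - t = s + 1 := ⟨k - t - 1, by omega⟩
  have hs' : k - (t + 1) = s := by omega
  rw [hs] at h31 h32 hA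
  have hlevρ : Level K k ρ := hlev.frame hf
  have e29' : ρ.nreg 29 = 2 * h := (hf.n 29).trans e29
  have e30' : ρ.nreg 30 = h := (hf.n 30).trans e30
  refine ((RunsWithin.mapR h 0 (invStage i h s (ρ.rarr 24)) (by decide) e30'
    (fun j X => by simp [NExpr.eval]) fun j X hj _ => ?_).seqf (T' := 60 * h + 20)
    fun ρ₁ h₁ hf₁ => ((RunsWithin.mapR h h (fun j => invStage i h s (ρ.rarr 24) (h + j))
    (by decide) ((hf₁.n 30).trans e30') (fun j X => by simp [NExpr.eval, upd, hf₁.n 30, e30'])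
    fun j X hj _ => ?_).seqf (T' := 24 * h + 14)
    fun ρ₂ h₂ hf₂ => ((RunsWithin.mapR (2 * h) 0 (ρ₂.rarr 25) (by decide)
    (((hf₂.n 29).trans (hf₁.n 29)).trans e29') (fun j X => by simp [NExpr.eval])
    fun j X hj _ => ?_).seqf (T' := 8) fun ρ₃ h₃ hf₃ => ?_).le ?_).le ?_).le ?_
  · simp only [RExpr.eval, NExpr.eval, upd, invStage]
    simp only [reduceIte, if_pos hj, two_mul, show (24 : ℕ) ≠ 25 by decide]
  · have e := hlevρ.rems (s + 1) (2 * j) (by omega) (by omega)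
    have e' := hlevρ.nodes (2 ^ (s + 1) * i + 2 * j % 2 ^ (s + 1)) (by
      have := Nat.mul_pos (Nat.two_pow_pos (s + 1)) hi; omega)
      (twiddle_index_lt (K := K) (k := k) hk (by omega) hi3)
    rw [two_mul] at e e'
    simp only [RExpr.eval, NExpr.eval, upd, invStage]
    simp only [show ¬h + j < h by omega, Nat.add_sub_cancel_left, two_mul, hf₁.ra 24, hf₁.na 20,
      hf₁.n 31, hf₁.n 32, h31, h32, e, hf₁.ra 26, e', reduceIte, show (24 : ℕ) ≠ 25 by decide,
      show (26 : ℕ) ≠ 25 by decide, show (31 : ℕ) ≠ 33 by decide, show (32 : ℕ) ≠ 33 by decide]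
  · simp [RExpr.eval, NExpr.eval, upd]
  · have hA' : ∀ m, m < 2 * h → ρ₃.rarr 24 m = invStage i h s (ρ.rarr 24) m := fun m hm => by
      have a₃ := h₃.1 m hm
      rw [Nat.zero_add] at a₃
      rw [a₃]
      rcases Nat.lt_or_ge m h with hmh | hmh
      · have a₁ := h₁.1 m hmh
        rw [Nat.zero_add] at a₁
        rw [h₂.2.1 m (Or.inl hmh), a₁]
      · have a₂ := h₂.1 (m - h) (by omega)
        rwa [show h + (m - h) = m by omega] at a₂
    refine RunsWithin.straight 8 rfl (by decide) ⟨?_, ?_, fun m hm => ?_⟩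
    · simp [Prog.run, upd, NExpr.eval, hf₃.n 31, hf₂.n 31, hf₁.n 31, h31, hs']
      rw [show 2 ^ (s + 1) * i = 2 * (2 ^ s * i) by ring]; omega
    · simp [Prog.run, upd, NExpr.eval, hf₃.n 32, hf₂.n 32, hf₁.n 32, h32, hf₃.n 22, hf₂.n 22,
        hf₁.n 22, hlevρ.size, hs']
      rw [add_mul]; omega
    · rw [← hA m hm, hs', inv]
      exact inv_congr hA' m hm
  · simp [NExpr.cost, RExpr.cost]; omega
  · simp [NExpr.cost, RExpr.cost]; omega
  · simp [NExpr.cost, RExpr.cost]; omega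

end FastCauchy

/-! ### Transforms between arrays, and the evaluations in a step up the product tree. -/

namespace FastCauchy

open RealRAM

/-- Load the transform array with the values of `e`, apply the program `T` to it and store the
values of `e'`. -/
def xform (L : ℕ) (e : RExpr) (T : Prog) (d : ℕ) (i : NExpr) (e' : RExpr) : Prog :=
  .seq (mapR 33 L 24 (.reg 33) e) (.seq T (mapR 33 L d i e'))

/-- `f` describes the effect of `T` on the first `M` cells, and `hf` says that it depends on these
cells only. The hypotheses `hi` and `he'` range over all states that agree with `σ` outside of what
a transform may overwrite. -/
theorem runsWithin_xform {K k L M d o : ℕ} {σ : State} {T : Prog} {i : NExpr} {e e' : RExpr}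
    {f : (ℕ → ℝ) → ℕ → ℝ} (a g : ℕ → ℝ) (hσ : Level K k σ) (hL : σ.nreg L = M)
    (hM : M ≤ 2 ^ (K + 2)) (hLw : L ∉ [27, 31, 32, 33]) (hd : d ∉ [24, 25])
    (hT : ∀ τ, Level K k τ → τ.nreg 29 = σ.nreg 29 → τ.nreg 30 = σ.nreg 30 →
      RunsWithin T τ (k * (45 * 2 ^ (K + 2) + 40) + 20) fun ρ =>
        ∀ m, m < M → ρ.rarr 24 m = f (τ.rarr 24) m)
    (hf : ∀ u v : ℕ → ℝ, (∀ m, m < M → u m = v m) → ∀ m, m < M → f u m = f v m)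
    (hwn : T.wn ⊆ [27, 31, 32, 33]) (hwra : T.wra ⊆ [24, 25])
    (he : ∀ j X, j < M →
      e.eval { σ with nreg := upd σ.nreg 33 j, rarr := upd σ.rarr 24 X } = a j)
    (hi : ∀ τ : State, (∀ r, r ∉ [27, 31, 32, 33] → τ.nreg r = σ.nreg r) → ∀ j X,
      i.eval { τ with nreg := upd τ.nreg 33 j, rarr := upd τ.rarr d X } = o + j)
    (he' : ∀ τ : State, (∀ r, r ∉ [27, 31, 32, 33] → τ.nreg r = σ.nreg r) →
      (∀ r, r ∉ [24, 25] → τ.rarr r = σ.rarr r) → ∀ j X, j < M → τ.rarr 24 j = f a j →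
      e'.eval { τ with nreg := upd τ.nreg 33 j, rarr := upd τ.rarr d X } = g j)
    (hc : e.cost ≤ 30 := by decide) (hc' : i.cost + e'.cost ≤ 31 := by decide) :
    RunsWithin (xform L e T d i e') σ (90 * (k + 1) * 2 ^ (K + 2)) fun τ =>
      (∀ j, j < M → τ.rarr d (o + j) = g j) ∧
      ∀ m, m < o ∨ o + M ≤ m → τ.rarr d m = σ.rarr d m := by
  have hJ : L ≠ 33 := fun h => hLw (by simp [h])
  have hn : 4 ≤ 2 ^ (K + 2) := by rw [pow_add]; have := Nat.two_pow_pos K; omega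
  refine ((RunsWithin.mapR M 0 a hJ hL (fun j X => by simp [NExpr.eval])
    fun j X hj _ => he j X hj).seq (T' := k * (45 * 2 ^ (K + 2) + 40) + 20 + (M * 40 + 6))
    fun τ hτ => ?_).le ?_
  · have hlev : Level K k τ := hσ.congr (fun r hr => hτ.2.2.2.1 r (by rintro rfl; simp at hr))
      (hτ.2.2.1 26 (by decide)) (by rw [hτ.2.2.2.2.1])
    refine (hT τ hlev (hτ.2.2.2.1 29 (by decide)) (hτ.2.2.2.1 30 (by decide))).seqf
      fun ρ hρ hfρ => ?_
    have hreg : ∀ r, r ∉ [27, 31, 32, 33] → ρ.nreg r = σ.nreg r := fun r hr => by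
      rw [hfρ.nreg r fun h => hr (hwn h), hτ.2.2.2.1 r (by rintro rfl; simp at hr)]
    have hrarr : ∀ r, r ∉ [24, 25] → ρ.rarr r = σ.rarr r := fun r hr => by
      rw [hfρ.rarr r fun h => hr (hwra h), hτ.2.2.1 r (by rintro rfl; simp at hr)]
    have hA : ∀ m, m < M → ρ.rarr 24 m = f a m := fun m hm => by
      rw [hρ m hm]
      exact hf _ _ (fun m hm => by simpa using hτ.1 m hm) m hm
    refine (RunsWithin.mapR M o g hJ ((hreg L hLw).trans hL) (hi ρ hreg) fun j X hj _ =>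
      he' ρ hreg hrarr j X hj (hA j hj)).mono ?_ fun ν hν => ⟨hν.1, ?_⟩
    · have : M * (i.cost + e'.cost + 9) ≤ M * 40 := Nat.mul_le_mul_left _ (by omega)
      omega
    · rw [← hrarr d hd]; exact hν.2.1
  · have h1 : M * (NExpr.cost (.reg 33) + e.cost + 9) ≤ M * 40 :=
      Nat.mul_le_mul_left _ (by simp only [NExpr.cost]; omega)
    have h2 : k * 40 ≤ k * (10 * 2 ^ (K + 2)) := Nat.mul_le_mul_left _ (by omega)
    nlinarith

/-- `2 ^ k * 2` and `2 ^ k * 3`. -/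
def pow2 : NExpr := .add (.reg 35) (.reg 35)
/-- `2 ^ k * 3`. -/
def pow3 : NExpr := .add (.reg 35) (.add (.reg 35) (.reg 35))

theorem hyp_fwd {K k i h M : ℕ} {σ : State} (hk : k < K + 2) (hi : 1 ≤ i) (hi3 : i ≤ 3)
    (hM : M = 2 * h) (h29 : σ.nreg 29 = M) (h30 : σ.nreg 30 = h) (hh : M ≤ 2 ^ (K + 2)) (τ : State)
    (hτ : Level K k τ) (h₁ : τ.nreg 29 = σ.nreg 29) (h₂ : τ.nreg 30 = σ.nreg 30) :
    RunsWithin (fwdProg i) τ (k * (45 * 2 ^ (K + 2) + 40) + 20) fun ρ =>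
      ∀ m, m < M → ρ.rarr 24 m = fwd i h k (τ.rarr 24) m := by
  subst hM
  exact   (runsWithin_fwdProg hτ hk hi hi3 (h₁.trans h29) (h₂.trans h30) hh).le
    (Nat.add_le_add_right (Nat.mul_le_mul_left _ (by omega)) _)

theorem hyp_inv {K k i h M : ℕ} {σ : State} {e : NExpr} (hk : k < K + 2) (hi : 1 ≤ i) (hi3 : i ≤ 3)
    (he : ∀ τ, Level K k τ → e.eval τ = 2 ^ k * i) (hec : e.cost ≤ 5)
    (hM : M = 2 * h) (h29 : σ.nreg 29 = M) (h30 : σ.nreg 30 = h) (hh : M ≤ 2 ^ (K + 2)) (τ : State)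
    (hτ : Level K k τ) (h₁ : τ.nreg 29 = σ.nreg 29) (h₂ : τ.nreg 30 = σ.nreg 30) :
    RunsWithin (invProg e) τ (k * (45 * 2 ^ (K + 2) + 40) + 20) fun ρ =>
      ∀ m, m < M → ρ.rarr 24 m = inv i h k (τ.rarr 24) m := by
  subst hM
  exact   (runsWithin_invProg hτ hk hi hi3 (he τ hτ) hec (h₁.trans h29) (h₂.trans h30) hh).le
    (Nat.add_le_add_right (Nat.mul_le_mul_left _ (by omega)) _)

theorem fwd_congr' {i h k M : ℕ} {a b : ℕ → ℝ} (hM : M = 2 * h) (hab : ∀ m, m < M → a m = b m)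
    (m : ℕ) (hm : m < M) : fwd i h k a m = fwd i h k b m := by
  subst hM; exact fwd_congr hab m hm

theorem inv_congr' {i h k M : ℕ} {a b : ℕ → ℝ} (hM : M = 2 * h) (hab : ∀ m, m < M → a m = b m)
    (m : ℕ) (hm : m < M) : inv i h k a m = inv i h k b m := by
  subst hM; exact inv_congr hab m hm

theorem pow2_eval {K k : ℕ} {τ : State} (h : Level K k τ) : pow2.eval τ = 2 ^ k * 2 := by
  simp [pow2, NExpr.eval, h.pow]; ring

theorem pow3_eval {K k : ℕ} {τ : State} (h : Level K k τ) : pow3.eval τ = 2 ^ k * 3 := by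
  simp [pow3, NExpr.eval, h.pow]; ring

/-- Transforms of size `n` from now on. -/
def sizeFull : Prog := .seq (.nset 29 (.reg 22)) (.nset 30 (.reg 23))
/-- Transforms of size `n / 2` from now on. -/
def sizeHalf : Prog := .seq (.nset 29 (.reg 23)) (.nset 30 (.reg 34))

/-- Write the values of `e₁` and `e₂` to the two halves of the array `d`. -/
def pairProg (d : ℕ) (e₁ e₂ : RExpr) : Prog :=
  .seq (mapR 33 23 d (.reg 33) e₁) (mapR 33 23 d (.add (.reg 23) (.reg 33)) e₂)

theorem runsWithin_pairProg {K d : ℕ} {σ : State} {e₁ e₂ : RExpr} (a₁ a₂ : ℕ → ℝ)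
    (hσ : Tables K σ)
    (he₁ : ∀ j X, j < 2 ^ (K + 1) →
      e₁.eval { σ with nreg := upd σ.nreg 33 j, rarr := upd σ.rarr d X } = a₁ j)
    (he₂ : ∀ τ : State, (∀ r, r ≠ 33 → τ.nreg r = σ.nreg r) →
      (∀ r, r ≠ d → τ.rarr r = σ.rarr r) → ∀ j X, j < 2 ^ (K + 1) →
      e₂.eval { τ with nreg := upd τ.nreg 33 j, rarr := upd τ.rarr d X } = a₂ j)
    (hc₁ : e₁.cost ≤ 28 := by decide) (hc₂ : e₂.cost ≤ 28 := by decide) :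
    RunsWithin (pairProg d e₁ e₂) σ (100 * 2 ^ (K + 2)) fun τ =>
      (∀ j, j < 2 ^ (K + 1) → τ.rarr d j = a₁ j) ∧
      ∀ j, j < 2 ^ (K + 1) → τ.rarr d (2 ^ (K + 1) + j) = a₂ j := by
  have hn' : 2 * 2 ^ (K + 1) = 2 ^ (K + 2) := by ring
  have hn : 4 ≤ 2 ^ (K + 2) := by rw [pow_add]; have := Nat.two_pow_pos K; omega
  have hc : ∀ x, x ≤ 31 → 2 ^ (K + 1) * (x + 9) ≤ 2 ^ (K + 1) * 40 :=
    fun x hx => Nat.mul_le_mul_left _ (by omega)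
  refine ((RunsWithin.mapR (2 ^ (K + 1)) 0 a₁ (by decide)
    hσ.half (fun j X => by simp [NExpr.eval]) fun j X hj _ => he₁ j X hj).seq
    (T' := 2 ^ (K + 1) * 40 + 6) fun τ hτ =>
    (RunsWithin.mapR (2 ^ (K + 1)) (2 ^ (K + 1)) a₂ (by decide) ?_
    (fun j X => ?_) fun j X hj _ => he₂ τ hτ.2.2.2.1 hτ.2.2.1 j X hj).mono
    (Nat.add_le_add_right (hc _ ?_) _) fun ρ hρ => ⟨fun j hj => ?_, hρ.1⟩).le ?_
  · rw [hτ.2.2.2.1 23 (by decide), hσ.half]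
  · simp [NExpr.eval, upd, hτ.2.2.2.1 23 (by decide), hσ.half]
  · simp only [NExpr.cost]; omega
  · have := hc (NExpr.cost (.reg 33) + e₁.cost) (by simp only [NExpr.cost]; omega)
    omega
  · rw [hρ.2.1 j (Or.inl hj)]
    simpa using hτ.1 j hj

/-- Put the two interpolants in the scratch arrays together. -/
noncomputable def mergeProg (d : ℕ) : Prog :=
  pairProg d (.div (.add (.get 34 (.reg 33)) (.get 35 (.reg 33))) (.const 2))
    (.div (.sub (.get 34 (.reg 33)) (.get 35 (.reg 33))) (.mul (.const 2) (.get 26 (.const 2))))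

theorem runsWithin_mergeProg {K d : ℕ} {σ : State} (hσ : Tables K σ) (hd : d ∉ [26, 34, 35]) :
    RunsWithin (mergeProg d) σ (100 * 2 ^ (K + 2)) fun τ =>
      (∀ j, j < 2 ^ (K + 1) → τ.rarr d j = (σ.rarr 34 j + σ.rarr 35 j) / 2) ∧
      ∀ j, j < 2 ^ (K + 1) → τ.rarr d (2 ^ (K + 1) + j) =
        (σ.rarr 34 j - σ.rarr 35 j) / (2 * node 2) := by
  simp only [List.mem_cons, List.not_mem_nil, or_false, not_or] at hd
  have h8 : (8 : ℕ) ≤ 2 ^ (K + 3) := by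
    rw [show (8 : ℕ) = 2 ^ 3 by norm_num]; exact Nat.pow_le_pow_right two_pos (by omega)
  refine runsWithin_pairProg _ _ hσ (fun j X _ => ?_) fun τ _ hτ j X _ => ?_
  · simp [RExpr.eval, NExpr.eval, upd, Ne.symm hd.2.1, Ne.symm hd.2.2]
  · simp [RExpr.eval, NExpr.eval, upd, Ne.symm hd.2.1, Ne.symm hd.2.2, Ne.symm hd.1,
      hτ 34 (Ne.symm hd.2.1), hτ 35 (Ne.symm hd.2.2), hτ 26 (Ne.symm hd.1),
      hσ.nodes 2 (by omega) (by omega)]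

/-- The first half of a step from one level of the products to the next: evaluation. -/
noncomputable def upEval : Prog :=
  .seq sizeFull
  (.seq (xform 22 (.get 27 (.reg 33)) (fwdProg 2) 30 (.add (.reg 26) (.reg 33))
    (.add (.get 24 (.reg 33)) (.get 26 (.const 2))))
  (.seq (xform 22 (.get 27 (.reg 33)) (fwdProg 3) 31 (.add (.reg 26) (.reg 33))
    (.add (.get 24 (.reg 33)) (.get 26 (.const 3))))
  (.seq (xform 22 (.get 28 (.reg 33)) (fwdProg 2) 32 (.reg 33) (.get 24 (.reg 33)))
    (xform 22 (.get 28 (.reg 33)) (fwdProg 3) 33 (.reg 33) (.get 24 (.reg 33))))))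

/-- The array `27` stores denominators minus `iter k`. Below node `2` (node `3`) the polynomial
`iter k` is the constant `node 2` (`node 3`), so adding this constant restores the values of the
denominators. They are kept for every level, at offset `k * n`, because the computation of residues
needs them again. -/
theorem runsWithin_upEval {K k : ℕ} {σ : State} (hσ : Level K k σ) (hk : k < K + 2) :
    RunsWithin upEval σ (361 * (k + 1) * 2 ^ (K + 2)) fun τ => Level K k τ ∧
      (∀ j, j < 2 ^ (K + 2) → τ.rarr 30 (k * 2 ^ (K + 2) + j) =
        fwd 2 (2 ^ (K + 1)) k (σ.rarr 27) j + node 2) ∧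
      (∀ j, j < 2 ^ (K + 2) → τ.rarr 31 (k * 2 ^ (K + 2) + j) =
        fwd 3 (2 ^ (K + 1)) k (σ.rarr 27) j + node 3) ∧
      (∀ j, j < 2 ^ (K + 2) → τ.rarr 32 j = fwd 2 (2 ^ (K + 1)) k (σ.rarr 28) j) ∧
      (∀ j, j < 2 ^ (K + 2) → τ.rarr 33 j = fwd 3 (2 ^ (K + 1)) k (σ.rarr 28) j) ∧
      (∀ m, m < k * 2 ^ (K + 2) → τ.rarr 30 m = σ.rarr 30 m) ∧
      (∀ m, m < k * 2 ^ (K + 2) → τ.rarr 31 m = σ.rarr 31 m) := by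
  have hn : 2 ^ (K + 2) = 2 * 2 ^ (K + 1) := by ring
  have h8 : (8 : ℕ) ≤ 2 ^ (K + 3) := by
    rw [show (8 : ℕ) = 2 ^ 3 by norm_num]; exact Nat.pow_le_pow_right two_pos (by omega)
  have hc : 4 ≤ (k + 1) * 2 ^ (K + 2) := by
    have : 1 * 2 ^ (K + 2) ≤ (k + 1) * 2 ^ (K + 2) := Nat.mul_le_mul_right _ (by omega)
    rw [pow_add] at *; have := Nat.two_pow_pos K; omega
  refine (RunsWithin.straight_seq (T := 4 * (90 * (k + 1) * 2 ^ (K + 2))) 4 rfl le_rfl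
    fun σ₀ h₀ hf₀ => ?_).le (by nlinarith)
  have hl₀ : Level K k σ₀ := hσ.frame hf₀
  have h29 : σ₀.nreg 29 = 2 ^ (K + 2) := by
    rw [h₀]; simp [sizeFull, Prog.run, upd, NExpr.eval, hσ.size]
  have h30 : σ₀.nreg 30 = 2 ^ (K + 1) := by
    rw [h₀]; simp [sizeFull, Prog.run, upd, NExpr.eval, hσ.half]
  clear h₀
  refine ((runsWithin_xform (T := fwdProg 2) (f := fwd 2 (2 ^ (K + 1)) k)
     (o := k * 2 ^ (K + 2)) (σ₀.rarr 27)
    (fun j => fwd 2 (2 ^ (K + 1)) k (σ₀.rarr 27) j + node 2) hl₀ hl₀.size le_rfl (by decide)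
    (by decide) (hyp_fwd (i := 2) hk (by decide) (by decide) hn h29 h30 le_rfl)
    (fun _ _ => fwd_congr' hn) (by decide) (by decide) ?_ ?_ ?_).seqf
    (T' := 3 * (90 * (k + 1) * 2 ^ (K + 2))) fun σ₁ h₁ hf₁ => ?_).le (by nlinarith)
  · intro j X hj; simp [RExpr.eval, NExpr.eval, upd]
  · intro τ hτ j X
    simp [NExpr.eval, upd, hτ 26 (by decide), hl₀.offset]
  · intro τ hτ hτ' j X hj hA
    simp [RExpr.eval, NExpr.eval, upd, hA, hτ' 26 (by decide), hl₀.nodes 2 (by omega) (by omega)]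
  have hl₁ : Level K k σ₁ := hl₀.frame hf₁
  refine ((runsWithin_xform (T := fwdProg 3) (f := fwd 3 (2 ^ (K + 1)) k)
     (o := k * 2 ^ (K + 2)) (σ₁.rarr 27)
    (fun j => fwd 3 (2 ^ (K + 1)) k (σ₁.rarr 27) j + node 3) hl₁ hl₁.size le_rfl (by decide)
    (by decide) (hyp_fwd (i := 3) hk (by decide) (by decide) hn ((hf₁.n 29).trans h29)
        ((hf₁.n 30).trans h30) le_rfl)
    (fun _ _ => fwd_congr' hn) (by decide) (by decide) ?_ ?_ ?_).seqf
    (T' := 2 * (90 * (k + 1) * 2 ^ (K + 2))) fun σ₂ h₂ hf₂ => ?_).le (by nlinarith)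
  · intro j X hj; simp [RExpr.eval, NExpr.eval, upd]
  · intro τ hτ j X
    simp [NExpr.eval, upd, hτ 26 (by decide), hl₁.offset]
  · intro τ hτ hτ' j X hj hA
    simp [RExpr.eval, NExpr.eval, upd, hA, hτ' 26 (by decide), hl₁.nodes 3 (by omega) (by omega)]
  have hl₂ : Level K k σ₂ := hl₁.frame hf₂
  refine ((runsWithin_xform (T := fwdProg 2) (f := fwd 2 (2 ^ (K + 1)) k)
     (o := 0) (σ₂.rarr 28)
    (fwd 2 (2 ^ (K + 1)) k (σ₂.rarr 28)) hl₂ hl₂.size le_rfl (by decide)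
    (by decide) (hyp_fwd (i := 2) hk (by decide) (by decide) hn (((hf₂.n 29).trans (hf₁.n 29)).trans h29)
        (((hf₂.n 30).trans (hf₁.n 30)).trans h30) le_rfl)
    (fun _ _ => fwd_congr' hn) (by decide) (by decide) ?_ ?_ ?_).seqf
    (T' := 90 * (k + 1) * 2 ^ (K + 2)) fun σ₃ h₃ hf₃ => ?_).le (by nlinarith)
  · intro j X hj; simp [RExpr.eval, NExpr.eval, upd]
  · intro τ hτ j X
    simp [NExpr.eval]
  · intro τ hτ hτ' j X hj hA
    simp [RExpr.eval, NExpr.eval, upd, hA]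
  have hl₃ : Level K k σ₃ := hl₂.frame hf₃
  refine (runsWithin_xform (T := fwdProg 3) (f := fwd 3 (2 ^ (K + 1)) k)
     (o := 0) (σ₃.rarr 28)
    (fwd 3 (2 ^ (K + 1)) k (σ₃.rarr 28)) hl₃ hl₃.size le_rfl (by decide)
    (by decide) (hyp_fwd (i := 3) hk (by decide) (by decide) hn
        ((((hf₃.n 29).trans (hf₂.n 29)).trans (hf₁.n 29)).trans h29)
        ((((hf₃.n 30).trans (hf₂.n 30)).trans (hf₁.n 30)).trans h30) le_rfl)
    (fun _ _ => fwd_congr' hn) (by decide) (by decide) ?_ ?_ ?_).frame.imp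
    fun σ₄ ⟨h₄, hf₄⟩ => ?_
  · intro j X hj; simp [RExpr.eval, NExpr.eval, upd]
  · intro τ hτ j X
    simp [NExpr.eval]
  · intro τ hτ hτ' j X hj hA
    simp [RExpr.eval, NExpr.eval, upd, hA]
  have e27 : σ₁.rarr 27 = σ.rarr 27 := (hf₁.ra 27).trans (hf₀.ra 27)
  have e28 : σ₂.rarr 28 = σ.rarr 28 := ((hf₂.ra 28).trans (hf₁.ra 28)).trans (hf₀.ra 28)
  refine ⟨hl₃.frame hf₄, fun j hj => ?_, fun j hj => ?_, fun j hj => ?_, fun j hj => ?_,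
    fun m hm => ?_, fun m hm => ?_⟩
  · rw [hf₄.ra 30, hf₃.ra 30, hf₂.ra 30, h₁.1 j hj, hf₀.ra 27]
  · rw [hf₄.ra 31, hf₃.ra 31, h₂.1 j hj, e27]
  · have := h₃.1 j hj
    rw [Nat.zero_add] at this
    rw [hf₄.ra 32, this, e28]
  · have := h₄.1 j hj
    rw [Nat.zero_add] at this
    rw [this, hf₃.ra 28, e28]
  · rw [hf₄.ra 30, hf₃.ra 30, hf₂.ra 30, h₁.2 m (Or.inl hm), hf₀.ra 30]
  · rw [hf₄.ra 31, hf₃.ra 31, h₂.2 m (Or.inl hm), hf₁.ra 31, hf₀.ra 31]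

end FastCauchy

/-! ### Interpolation, and a complete step up the product tree. -/

namespace FastCauchy

open RealRAM Polynomial

/-- Interpolate from the values of `e₂` and `e₃` in the two halves below the root. -/
noncomputable def mergePair (e₂ e₃ : RExpr) (d : ℕ) : Prog :=
  .seq (xform 23 e₂ (invProg pow2) 34 (.reg 33) (.get 24 (.reg 33)))
  (.seq (xform 23 e₃ (invProg pow3) 35 (.reg 33) (.get 24 (.reg 33))) (mergeProg d))

theorem runsWithin_mergePair {K k d : ℕ} {σ : State} {e₂ e₃ : RExpr} (a₂ a₃ : ℕ → ℝ)
    (hσ : Level K k σ) (hk : k < K + 2) (h29 : σ.nreg 29 = 2 ^ (K + 1)) (h30 : σ.nreg 30 = 2 ^ K)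
    (hd : d ∉ [26, 34, 35])
    (he₂ : ∀ τ : State, (∀ r, r ∉ [27, 31, 32, 33] → τ.nreg r = σ.nreg r) →
      (∀ r, r ∉ [24, 25, 34, 35] → τ.rarr r = σ.rarr r) → ∀ j X, j < 2 ^ (K + 1) →
      e₂.eval { τ with nreg := upd τ.nreg 33 j, rarr := upd τ.rarr 24 X } = a₂ j)
    (he₃ : ∀ τ : State, (∀ r, r ∉ [27, 31, 32, 33] → τ.nreg r = σ.nreg r) →
      (∀ r, r ∉ [24, 25, 34, 35] → τ.rarr r = σ.rarr r) → ∀ j X, j < 2 ^ (K + 1) →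
      e₃.eval { τ with nreg := upd τ.nreg 33 j, rarr := upd τ.rarr 24 X } = a₃ j)
    (hc₂ : e₂.cost ≤ 30 := by decide) (hc₃ : e₃.cost ≤ 30 := by decide) :
    RunsWithin (mergePair e₂ e₃ d) σ (280 * (k + 1) * 2 ^ (K + 2)) fun τ =>
      (∀ j, j < 2 ^ (K + 1) → τ.rarr d j = (inv 2 (2 ^ K) k a₂ j + inv 3 (2 ^ K) k a₃ j) / 2) ∧
      ∀ j, j < 2 ^ (K + 1) → τ.rarr d (2 ^ (K + 1) + j) =
        (inv 2 (2 ^ K) k a₂ j - inv 3 (2 ^ K) k a₃ j) / (2 * node 2) := by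
  have hn : 2 ^ (K + 1) = 2 * 2 ^ K := by ring
  have hn' : 2 ^ (K + 1) ≤ 2 ^ (K + 2) := Nat.pow_le_pow_right two_pos (by omega)
  have hf : ∀ i, ∀ u v : ℕ → ℝ, (∀ m, m < 2 ^ (K + 1) → u m = v m) → ∀ m, m < 2 ^ (K + 1) →
      inv i (2 ^ K) k u m = inv i (2 ^ K) k v m := fun i _ _ => inv_congr' hn
  refine ((runsWithin_xform (T := invProg pow2) (f := inv 2 (2 ^ K) k) (o := 0) a₂
    (inv 2 (2 ^ K) k a₂) hσ hσ.half hn' (by decide) (by decide)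
    (hyp_inv (i := 2) hk (by decide) (by decide) (fun _ => pow2_eval) (by decide) hn h29 h30 hn')
    (hf 2) (by decide) (by decide) (he₂ σ (fun _ _ => rfl) fun _ _ => rfl) ?_ ?_ hc₂).seqf
    (T' := 90 * (k + 1) * 2 ^ (K + 2) + 100 * 2 ^ (K + 2)) fun σ₁ h₁ hf₁ => ?_).le (by nlinarith)
  · intro τ _ j X; simp [NExpr.eval]
  · intro τ _ _ j X _ hA; simp [RExpr.eval, NExpr.eval, upd, hA]
  have hl₁ : Level K k σ₁ := hσ.frame hf₁
  refine (runsWithin_xform (T := invProg pow3) (f := inv 3 (2 ^ K) k) (o := 0) a₃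
    (inv 3 (2 ^ K) k a₃) hl₁ hl₁.half hn' (by decide) (by decide)
    (hyp_inv (i := 3) hk (by decide) (by decide) (fun _ => pow3_eval) (by decide) hn
      ((hf₁.n 29).trans h29) ((hf₁.n 30).trans h30) hn')
    (hf 3) (by decide) (by decide) (he₃ σ₁ (fun r hr => hf₁.nreg r (fun h => hr ?_))
      fun r hr => hf₁.rarr r (fun h => hr ?_)) ?_ ?_ hc₃).seqf fun σ₂ h₂ hf₂ => ?_
  -- What the program writes to does not depend on `e₂`; replacing `e₂` by a constant gives a closed
  -- statement that can be decided.
  · exact (by decide : Prog.wn (xform 23 (.const 0) (invProg pow2) 34 (.reg 33)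
      (.get 24 (.reg 33))) ⊆ [27, 31, 32, 33]) h
  · exact (by decide : Prog.wra (xform 23 (.const 0) (invProg pow2) 34 (.reg 33)
      (.get 24 (.reg 33))) ⊆ [24, 25, 34, 35]) h
  · intro τ _ j X; simp [NExpr.eval]
  · intro τ _ _ j X _ hA; simp [RExpr.eval, NExpr.eval, upd, hA]
  refine (runsWithin_mergeProg (hl₁.frame hf₂).toTables hd).imp fun σ₃ h₃ => ?_
  have e₁ : ∀ j, j < 2 ^ (K + 1) → σ₂.rarr 34 j = inv 2 (2 ^ K) k a₂ j := fun j hj => by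
    rw [hf₂.ra 34]; simpa using h₁.1 j hj
  have e₂ : ∀ j, j < 2 ^ (K + 1) → σ₂.rarr 35 j = inv 3 (2 ^ K) k a₃ j := fun j hj => by
    simpa using h₂.1 j hj
  exact ⟨fun j hj => by rw [h₃.1 j hj, e₁ j hj, e₂ j hj],
    fun j hj => by rw [h₃.2 j hj, e₁ j hj, e₂ j hj]⟩

/-- The entry `j` of the current level of the array `d`, and the entry `j + n / 2`. -/
def levelGet (d : ℕ) : RExpr := .get d (.add (.reg 26) (.reg 33))
/-- The entry `j + n / 2` of the current level of the array `d`. -/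
def levelGet' (d : ℕ) : RExpr := .get d (.add (.reg 26) (.add (.reg 23) (.reg 33)))

/-- The second half of a step from one level of the products to the next: interpolation. -/
noncomputable def upMerge : Prog :=
  .seq sizeHalf
  (.seq (mergePair (.mul (levelGet 30) (levelGet' 30)) (.mul (levelGet 31) (levelGet' 31)) 27)
    (mergePair
      (.add (.mul (.get 32 (.reg 33)) (levelGet' 30))
        (.mul (.get 32 (.add (.reg 23) (.reg 33))) (levelGet 30)))
      (.add (.mul (.get 33 (.reg 33)) (levelGet' 31))
        (.mul (.get 33 (.add (.reg 23) (.reg 33))) (levelGet 31))) 28))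

theorem runsWithin_upMerge {K k : ℕ} {σ : State} (hσ : Level K k σ) (hk : k < K + 2)
    (V₂ V₃ W₂ W₃ : ℕ → ℝ) (hV₂ : V₂ = fun j => σ.rarr 30 (k * 2 ^ (K + 2) + j))
    (hV₃ : V₃ = fun j => σ.rarr 31 (k * 2 ^ (K + 2) + j)) (hW₂ : W₂ = σ.rarr 32)
    (hW₃ : W₃ = σ.rarr 33) :
    RunsWithin upMerge σ (561 * (k + 1) * 2 ^ (K + 2)) fun τ => Level K k τ ∧
      (∃ a₂ a₃ : ℕ → ℝ, a₂ = (fun j => V₂ j * V₂ (2 ^ (K + 1) + j)) ∧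
        a₃ = (fun j => V₃ j * V₃ (2 ^ (K + 1) + j)) ∧
        (∀ j, j < 2 ^ (K + 1) → τ.rarr 27 j =
          (inv 2 (2 ^ K) k a₂ j + inv 3 (2 ^ K) k a₃ j) / 2) ∧
        ∀ j, j < 2 ^ (K + 1) → τ.rarr 27 (2 ^ (K + 1) + j) =
          (inv 2 (2 ^ K) k a₂ j - inv 3 (2 ^ K) k a₃ j) / (2 * node 2)) ∧
      (∃ a₂ a₃ : ℕ → ℝ,
        a₂ = (fun j => W₂ j * V₂ (2 ^ (K + 1) + j) + W₂ (2 ^ (K + 1) + j) * V₂ j) ∧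
        a₃ = (fun j => W₃ j * V₃ (2 ^ (K + 1) + j) + W₃ (2 ^ (K + 1) + j) * V₃ j) ∧
        (∀ j, j < 2 ^ (K + 1) → τ.rarr 28 j =
          (inv 2 (2 ^ K) k a₂ j + inv 3 (2 ^ K) k a₃ j) / 2) ∧
        ∀ j, j < 2 ^ (K + 1) → τ.rarr 28 (2 ^ (K + 1) + j) =
          (inv 2 (2 ^ K) k a₂ j - inv 3 (2 ^ K) k a₃ j) / (2 * node 2)) := by
  have hc : 4 ≤ (k + 1) * 2 ^ (K + 2) := by
    have : 1 * 2 ^ (K + 2) ≤ (k + 1) * 2 ^ (K + 2) := Nat.mul_le_mul_right _ (by omega)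
    rw [pow_add] at *; have := Nat.two_pow_pos K; omega
  refine (RunsWithin.straight_seq (T := 2 * (280 * (k + 1) * 2 ^ (K + 2))) 4 rfl le_rfl
    fun σ₀ h₀ hf₀ => ?_).le (by nlinarith)
  have hl₀ : Level K k σ₀ := hσ.frame hf₀
  have h29 : σ₀.nreg 29 = 2 ^ (K + 1) := by
    rw [h₀]; simp [sizeHalf, Prog.run, upd, NExpr.eval, hσ.half]
  have h30 : σ₀.nreg 30 = 2 ^ K := by
    rw [h₀]; simp [sizeHalf, Prog.run, upd, NExpr.eval, hσ.quarter]
  clear h₀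
  have e30 : ∀ j, σ₀.rarr 30 (k * 2 ^ (K + 2) + j) = V₂ j := fun j => by rw [hf₀.ra 30, hV₂]
  have e31 : ∀ j, σ₀.rarr 31 (k * 2 ^ (K + 2) + j) = V₃ j := fun j => by rw [hf₀.ra 31, hV₃]
  have e32 : σ₀.rarr 32 = W₂ := (hf₀.ra 32).trans hW₂.symm
  have e33 : σ₀.rarr 33 = W₃ := (hf₀.ra 33).trans hW₃.symm
  refine ((runsWithin_mergePair (fun j => V₂ j * V₂ (2 ^ (K + 1) + j))
    (fun j => V₃ j * V₃ (2 ^ (K + 1) + j)) hl₀ hk h29 h30 (by decide) ?_ ?_).seqf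
    (T' := 280 * (k + 1) * 2 ^ (K + 2)) fun σ₁ h₁ hf₁ => ?_).le (by nlinarith)
  · intro τ hτ hτ' j X _
    simp [RExpr.eval, NExpr.eval, upd, levelGet, levelGet', hτ 26 (by decide), hτ 23 (by decide),
      hτ' 30 (by decide), hl₀.offset, hl₀.half, e30]
  · intro τ hτ hτ' j X _
    simp [RExpr.eval, NExpr.eval, upd, levelGet, levelGet', hτ 26 (by decide), hτ 23 (by decide),
      hτ' 31 (by decide), hl₀.offset, hl₀.half, e31]
  have hl₁ : Level K k σ₁ := hl₀.frame hf₁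
  refine (runsWithin_mergePair
    (fun j => W₂ j * V₂ (2 ^ (K + 1) + j) + W₂ (2 ^ (K + 1) + j) * V₂ j)
    (fun j => W₃ j * V₃ (2 ^ (K + 1) + j) + W₃ (2 ^ (K + 1) + j) * V₃ j)
    hl₁ hk ((hf₁.n 29).trans h29) ((hf₁.n 30).trans h30) (by decide) ?_ ?_).frame.imp
    fun σ₂ ⟨h₂, hf₂⟩ => ?_
  · intro τ hτ hτ' j X _
    simp [RExpr.eval, NExpr.eval, upd, levelGet, levelGet', hτ 26 (by decide), hτ 23 (by decide),
      hτ' 30 (by decide), hτ' 32 (by decide), hl₁.offset, hl₁.half, hf₁.ra 30, hf₁.ra 32, e30, e32]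
  · intro τ hτ hτ' j X _
    simp [RExpr.eval, NExpr.eval, upd, levelGet, levelGet', hτ 26 (by decide), hτ 23 (by decide),
      hτ' 31 (by decide), hτ' 33 (by decide), hl₁.offset, hl₁.half, hf₁.ra 31, hf₁.ra 33, e31, e33]
  refine ⟨hl₁.frame hf₂, ⟨_, _, rfl, rfl, ?_⟩, ⟨_, _, rfl, rfl, h₂⟩⟩
  rw [hf₂.ra 27]
  exact h₁

/-- One step from one level of the products to the next. -/
noncomputable def upStep : Prog :=
  .seq upEval (.seq upMerge (.seq (.nset 25 (.add (.reg 25) (.const 1)))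
    (.seq (.nset 26 (.add (.reg 26) (.reg 22))) (.nset 35 (.add (.reg 35) (.reg 35))))))

/-- The products at level `k` are known, with their values at all levels below. -/
structure UpInv (K k : ℕ) (t w : ℕ → ℝ) (σ : State) : Prop where
  den : Rep k (2 ^ (K + 2 - k)) (σ.rarr 27) fun q => den (K + 2) t k q - iter k
  num : Rep k (2 ^ (K + 2 - k)) (σ.rarr 28) (num (K + 2) t w k)
  left : ∀ l q b, l < k → q < 2 ^ (K + 2 - l) → b < 2 ^ l →
    σ.rarr 30 (l * 2 ^ (K + 2) + (q * 2 ^ l + b)) =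
      (FastCauchy.den (K + 2) t l q).eval (node (2 ^ l * 2 + b))
  right : ∀ l q b, l < k → q < 2 ^ (K + 2 - l) → b < 2 ^ l →
    σ.rarr 31 (l * 2 ^ (K + 2) + (q * 2 ^ l + b)) =
      (FastCauchy.den (K + 2) t l q).eval (node (2 ^ l * 3 + b))

/-- The nodes concerned are the descendants of the root `1` in generation `k + 1`, and the root has
the value `0`. So the values of a denominator of level `k + 1` minus `iter (k + 1)` are plain
products of values from level `k`. -/
theorem eval_iter_succ_node (k : ℕ) {b : ℕ} (hb : b < 2 ^ k) :
    (iter (k + 1)).eval (node (2 ^ k * 2 + b)) = 0 ∧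
    (iter (k + 1)).eval (node (2 ^ k * 3 + b)) = 0 := by
  constructor
  · rw [show 2 ^ k * 2 + b = 2 ^ (k + 1) * 1 + b by ring,
      eval_node_iter le_rfl (by rw [pow_succ]; omega), node_one]
  · rw [show 2 ^ k * 3 + b = 2 ^ (k + 1) * 1 + (2 ^ k + b) by ring,
      eval_node_iter le_rfl (by rw [pow_succ]; omega), node_one]

/-- Numerators and denominators are combined pointwise at the `2 ^ (k + 1)` nodes below `2` and `3`,
which are just enough for interpolation at the next level by `Rep.merge`. -/
theorem runsWithin_upStep {K k : ℕ} {t w : ℕ → ℝ} {σ : State} (hσ : Level K k σ) (hk : k < K + 2)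
    (hI : UpInv K k t w σ) :
    RunsWithin upStep σ (940 * (k + 1) * 2 ^ (K + 2)) fun τ =>
      Level K (k + 1) τ ∧ UpInv K (k + 1) t w τ := by
  have hc : 4 ≤ (k + 1) * 2 ^ (K + 2) := by
    have : 1 * 2 ^ (K + 2) ≤ (k + 1) * 2 ^ (K + 2) := Nat.mul_le_mul_right _ (by omega)
    rw [pow_add] at *; have := Nat.two_pow_pos K; omega
  obtain ⟨B, hB⟩ : ∃ B, B = 2 ^ (K + 2 - (k + 1)) := ⟨_, rfl⟩
  have hBk : 2 ^ (K + 2 - k) = 2 * B := by rw [hB, ← pow_succ']; congr 1; omega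
  have hh : 2 ^ (K + 1) = 2 ^ k * B := by rw [hB, ← pow_add]; congr 1; omega
  have hhn : 2 * 2 ^ (K + 1) = 2 ^ k * 2 ^ (K + 2 - k) := by rw [hBk, hh]; ring
  have hq4 : 2 * 2 ^ K = 2 ^ k * B := by rw [← hh]; ring
  have hlt : ∀ q b, q < 2 ^ (K + 2 - k) → b < 2 ^ k → q * 2 ^ k + b < 2 ^ (K + 2) := by
    intro q b hq hb
    have := index_lt' hb hq
    rw [← hhn] at this
    rw [pow_succ']; exact this
  refine ((runsWithin_upEval hσ hk).seqf (T' := 561 * (k + 1) * 2 ^ (K + 2) + 12)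
    fun σ₁ ⟨hl₁, h30, h31, h32, h33, h30', h31'⟩ hf₁ =>
    (runsWithin_upMerge hl₁ hk _ _ _ _ rfl rfl rfl rfl).seqf
    fun σ₂ ⟨hl₂, ⟨a₂, a₃, ha₂, ha₃, ha, ha'⟩, ⟨b₂, b₃, hb₂, hb₃, hb, hb'⟩⟩ hf₂ => ?_).le
    (by nlinarith)
  have v₂ : ∀ q b, q < 2 ^ (K + 2 - k) → b < 2 ^ k →
      σ₁.rarr 30 (k * 2 ^ (K + 2) + (q * 2 ^ k + b)) =
        (den (K + 2) t k q).eval (node (2 ^ k * 2 + b)) := fun q b hq hb => by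
    rw [h30 _ (hlt q b hq hb), hI.den.fwd_eq (by decide) hhn hq hb, eval_sub,
      eval_node_iter (by decide) hb, sub_add_cancel]
  have v₃ : ∀ q b, q < 2 ^ (K + 2 - k) → b < 2 ^ k →
      σ₁.rarr 31 (k * 2 ^ (K + 2) + (q * 2 ^ k + b)) =
        (den (K + 2) t k q).eval (node (2 ^ k * 3 + b)) := fun q b hq hb => by
    rw [h31 _ (hlt q b hq hb), hI.den.fwd_eq (by decide) hhn hq hb, eval_sub,
      eval_node_iter (by decide) hb, sub_add_cancel]
  have w₂ : ∀ q b, q < 2 ^ (K + 2 - k) → b < 2 ^ k → σ₁.rarr 32 (q * 2 ^ k + b) =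
        (num (K + 2) t w k q).eval (node (2 ^ k * 2 + b)) := fun q b hq hb => by
    rw [h32 _ (hlt q b hq hb), hI.num.fwd_eq (by decide) hhn hq hb]
  have w₃ : ∀ q b, q < 2 ^ (K + 2 - k) → b < 2 ^ k → σ₁.rarr 33 (q * 2 ^ k + b) =
        (num (K + 2) t w k q).eval (node (2 ^ k * 3 + b)) := fun q b hq hb => by
    rw [h33 _ (hlt q b hq hb), hI.num.fwd_eq (by decide) hhn hq hb]
  -- The two children `q` and `B + q` of a node of the product tree are half an array apart.
  have hsh : ∀ q b, 2 ^ (K + 1) + (q * 2 ^ k + b) = (B + q) * 2 ^ k + b := fun q b => by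
    rw [hh]; ring
  refine RunsWithin.straight 12 rfl (by decide) ⟨⟨⟨?_, ?_, ?_, ?_, ?_⟩, ?_, ?_, ?_⟩,
    ⟨?_, ?_, ?_, ?_⟩⟩
  · simpa [Prog.run, upd] using hl₂.size
  · simpa [Prog.run, upd] using hl₂.half
  · simpa [Prog.run, upd] using hl₂.quarter
  · exact hl₂.nodes
  · exact hl₂.rems
  · simp [Prog.run, upd, NExpr.eval, hl₂.level]
  · simp [Prog.run, upd, NExpr.eval, hl₂.offset, hl₂.size]; ring
  · simp [Prog.run, upd, NExpr.eval, hl₂.pow]; ring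
  · rw [← hB]
    refine Rep.merge (h := 2 ^ K) (v₂ := a₂) (v₃ := a₃) hq4
      (fun q _ => degree_den_sub_iter _ _ _ _) (fun q b hq hb => ?_) (fun q b hq hb => ?_)
      (fun j hj => ha j (by rwa [pow_succ'])) fun j hj => ?_
    · rw [ha₂]
      simp only [hsh]
      rw [v₂ q b (by omega) hb, v₂ (B + q) b (by omega) hb, eval_sub,
        (eval_iter_succ_node k hb).1, FastCauchy.den, eval_mul, hB, sub_zero]
    · rw [ha₃]
      simp only [hsh]
      rw [v₃ q b (by omega) hb, v₃ (B + q) b (by omega) hb, eval_sub,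
        (eval_iter_succ_node k hb).2, FastCauchy.den, eval_mul, hB, sub_zero]
    · have := ha' j (by rwa [pow_succ'])
      rwa [pow_succ'] at this
  · rw [← hB]
    refine Rep.merge (h := 2 ^ K) (v₂ := b₂) (v₃ := b₃) hq4
      (fun q _ => degree_num _ _ _ _ _) (fun q b hq hb => ?_) (fun q b hq hb => ?_)
      (fun j hj => hb j (by rwa [pow_succ'])) fun j hj => ?_
    · rw [hb₂]
      simp only [hsh]
      rw [v₂ q b (by omega) hb, v₂ (B + q) b (by omega) hb, w₂ q b (by omega) hb,
        w₂ (B + q) b (by omega) hb, FastCauchy.num, eval_add, eval_mul, eval_mul, hB]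
    · rw [hb₃]
      simp only [hsh]
      rw [v₃ q b (by omega) hb, v₃ (B + q) b (by omega) hb, w₃ q b (by omega) hb,
        w₃ (B + q) b (by omega) hb, FastCauchy.num, eval_add, eval_mul, eval_mul, hB]
    · have := hb' j (by rwa [pow_succ'])
      rwa [pow_succ'] at this
  · intro l q b hl hq hbl
    change σ₂.rarr 30 _ = _
    rw [hf₂.ra 30]
    rcases Nat.lt_succ_iff_lt_or_eq.1 hl with hl' | rfl
    · rw [h30' _ ?_, hI.left l q b hl' hq hbl]
      have h1 := index_lt' hbl hq
      rw [← pow_add, show l + (K + 2 - l) = K + 2 by omega] at h1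
      calc _ < l * 2 ^ (K + 2) + 2 ^ (K + 2) := by omega
        _ = (l + 1) * 2 ^ (K + 2) := by ring
        _ ≤ k * 2 ^ (K + 2) := Nat.mul_le_mul_right _ hl'
    · exact v₂ q b hq hbl
  · intro l q b hl hq hbl
    change σ₂.rarr 31 _ = _
    rw [hf₂.ra 31]
    rcases Nat.lt_succ_iff_lt_or_eq.1 hl with hl' | rfl
    · rw [h31' _ ?_, hI.right l q b hl' hq hbl]
      have h1 := index_lt' hbl hq
      rw [← pow_add, show l + (K + 2 - l) = K + 2 by omega] at h1
      calc _ < l * 2 ^ (K + 2) + 2 ^ (K + 2) := by omega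
        _ = (l + 1) * 2 ^ (K + 2) := by ring
        _ ≤ k * 2 ^ (K + 2) := Nat.mul_le_mul_right _ hl'
    · exact v₃ q b hq hbl

end FastCauchy

/-! ### A step down the product tree: residues at the next level. -/

namespace FastCauchy

open RealRAM Polynomial

/-- One step from the residues at one level to the residues at the level below. -/
noncomputable def downStep : Prog :=
  .seq sizeHalf
  (.seq (xform 23 (.add (.get 36 (.reg 33)) (.mul (.get 26 (.const 2))
    (.get 36 (.add (.reg 23) (.reg 33))))) (fwdProg 2) 34 (.reg 33) (.get 24 (.reg 33)))
  (.seq (xform 23 (.add (.get 36 (.reg 33)) (.mul (.get 26 (.const 3))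
    (.get 36 (.add (.reg 23) (.reg 33))))) (fwdProg 3) 35 (.reg 33) (.get 24 (.reg 33)))
  (.seq sizeFull
  (.seq (pairProg 37 (.div (.get 34 (.reg 33)) (levelGet 30))
    (.div (.get 34 (.reg 33)) (levelGet' 30)))
  (.seq (xform 22 (.get 37 (.reg 33)) (invProg pow2) 37 (.reg 33) (.get 24 (.reg 33)))
  (.seq (xform 22 (.get 37 (.reg 33)) (fwdProg 3) 37 (.reg 33) (.get 24 (.reg 33)))
  (.seq (pairProg 38 (.sub (.get 35 (.reg 33)) (.mul (.get 37 (.reg 33)) (levelGet 31)))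
    (.sub (.get 35 (.reg 33)) (.mul (.get 37 (.add (.reg 23) (.reg 33))) (levelGet' 31))))
    (xform 22 (.get 38 (.reg 33)) (invProg pow3) 36 (.reg 33) (.get 24 (.reg 33))))))))))

/-- The program carries out `Rep.residues` for all nodes of a level at once. Since every `s j`
exceeds `2`, the denominators by which it divides do not vanish at the transform nodes. -/
theorem runsWithin_downStep {K k : ℕ} {s : ℕ → ℝ} {σ : State} {F : ℕ → ℝ[X]}
    (hσ : Level K k σ) (hk : k < K + 2) (hs : ∀ j, 2 < s j)
    (hF : Rep (k + 1) (2 ^ (K + 2 - (k + 1))) (σ.rarr 36) F)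
    (h30 : ∀ q b, q < 2 ^ (K + 2 - k) → b < 2 ^ k →
      σ.rarr 30 (k * 2 ^ (K + 2) + (q * 2 ^ k + b)) =
        (den (K + 2) s k q).eval (node (2 ^ k * 2 + b)))
    (h31 : ∀ q b, q < 2 ^ (K + 2 - k) → b < 2 ^ k →
      σ.rarr 31 (k * 2 ^ (K + 2) + (q * 2 ^ k + b)) =
        (den (K + 2) s k q).eval (node (2 ^ k * 3 + b))) :
    RunsWithin downStep σ (660 * (k + 1) * 2 ^ (K + 2)) fun τ =>
      ∃ F', Rep k (2 ^ (K + 2 - k)) (τ.rarr 36) F' ∧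
        ∀ q z, q < 2 ^ (K + 2 - k) → (den (K + 2) s k q).eval z = 0 →
          (F (q % 2 ^ (K + 2 - (k + 1)))).eval z =
            ((iter k).eval z - node 2) / (-2 * node 2) * (F' q).eval z := by
  have hc : 2 ^ (K + 2) ≤ (k + 1) * 2 ^ (K + 2) :=
    Nat.le_mul_of_pos_left _ (Nat.succ_pos k)
  have hc4 : 4 ≤ 2 ^ (K + 2) := by rw [pow_add]; have := Nat.two_pow_pos K; omega
  have h8 : (8 : ℕ) ≤ 2 ^ (K + 3) := by
    rw [show (8 : ℕ) = 2 ^ 3 by norm_num]; exact Nat.pow_le_pow_right two_pos (by omega)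
  have hn1 : 2 ^ (K + 1) = 2 * 2 ^ K := by ring
  have hn2 : 2 ^ (K + 2) = 2 * 2 ^ (K + 1) := by ring
  have hle : 2 ^ (K + 1) ≤ 2 ^ (K + 2) := by omega
  obtain ⟨B, hB⟩ : ∃ B, B = 2 ^ (K + 2 - (k + 1)) := ⟨_, rfl⟩
  have hBk : 2 ^ (K + 2 - k) = 2 * B := by rw [hB, ← pow_succ']; congr 1; omega
  have hh : 2 ^ (K + 1) = 2 ^ k * B := by rw [hB, ← pow_add]; congr 1; omega
  rw [hBk] at h30 h31 ⊢
  rw [← hB] at hF ⊢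
  refine (RunsWithin.straight_seq (T := 5 * (90 * (k + 1) * 2 ^ (K + 2)) + 200 * 2 ^ (K + 2) + 4)
    4 rfl le_rfl fun σ₀ h₀ hf₀ => ?_).le (by nlinarith)
  have hl₀ : Level K k σ₀ := hσ.frame hf₀
  have h29 : σ₀.nreg 29 = 2 ^ (K + 1) := by
    rw [h₀]; simp [sizeHalf, Prog.run, upd, NExpr.eval, hσ.half]
  have h30r : σ₀.nreg 30 = 2 ^ K := by
    rw [h₀]; simp [sizeHalf, Prog.run, upd, NExpr.eval, hσ.quarter]
  clear h₀
  refine ((runsWithin_xform (T := fwdProg 2) (f := fwd 2 (2 ^ K) k) (o := 0)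
    (fun j => σ₀.rarr 36 j + node 2 * σ₀.rarr 36 (2 ^ (K + 1) + j))
    (fwd 2 (2 ^ K) k fun j => σ₀.rarr 36 j + node 2 * σ₀.rarr 36 (2 ^ (K + 1) + j))
    hl₀ hl₀.half hle (by decide) (by decide)
    (hyp_fwd (i := 2) hk (by decide) (by decide) hn1 h29 h30r hle)
    (fun _ _ => fwd_congr' hn1) (by decide) (by decide) ?_ ?_ ?_).seqf
    (T' := 4 * (90 * (k + 1) * 2 ^ (K + 2)) + 200 * 2 ^ (K + 2) + 4) fun σ₁ h₁ hf₁ => ?_).le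
    (by nlinarith)
  · intro j X hj
    simp [RExpr.eval, NExpr.eval, upd, hl₀.half, hl₀.nodes 2 (by omega) (by omega)]
  · intro τ hτ j X; simp [NExpr.eval]
  · intro τ hτ hτ' j X hj hA; simp [RExpr.eval, NExpr.eval, upd, hA]
  have hl₁ : Level K k σ₁ := hl₀.frame hf₁
  refine ((runsWithin_xform (T := fwdProg 3) (f := fwd 3 (2 ^ K) k) (o := 0)
    (fun j => σ₁.rarr 36 j + node 3 * σ₁.rarr 36 (2 ^ (K + 1) + j))
    (fwd 3 (2 ^ K) k fun j => σ₁.rarr 36 j + node 3 * σ₁.rarr 36 (2 ^ (K + 1) + j))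
    hl₁ hl₁.half hle (by decide) (by decide)
    (hyp_fwd (i := 3) hk (by decide) (by decide) hn1 ((hf₁.n 29).trans h29)
      ((hf₁.n 30).trans h30r) hle)
    (fun _ _ => fwd_congr' hn1) (by decide) (by decide) ?_ ?_ ?_).seqf
    (T' := 3 * (90 * (k + 1) * 2 ^ (K + 2)) + 200 * 2 ^ (K + 2) + 4) fun σ₂ h₂ hf₂ => ?_).le
    (by nlinarith)
  · intro j X hj
    simp [RExpr.eval, NExpr.eval, upd, hl₁.half, hl₁.nodes 3 (by omega) (by omega)]
  · intro τ hτ j X; simp [NExpr.eval]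
  · intro τ hτ hτ' j X hj hA; simp [RExpr.eval, NExpr.eval, upd, hA]
  have hl₂ : Level K k σ₂ := hl₁.frame hf₂
  have hF₂ : ∀ q b, q < B → b < 2 ^ k →
      σ₂.rarr 34 (q * 2 ^ k + b) = (F q).eval (node (2 ^ k * 2 + b)) := fun q b hq hb => by
    have := h₁.1 (q * 2 ^ k + b) (by rw [hh]; exact index_lt' hb hq)
    rw [Nat.zero_add, hf₀.ra 36, hn1, hF.eval_half (by decide) (hn1.symm.trans hh) hq hb] at this
    rw [hf₂.ra 34, this]
  have hF₃ : ∀ q b, q < B → b < 2 ^ k →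
      σ₂.rarr 35 (q * 2 ^ k + b) = (F q).eval (node (2 ^ k * 3 + b)) := fun q b hq hb => by
    have := h₂.1 (q * 2 ^ k + b) (by rw [hh]; exact index_lt' hb hq)
    rwa [Nat.zero_add, hf₁.ra 36, hf₀.ra 36, hn1,
      hF.eval_half (by decide) (hn1.symm.trans hh) hq hb] at this
  have e30 : σ₂.rarr 30 = σ.rarr 30 := by rw [hf₂.ra 30, hf₁.ra 30, hf₀.ra 30]
  have e31 : σ₂.rarr 31 = σ.rarr 31 := by rw [hf₂.ra 31, hf₁.ra 31, hf₀.ra 31]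
  clear h₁ h₂ hf₁ hf₂ hl₁ hl₀ h29 h30r hf₀
  refine (RunsWithin.straight_seq (T := 3 * (90 * (k + 1) * 2 ^ (K + 2)) + 200 * 2 ^ (K + 2))
    4 rfl le_rfl fun σ₃ h₃ hf₃ => ?_).le (by nlinarith)
  have hl₃ : Level K k σ₃ := hl₂.frame hf₃
  have h29 : σ₃.nreg 29 = 2 ^ (K + 2) := by
    rw [h₃]; simp [sizeFull, Prog.run, upd, NExpr.eval, hl₂.size]
  have h30r : σ₃.nreg 30 = 2 ^ (K + 1) := by
    rw [h₃]; simp [sizeFull, Prog.run, upd, NExpr.eval, hl₂.half]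
  clear h₃
  refine ((runsWithin_pairProg (fun j => σ₃.rarr 34 j / σ₃.rarr 30 (k * 2 ^ (K + 2) + j))
    (fun j => σ₃.rarr 34 j / σ₃.rarr 30 (k * 2 ^ (K + 2) + (2 ^ (K + 1) + j))) hl₃.toTables
    ?_ ?_).seqf (T' := 3 * (90 * (k + 1) * 2 ^ (K + 2)) + 100 * 2 ^ (K + 2))
    fun σ₄ h₄ hf₄ => ?_).le (by nlinarith)
  · intro j X hj
    simp [RExpr.eval, NExpr.eval, upd, levelGet, hl₃.offset]
  · intro τ hτ hτ' j X hj
    simp [RExpr.eval, NExpr.eval, upd, levelGet', hτ 26 (by decide), hτ 23 (by decide),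
      hτ' 30 (by decide), hτ' 34 (by decide), hl₃.offset, hl₃.half]
  have hl₄ : Level K k σ₄ := hl₃.frame hf₄
  refine ((runsWithin_xform (T := invProg pow2) (f := inv 2 (2 ^ (K + 1)) k) (o := 0)
    (σ₄.rarr 37) (inv 2 (2 ^ (K + 1)) k (σ₄.rarr 37)) hl₄ hl₄.size le_rfl (by decide) (by decide)
    (hyp_inv (i := 2) hk (by decide) (by decide) (fun _ => pow2_eval) (by decide) hn2
      ((hf₄.n 29).trans h29) ((hf₄.n 30).trans h30r) le_rfl)
    (fun _ _ => inv_congr' hn2) (by decide) (by decide) ?_ ?_ ?_).seqf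
    (T' := 2 * (90 * (k + 1) * 2 ^ (K + 2)) + 100 * 2 ^ (K + 2)) fun σ₅ h₅ hf₅ => ?_).le
    (by nlinarith)
  · intro j X hj; simp [RExpr.eval, NExpr.eval, upd]
  · intro τ hτ j X; simp [NExpr.eval]
  · intro τ hτ hτ' j X hj hA; simp [RExpr.eval, NExpr.eval, upd, hA]
  have hl₅ : Level K k σ₅ := hl₄.frame hf₅
  refine ((runsWithin_xform (T := fwdProg 3) (f := fwd 3 (2 ^ (K + 1)) k) (o := 0)
    (σ₅.rarr 37) (fwd 3 (2 ^ (K + 1)) k (σ₅.rarr 37)) hl₅ hl₅.size le_rfl (by decide) (by decide)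
    (hyp_fwd (i := 3) hk (by decide) (by decide) hn2
      (((hf₅.n 29).trans (hf₄.n 29)).trans h29) (((hf₅.n 30).trans (hf₄.n 30)).trans h30r) le_rfl)
    (fun _ _ => fwd_congr' hn2) (by decide) (by decide) ?_ ?_ ?_).seqf
    (T' := 90 * (k + 1) * 2 ^ (K + 2) + 100 * 2 ^ (K + 2)) fun σ₆ h₆ hf₆ => ?_).le
    (by nlinarith)
  · intro j X hj; simp [RExpr.eval, NExpr.eval, upd]
  · intro τ hτ j X; simp [NExpr.eval]
  · intro τ hτ hτ' j X hj hA; simp [RExpr.eval, NExpr.eval, upd, hA]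
  have hl₆ : Level K k σ₆ := hl₅.frame hf₆
  refine ((runsWithin_pairProg
    (fun j => σ₆.rarr 35 j - σ₆.rarr 37 j * σ₆.rarr 31 (k * 2 ^ (K + 2) + j))
    (fun j => σ₆.rarr 35 j - σ₆.rarr 37 (2 ^ (K + 1) + j) *
      σ₆.rarr 31 (k * 2 ^ (K + 2) + (2 ^ (K + 1) + j))) hl₆.toTables
    ?_ ?_).seqf (T' := 90 * (k + 1) * 2 ^ (K + 2))
    fun σ₇ h₇ hf₇ => ?_).le (by nlinarith)
  · intro j X hj
    simp [RExpr.eval, NExpr.eval, upd, levelGet, hl₆.offset]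
  · intro τ hτ hτ' j X hj
    simp [RExpr.eval, NExpr.eval, upd, levelGet', hτ 26 (by decide), hτ 23 (by decide),
      hτ' 31 (by decide), hτ' 35 (by decide), hτ' 37 (by decide), hl₆.offset, hl₆.half]
  have hl₇ : Level K k σ₇ := hl₆.frame hf₇
  refine (runsWithin_xform (T := invProg pow3) (f := inv 3 (2 ^ (K + 1)) k) (o := 0)
    (σ₇.rarr 38) (inv 3 (2 ^ (K + 1)) k (σ₇.rarr 38)) hl₇ hl₇.size le_rfl (by decide) (by decide)
    (hyp_inv (i := 3) hk (by decide) (by decide) (fun _ => pow3_eval) (by decide) hn2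
      ((((hf₇.n 29).trans (hf₆.n 29)).trans ((hf₅.n 29).trans (hf₄.n 29))).trans h29)
      ((((hf₇.n 30).trans (hf₆.n 30)).trans ((hf₅.n 30).trans (hf₄.n 30))).trans h30r) le_rfl)
    (fun _ _ => inv_congr' hn2) (by decide) (by decide) ?_ ?_ ?_).imp fun σ₈ h₈ => ?_
  · intro j X hj; simp [RExpr.eval, NExpr.eval, upd]
  · intro τ hτ j X; simp [NExpr.eval]
  · intro τ hτ hτ' j X hj hA; simp [RExpr.eval, NExpr.eval, upd, hA]
  have f30 : σ₃.rarr 30 = σ.rarr 30 := (hf₃.ra 30).trans e30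
  have f34 : σ₃.rarr 34 = σ₂.rarr 34 := hf₃.ra 34
  have f31 : σ₆.rarr 31 = σ.rarr 31 := by
    rw [hf₆.ra 31, hf₅.ra 31, hf₄.ra 31, hf₃.ra 31, e31]
  have f35 : σ₆.rarr 35 = σ₂.rarr 35 := by
    rw [hf₆.ra 35, hf₅.ra 35, hf₄.ra 35, hf₃.ra 35]
  have f37 : ∀ j, j < 2 ^ (K + 2) → σ₆.rarr 37 j =
      fwd 3 (2 ^ (K + 1)) k (inv 2 (2 ^ (K + 1)) k (σ₄.rarr 37)) j := fun j hj => by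
    have a₆ := h₆.1 j hj
    rw [Nat.zero_add] at a₆
    rw [a₆]
    exact fwd_congr' hn2 (fun m hm => by simpa using h₅.1 m hm) j hj
  rw [f30, f34] at h₄
  rw [f31, f35] at h₇
  refine Rep.residues (h := 2 ^ (K + 1)) (u := σ₄.rarr 37) (r := σ₇.rarr 38)
    (V₂ := fun j => σ.rarr 30 (k * 2 ^ (K + 2) + j))
    (V₃ := fun j => σ.rarr 31 (k * 2 ^ (K + 2) + j)) hh
    (fun q hq => hF.degree_lt hq) (fun q => degree_den _ _ _ _)
    (fun q i _ => eval_den_ne_zero (fun j => node_ne_of_two_lt (hs j) i) _ _) hF₂ hF₃ h30 h31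
    h₄.1 h₄.2 (fun j hj => ?_) (fun j hj => ?_) fun j hj => ?_
  · rw [h₇.1 j hj, f37 j (by omega)]
  · rw [h₇.2 j hj, f37 _ (by omega)]
  · simpa using h₈.1 j (by omega)

end FastCauchy

/-! ### The passes up and down the product tree, and the tables. -/

namespace FastCauchy

open RealRAM Polynomial

/-- All products, from the leaves to the root. -/
noncomputable def upTree : Prog :=
  .seq (.seq (.nset 25 (.const 0)) (.seq (.nset 26 (.const 0)) (.nset 35 (.const 1))))
    (forLoop 36 24 upStep)

/-- The initial contents are `-t` because `iter 0 = X`, so that `(X - t) - iter 0 = -t` at a leaf.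
-/
theorem runsWithin_upTree {K : ℕ} {t w : ℕ → ℝ} {σ : State} (hσ : Tables K σ)
    (h24 : σ.nreg 24 = K + 2) (h27 : ∀ j, j < 2 ^ (K + 2) → σ.rarr 27 j = -t j)
    (h28 : ∀ j, j < 2 ^ (K + 2) → σ.rarr 28 j = w j) :
    RunsWithin upTree σ (950 * (K + 2) ^ 2 * 2 ^ (K + 2)) fun τ =>
      Level K (K + 2) τ ∧ UpInv K (K + 2) t w τ := by
  have hc4 : 4 ≤ 2 ^ (K + 2) := by rw [pow_add]; have := Nat.two_pow_pos K; omega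
  refine (RunsWithin.straight_seq (T := (K + 2) * (940 * (K + 2) * 2 ^ (K + 2) + 8) + 6) 6 rfl
    le_rfl fun σ₀ h₀ hf₀ => ?_).le (by nlinarith [mul_le_mul_left hc4 ((K + 2) ^ 2)])
  have hl₀ : Level K 0 σ₀ := by
    refine ⟨hσ.congr (hf₀.n 22) (hf₀.n 23) (hf₀.n 34) (hf₀.ra 26) (hf₀.na 20), ?_, ?_, ?_⟩ <;>
    simp [h₀, Prog.run, upd, NExpr.eval]
  have hI₀ : UpInv K 0 t w σ₀ := by
    refine ⟨fun q hq => ?_, fun q hq => ?_, fun l q b hl => by omega, fun l q b hl => by omega⟩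
    · rw [Nat.sub_zero] at hq
      simp [expand, den, iter, hf₀.ra 27, h27 q hq]
    · rw [Nat.sub_zero] at hq
      simp [expand, num, hf₀.ra 28, h28 q hq]
  clear h₀
  refine (RunsWithin.forLoopF (n := K + 2) (C := 940 * (K + 2) * 2 ^ (K + 2))
    (fun k τ => Level K k τ ∧ UpInv K k t w τ) ((hf₀.n 24).trans h24) ⟨?_, ?_⟩ ?_).imp
    fun τ hτ => hτ.1
  · exact hl₀.congr (by simp [upd]) rfl rfl
  · exact ⟨hI₀.den, hI₀.num, hI₀.left, hI₀.right⟩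
  · rintro k τ hk - - ⟨hl, hI⟩
    refine (runsWithin_upStep hl hk hI).mono (Nat.mul_le_mul_right _ (Nat.mul_le_mul_left _ (by omega))) fun τ' h => ⟨?_, ?_⟩
    · exact h.1.congr (by simp [upd]) rfl rfl
    · exact ⟨h.2.den, h.2.num, h.2.left, h.2.right⟩

/-- All residues, from the root to the leaves. Register `37` holds the offset of the root. -/
noncomputable def downTree : Prog :=
  .seq (.seq (.nset 25 (.reg 24)) (.seq (.nset 26 (.reg 37)) (.nset 35 (.reg 22))))
    (forLoop 36 24 (.seq (.seq (.nset 25 (.sub (.reg 25) (.const 1)))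
      (.seq (.nset 26 (.sub (.reg 26) (.reg 22))) (.nset 35 (.half (.reg 35))))) downStep))

/-- Every level divides the value at `s j` by a factor that depends on `s j` and the level but not
on `F`. The product of these factors is never computed: the same one appears for numerator and
denominator. -/
theorem runsWithin_downTree {K : ℕ} {s : ℕ → ℝ} {σ : State} {F : ℝ[X]} (hσ : Tables K σ)
    (h24 : σ.nreg 24 = K + 2) (h37 : σ.nreg 37 = (K + 2) * 2 ^ (K + 2)) (hs : ∀ j, 2 < s j)
    (hF : Rep (K + 2) 1 (σ.rarr 36) fun _ => F)
    (h30 : ∀ l q b, l < K + 2 → q < 2 ^ (K + 2 - l) → b < 2 ^ l →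
      σ.rarr 30 (l * 2 ^ (K + 2) + (q * 2 ^ l + b)) =
        (den (K + 2) s l q).eval (node (2 ^ l * 2 + b)))
    (h31 : ∀ l q b, l < K + 2 → q < 2 ^ (K + 2 - l) → b < 2 ^ l →
      σ.rarr 31 (l * 2 ^ (K + 2) + (q * 2 ^ l + b)) =
        (den (K + 2) s l q).eval (node (2 ^ l * 3 + b))) :
    RunsWithin downTree σ (680 * (K + 2) ^ 2 * 2 ^ (K + 2)) fun τ =>
      ∀ j, j < 2 ^ (K + 2) → F.eval (s j) = scale (K + 2) 0 (s j) * τ.rarr 36 j := by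
  have hc4 : 4 ≤ 2 ^ (K + 2) := by rw [pow_add]; have := Nat.two_pow_pos K; omega
  refine (RunsWithin.straight_seq (T := (K + 2) * ((660 * (K + 2) * 2 ^ (K + 2) + 11) + 8) + 6) 6
    rfl le_rfl fun σ₀ h₀ hf₀ => ?_).le (by nlinarith [mul_le_mul_left hc4 ((K + 2) ^ 2)])
  have hl₀ : Level K (K + 2) σ₀ := by
    refine ⟨hσ.congr (hf₀.n 22) (hf₀.n 23) (hf₀.n 34) (hf₀.ra 26) (hf₀.na 20), ?_, ?_, ?_⟩ <;>
    simp [h₀, Prog.run, upd, NExpr.eval, h24, h37, hσ.size]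
  clear h₀
  refine (RunsWithin.forLoopF (n := K + 2) (C := 660 * (K + 2) * 2 ^ (K + 2) + 11)
    (fun m τ => ∃ F' : ℕ → ℝ[X], Level K (K + 2 - m) τ ∧
      Rep (K + 2 - m) (2 ^ m) (τ.rarr 36) F' ∧ ∀ j, j < 2 ^ (K + 2) →
        F.eval (s j) = scale (K + 2) (K + 2 - m) (s j) * (F' (j % 2 ^ m)).eval (s j))
    ((hf₀.n 24).trans h24) ?_ ?_).imp ?_
  · refine ⟨fun _ => F, hl₀.congr (by simp [upd]) rfl rfl, ?_, fun j _ => ?_⟩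
    · rw [← hf₀.ra 36] at hF; simpa using hF
    · simp [scale]
  · rintro m τ hm - hf ⟨F', hl, hr, hv⟩
    obtain ⟨k, hk⟩ : ∃ k, K + 2 - m = k + 1 := ⟨K + 2 - m - 1, by omega⟩
    have hk' : K + 2 - (m + 1) = k := by omega
    have hkm : K + 2 - (k + 1) = m := by omega
    have hkm' : K + 2 - k = m + 1 := by omega
    rw [hk] at hl hr hv
    rw [hk']
    refine (RunsWithin.straight_seq (T := 660 * (k + 1) * 2 ^ (K + 2)) 11 rfl le_rfl
      fun τ₁ h₁ hf₁ => ?_).le (by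
        have : 660 * (k + 1) * 2 ^ (K + 2) ≤ 660 * (K + 2) * 2 ^ (K + 2) :=
          Nat.mul_le_mul_right _ (Nat.mul_le_mul_left _ (by omega))
        omega)
    have hl₁ : Level K k τ₁ := by
      refine ⟨hl.toTables.congr (hf₁.n 22) (hf₁.n 23) (hf₁.n 34) (hf₁.ra 26) (hf₁.na 20),
        ?_, ?_, ?_⟩
      · simp [h₁, Prog.run, upd, NExpr.eval, hl.level]
      · simp [h₁, Prog.run, upd, NExpr.eval, hl.offset, hl.size, add_mul]
      · simp [h₁, Prog.run, upd, NExpr.eval, hl.pow, pow_succ]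
    clear h₁
    have e30 : τ₁.rarr 30 = σ.rarr 30 := ((hf₁.ra 30).trans (hf.ra 30)).trans (hf₀.ra 30)
    have e31 : τ₁.rarr 31 = σ.rarr 31 := ((hf₁.ra 31).trans (hf.ra 31)).trans (hf₀.ra 31)
    have e36 : τ₁.rarr 36 = τ.rarr 36 := hf₁.ra 36
    refine (runsWithin_downStep hl₁ (by omega) hs (F := F') (by rw [hkm, e36]; exact hr)
      (by rw [e30]; exact fun q b => h30 k q b (by omega))
      (by rw [e31]; exact fun q b => h31 k q b (by omega))).frame.imp ?_
    rintro τ₂ ⟨⟨F'', hr', hv'⟩, hf₂⟩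
    rw [hkm', hkm] at hv'
    rw [hkm'] at hr'
    refine ⟨F'', (hl₁.frame hf₂).congr (by simp [upd]) rfl rfl, hr', fun j hj => ?_⟩
    -- The point `s j` is a root of the product at node `j % 2 ^ (m + 1)`, the ancestor of the leaf
    -- `j` on this level; this is what makes the residue there carry the value at `s j`.
    have hz := eval_den_leaf (K := K + 2) s (k := k) (j := j) (by omega) hj
    rw [hkm'] at hz
    have := hv' (j % 2 ^ (m + 1)) (s j) (Nat.mod_lt _ (Nat.two_pow_pos _)) hz
    rw [Nat.mod_mod_of_dvd _ (pow_dvd_pow 2 (Nat.le_succ m))] at this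
    rw [hv j hj, this, scale_eq (k := k) (by omega)]
    ring
  · rintro τ ⟨⟨F', -, hr, hv⟩, -⟩ j hj
    rw [Nat.sub_self] at hr hv
    have := hr j hj
    rw [hv j hj, Nat.mod_eq_of_lt hj, ← this]
    simp [expand]

/-- Find the least `n = 2 ^ (K + 2)` that is at least the sum of the sizes. -/
def sizeProg : Prog :=
  .seq (.seq (.nset 24 (.const 2)) (.seq (.nset 22 (.const 4))
    (.seq (.nset 23 (.const 2)) (.nset 34 (.const 1)))))
  (.loop (.nlt (.reg 22) (.add (.reg 20) (.reg 21)))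
    (.seq (.nset 24 (.add (.reg 24) (.const 1))) (.seq (.nset 34 (.reg 23))
      (.seq (.nset 23 (.reg 22)) (.nset 22 (.add (.reg 22) (.reg 22)))))))

/-- The exponent starts at `2` in order that half and quarter of the size are powers of two.
Minimality of `K` bounds the padded size by `2 * m`; for `K = 0` this uses `2 ≤ m`. -/
theorem runsWithin_sizeProg {σ : State} {m : ℕ} (hm : σ.nreg 20 + σ.nreg 21 = m) (hm2 : 2 ≤ m) :
    ∃ K, m ≤ 2 ^ (K + 2) ∧ 2 ^ (K + 2) ≤ 2 * m ∧
    RunsWithin sizeProg σ (20 * (K + 2)) fun τ => τ.nreg 24 = K + 2 ∧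
      τ.nreg 22 = 2 ^ (K + 2) ∧ τ.nreg 23 = 2 ^ (K + 1) ∧ τ.nreg 34 = 2 ^ K := by
  have hex : ∃ K, m ≤ 2 ^ (K + 2) := ⟨m, (Nat.lt_two_pow_self (n := m)).le.trans
    (Nat.pow_le_pow_right two_pos (by omega))⟩
  classical
  set K := Nat.find hex with hK
  have hKm : m ≤ 2 ^ (K + 2) := Nat.find_spec hex
  have hlt : ∀ k, k < K → 2 ^ (k + 2) < m := fun k hk => not_le.1 (Nat.find_min hex hk)
  refine ⟨K, hKm, ?_, ?_⟩
  · rcases Nat.eq_zero_or_pos K with h0 | h0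
    · rw [h0]; omega
    · have := hlt (K - 1) (by omega)
      rw [show K + 2 = (K - 1 + 2) + 1 by omega, pow_succ]; omega
  refine (RunsWithin.straight_seq (T := K * (12 + 5 + 1) + 5 + 1) 8 rfl le_rfl
    fun σ₀ h₀ hf₀ => ?_).le (by omega)
  refine RunsWithin.loop_count (n := K) (C := 12) (fun k τ => τ.nreg 24 = k + 2 ∧
      τ.nreg 22 = 2 ^ (k + 2) ∧ τ.nreg 23 = 2 ^ (k + 1) ∧ τ.nreg 34 = 2 ^ k ∧
      τ.nreg 20 + τ.nreg 21 = m) (fun k τ hk hI => ?_) (fun k τ hk hI => ?_) ?_ |>.imp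
      fun τ hτ => ⟨hτ.1, hτ.2.1, hτ.2.2.1, hτ.2.2.2.1⟩
  · simp only [Test.Holds, NExpr.eval, hI.2.1, hI.2.2.2.2]
    refine ⟨fun h => ?_, hlt k⟩
    by_contra hc
    obtain rfl : k = K := by omega
    omega
  · refine RunsWithin.straight 12 rfl le_rfl ?_
    simp only [Prog.run, upd, NExpr.eval]
    simp [hI]
    ring
  · simp [h₀, Prog.run, upd, NExpr.eval, hm]

/-- The table of the nodes. -/
noncomputable def nodeProg : Prog :=
  .seq (.rput 26 (.const 1) (.const 0))
  (forLoop 33 22 (.seq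
    (.rput 26 (.add (.add (.reg 33) (.reg 33)) (.const 2))
      (.sqrt (.add (.const 2) (.get 26 (.add (.reg 33) (.const 1))))))
    (.rput 26 (.add (.add (.reg 33) (.reg 33)) (.const 3))
      (.sub (.const 0) (.get 26 (.add (.add (.reg 33) (.reg 33)) (.const 2)))))))

theorem runsWithin_nodeProg {σ : State} {n : ℕ} (h22 : σ.nreg 22 = n) :
    RunsWithin nodeProg σ (n * 40 + 10) fun τ =>
      ∀ m, 1 ≤ m → m < 2 * n + 2 → τ.rarr 26 m = node m := by
  refine (RunsWithin.straight_seq (T := n * (28 + 8) + 6) 3 rfl le_rfl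
    fun σ₀ h₀ hf₀ => ?_).le (by omega)
  refine (RunsWithin.forLoopF (n := n) (C := 28) (fun j τ =>
    ∀ m, 1 ≤ m → m < 2 * j + 2 → τ.rarr 26 m = node m) ((hf₀.n 22).trans h22) ?_ ?_).imp
    fun τ hτ => hτ.1
  · intro m h1 h2
    obtain rfl : m = 1 := by omega
    simp [h₀, Prog.run, upd, NExpr.eval, RExpr.eval, node_one]
  · intro j τ hj hJ hf hI
    refine RunsWithin.straight 28 rfl (by decide) fun m h1 h2 => ?_
    have hn := node_two_mul (i := j + 1) (by omega)
    have hn' := node_two_mul_add_one (i := j + 1) (by omega)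
    rw [show 2 * (j + 1) = j + j + 2 by ring] at hn
    rw [show 2 * (j + 1) = j + j + 2 by ring] at hn'
    simp only [Prog.run, upd, NExpr.eval, RExpr.eval, hJ, hI (j + 1) (by omega) (by omega),
      if_true]
    rcases Nat.lt_or_ge m (2 * j + 2) with h | h
    · rw [if_neg (by omega), if_neg (by omega), hI m h1 h]
    · rcases (by omega : m = j + j + 2 ∨ m = j + j + 3) with rfl | rfl
      · rw [if_neg (by omega), if_pos rfl, hn]
      · rw [if_pos rfl, hn', hn, zero_sub]

/-- The table of the remainders. -/
def remProg : Prog :=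
  .seq (mapN 33 22 20 (.reg 33) (.const 0)) (.seq (.nset 26 (.const 0))
  (forLoop 27 24 (.seq (mapN 33 22 20 (.add (.add (.reg 26) (.reg 22)) (.reg 33))
    (.add (.add (.get 20 (.add (.reg 26) (.half (.reg 33))))
      (.get 20 (.add (.reg 26) (.half (.reg 33)))))
      (.sub (.reg 33) (.add (.half (.reg 33)) (.half (.reg 33))))))
    (.nset 26 (.add (.reg 26) (.reg 22))))))

/-- Row `s + 1` is computed from row `s` by `m % 2 ^ (s + 1) = 2 * ((m / 2) % 2 ^ s) + m % 2`, which
needs only halving, addition and subtraction. -/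
theorem runsWithin_remProg {σ : State} {n k : ℕ} (h22 : σ.nreg 22 = n) (h24 : σ.nreg 24 = k) :
    RunsWithin remProg σ ((k + 1) * (n * 40 + 40)) fun τ =>
      ∀ s m, s ≤ k → m < n → τ.narr 20 (s * n + m) = m % 2 ^ s := by
  refine ((RunsWithin.mapN n 0 (fun _ => 0) (by decide) h22 (fun j X => by simp [NExpr.eval])
    fun j X _ _ => by simp [NExpr.eval]).seqf (T' := 2 + (k * (n * 35 + 10 + 8) + 6))
    fun σ₁ h₁ hf₁ => RunsWithin.straight_seq 2 rfl le_rfl fun σ₂ h₂ hf₂ => ?_).le ?_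
  · refine (RunsWithin.forLoopF (n := k) (C := n * 35 + 10) (fun j τ =>
      τ.nreg 26 = j * n ∧ ∀ s m, s ≤ j → m < n → τ.narr 20 (s * n + m) = m % 2 ^ s)
      (((hf₂.n 24).trans (hf₁.n 24)).trans h24) ⟨?_, ?_⟩ ?_).imp fun τ hτ => hτ.1.2
    · simp [h₂, Prog.run, upd, NExpr.eval]
    · intro s m hs hm
      obtain rfl : s = 0 := by omega
      have := h₁.1 m hm
      change σ₂.narr 20 _ = _
      rw [hf₂.na 20, zero_mul, this, pow_zero, Nat.mod_one]
    · rintro j τ hj hJ hf ⟨h26, hI⟩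
      have e22 : τ.nreg 22 = n := by rw [hf.n 22, hf₂.n 22, hf₁.n 22, h22]
      refine ((RunsWithin.mapN n ((j + 1) * n) (fun m => m % 2 ^ (j + 1)) (by decide) e22
        (fun j X => by simp [NExpr.eval, upd, h26, e22]; ring) fun m X hm hX => ?_).seqf
        (T' := 4) fun τ₁ g₁ hg₁ => ?_).le ?_
      · have hmj : m / 2 < n := by omega
        have hlt : j * n + m / 2 < (j + 1) * n := by rw [add_mul]; omega
        have e := hI j (m / 2) le_rfl hmj
        rw [← hX _ (Or.inl hlt)] at e
        simp only [NExpr.eval, upd, h26, if_true, show (26 : ℕ) ≠ 33 by decide, if_false, e]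
        rcases Nat.even_or_odd' m with ⟨i, rfl | rfl⟩
        · rw [two_mul_mod_two_pow, show 2 * i / 2 = i by omega]; omega
        · rw [two_mul_add_one_mod_two_pow, show (2 * i + 1) / 2 = i by omega]; omega
      · refine RunsWithin.straight 4 rfl le_rfl ⟨?_, fun s m hs hm => ?_⟩
        · simp [Prog.run, upd, NExpr.eval, hg₁.n 26, hg₁.n 22, h26, e22]; ring
        · change τ₁.narr 20 _ = _
          rcases Nat.lt_or_ge j s with h | h
          · obtain rfl : s = j + 1 := by omega
            exact g₁.1 m hm
          · rw [g₁.2.1 _ (Or.inl ?_), hI s m h hm]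
            calc s * n + m < s * n + n := by omega
              _ = (s + 1) * n := by ring
              _ ≤ (j + 1) * n := Nat.mul_le_mul_right _ (by omega)
      · simp only [NExpr.cost]; omega
  · simp only [NExpr.cost]; nlinarith

end FastCauchy

/-! ### Multiplication of a vector by the matrix. -/

namespace FastCauchy

open RealRAM Polynomial

theorem _root_.RealRAM.Exec.pos {p : Prog} {σ τ : State} {t : ℕ} (h : Exec p σ t τ) : 0 < t := by
  induction h <;> omega

/-- Composition in which the second program has the remaining time at its disposal. -/
theorem _root_.RealRAM.RunsWithin.andThen {p q : Prog} {σ : State} {T B : ℕ} {Q R : State → Prop}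
    (h : RunsWithin p σ T R) (h' : ∀ τ, R τ → Frame p σ τ → RunsWithin q τ (B - T) Q) :
    RunsWithin (.seq p q) σ B Q := by
  obtain ⟨t, τ, h₁, h₂, h₃⟩ := h
  obtain ⟨t', τ', h₁', h₂', h₃'⟩ := h' τ h₃ h₁.frame
  -- An execution takes at least one step, so `B - T` is positive and the truncated subtraction
  -- loses nothing.
  have := h₁'.pos
  exact ⟨t + t', τ', .seq h₁ h₁', by omega, h₃'⟩


/-- Write the values of `e` to the first `L` cells of the array `d`. -/
def fill (L d : ℕ) (e : RExpr) : Prog := mapR 33 L d (.reg 33) e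

theorem runsWithin_fill (L d : ℕ) (e : RExpr) {σ : State} (n : ℕ) (f : ℕ → ℝ)
    (hL : σ.nreg L = n) (he : ∀ j X, j < n →
      e.eval { σ with nreg := upd σ.nreg 33 j, rarr := upd σ.rarr d X } = f j)
    (hJ : L ≠ 33 := by decide) (hc : e.cost ≤ 30 := by simp +decide [RExpr.cost, NExpr.cost]) :
    RunsWithin (fill L d e) σ (n * 40 + 6) fun τ =>
      (∀ j, j < n → τ.rarr d j = f j) ∧ ∀ j, n ≤ j → τ.rarr d j = σ.rarr d j := by
  refine (RunsWithin.mapR n 0 f hJ hL (fun j X => by simp [NExpr.eval])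
    fun j X hj _ => he j X hj).mono ?_ fun τ hτ => ⟨fun j hj => ?_, fun j hj => ?_⟩
  · have : n * (NExpr.cost (.reg 33) + e.cost + 9) ≤ n * 40 :=
      Nat.mul_le_mul_left _ (by simp only [NExpr.cost]; omega)
    omega
  · simpa using hτ.1 j hj
  · exact hτ.2.1 j (Or.inr (by omega))

/-- Compute a number that exceeds the absolute values of the negative `x i` by more than `2`. -/
noncomputable def shiftProg : Prog :=
  .seq (.rset 20 (.const 3))
    (forLoop 33 20 (.rset 20 (.add (.reg 20) (.mul (.get 20 (.reg 33)) (.get 20 (.reg 33))))))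

/-- The shift is `3 + ∑ xᵢ ^ 2`; it suffices as `x ^ 2 + x ≥ -1 / 4`. Partial sums only grow, so
earlier bounds persist. -/
theorem runsWithin_shiftProg {σ : State} {a : ℕ} (ha : σ.nreg 20 = a) :
    RunsWithin shiftProg σ (a * 20 + 10) fun τ => ∀ j, j < a → 2 < σ.rarr 20 j + τ.rreg 20 := by
  refine (RunsWithin.straight_seq (T := a * (8 + 8) + 6) 2 rfl le_rfl fun σ₀ h₀ hf₀ => ?_).le
    (by omega)
  refine (RunsWithin.forLoopF (n := a) (C := 8) (fun m τ =>
    3 ≤ τ.rreg 20 ∧ ∀ j, j < m → 2 < σ.rarr 20 j + τ.rreg 20) ((hf₀.n 20).trans ha) ?_ ?_).imp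
    fun τ hτ => hτ.1.2
  · simp [h₀, Prog.run, RExpr.eval]
  · rintro m τ hm hJ hf ⟨h3, hI⟩
    have e20 : τ.rarr 20 = σ.rarr 20 := (hf.ra 20).trans (hf₀.ra 20)
    refine RunsWithin.straight 8 rfl le_rfl ?_
    simp only [Prog.run, upd, RExpr.eval, NExpr.eval, hJ, e20, if_true]
    have hsq := mul_self_nonneg (σ.rarr 20 m)
    refine ⟨by linarith, fun j hj => ?_⟩
    rcases Nat.lt_succ_iff_lt_or_eq.1 hj with h | rfl
    · linarith [hI j h]
    · nlinarith [sq_nonneg (σ.rarr 20 j + 1)]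

theorem Rep.sub {k B : ℕ} {a b c : ℕ → ℝ} {p q : ℕ → ℝ[X]} (ha : Rep k B a p) (hb : Rep k B b q)
    (hc : ∀ m, m < 2 ^ k * B → c m = a m - b m) : Rep k B c fun i => p i - q i := fun i hi => by
  change expand k (fun m => c (m * B + i)) = p i - q i
  rw [← ha i hi, ← hb i hi]
  rw [expand_congr (c' := fun m => 1 * a (m * B + i) + (-1) * b (m * B + i)) fun m hm => by
    rw [hc _ (index_lt hm hi)]; ring, expand_linear]
  simp [sub_eq_add_neg]

/-- The sizes, the tables and the shift. -/
noncomputable def prepProg : Prog := .seq sizeProg (.seq nodeProg (.seq remProg shiftProg))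

/-- The product tree of the nodes `t`. -/
noncomputable def colProg (lam c : ℝ) : Prog :=
  .seq (fill 22 27 (.const 0)) (.seq (fill 22 28 (.const 0))
  (.seq (fill 21 27 (.sub (.add (.get 21 (.reg 33)) (.const c)) (.reg 20)))
  (.seq (fill 21 28 (.mul (.get 22 (.reg 33)) (.exp (.mul (.const lam) (.get 21 (.reg 33))))))
  (.seq upTree
  (.seq (fill 22 39 (.get 27 (.reg 33))) (fill 22 40 (.get 28 (.reg 33))))))))

/-- The product tree of the nodes `s`. -/
noncomputable def rowProg : Prog :=
  .seq (fill 22 27 (.const (-3))) (.seq (fill 22 28 (.const 0))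
  (.seq (fill 20 27 (.sub (.const 0) (.add (.get 20 (.reg 33)) (.reg 20))))
  (.seq upTree (.nset 37 (.reg 26)))))

/-- The residues of denominator and numerator, and the result. -/
noncomputable def evalProg (lam : ℝ) : Prog :=
  .seq (fill 22 36 (.sub (.get 39 (.reg 33)) (.get 27 (.reg 33)))) (.seq downTree
  (.seq (fill 22 39 (.get 36 (.reg 33))) (.seq (fill 22 36 (.get 40 (.reg 33))) (.seq downTree
    (fill 20 23 (.mul (.exp (.mul (.const lam) (.get 20 (.reg 33))))
      (.div (.get 36 (.reg 33)) (.get 39 (.reg 33)))))))))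

/-- Multiplication of a vector by a matrix `[exp (lam * (xᵢ + yⱼ)) / (xᵢ + yⱼ + c)]`. -/
noncomputable def mulProg (lam c : ℝ) : Prog :=
  .seq prepProg (.seq (colProg lam c) (.seq rowProg (evalProg lam)))

theorem runsWithin_prepProg {σ : State} {a m : ℕ} (ha : σ.nreg 20 = a)
    (hm : σ.nreg 20 + σ.nreg 21 = m) (hm2 : 2 ≤ m) :
    ∃ K, m ≤ 2 ^ (K + 2) ∧ 2 ^ (K + 2) ≤ 2 * m ∧
    RunsWithin prepProg σ (200 * ((K + 2) * 2 ^ (K + 2))) fun τ => Tables K τ ∧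
      τ.nreg 24 = K + 2 ∧ ∀ j, j < a → 2 < σ.rarr 20 j + τ.rreg 20 := by
  obtain ⟨K, h₁, h₂, h⟩ := runsWithin_sizeProg hm hm2
  refine ⟨K, h₁, h₂, ?_⟩
  have hc4 : 4 ≤ 2 ^ (K + 2) := by rw [pow_add]; have := Nat.two_pow_pos K; omega
  have e1 : 2 * 2 ^ (K + 2) ≤ (K + 2) * 2 ^ (K + 2) := Nat.mul_le_mul_right _ (by omega)
  have e2 : (K + 2) * 4 ≤ (K + 2) * 2 ^ (K + 2) := Nat.mul_le_mul_left _ hc4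
  have e3 : (K + 2 + 1) * (2 ^ (K + 2) * 40 + 40) =
    40 * ((K + 2) * 2 ^ (K + 2)) + 40 * (K + 2) + 40 * 2 ^ (K + 2) + 40 := by ring
  have e4 : 40 ≤ 10 * 2 ^ (K + 2) := by omega
  refine RunsWithin.andThen h fun σ₁ ⟨h24, h22, h23, h34⟩ hf₁ => ?_
  refine RunsWithin.andThen (runsWithin_nodeProg h22) fun σ₂ hn hf₂ => ?_
  refine RunsWithin.andThen (runsWithin_remProg ((hf₂.n 22).trans h22)
    ((hf₂.n 24).trans h24)) fun σ₃ hr hf₃ => ?_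
  refine (runsWithin_shiftProg (a := a) ?_).frame.mono (by omega) fun σ₄ ⟨hs, hf₄⟩ => ⟨⟨?_, ?_, ?_, ?_, ?_⟩,
    ?_, ?_⟩
  · rw [hf₃.n 20, hf₂.n 20, hf₁.n 20, ha]
  · rw [hf₄.n 22, hf₃.n 22, hf₂.n 22, h22]
  · rw [hf₄.n 23, hf₃.n 23, hf₂.n 23, h23]
  · rw [hf₄.n 34, hf₃.n 34, hf₂.n 34, h34]
  · intro m hm1 hm2
    rw [hf₄.ra 26, hf₃.ra 26]
    exact hn m hm1 (by rw [pow_succ] at hm2; omega)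
  · rw [hf₄.na 20]; exact hr
  · rw [hf₄.n 24, hf₃.n 24, hf₂.n 24, h24]
  · rw [hf₃.ra 20, hf₂.ra 20, hf₁.ra 20] at hs
    exact hs

/-- With the shift `ρ` the poles are `tⱼ = ρ - yⱼ - c`. Padding uses the pole `0` with weight `0`,
which contributes nothing and is different from all evaluation points, as these exceed `2`. -/
theorem runsWithin_colProg {lam c : ℝ} {K b : ℕ} {σ : State} (hσ : Tables K σ)
    (h24 : σ.nreg 24 = K + 2) (hb : σ.nreg 21 = b) (hbn : b ≤ 2 ^ (K + 2)) :
    RunsWithin (colProg lam c) σ (1100 * ((K + 2) ^ 2 * 2 ^ (K + 2))) fun τ =>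
      Rep (K + 2) 1 (τ.rarr 39) (fun q => den (K + 2)
        (fun j => if j < b then σ.rreg 20 - σ.rarr 21 j - c else 0) (K + 2) q - iter (K + 2)) ∧
      Rep (K + 2) 1 (τ.rarr 40) (num (K + 2)
        (fun j => if j < b then σ.rreg 20 - σ.rarr 21 j - c else 0)
        (fun j => if j < b then σ.rarr 22 j * Real.exp (lam * σ.rarr 21 j) else 0) (K + 2)) := by
  have hc4 : 4 ≤ 2 ^ (K + 2) := by rw [pow_add]; have := Nat.two_pow_pos K; omega
  have e1 : 4 * 2 ^ (K + 2) ≤ (K + 2) ^ 2 * 2 ^ (K + 2) := Nat.mul_le_mul_right _ (by nlinarith)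
  have e2 := mul_assoc 950 ((K + 2) ^ 2) (2 ^ (K + 2))
  refine RunsWithin.andThen (runsWithin_fill 22 27 (.const 0) _ (fun _ => 0) hσ.size
    fun j X _ => by simp [RExpr.eval]) fun σ₁ h₁ hf₁ => ?_
  refine RunsWithin.andThen (runsWithin_fill 22 28 (.const 0) _ (fun _ => 0) ((hf₁.n 22).trans hσ.size)
    fun j X _ => by simp [RExpr.eval]) fun σ₂ h₂ hf₂ => ?_
  have e21 : σ₂.nreg 21 = b := by rw [hf₂.n 21, hf₁.n 21, hb]
  have ey : σ₂.rarr 21 = σ.rarr 21 := by rw [hf₂.ra 21, hf₁.ra 21]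
  refine RunsWithin.andThen (runsWithin_fill 21 27 (.sub (.add (.get 21 (.reg 33)) (.const c)) (.reg 20)) _ (fun j => σ.rarr 21 j + c - σ.rreg 20)
    e21 fun j X _ => by
      simp [RExpr.eval, NExpr.eval, upd, ey, hf₂.r 20, hf₁.r 20]) fun σ₃ h₃ hf₃ => ?_
  refine RunsWithin.andThen (runsWithin_fill 21 28 (.mul (.get 22 (.reg 33)) (.exp (.mul (.const lam) (.get 21 (.reg 33))))) _
    (fun j => σ.rarr 22 j * Real.exp (lam * σ.rarr 21 j)) ((hf₃.n 21).trans e21) fun j X _ => by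
      simp [RExpr.eval, NExpr.eval, upd, hf₃.ra 21, hf₃.ra 22, hf₂.ra 22, hf₁.ra 22, ey])
    fun σ₄ h₄ hf₄ => ?_
  have ht : Tables K σ₄ := hσ.congr (by rw [hf₄.n 22, hf₃.n 22, hf₂.n 22, hf₁.n 22])
    (by rw [hf₄.n 23, hf₃.n 23, hf₂.n 23, hf₁.n 23])
    (by rw [hf₄.n 34, hf₃.n 34, hf₂.n 34, hf₁.n 34])
    (by rw [hf₄.ra 26, hf₃.ra 26, hf₂.ra 26, hf₁.ra 26])
    (by rw [hf₄.na 20, hf₃.na 20, hf₂.na 20, hf₁.na 20])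
  refine RunsWithin.andThen (runsWithin_upTree
    (t := fun j => if j < b then σ.rreg 20 - σ.rarr 21 j - c else 0)
    (w := fun j => if j < b then σ.rarr 22 j * Real.exp (lam * σ.rarr 21 j) else 0) ht
    (by rw [hf₄.n 24, hf₃.n 24, hf₂.n 24, hf₁.n 24, h24]) ?_ ?_) fun σ₅ ⟨hl₅, hI⟩ hf₅ => ?_
  · intro j hj
    rw [hf₄.ra 27]
    split_ifs with hjb
    · rw [h₃.1 j hjb]; ring
    · rw [h₃.2 j (by omega), hf₂.ra 27, h₁.1 j hj, neg_zero]
  · intro j hj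
    split_ifs with hjb
    · exact h₄.1 j hjb
    · rw [h₄.2 j (by omega), hf₃.ra 28, h₂.1 j hj]
  refine RunsWithin.andThen (runsWithin_fill 22 39 (.get 27 (.reg 33)) _ (σ₅.rarr 27) hl₅.size
    fun j X _ => by simp [RExpr.eval, NExpr.eval, upd]) fun σ₆ h₆ hf₆ => ?_
  refine (runsWithin_fill 22 40 (.get 28 (.reg 33)) _ (σ₆.rarr 28) ((hf₆.n 22).trans hl₅.size)
    fun j X _ => by simp [RExpr.eval, NExpr.eval, upd]).frame.mono (by omega) fun σ₇ ⟨h₇, hf₇⟩ => ⟨?_, ?_⟩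
  · have := hI.den
    rw [Nat.sub_self, pow_zero] at this
    refine this.congr fun m hm => ?_
    rw [hf₇.ra 39, h₆.1 m (by omega)]
  · have := hI.num
    rw [Nat.sub_self, pow_zero] at this
    refine this.congr fun m hm => ?_
    rw [h₇.1 m (by omega), hf₆.ra 28]

/-- The evaluation points are padded by `3`, since all of them have to lie beyond `2`. Only
denominators matter here, so the weights are zero. -/
theorem runsWithin_rowProg {K a : ℕ} {σ : State} (hσ : Tables K σ)
    (h24 : σ.nreg 24 = K + 2) (ha : σ.nreg 20 = a) (han : a ≤ 2 ^ (K + 2)) :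
    RunsWithin rowProg σ (1100 * ((K + 2) ^ 2 * 2 ^ (K + 2))) fun τ => Level K (K + 2) τ ∧
      τ.nreg 37 = (K + 2) * 2 ^ (K + 2) ∧
      UpInv K (K + 2) (fun j => if j < a then σ.rarr 20 j + σ.rreg 20 else 3) (fun _ => 0) τ := by
  have hc4 : 4 ≤ 2 ^ (K + 2) := by rw [pow_add]; have := Nat.two_pow_pos K; omega
  have e1 : 4 * 2 ^ (K + 2) ≤ (K + 2) ^ 2 * 2 ^ (K + 2) := Nat.mul_le_mul_right _ (by nlinarith)
  have e2 := mul_assoc 950 ((K + 2) ^ 2) (2 ^ (K + 2))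
  refine RunsWithin.andThen (runsWithin_fill 22 27 (.const (-3)) _ (fun _ => -3) hσ.size
    fun j X _ => by simp [RExpr.eval]) fun σ₁ h₁ hf₁ => ?_
  refine RunsWithin.andThen (runsWithin_fill 22 28 (.const 0) _ (fun _ => 0) ((hf₁.n 22).trans hσ.size)
    fun j X _ => by simp [RExpr.eval]) fun σ₂ h₂ hf₂ => ?_
  refine RunsWithin.andThen (runsWithin_fill 20 27 (.sub (.const 0) (.add (.get 20 (.reg 33)) (.reg 20))) a (fun j => 0 - (σ.rarr 20 j + σ.rreg 20))
    (by rw [hf₂.n 20, hf₁.n 20, ha]) fun j X _ => by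
      simp [RExpr.eval, NExpr.eval, upd, hf₂.ra 20, hf₁.ra 20, hf₂.r 20, hf₁.r 20])
    fun σ₃ h₃ hf₃ => ?_
  have ht : Tables K σ₃ := hσ.congr (by rw [hf₃.n 22, hf₂.n 22, hf₁.n 22])
    (by rw [hf₃.n 23, hf₂.n 23, hf₁.n 23]) (by rw [hf₃.n 34, hf₂.n 34, hf₁.n 34])
    (by rw [hf₃.ra 26, hf₂.ra 26, hf₁.ra 26]) (by rw [hf₃.na 20, hf₂.na 20, hf₁.na 20])
  refine RunsWithin.andThen (runsWithin_upTree
    (t := fun j => if j < a then σ.rarr 20 j + σ.rreg 20 else 3) (w := fun _ => 0) ht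
    (by rw [hf₃.n 24, hf₂.n 24, hf₁.n 24, h24]) ?_ ?_) fun σ₄ ⟨hl₄, hI⟩ hf₄ => ?_
  · intro j hj
    split_ifs with hja
    · rw [h₃.1 j hja, zero_sub]
    · rw [h₃.2 j (by omega), hf₂.ra 27, h₁.1 j hj]
  · intro j hj
    rw [hf₃.ra 28, h₂.1 j hj]
  refine (RunsWithin.straight 2 rfl le_rfl ?_).le (by omega)
  refine ⟨hl₄.congr (by simp [Prog.run, upd]) rfl rfl, ?_,
    ⟨hI.den, hI.num, hI.left, hI.right⟩⟩
  simp [Prog.run, upd, NExpr.eval, hl₄.offset]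

/-- The denominator is monic of degree `n`, too large for the pass down. The denominator of the
points `s` vanishes at all of them, so it can be subtracted without changing the values, and the
difference has smaller degree; the `iter` terms of the stored forms cancel. The common factor
`scale` disappears in the final quotient. -/
theorem runsWithin_evalProg {lam : ℝ} {K a : ℕ} {σ : State} {s t w : ℕ → ℝ}
    (hσ : Level K (K + 2) σ) (h24 : σ.nreg 24 = K + 2) (h37 : σ.nreg 37 = (K + 2) * 2 ^ (K + 2))
    (ha : σ.nreg 20 = a) (han : a ≤ 2 ^ (K + 2)) (hs : ∀ j, 2 < s j)
    (hI : UpInv K (K + 2) s (fun _ => 0) σ)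
    (h39 : Rep (K + 2) 1 (σ.rarr 39) fun q => den (K + 2) t (K + 2) q - iter (K + 2))
    (h40 : Rep (K + 2) 1 (σ.rarr 40) (num (K + 2) t w (K + 2))) :
    RunsWithin (evalProg lam) σ (1500 * ((K + 2) ^ 2 * 2 ^ (K + 2))) fun τ => ∀ i, i < a →
      τ.rarr 23 i = Real.exp (lam * σ.rarr 20 i) *
        ((num (K + 2) t w (K + 2) 0).eval (s i) / (den (K + 2) t (K + 2) 0).eval (s i)) := by
  have hc4 : 4 ≤ 2 ^ (K + 2) := by rw [pow_add]; have := Nat.two_pow_pos K; omega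
  have e1 : 4 * 2 ^ (K + 2) ≤ (K + 2) ^ 2 * 2 ^ (K + 2) := Nat.mul_le_mul_right _ (by nlinarith)
  have e2 := mul_assoc 680 ((K + 2) ^ 2) (2 ^ (K + 2))
  refine RunsWithin.andThen (runsWithin_fill 22 36 (.sub (.get 39 (.reg 33)) (.get 27 (.reg 33))) _ (fun j => σ.rarr 39 j - σ.rarr 27 j)
    hσ.size fun j X _ => by simp [RExpr.eval, NExpr.eval, upd]) fun σ₁ h₁ hf₁ => ?_
  have ht₁ : Tables K σ₁ := (hσ.frame hf₁).toTables
  have hr₁ : Rep (K + 2) 1 (σ₁.rarr 36) fun _ =>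
      den (K + 2) t (K + 2) 0 - den (K + 2) s (K + 2) 0 := by
    have := hI.den
    rw [Nat.sub_self, pow_zero] at this
    intro q hq
    obtain rfl : q = 0 := by omega
    rw [h39.sub this (fun m hm => h₁.1 m (by omega)) 0 hq]
    ring
  refine RunsWithin.andThen (runsWithin_downTree ht₁ ((hf₁.n 24).trans h24)
    ((hf₁.n 37).trans h37) hs hr₁ (by rw [hf₁.ra 30]; exact fun l q b hl => hI.left l q b hl)
    (by rw [hf₁.ra 31]; exact fun l q b hl => hI.right l q b hl)) fun σ₂ h₂ hf₂ => ?_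
  have ht₂ : Tables K σ₂ := ht₁.congr (hf₂.n 22) (hf₂.n 23) (hf₂.n 34) (hf₂.ra 26) (hf₂.na 20)
  refine RunsWithin.andThen (runsWithin_fill 22 39 (.get 36 (.reg 33)) _ (σ₂.rarr 36)
    ht₂.size fun j X _ => by simp [RExpr.eval, NExpr.eval, upd]) fun σ₃ h₃ hf₃ => ?_
  have ht₃ : Tables K σ₃ := ht₂.congr (hf₃.n 22) (hf₃.n 23) (hf₃.n 34) (hf₃.ra 26) (hf₃.na 20)
  refine RunsWithin.andThen (runsWithin_fill 22 36 (.get 40 (.reg 33)) _ (σ₃.rarr 40)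
    ht₃.size fun j X _ => by simp [RExpr.eval, NExpr.eval, upd]) fun σ₄ h₄ hf₄ => ?_
  have ht₄ : Tables K σ₄ := ht₃.congr (hf₄.n 22) (hf₄.n 23) (hf₄.n 34) (hf₄.ra 26) (hf₄.na 20)
  have e40 : σ₃.rarr 40 = σ.rarr 40 := by rw [hf₃.ra 40, hf₂.ra 40, hf₁.ra 40]
  have hr₄ : Rep (K + 2) 1 (σ₄.rarr 36) fun _ => num (K + 2) t w (K + 2) 0 := by
    intro q hq
    obtain rfl : q = 0 := by omega
    exact (h40.congr fun m hm => by rw [h₄.1 m (by omega), e40]) 0 hq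
  refine RunsWithin.andThen (runsWithin_downTree ht₄
    (by rw [hf₄.n 24, hf₃.n 24, hf₂.n 24, hf₁.n 24, h24])
    (by rw [hf₄.n 37, hf₃.n 37, hf₂.n 37, hf₁.n 37, h37]) hs hr₄
    (by
      rw [hf₄.ra 30, hf₃.ra 30, hf₂.ra 30, hf₁.ra 30]
      exact fun l q b hl => hI.left l q b hl)
    (by
      rw [hf₄.ra 31, hf₃.ra 31, hf₂.ra 31, hf₁.ra 31]
      exact fun l q b hl => hI.right l q b hl)) fun σ₅ h₅ hf₅ => ?_
  refine (runsWithin_fill 20 23 (.mul (.exp (.mul (.const lam) (.get 20 (.reg 33)))) (.div (.get 36 (.reg 33)) (.get 39 (.reg 33)))) a (fun j => Real.exp (lam * σ.rarr 20 j) *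
    (σ₅.rarr 36 j / σ₅.rarr 39 j)) ?_ fun j X _ => ?_).mono (by omega) fun σ₆ h₆ i hi => ?_
  · rw [hf₅.n 20, hf₄.n 20, hf₃.n 20, hf₂.n 20, hf₁.n 20, ha]
  · have : σ₅.rarr 20 = σ.rarr 20 := by
      rw [hf₅.ra 20, hf₄.ra 20, hf₃.ra 20, hf₂.ra 20, hf₁.ra 20]
    simp [RExpr.eval, NExpr.eval, upd, this]
  · have hin : i < 2 ^ (K + 2) := by omega
    have hz := eval_den_leaf (K := K + 2) s (k := K + 2) le_rfl hin
    rw [Nat.sub_self, pow_zero, Nat.mod_one] at hz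
    have e₂ := h₂ i hin
    rw [eval_sub, hz, sub_zero] at e₂
    have hsc := scale_ne_zero (hs i) (K + 2) 0
    rw [h₆.1 i hi, h₅ i hin, e₂, hf₅.ra 39, hf₄.ra 39, h₃.1 i hin, mul_div_mul_left _ _ hsc]

theorem sum_pad {a n : ℕ} (h : a ≤ n) (f : ℕ → ℝ) (hf : ∀ j, a ≤ j → f j = 0) :
    ∑ j ∈ Finset.range n, f j = ∑ j ∈ Finset.range a, f j := by
  refine (Finset.sum_subset (Finset.range_mono h) fun j _ hj => hf j ?_).symm
  simpa using hj

/-- The shift cancels in `sᵢ - tⱼ = xᵢ + yⱼ + c`, and the exponential of the sum is split between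
the weights and the final scaling by `exp (λ xᵢ)`. -/
theorem runsWithin_mulProg {lam c : ℝ} {a b : ℕ} {σ : State} (ha : σ.nreg 20 = a)
    (hb : σ.nreg 21 = b) (ha1 : 1 ≤ a) (hb1 : 1 ≤ b)
    (hne : ∀ i j, i < a → j < b → σ.rarr 20 i + σ.rarr 21 j ≠ -c) :
    RunsWithin (mulProg lam c) σ (8000 * (a + b) * (Nat.log 2 (a + b) + 1) ^ 2) fun τ =>
      ∀ i, i < a → τ.rarr 23 i = ∑ j ∈ Finset.range b,
        Real.exp (lam * (σ.rarr 20 i + σ.rarr 21 j)) / (σ.rarr 20 i + σ.rarr 21 j + c) *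
          σ.rarr 22 j := by
  obtain ⟨K, hK, hK2, hprep⟩ := runsWithin_prepProg ha (m := a + b) (by rw [ha, hb]) (by omega)
  -- The padded size is at most twice `a + b`, hence `2 ^ (K + 1) ≤ a + b`.
  have hlog : K + 2 ≤ Nat.log 2 (a + b) + 1 := by
    have : 2 ^ (K + 1) ≤ a + b := by rw [pow_succ] at hK2; omega
    have := Nat.le_log_of_pow_le one_lt_two this
    omega
  have e1 : 2 * ((K + 2) * 2 ^ (K + 2)) ≤ (K + 2) ^ 2 * 2 ^ (K + 2) := by
    rw [sq, mul_assoc]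
    exact Nat.mul_le_mul_right _ (by omega)
  have e2 : (K + 2) ^ 2 * 2 ^ (K + 2) ≤ (Nat.log 2 (a + b) + 1) ^ 2 * (2 * (a + b)) :=
    Nat.mul_le_mul (Nat.pow_le_pow_left hlog 2) hK2
  have e3 : 4000 * ((Nat.log 2 (a + b) + 1) ^ 2 * (2 * (a + b))) =
    8000 * (a + b) * (Nat.log 2 (a + b) + 1) ^ 2 := by ring
  refine RunsWithin.andThen hprep fun σ₁ ⟨ht₁, h24, hsh⟩ hf₁ => ?_
  refine RunsWithin.andThen (runsWithin_colProg (lam := lam) (c := c) (b := b)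
    ht₁ h24 ((hf₁.n 21).trans hb) (by omega)) fun σ₂ ⟨h39, h40⟩ hf₂ => ?_
  have ht₂ : Tables K σ₂ := ht₁.congr (hf₂.n 22) (hf₂.n 23) (hf₂.n 34) (hf₂.ra 26) (hf₂.na 20)
  refine RunsWithin.andThen (runsWithin_rowProg (a := a) ht₂ ((hf₂.n 24).trans h24)
    (by rw [hf₂.n 20, hf₁.n 20, ha]) (by omega)) fun σ₃ ⟨hl₃, h37, hI⟩ hf₃ => ?_
  have ex : σ₂.rarr 20 = σ.rarr 20 := by rw [hf₂.ra 20, hf₁.ra 20]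
  have hs : ∀ j, 2 < (if j < a then σ₂.rarr 20 j + σ₂.rreg 20 else 3 : ℝ) := by
    intro j
    split_ifs with hj
    · rw [ex, hf₂.r 20]; exact hsh j hj
    · norm_num
  rw [← hf₃.ra 39] at h39
  rw [← hf₃.ra 40] at h40
  refine (runsWithin_evalProg (lam := lam) hl₃ (by rw [hf₃.n 24, hf₂.n 24, h24]) h37
    (by rw [hf₃.n 20, hf₂.n 20, hf₁.n 20, ha]) (by omega) hs hI h39 h40).mono (by omega)
    fun σ₄ h₄ i hi => ?_
  have ey : σ₁.rarr 21 = σ.rarr 21 := hf₁.ra 21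
  have ev : σ₁.rarr 22 = σ.rarr 22 := hf₁.ra 22
  have er : σ₂.rreg 20 = σ₁.rreg 20 := hf₂.r 20
  rw [h₄ i hi, eval_num_div_den _ le_rfl, sum_pad (a := b), Finset.mul_sum, hf₃.ra 20, ex]
  · refine Finset.sum_congr rfl fun j hj => ?_
    have hjb := Finset.mem_range.1 hj
    rw [Nat.sub_self, pow_zero, mul_one, add_zero, if_pos hjb, if_pos hi, if_pos hjb, er, ey, ev,
      mul_add, Real.exp_add]
    rw [show σ.rarr 20 i + σ₁.rreg 20 - (σ₁.rreg 20 - σ.rarr 21 j - c) =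
      σ.rarr 20 i + σ.rarr 21 j + c by ring]
    ring
  · omega
  · intro j hj
    rw [Nat.sub_self, pow_zero, mul_one, add_zero, if_neg (by omega), zero_div]
  · intro j
    rw [if_pos hi]
    split_ifs with hj
    · rw [ex, er, ey]
      intro h
      exact hne i j hi hj (by linarith)
    · have := hs i
      rw [if_pos hi] at this
      linarith

end FastCauchy

/-! ### Asymptotic bounds, displacement rank and cordiality. -/

namespace FastCauchy

open RealRAM

/-- For `n ≥ 2` the binary logarithm is at least `1` and absorbs the summand `1`, at the cost of a
factor `2`. -/
theorem isBigO_log_pow (C d : ℕ) :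
    (fun n : ℕ => ((C * n * (Nat.log 2 n + 1) ^ d : ℕ) : ℝ)) =O[Filter.atTop]
      fun n : ℕ => (n : ℝ) * Real.log n ^ d := by
  refine Asymptotics.IsBigO.of_bound (C * (2 / Real.log 2) ^ d) ?_
  filter_upwards [Filter.eventually_ge_atTop 2] with n hn
  have h2 : 0 < Real.log 2 := Real.log_pos one_lt_two
  have hn2 : Real.log 2 ≤ Real.log n := Real.log_le_log two_pos (by exact_mod_cast hn)
  have hlog : (Nat.log 2 n : ℝ) ≤ Real.log n / Real.log 2 := by
    have := Real.natLog_le_logb n 2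
    simpa [Real.logb] using this
  have h1 : 1 ≤ Real.log n / Real.log 2 := (one_le_div h2).2 hn2
  have hb : (Nat.log 2 n : ℝ) + 1 ≤ 2 / Real.log 2 * Real.log n := by
    have : 2 / Real.log 2 * Real.log n = Real.log n / Real.log 2 + Real.log n / Real.log 2 := by
      ring
    linarith
  rw [Real.norm_of_nonneg (by positivity), Real.norm_of_nonneg (by
    have := h2.le.trans hn2; positivity)]
  push_cast
  calc (C : ℝ) * n * (Nat.log 2 n + 1) ^ d ≤ C * n * (2 / Real.log 2 * Real.log n) ^ d := by
        gcongr
    _ = _ := by rw [mul_pow]; ring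

/-- The difference `sᵢ - tⱼ` is the denominator of the entry, so what remains of it is `exp (λ xᵢ) *
exp (λ yⱼ)`, an outer product. -/
theorem isCauchyLike_sumMatrix (lam c : ℝ) {a b : ℕ} (x : Fin a → ℝ) (y : Fin b → ℝ)
    (h : ∀ i j, x i + y j ≠ -c) :
    IsCauchyLike (fun i => x i + c / 2) (fun j => -(y j + c / 2)) 1
      (sumMatrix (fun z => Real.exp (lam * z) / (z + c)) x y) := by
  refine ⟨fun i j hij => h i j (by linarith), ?_⟩
  have : Matrix.diagonal (fun i => x i + c / 2) *
      sumMatrix (fun z => Real.exp (lam * z) / (z + c)) x y -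
      sumMatrix (fun z => Real.exp (lam * z) / (z + c)) x y *
        Matrix.diagonal (fun j => -(y j + c / 2)) =
      Matrix.vecMulVec (fun i => Real.exp (lam * x i)) fun j => Real.exp (lam * y j) := by
    ext i j
    have hne : x i + y j + c ≠ 0 := fun h0 => h i j (by linarith)
    rw [Matrix.sub_apply, Matrix.diagonal_mul, Matrix.mul_diagonal, Matrix.vecMulVec_apply,
      sumMatrix, Matrix.of_apply, ← Real.exp_add, ← mul_add]
    field_simp
    ring
  rw [this]
  exact Matrix.rank_vecMulVec_le _ _

theorem store_val {α : Type} [Zero α] {n : ℕ} (u : Fin n → α) (i : Fin n) : store u i = u i := by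
  simp [store]

/-- The registers and arrays, from number `50` on, and the inputs survive a multiplication. -/
structure Kept (σ τ : State) : Prop where
  nreg : ∀ k, k < 22 ∨ 50 ≤ k → τ.nreg k = σ.nreg k
  narr : ∀ k, k < 20 ∨ 50 ≤ k → τ.narr k = σ.narr k
  rarr : ∀ k, k < 20 ∨ 50 ≤ k → τ.rarr k = σ.rarr k

set_option maxRecDepth 100000 in
-- `rfl` evaluates the lists of everything the multiplication writes to; surrounding programs may
-- therefore keep their data in numbers from `50` on.
theorem Kept.of_frame {lam c : ℝ} {σ τ : State} (h : Frame (mulProg lam c) σ τ) : Kept σ τ := by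
  have h₁ : (mulProg lam c).wn.all (fun k => decide (22 ≤ k) && decide (k < 50)) = true := by rfl
  have h₂ : (mulProg lam c).wna.all (fun k => decide (20 ≤ k) && decide (k < 50)) = true := by rfl
  have h₃ : (mulProg lam c).wra.all (fun k => decide (20 ≤ k) && decide (k < 50)) = true := by rfl
  rw [List.all_eq_true] at h₁ h₂ h₃
  refine ⟨fun k hk => h.nreg k fun hm => ?_, fun k hk => h.narr k fun hm => ?_,
    fun k hk => h.rarr k fun hm => ?_⟩
  · have := h₁ k hm; simp at this; omega
  · have := h₂ k hm; simp at this; omega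
  · have := h₃ k hm; simp at this; omega

/-- Copy the input of the multiplication, multiply, and copy the result. -/
noncomputable def cordialProg (lam c : ℝ) : Prog :=
  .seq (.seq (.nset 20 (.reg 0)) (.nset 21 (.reg 1))) (.seq (fill 20 20 (.get 0 (.reg 33)))
  (.seq (fill 21 21 (.get 1 (.reg 33))) (.seq (fill 21 22 (.get 2 (.reg 33)))
  (.seq (mulProg lam c) (fill 20 3 (.get 23 (.reg 33)))))))

theorem isCordialOn (lam c : ℝ) :
    IsCordialOn (fun z => Real.exp (lam * z) / (z + c)) {z : ℝ | z ≠ -c} 2 := by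
  refine ⟨cordialProg lam c, fun n => 8200 * n * (Nat.log 2 n + 1) ^ 2, isBigO_log_pow _ _,
    fun a b ha hb x y v hxy => ?_⟩
  have hbound : 200 * (a + b) + 8000 * (a + b) * (Nat.log 2 (a + b) + 1) ^ 2 ≤
      8200 * (a + b) * (Nat.log 2 (a + b) + 1) ^ 2 := by
    have : 200 * (a + b) * 1 ≤ 200 * (a + b) * (Nat.log 2 (a + b) + 1) ^ 2 :=
      Nat.mul_le_mul_left _ (Nat.one_le_pow _ _ (Nat.succ_pos _))
    have e : 8200 * (a + b) * (Nat.log 2 (a + b) + 1) ^ 2 = 200 * (a + b) *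
      (Nat.log 2 (a + b) + 1) ^ 2 + 8000 * (a + b) * (Nat.log 2 (a + b) + 1) ^ 2 := by ring
    omega
  set σ := mulVecInput x y v
  refine RunsWithin.andThen (RunsWithin.straight (Q := fun τ => τ.nreg 20 = a ∧ τ.nreg 21 = b ∧
    τ.rarr = σ.rarr) 4 rfl le_rfl (by simp [Prog.run, NExpr.eval, upd, σ, mulVecInput, store]))
    fun σ₁ ⟨h20, h21, hr⟩ hf₁ => ?_
  refine RunsWithin.andThen (runsWithin_fill 20 20 (.get 0 (.reg 33)) a (store x) h20
    fun j X _ => by simp [RExpr.eval, NExpr.eval, upd, hr, σ, mulVecInput]) fun σ₂ h₂ hf₂ => ?_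
  refine RunsWithin.andThen (runsWithin_fill 21 21 (.get 1 (.reg 33)) b (store y)
    ((hf₂.n 21).trans h21)
    fun j X _ => by simp [RExpr.eval, NExpr.eval, upd, hf₂.ra 1, hr, σ, mulVecInput])
    fun σ₃ h₃ hf₃ => ?_
  refine RunsWithin.andThen (runsWithin_fill 21 22 (.get 2 (.reg 33)) b (store v)
    (by rw [hf₃.n 21, hf₂.n 21, h21])
    fun j X _ => by simp [RExpr.eval, NExpr.eval, upd, hf₃.ra 2, hf₂.ra 2, hr, σ, mulVecInput])
    fun σ₄ h₄ hf₄ => ?_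
  have hx : ∀ i : Fin a, σ₄.rarr 20 i = x i := fun i => by
    rw [hf₄.ra 20, hf₃.ra 20, h₂.1 i i.2, store_val]
  have hy : ∀ j : Fin b, σ₄.rarr 21 j = y j := fun j => by
    rw [hf₄.ra 21, h₃.1 j j.2, store_val]
  refine RunsWithin.andThen (runsWithin_mulProg (lam := lam) (c := c) (a := a) (b := b)
    (by rw [hf₄.n 20, hf₃.n 20, hf₂.n 20, h20]) (by rw [hf₄.n 21, hf₃.n 21, hf₂.n 21, h21])
    ha hb ?_) fun σ₅ h₅ hf₅ => ?_
  · intro i j hi hj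
    rw [hx ⟨i, hi⟩, hy ⟨j, hj⟩]
    exact hxy _ _
  refine (runsWithin_fill 20 3 (.get 23 (.reg 33)) a (σ₅.rarr 23)
    (by rw [(Kept.of_frame hf₅).nreg 20 (by omega), hf₄.n 20, hf₃.n 20, hf₂.n 20, h20])
    fun j X _ => by simp [RExpr.eval, NExpr.eval, upd]).mono (by dsimp only; omega) fun τ hτ i => ?_
  rw [hτ.1 i i.2, h₅ i i.2, Finset.sum_range]
  refine Finset.sum_congr rfl fun j _ => ?_
  rw [hx, hy, h₄.1 j j.2, store_val]
  rfl

end FastCauchy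

/-! ### Distances, branches and counting in a rooted tree. -/

namespace FastCauchy

open Finset

/-- A weighted tree with vertices `0, …, N - 1` in which every vertex `v ≠ 0` has a parent
`par v < v` at distance `W v`; the distances are `D`. -/
structure RootedTree (N : ℕ) (par : ℕ → ℕ) (W : ℕ → ℝ) (D : ℕ → ℕ → ℝ) : Prop where
  par_lt : ∀ v, 0 < v → v < N → par v < v
  symm : ∀ i j, D i j = D j i
  self : ∀ i, D i i = 0
  step : ∀ v j, j < v → v < N → D v j = W v + D (par v) j

/-- `S` is a subtree with root `r`. -/
structure IsSubtree (N : ℕ) (par : ℕ → ℕ) (S : Finset ℕ) (r : ℕ) : Prop where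
  root_mem : r ∈ S
  lt : ∀ v ∈ S, v < N
  par_mem : ∀ v ∈ S, v ≠ r → r < v ∧ par v ∈ S

/-- The set `M` consists of some children of `p` and all their descendants in the subtree `S`. -/
structure IsBranch (par : ℕ → ℕ) (S : Finset ℕ) (r p : ℕ) (M : Finset ℕ) : Prop where
  subset : M ⊆ S
  par_mem : ∀ v ∈ M, p < v ∧ (par v ∈ M ∨ par v = p)
  mem_of_par : ∀ v ∈ S, v ≠ r → par v ∈ M → v ∈ M

section

variable {N : ℕ} {par : ℕ → ℕ} {W : ℕ → ℝ} {D : ℕ → ℕ → ℝ} {S M : Finset ℕ} {r p : ℕ}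

theorem IsSubtree.le (hS : IsSubtree N par S r) {v : ℕ} (hv : v ∈ S) : r ≤ v := by
  by_cases h : v = r
  · exact h.ge
  · exact (hS.par_mem v hv h).1.le

theorem IsBranch.notMem (hM : IsBranch par S r p M) : p ∉ M := fun h =>
  (hM.par_mem p h).1.false

theorem IsBranch.ne_root (hM : IsBranch par S r p M) (hS : IsSubtree N par S r) (hp : p ∈ S)
    {v : ℕ} (hv : v ∈ M) : v ≠ r := by
  have := hS.le hp
  have := (hM.par_mem v hv).1
  omega

/-- A path that enters a branch passes through its base. -/
theorem RootedTree.dist_branch (hT : RootedTree N par W D) (hS : IsSubtree N par S r)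
    (hp : p ∈ S) (hM : IsBranch par S r p M) {i j : ℕ} (hi : i ∈ S) (hiM : i ∉ M) (hj : j ∈ M) :
    D i j = D p i + D p j := by
  -- Parents have smaller numbers, so the path from the larger of the two vertices to the smaller
  -- one starts with the edge to its parent. The parent of `i` stays outside `M`; that of `j` is in
  -- `M` or equals `p`.
  induction hn : i + j using Nat.strong_induction_on generalizing i j with
  | _ n ih =>
    have hjN := hS.lt j (hM.subset hj)
    have hpj := (hM.par_mem j hj).1
    have hrp := hS.le hp
    have hne : i ≠ j := fun h => hiM (h ▸ hj)
    rcases lt_or_gt_of_ne hne with h | h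
    · have h1 := hT.step j i h hjN
      have h2 := hT.step j p hpj hjN
      have hlt := hT.par_lt j (by omega) hjN
      rw [hT.symm i j, h1, hT.symm p j, h2]
      rcases (hM.par_mem j hj).2 with hm | hm
      · rw [hT.symm _ i, ih (i + par j) (by omega) hi hiM hm rfl, hT.symm p (par j)]
        ring
      · rw [hm, hT.self]; ring
    · have hiN := hS.lt i hi
      have hir : i ≠ r := by omega
      have hlt := hT.par_lt i (by omega) hiN
      rw [hT.step i j h hiN, hT.symm p i, hT.step i p (by omega) hiN,
        ih (par i + j) (by omega) (hS.par_mem i hi hir).2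
          (fun hm => hiM (hM.mem_of_par i hi hir hm)) hj rfl, hT.symm p (par i)]
      ring

/-- Distances from `p` along the path from `p` to the root. -/
theorem RootedTree.dist_ancestor (hT : RootedTree N par W D) {v : ℕ} (hv : 0 < v) (hvN : v < N)
    (h : ∀ z < v, D p z = D p v + D v z) :
    D p (par v) = D p v + W v ∧ ∀ z < par v, D p z = D p (par v) + D (par v) z := by
  have hlt := hT.par_lt v hv hvN
  have h1 : D p (par v) = D p v + W v := by
    rw [h _ hlt, hT.step v _ hlt hvN, hT.self, add_zero]
  refine ⟨h1, fun z hz => ?_⟩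
  rw [h z (hz.trans hlt), hT.step v z (hz.trans hlt) hvN, h1]
  ring

/-- Distances from the vertices `y` of a set that contains the parents of its elements. -/
theorem RootedTree.dist_of_notMem (hT : RootedTree N par W D) (hS : IsSubtree N par S r)
    {P : ℕ → Prop} (hP : ∀ y ∈ S, y ≠ r → P y → P (par y)) {v : ℕ} (hv : v ∈ S) (hvr : v ≠ r)
    (hvP : ¬ P v) {y : ℕ} (hy : y ∈ S) (hyP : P y) : D y v = D y (par v) + W v := by
  have hvN := hS.lt v hv
  have hv0 : 0 < v := by have := (hS.par_mem v hv hvr).1; omega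
  have hlt := hT.par_lt v hv0 hvN
  -- If `y > v`, the first edge of the path from `y` leads to the parent of `y`, which still
  -- satisfies `P`; if `y < v`, the last edge is the one above `v`.
  induction hn : y using Nat.strong_induction_on generalizing y with
  | _ n ih =>
    subst hn
    have hne : y ≠ v := fun h => hvP (h ▸ hyP)
    rcases lt_or_gt_of_ne hne with h | h
    · rw [hT.symm y v, hT.step v y h hvN, hT.symm y]; ring
    · have hyN := hS.lt y hy
      have hyr : y ≠ r := by have := hS.le hv; omega
      rw [hT.step y v h hyN, hT.step y (par v) (hlt.trans h) hyN,
        ih (par y) (hT.par_lt y (by omega) hyN) (hS.par_mem y hy hyr).2 (hP y hy hyr hyP) rfl]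
      ring

theorem IsSubtree.sdiff (hS : IsSubtree N par S r) (hp : p ∈ S) (hM : IsBranch par S r p M) :
    IsSubtree N par (S \ M) r where
  root_mem := mem_sdiff.2 ⟨hS.root_mem, fun h => hM.ne_root hS hp h rfl⟩
  lt v hv := hS.lt v (mem_sdiff.1 hv).1
  par_mem v hv hvr := by
    rw [mem_sdiff] at hv
    have := hS.par_mem v hv.1 hvr
    exact ⟨this.1, mem_sdiff.2 ⟨this.2, fun h => hv.2 (hM.mem_of_par v hv.1 hvr h)⟩⟩

theorem IsSubtree.insert (hS : IsSubtree N par S r) (hp : p ∈ S) (hM : IsBranch par S r p M) :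
    IsSubtree N par (insert p M) p where
  root_mem := mem_insert_self _ _
  lt v hv := by
    rcases mem_insert.1 hv with rfl | hv
    · exact hS.lt v hp
    · exact hS.lt v (hM.subset hv)
  par_mem v hv hvr := by
    have hv := (mem_insert.1 hv).resolve_left hvr
    have := hM.par_mem v hv
    exact ⟨this.1, mem_insert.2 this.2.symm⟩

/-- The sum of `g i j` over the elements `j ≠ i` of `S`, for an element `i` of `S`. -/
noncomputable def rest (g : ℕ → ℕ → ℝ) (S : Finset ℕ) (i : ℕ) : ℝ :=
  if i ∈ S then ∑ j ∈ S.erase i, g i j else 0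

/-- The sum of `g i j` over the elements `j` of `B`, for an element `i` of `A`. -/
noncomputable def cross (g : ℕ → ℕ → ℝ) (A B : Finset ℕ) (i : ℕ) : ℝ :=
  if i ∈ A then ∑ j ∈ B, g i j else 0

/-- A pair of distinct vertices lies in `S \ M`, or in `M ∪ {p}`, or has one element in `M` and the
other in `S \ M` apart from `p`. The two parts share only `p`, so no pair is counted twice. -/
theorem rest_split (g : ℕ → ℕ → ℝ) (hMS : M ⊆ S) (hp : p ∈ S) (hpM : p ∉ M) (i : ℕ) :
    rest g S i = cross g ((S \ M).erase p) M i + cross g M ((S \ M).erase p) i +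
      (rest g (S \ M) i + rest g (insert p M) i) := by
  have hpS : p ∈ S \ M := mem_sdiff.2 ⟨hp, hpM⟩
  by_cases hi : i ∈ S
  swap
  · have h1 : i ∉ M := fun h => hi (hMS h)
    have h2 : i ≠ p := fun h => hi (h ▸ hp)
    simp [rest, cross, hi, h1, h2]
  have hsplit : ∀ T ⊆ S, ∑ j ∈ S, g i j = ∑ j ∈ T, g i j + ∑ j ∈ S \ T, g i j := fun T hT => by
    rw [← sum_sdiff hT, add_comm]
  have hM := hsplit M hMS
  have e1 := sum_erase_eq_sub (f := fun j => g i j) hi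
  have e2 := sum_erase_eq_sub (f := fun j => g i j) hpS
  by_cases hiM : i ∈ M
  · have hip : i ≠ p := fun h => hpM (h ▸ hiM)
    have e3 : (insert p M).erase i = insert p (M.erase i) := by
      rw [erase_insert_of_ne (Ne.symm hip)]
    have e4 := sum_erase_eq_sub (f := fun j => g i j) hiM
    have e5 : ∑ j ∈ insert p (M.erase i), g i j = g i p + ∑ j ∈ M.erase i, g i j :=
      sum_insert fun h => hpM (mem_of_mem_erase h)
    simp only [rest, cross, hi, hiM, mem_erase, mem_sdiff, mem_insert, not_true, and_false,
      if_true, if_false, or_true, e1, e2, e3, e5, e4, hM]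
    ring
  · by_cases hip : i = p
    · subst hip
      have e3 : (insert i M).erase i = M := erase_insert hpM
      simp only [rest, cross, hi, hiM, mem_erase, mem_sdiff, mem_insert, e1, e2, e3, hM, ne_eq,
        not_true, not_false_iff, if_true, if_false, true_or, and_true]
      ring
    · have hiT : i ∈ S \ M := mem_sdiff.2 ⟨hi, hiM⟩
      have e3 := sum_erase_eq_sub (f := fun j => g i j) hiT
      simp only [rest, cross, hi, hiM, hip, mem_erase, mem_sdiff, mem_insert, e1, e3, hM, ne_eq,
        not_false_iff, if_true, if_false, or_false, and_true]
      ring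

/-- Adding up the recursion for `s` over `M` gives the cardinality plus the values at all vertices
whose parent is in `M`; these cancel and leave the topmost vertices. -/
theorem card_of_weights {s : ℕ → ℕ} (hs : ∀ v ∈ S, s v = 1 + ∑ x ∈ S.erase r with par x = v, s x)
    (hM : M ⊆ S) (hc : ∀ v ∈ S, v ≠ r → par v ∈ M → v ∈ M) :
    ∑ v ∈ M with v = r ∨ par v ∉ M, s v = M.card := by
  have h1 : ∑ v ∈ M, s v = M.card + ∑ x ∈ S.erase r with par x ∈ M, s x := by
    rw [sum_congr rfl fun v hv => hs v (hM hv), sum_add_distrib, card_eq_sum_ones]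
    congr 1
    rw [← sum_fiberwise_of_maps_to (g := par) (t := M) fun x hx => (mem_filter.1 hx).2]
    refine sum_congr rfl fun v hv => sum_congr ?_ fun _ _ => rfl
    ext x
    simp only [mem_filter, mem_erase]
    constructor
    · rintro ⟨h, rfl⟩; exact ⟨⟨h, hv⟩, rfl⟩
    · rintro ⟨⟨h, _⟩, h'⟩; exact ⟨h, h'⟩
  have h2 : (S.erase r).filter (fun x => par x ∈ M) = M.filter fun v => ¬ (v = r ∨ par v ∉ M) := by
    ext x
    simp only [mem_filter, mem_erase, not_or, not_not]
    constructor
    · rintro ⟨⟨h, h'⟩, h''⟩; exact ⟨hc x h' h h'', h, h''⟩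
    · rintro ⟨h, h', h''⟩; exact ⟨⟨h', hM h⟩, h''⟩
  have h3 := sum_filter_add_sum_filter_not M (fun v => v = r ∨ par v ∉ M) s
  rw [← h2] at h3
  omega

theorem size_root {s : ℕ → ℕ} (hS : IsSubtree N par S r)
    (hs : ∀ v ∈ S, s v = 1 + ∑ x ∈ S.erase r with par x = v, s x) : s r = S.card := by
  rw [← card_of_weights hs Subset.rfl fun v hv _ _ => hv]
  have : S.filter (fun v => v = r ∨ par v ∉ S) = {r} := by
    ext x
    simp only [mem_filter, mem_singleton]
    constructor
    · rintro ⟨h, h' | h'⟩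
      · exact h'
      · by_contra hx
        exact h' (hS.par_mem x h hx).2
    · rintro rfl; exact ⟨hS.root_mem, Or.inl rfl⟩
  rw [this, sum_singleton]

theorem IsBranch.card {s : ℕ → ℕ} (hS : IsSubtree N par S r) (hp : p ∈ S)
    (hs : ∀ v ∈ S, s v = 1 + ∑ x ∈ S.erase r with par x = v, s x) (hM : IsBranch par S r p M) :
    ∑ v ∈ M with par v = p, s v = M.card := by
  rw [← card_of_weights hs hM.subset hM.mem_of_par]
  refine sum_congr ?_ fun _ _ => rfl
  ext x
  simp only [mem_filter, and_congr_right_iff]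
  intro hx
  constructor
  · intro h; exact Or.inr (h ▸ hM.notMem)
  · rintro (h | h)
    · exact absurd h (hM.ne_root hS hp hx)
    · exact (hM.par_mem x hx).2.resolve_left h

end

end FastCauchy

/-! ### Sorted lists of vertices, sizes of branches, the pivot and its ancestors. -/

namespace FastCauchy

open RealRAM Finset

/-- The first `n` cells of `a` contain the elements of `S` in increasing order. -/
structure Lists (a : ℕ → ℕ) (n : ℕ) (S : Finset ℕ) : Prop where
  lt : ∀ j k, j < k → k < n → a j < a k
  mem_iff : ∀ v, v ∈ S ↔ ∃ j < n, a j = v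

namespace Lists

variable {a b : ℕ → ℕ} {n : ℕ} {S : Finset ℕ}

theorem mem (h : Lists a n S) {j : ℕ} (hj : j < n) : a j ∈ S := (h.mem_iff _).2 ⟨j, hj, rfl⟩

theorem inj (h : Lists a n S) {j k : ℕ} (hj : j < n) (hk : k < n) (e : a j = a k) : j = k := by
  rcases lt_trichotomy j k with h' | h' | h'
  · exact absurd e (h.lt j k h' hk).ne
  · exact h'
  · exact absurd e (h.lt k j h' hj).ne'

theorem lt_iff (h : Lists a n S) {j k : ℕ} (hj : j < n) (hk : k < n) : a j < a k ↔ j < k := by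
  refine ⟨fun h' => ?_, fun h' => h.lt j k h' hk⟩
  by_contra hc
  rcases Nat.lt_or_ge k j with h1 | h1
  · exact absurd h' (h.lt k j h1 hj).not_gt
  · rw [show j = k by omega] at h'; exact h'.false

theorem eq_image (h : Lists a n S) : S = (range n).image a := by
  ext v
  simp [h.mem_iff]

theorem card (h : Lists a n S) : S.card = n := by
  rw [h.eq_image, card_image_of_injOn, card_range]
  intro j hj k hk e
  exact h.inj (by simpa using hj) (by simpa using hk) e

theorem congr (h : Lists a n S) (e : ∀ j < n, b j = a j) : Lists b n S where
  lt j k hj hk := by rw [e j (by omega), e k hk]; exact h.lt j k hj hk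
  mem_iff v := by
    rw [h.mem_iff]
    constructor
    · rintro ⟨j, hj, rfl⟩; exact ⟨j, hj, e j hj⟩
    · rintro ⟨j, hj, rfl⟩; exact ⟨j, hj, (e j hj).symm⟩

theorem sum {β : Type} [AddCommMonoid β] (h : Lists a n S) (f : ℕ → β) :
    ∑ v ∈ S, f v = ∑ j ∈ range n, f (a j) := by
  rw [h.eq_image, sum_image]
  intro j hj k hk e
  exact h.inj (by simpa using hj) (by simpa using hk) e

theorem root {N r : ℕ} {par : ℕ → ℕ} (h : Lists a n S) (hS : IsSubtree N par S r) : a 0 = r := by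
  obtain ⟨j, hj, e⟩ := (h.mem_iff r).1 hS.root_mem
  have h0 := hS.le (h.mem (show 0 < n by omega))
  rcases Nat.eq_zero_or_pos j with rfl | hj0
  · exact e
  · have := h.lt 0 j hj0 hj
    omega

theorem ne_root {N r : ℕ} {par : ℕ → ℕ} (h : Lists a n S) (hS : IsSubtree N par S r) {j : ℕ}
    (hj : j < n) (hj0 : 0 < j) : a j ≠ r := by
  have h1 := h.lt 0 j hj0 hj
  rw [h.root hS] at h1
  exact h1.ne'

theorem empty (a : ℕ → ℕ) : Lists a 0 ∅ := ⟨fun _ _ _ h => absurd h (Nat.not_lt_zero _), by simp⟩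

theorem snoc (h : Lists a n S) {v : ℕ} (hv : ∀ u ∈ S, u < v) (e : ∀ j < n, b j = a j)
    (hb : b n = v) : Lists b (n + 1) (insert v S) := by
  have h' := h.congr e
  refine ⟨fun j k hj hk => ?_, fun u => ?_⟩
  · rcases Nat.lt_succ_iff_lt_or_eq.1 hk with h1 | rfl
    · exact h'.lt j k hj h1
    · rw [hb]; exact hv _ (h'.mem hj)
  · rw [mem_insert, h'.mem_iff]
    constructor
    · rintro (rfl | ⟨j, hj, rfl⟩)
      · exact ⟨n, by omega, hb⟩
      · exact ⟨j, by omega, rfl⟩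
    · rintro ⟨j, hj, rfl⟩
      rcases Nat.lt_succ_iff_lt_or_eq.1 hj with h1 | rfl
      · exact Or.inr ⟨j, h1, rfl⟩
      · exact Or.inl hb

end Lists

/-- The array `112` contains the subtree `S`. -/
structure Loaded (N : ℕ) (par : ℕ → ℕ) (S : Finset ℕ) (r m : ℕ) (σ : State) : Prop where
  size : σ.nreg 112 = m
  par_eq : σ.narr 100 = par
  lists : Lists (σ.narr 112) m S
  sub : IsSubtree N par S r
  pos : 0 < m

/-- Initial values of the arrays for the sizes of branches, for the ancestors and for the marks;
then compute the sizes. -/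
def sizesProg : Prog :=
  .seq (.nset 118 (.sub (.reg 112) (.const 1)))
  (.seq (forLoop 116 112 (.seq (.nset 113 (.get 112 (.reg 116)))
    (.seq (.nput 113 (.reg 113) (.const 1))
      (.seq (.nput 114 (.reg 113) (.const 0)) (.nput 115 (.reg 113) (.const 0))))))
  (forLoop 116 118 (.seq (.nset 113 (.get 112 (.sub (.reg 118) (.reg 116))))
    (.nput 113 (.get 100 (.reg 113))
      (.add (.get 113 (.get 100 (.reg 113))) (.get 113 (.reg 113)))))))

/-- Find the last vertex whose branch contains more than half of the vertices. -/
def pivotProg : Prog :=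
  .seq (.nset 114 (.get 112 (.const 0)))
  (forLoop 116 112 (.seq (.nset 113 (.get 112 (.reg 116)))
    (.cond (.nlt (.reg 112) (.add (.get 113 (.reg 113)) (.get 113 (.reg 113))))
      (.nset 114 (.reg 113)) .skip)))

/-- Mark the ancestors of the pivot, and compute their distances. -/
def ancestorProg : Prog :=
  .seq (.seq (.nput 114 (.reg 114) (.const 1)) (.rput 110 (.reg 114) (.const 0)))
  (forLoop 116 118 (.seq (.nset 113 (.get 112 (.sub (.reg 118) (.reg 116))))
    (.cond (.neq (.get 114 (.reg 113)) (.const 1))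
      (.seq (.nput 114 (.get 100 (.reg 113)) (.const 1))
        (.rput 110 (.get 100 (.reg 113)) (.add (.get 110 (.reg 113)) (.get 100 (.reg 113)))))
      .skip)))

section

variable {N : ℕ} {par : ℕ → ℕ} {W : ℕ → ℝ} {D : ℕ → ℕ → ℝ} {S : Finset ℕ} {r p m : ℕ} {σ : State}

/-- `Q` consists of the vertices treated so far, in decreasing order. The value at `x` is passed on
to its parent, which is smaller than `x` and all of `Q`, so no value that has already been passed on
is altered. -/
theorem weights_step {par s : ℕ → ℕ} {Q : Finset ℕ} {x : ℕ} (hx : x ∉ Q) (hpx : par x < x)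
    (hQ : ∀ y ∈ Q, x < y) (h : ∀ v ∈ S, s v = 1 + ∑ y ∈ Q with par y = v, s y) :
    ∀ v ∈ S, upd s (par x) (s (par x) + s x) v =
      1 + ∑ y ∈ insert x Q with par y = v, upd s (par x) (s (par x) + s x) y := by
  intro v hv
  have e : ∑ y ∈ insert x Q with par y = v, upd s (par x) (s (par x) + s x) y =
      ∑ y ∈ insert x Q with par y = v, s y := sum_congr rfl fun y hy => by
    refine upd_ne _ _ ?_
    rcases mem_insert.1 (mem_filter.1 hy).1 with rfl | h'
    · exact hpx.ne'
    · exact (hpx.trans (hQ y h')).ne'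
  rw [e, filter_insert]
  by_cases hxv : par x = v
  · subst hxv
    rw [upd_same, if_pos rfl, sum_insert fun h' => hx (mem_filter.1 h').1, h _ hv]
    ring
  · rw [if_neg hxv, upd_ne _ _ (Ne.symm hxv), h v hv]

theorem runsWithin_sizesProg (hσ : Loaded N par S r m σ) (hpar : ∀ v, 0 < v → v < N → par v < v) :
    RunsWithin sizesProg σ (m * 50 + 20) fun τ => τ.nreg 118 = m - 1 ∧
      (∀ v ∈ S, τ.narr 113 v = 1 + ∑ x ∈ S.erase r with par x = v, τ.narr 113 x) ∧
      (∀ v ∈ S, τ.narr 114 v = 0) ∧ ∀ v ∈ S, τ.narr 115 v = 0 := by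
  have hm := hσ.pos
  refine RunsWithin.andThen (RunsWithin.straight (Q := fun τ => τ.nreg 118 = m - 1) 4 rfl le_rfl
    (by simp [Prog.run, NExpr.eval, upd, hσ.size])) fun σ₁ h₁ hf₁ => ?_
  have hL : Lists (σ₁.narr 112) m S := by rw [hf₁.na 112]; exact hσ.lists
  refine RunsWithin.andThen (RunsWithin.forLoopF (n := m) (C := 12) (fun j τ => ∀ i < j,
    τ.narr 113 (σ₁.narr 112 i) = 1 ∧ τ.narr 114 (σ₁.narr 112 i) = 0 ∧
      τ.narr 115 (σ₁.narr 112 i) = 0) ((hf₁.n 112).trans hσ.size) (by simp)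
    fun j τ hj hJ hf hI => ?_) fun σ₂ ⟨h₂, _⟩ hf₂ => ?_
  · refine RunsWithin.straight 12 rfl le_rfl fun i hi => ?_
    simp only [Prog.run, NExpr.eval, upd, hJ, hf.na 112]
    by_cases h : σ₁.narr 112 i = σ₁.narr 112 j
    · simp [h]
    · have : i < j := lt_of_le_of_ne (by omega) fun e => h (e ▸ rfl)
      simpa [upd, h] using hI i this
  have e100 : σ₂.narr 100 = par := by rw [hf₂.na 100, hf₁.na 100, hσ.par_eq]
  refine (RunsWithin.forLoopF (n := m - 1) (C := 14) (fun j τ =>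
    (∀ v ∈ S, τ.narr 113 v = 1 + ∑ x ∈ (Ico (m - j) m).image (σ₁.narr 112) with par x = v,
      τ.narr 113 x)) ((hf₂.n 118).trans h₁) ?_
    fun j τ hj hJ hf hI => ?_).frame.mono (by omega) fun τ ⟨⟨hτ, _⟩, hf₃⟩ => ⟨?_, ?_, ?_, ?_⟩
  · intro v hv
    obtain ⟨i, hi, rfl⟩ := (hL.mem_iff v).1 hv
    simpa using (h₂ i hi).1
  · have e112 : τ.narr 112 = σ₁.narr 112 := by rw [hf.na 112, hf₂.na 112]
    have e : τ.nreg 118 - j = m - 1 - j := by rw [hf.n 118, hf₂.n 118, h₁]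
    have hx := hL.mem (show m - 1 - j < m by omega)
    have hxr := hL.ne_root hσ.sub (show m - 1 - j < m by omega) (by omega)
    have h0 := (hσ.sub.par_mem _ hx hxr).1
    have hI' := weights_step (x := σ₁.narr 112 (m - 1 - j)) ?_ (hpar _ (by omega)
      (hσ.sub.lt _ hx)) ?_ hI
    · refine RunsWithin.straight 14 rfl le_rfl fun v hv => ?_
      have e' : (Ico (m - (j + 1)) m).image (σ₁.narr 112) =
          insert (σ₁.narr 112 (m - 1 - j)) ((Ico (m - j) m).image (σ₁.narr 112)) := by
        rw [← image_insert]
        congr 1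
        ext i
        simp only [mem_Ico, mem_insert]
        omega
      have := hI' v hv
      rw [e']
      simp only [Prog.run, NExpr.eval, upd_same, hf.na 100, e100,
        hJ, e, e112]
      exact this
    · simp only [mem_image, mem_Ico, not_exists, not_and, and_imp]
      intro i hi hi' h
      have := hL.inj hi' (by omega) h
      omega
    · simp only [mem_image, mem_Ico, forall_exists_index, and_imp]
      rintro _ i hi hi' rfl
      exact hL.lt _ _ (by omega) hi'
  · rw [hf₃.n 118, hf₂.n 118, h₁]
  · have : (Ico (m - (m - 1)) m).image (σ₁.narr 112) = S.erase r := by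
      ext v
      simp only [mem_image, mem_Ico, mem_erase]
      constructor
      · rintro ⟨i, hi, rfl⟩
        exact ⟨hL.ne_root hσ.sub hi.2 (by omega), hL.mem hi.2⟩
      · rintro ⟨hv, hv'⟩
        obtain ⟨i, hi, rfl⟩ := (hL.mem_iff v).1 hv'
        refine ⟨i, ⟨?_, hi⟩, rfl⟩
        by_contra hc
        obtain rfl : i = 0 := by omega
        exact hv (hL.root hσ.sub)
    rw [this] at hτ
    exact hτ
  · intro v hv
    obtain ⟨i, hi, rfl⟩ := (hL.mem_iff v).1 hv
    rw [hf₃.na 114]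
    exact (h₂ i hi).2.1
  · intro v hv
    obtain ⟨i, hi, rfl⟩ := (hL.mem_iff v).1 hv
    rw [hf₃.na 115]
    exact (h₂ i hi).2.2

theorem Loaded.frame {q : Prog} {τ : State} (hσ : Loaded N par S r m σ) (hf : Frame q σ τ)
    (h₁ : q.wn.elem 112 = false := by rfl) (h₂ : q.wna.elem 100 = false := by rfl)
    (h₃ : q.wna.elem 112 = false := by rfl) : Loaded N par S r m τ where
  size := (hf.n 112 h₁).trans hσ.size
  par_eq := (hf.na 100 h₂).trans hσ.par_eq
  lists := by rw [hf.na 112 h₃]; exact hσ.lists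
  sub := hσ.sub
  pos := hσ.pos

/-- The branch of the root is all of `S`, so the search starts with a valid candidate. The vertices
are scanned in increasing order; therefore every later vertex, in particular every child of the
pivot, has a branch of at most half the size. -/
theorem runsWithin_pivotProg (hσ : Loaded N par S r m σ)
    (hr : σ.narr 113 r = m) :
    RunsWithin pivotProg σ (m * 30 + 20) fun τ => τ.nreg 114 ∈ S ∧
      m < σ.narr 113 (τ.nreg 114) + σ.narr 113 (τ.nreg 114) ∧
      ∀ v ∈ S, τ.nreg 114 < v → σ.narr 113 v + σ.narr 113 v ≤ m := by
  have hm := hσ.pos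
  refine RunsWithin.andThen (RunsWithin.straight (Q := fun τ => τ.nreg 114 = r) 3 rfl le_rfl
    (by simp [Prog.run, NExpr.eval, hσ.lists.root hσ.sub])) fun σ₁ h₁ hf₁ => ?_
  have e112 : σ₁.narr 112 = σ.narr 112 := hf₁.na 112
  have e113 : σ₁.narr 113 = σ.narr 113 := hf₁.na 113
  refine (RunsWithin.forLoopF (n := m) (C := 15) (fun j τ => τ.nreg 114 ∈ S ∧
      m < σ.narr 113 (τ.nreg 114) + σ.narr 113 (τ.nreg 114) ∧
      ∀ i < j, τ.nreg 114 < σ.narr 112 i →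
        σ.narr 113 (σ.narr 112 i) + σ.narr 113 (σ.narr 112 i) ≤ m) ((hf₁.n 112).trans hσ.size) ?_
    fun j τ hj hJ hf hI => ?_).mono (by omega) fun τ ⟨⟨h₂, h₃, h₄⟩, _⟩ => ⟨h₂, h₃, ?_⟩
  · simp only [upd, h₁]
    refine ⟨hσ.sub.root_mem, ?_, by simp⟩
    simp only [show (114 : ℕ) ≠ 116 by decide, if_false, hr]
    omega
  · have t112 : τ.narr 112 = σ.narr 112 := (hf.na 112).trans e112
    have t113 : τ.narr 113 = σ.narr 113 := (hf.na 113).trans e113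
    have tm : τ.nreg 112 = m := by rw [hf.n 112, hf₁.n 112, hσ.size]
    refine RunsWithin.straight 15 rfl (by decide) ?_
    by_cases hc : m < σ.narr 113 (σ.narr 112 j) + σ.narr 113 (σ.narr 112 j)
    · simp only [Prog.run, Test.Holds, NExpr.eval, upd, t112, t113, hJ, tm, if_true, hc,
        show (112 : ℕ) ≠ 113 by decide, show (114 : ℕ) ≠ 116 by decide, if_false, true_and]
      refine ⟨hσ.lists.mem hj, fun i hi h => ?_⟩
      have := (hσ.lists.lt_iff hj (by omega)).1 h
      omega
    · simp only [Prog.run, Test.Holds, NExpr.eval, upd, t112, t113, hJ, tm, if_true, hc,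
        show (112 : ℕ) ≠ 113 by decide, show (114 : ℕ) ≠ 116 by decide,
        show (114 : ℕ) ≠ 113 by decide, if_false]
      refine ⟨hI.1, hI.2.1, fun i hi h => ?_⟩
      rcases Nat.lt_succ_iff_lt_or_eq.1 hi with h' | rfl
      · exact hI.2.2 i h' h
      · omega
  · intro v hv hlt
    obtain ⟨i, hi, rfl⟩ := (hσ.lists.mem_iff v).1 hv
    exact h₄ i hi hlt

/-- In decreasing order, each flagged vertex flags its parent and hands on the distance. The
invariant includes that the paths from `p` to smaller vertices pass through every flagged vertex,
which is what `RootedTree.dist_ancestor` needs. -/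
theorem runsWithin_ancestorProg (hσ : Loaded N par S r m σ) (hT : RootedTree N par W D)
    (h118 : σ.nreg 118 = m - 1) (hW : σ.rarr 100 = W) (hp : σ.nreg 114 = p) (hpS : p ∈ S)
    (h0 : ∀ v ∈ S, σ.narr 114 v = 0) :
    RunsWithin ancestorProg σ (m * 40 + 20) fun τ => τ.narr 114 p = 1 ∧
      (∀ v ∈ S, v ≠ r → τ.narr 114 v = 1 → τ.narr 114 (par v) = 1) ∧
      ∀ v ∈ S, τ.narr 114 v = 1 → v ≤ p ∧ τ.rarr 110 v = D p v := by
  have hm := hσ.pos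
  refine RunsWithin.andThen (RunsWithin.straight (Q := fun τ => τ.narr 114 p = 1 ∧
    τ.rarr 110 p = 0 ∧ ∀ v ∈ S, τ.narr 114 v = 1 → v = p) 6 rfl le_rfl ?_)
    fun σ₁ ⟨h₁, h₂, h₃⟩ hf₁ => ?_
  · simp only [Prog.run, NExpr.eval, RExpr.eval, upd, hp, if_true, true_and]
    intro v hv
    split_ifs with h
    · exact fun _ => h
    · simp [h0 v hv]
  have hσ₁ := hσ.frame hf₁
  have hL := hσ₁.lists
  refine (RunsWithin.forLoopF (n := m - 1) (C := 22) (fun j τ => τ.narr 114 p = 1 ∧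
    (∀ i < m, m - j ≤ i → τ.narr 114 (σ₁.narr 112 i) = 1 →
      τ.narr 114 (par (σ₁.narr 112 i)) = 1) ∧
    ∀ v ∈ S, τ.narr 114 v = 1 → (v ≤ p ∧ τ.rarr 110 v = D p v) ∧ ∀ z < v, D p z = D p v + D v z)
    ((hf₁.n 118).trans h118) ⟨h₁, fun i hi hi' => by omega, fun v hv h => ?_⟩
    fun j τ hj hJ hf hI => ?_).mono (by omega) fun τ ⟨⟨t₁, t₂, t₃⟩, _⟩ => ⟨t₁, ?_, ?_⟩
  · obtain rfl := h₃ v hv h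
    exact ⟨⟨le_rfl, by rw [h₂, hT.self]⟩, fun z _ => by rw [hT.self, zero_add]⟩
  · obtain ⟨I₁, I₂, I₃⟩ := hI
    have e112 : τ.narr 112 = σ₁.narr 112 := hf.na 112
    have e100 : τ.narr 100 = par := (hf.na 100).trans hσ₁.par_eq
    have eW : τ.rarr 100 = W := by rw [hf.ra 100, hf₁.ra 100, hW]
    have e : τ.nreg 118 - j = m - 1 - j := by rw [hf.n 118, hf₁.n 118, h118]
    refine RunsWithin.straight 22 rfl (by decide) ?_
    have hx := hL.mem (show m - 1 - j < m by omega)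
    have hxr := hL.ne_root hσ.sub (show m - 1 - j < m by omega) (by omega)
    have hlt : ∀ i < m, m - (j + 1) ≤ i → i = m - 1 - j ∨ m - j ≤ i := fun i _ hi => by omega
    obtain ⟨x, hxe⟩ : ∃ x, σ₁.narr 112 (m - 1 - j) = x := ⟨_, rfl⟩
    rw [hxe] at hx hxr
    have hx0 := (hσ.sub.par_mem _ hx hxr).1
    have hxN := hσ.sub.lt _ hx
    have hpx := hT.par_lt x (by omega) hxN
    by_cases hc : τ.narr 114 x = 1
    · obtain ⟨⟨k₁, k₂⟩, k₃⟩ := I₃ x hx hc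
      obtain ⟨k₄, k₅⟩ := hT.dist_ancestor (by omega) hxN k₃
      simp only [Prog.run, Test.Holds, NExpr.eval, RExpr.eval, upd, hJ, e112, e100, eW, e, if_true,
        hxe, hc, show (100 : ℕ) ≠ 114 by decide, if_false]
      refine ⟨by simp [I₁], fun i hi hi' h => ?_, fun v hv h => ?_⟩
      · split_ifs with h'
        · rfl
        · rcases hlt i hi hi' with rfl | h''
          · exact absurd (by rw [hxe]) h'
          · refine I₂ i hi h'' ?_
            split_ifs at h with h4
            · have := hL.lt (m - 1 - j) i (by omega) hi
              rw [hxe] at this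
              omega
            · exact h
      · split_ifs with h'
        · subst h'
          exact ⟨⟨by omega, by rw [k₂, k₄]⟩, k₅⟩
        · rw [if_neg h'] at h
          exact I₃ v hv h
    · simp only [Prog.run, Test.Holds, NExpr.eval, RExpr.eval, upd, hJ, e112, e100, eW, e, if_true,
        hxe, hc, if_false]
      refine ⟨I₁, fun i hi hi' h => ?_, I₃⟩
      rcases hlt i hi hi' with rfl | h''
      · rw [hxe] at h; exact absurd h hc
      · exact I₂ i hi h'' h
  · intro v hv hvr h
    obtain ⟨i, hi, rfl⟩ := (hL.mem_iff v).1 hv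
    refine t₂ i hi ?_ h
    by_contra hc
    obtain rfl : i = 0 := by omega
    exact hvr (hL.root hσ.sub)
  · exact fun v hv h => (t₃ v hv h).1

end

end FastCauchy

/-! ### The invariant of the marking of a branch. -/

namespace FastCauchy

open RealRAM Finset

/-- The invariant of the construction of a branch: `d` are distances from `p`, `mk` the marks, `A`
the number of marked vertices, after the first `j` vertices `a 1, …, a j`. -/
structure MarkInv (par : ℕ → ℕ) (D : ℕ → ℕ → ℝ) (S : Finset ℕ) (p m : ℕ) (a s an : ℕ → ℕ)
    (j : ℕ) (d : ℕ → ℝ) (mk : ℕ → ℕ) (A : ℕ) : Prop where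
  dist : ∀ v ∈ S, (an v = 1 ∨ ∃ i ≤ j, a i = v) → d v = D p v
  mark : ∀ v ∈ S, mk v = 1 → an v ≠ 1 ∧ (∃ i ≤ j, a i = v) ∧ p < v ∧ (mk (par v) = 1 ∨ par v = p)
  mark_par : ∀ i, 0 < i → i ≤ j → mk (par (a i)) = 1 → mk (a i) = 1
  sum : A = ∑ x ∈ S with mk x = 1 ∧ par x = p, s x
  full : 4 * A < m → ∀ i, 0 < i → i ≤ j → par (a i) = p → mk (a i) = 1
  le : 4 * A ≤ m - 1 + 4 * (m / 2)

section

variable {N : ℕ} {par : ℕ → ℕ} {W : ℕ → ℝ} {D : ℕ → ℕ → ℝ} {S : Finset ℕ} {r p m : ℕ} {σ : State}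
  {a s an : ℕ → ℕ} {j : ℕ} {d : ℕ → ℝ} {mk : ℕ → ℕ} {A : ℕ}

/-- The vertices from `p` to the root are flagged in `an`. -/
structure Ancestors (par : ℕ → ℕ) (S : Finset ℕ) (r p : ℕ) (an : ℕ → ℕ) : Prop where
  self : an p = 1
  par : ∀ v ∈ S, v ≠ r → an v = 1 → an (par v) = 1
  le : ∀ v ∈ S, an v = 1 → v ≤ p

/-- Following parents from `p` reaches the root, and flags are handed on at each step. -/
theorem Ancestors.root (h : Ancestors par S r p an) (hS : IsSubtree N par S r) (hp : p ∈ S)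
    (hpar : ∀ v, 0 < v → v < N → par v < v) : an r = 1 := by
  have : ∀ v ∈ S, an v = 1 → an r = 1 := fun v => by
    induction v using Nat.strong_induction_on with
    | _ v ih =>
      intro hv h1
      by_cases hvr : v = r
      · rwa [← hvr]
      · have h2 := hS.par_mem v hv hvr
        exact ih (par v) (hpar v (by omega) (hS.lt v hv)) h2.2 (h.par v hv hvr h1)
  exact this p hp h.self

/-- An ancestor of `p` already has its distance. It is never marked: its parent is an ancestor too,
hence neither marked nor equal to `p`. -/
theorem MarkInv.skip (h : MarkInv par D S p m a s an j d mk A) (hL : Lists a m S)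
    (hS : IsSubtree N par S r) (hA : Ancestors par S r p an) (hj : j + 1 < m)
    (hpar : ∀ v, 0 < v → v < N → par v < v) (han : an (a (j + 1)) = 1) :
    MarkInv par D S p m a s an (j + 1) d mk A := by
  have hx := hL.mem hj
  have hxr := hL.ne_root hS hj (Nat.succ_pos _)
  have hx0 := hS.par_mem _ hx hxr
  have hpx := hpar _ (by omega) (hS.lt _ hx)
  have hanp := hA.par _ hx hxr han
  refine ⟨fun v hv hv' => h.dist v hv ?_, fun v hv h1 => ?_, fun i hi hij h1 => ?_, h.sum,
    fun hm i hi hij h1 => ?_, h.le⟩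
  · rcases hv' with hv' | ⟨i, hi, rfl⟩
    · exact Or.inl hv'
    · rcases (show i ≤ j ∨ i = j + 1 by omega) with hi | rfl
      · exact Or.inr ⟨i, hi, rfl⟩
      · exact Or.inl han
  · obtain ⟨h1, ⟨i, hi, e⟩, h2⟩ := h.mark v hv h1
    exact ⟨h1, ⟨i, hi.trans (Nat.le_succ _), e⟩, h2⟩
  · rcases (show i ≤ j ∨ i = j + 1 by omega) with hij | rfl
    · exact h.mark_par i hi hij h1
    · exact absurd hanp (h.mark _ hx0.2 h1).1
  · rcases (show i ≤ j ∨ i = j + 1 by omega) with hij | rfl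
    · exact h.full hm i hi hij h1
    · have := hA.le _ hx han
      omega

/-- The invariant is preserved if the next vertex obtains its distance and the mark `b`. -/
theorem MarkInv.next (h : MarkInv par D S p m a s an j d mk A) (hT : RootedTree N par W D)
    (hL : Lists a m S) (hS : IsSubtree N par S r) (hA : Ancestors par S r p an) (hp : p ∈ S)
    (hj : j + 1 < m) {x b A' : ℕ} (hxe : a (j + 1) = x) (han : an x ≠ 1)
    (hb : b = 1 → p < x ∧ (mk (par x) = 1 ∨ par x = p)) (hb' : mk (par x) = 1 → b = 1)
    (hA' : A' = A + if b = 1 ∧ par x = p then s x else 0)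
    (hfull : 4 * A' < m → par x = p → b = 1) (hle : 4 * A' ≤ m - 1 + 4 * (m / 2)) :
    MarkInv par D S p m a s an (j + 1) (upd d x (d (par x) + W x)) (upd mk x b) A' := by
  have hx := hL.mem hj
  have hxr := hL.ne_root hS hj (Nat.succ_pos _)
  have hne : ∀ i ≤ j, a i ≠ x := fun i hi e => by
    have := hL.inj (by omega) hj (e.trans hxe.symm)
    omega
  rw [hxe] at hx hxr
  have hx0 := hS.par_mem _ hx hxr
  have hpx := hT.par_lt x (by omega) (hS.lt _ hx)
  have hmk : mk x ≠ 1 := fun h1 => by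
    obtain ⟨-, ⟨i, hi, e⟩, -⟩ := h.mark x hx h1
    exact hne i hi e
  have hparx : upd mk x b (par x) = mk (par x) := upd_ne _ _ hpx.ne
  refine ⟨fun v hv hv' => ?_, fun v hv h1 => ?_, fun i hi hij h1 => ?_, ?_,
    fun hm i hi hij h1 => ?_, hle⟩
  · by_cases hvx : v = x
    · subst hvx
      -- The parent has a smaller number, so it stands earlier in the list and its distance is
      -- known.
      have : d (par v) = D p (par v) := by
        refine h.dist _ hx0.2 ?_
        obtain ⟨i, hi, e⟩ := (hL.mem_iff _).1 hx0.2
        refine Or.inr ⟨i, ?_, e⟩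
        have := (hL.lt_iff hi hj).1 (by rw [e, hxe]; exact hpx)
        omega
      rw [upd_same, this, hT.dist_of_notMem hS (P := fun y => an y = 1) hA.par hx hxr han hp
        hA.self]
    · rw [upd_ne _ _ hvx]
      refine h.dist v hv (hv'.imp_right ?_)
      rintro ⟨i, hi, rfl⟩
      rcases (show i ≤ j ∨ i = j + 1 by omega) with hi | rfl
      · exact ⟨i, hi, rfl⟩
      · exact absurd hxe hvx
  · by_cases hvx : v = x
    · subst hvx
      rw [upd_same] at h1
      rw [hparx]
      exact ⟨han, ⟨j + 1, le_rfl, hxe⟩, hb h1⟩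
    · rw [upd_ne _ _ hvx] at h1
      obtain ⟨h1, ⟨i, hi, e⟩, h2, h3⟩ := h.mark v hv h1
      refine ⟨h1, ⟨i, hi.trans (Nat.le_succ _), e⟩, h2, h3.imp_left fun h4 => ?_⟩
      rwa [upd_ne _ _ fun e' => hmk (by rwa [← e'])]
  · rcases (show i ≤ j ∨ i = j + 1 by omega) with hij | rfl
    · have hi1 := hL.mem (show i < m by omega)
      have hir := hL.ne_root hS (show i < m by omega) hi
      have hi0 := hS.par_mem _ hi1 hir
      have hpi := hT.par_lt _ (by omega) (hS.lt _ hi1)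
      have hix : a i < x := hxe ▸ hL.lt i (j + 1) (by omega) hj
      rw [upd_ne _ _ (by omega)] at h1 ⊢
      exact h.mark_par i hi hij h1
    · rw [hxe, upd_same]
      rw [hxe, hparx] at h1
      exact hb' h1
  · rw [hA', h.sum]
    have hnot : x ∉ S.filter fun y => mk y = 1 ∧ par y = p := fun h' => hmk (mem_filter.1 h').2.1
    split_ifs with hc
    · have : (S.filter fun y => upd mk x b y = 1 ∧ par y = p) =
          insert x (S.filter fun y => mk y = 1 ∧ par y = p) := by
        ext y
        by_cases hyx : y = x
        · subst hyx; simp [hc, hx]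
        · simp [upd_ne _ _ hyx, hyx]
      rw [this, sum_insert hnot, add_comm]
    · rw [add_zero]
      refine sum_congr ?_ fun _ _ => rfl
      ext y
      by_cases hyx : y = x
      · subst hyx
        simp only [mem_filter, upd_same, hc, and_false, hmk, false_and]
      · simp [upd_ne _ _ hyx]
  · rcases (show i ≤ j ∨ i = j + 1 by omega) with hij | rfl
    · rw [upd_ne _ _ (hne i hij)]
      exact h.full (by split_ifs at hA' <;> omega) i hi hij h1
    · rw [hxe, upd_same]
      exact hfull hm (hxe ▸ h1)

theorem MarkInv.branch (h : MarkInv par D S p m a s an (m - 1) d mk A) (hL : Lists a m S)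
    (hS : IsSubtree N par S r) (hr : an r = 1) : IsBranch par S r p (S.filter fun v => mk v = 1) where
  subset := filter_subset _ _
  par_mem v hv := by
    rw [mem_filter] at hv
    obtain ⟨h0, -, h1, h2⟩ := h.mark v hv.1 hv.2
    have hvr : v ≠ r := fun e => h0 (e ▸ hr)
    exact ⟨h1, h2.imp_left fun h3 => mem_filter.2 ⟨(hS.par_mem v hv.1 hvr).2, h3⟩⟩
  mem_of_par v hv hvr h1 := by
    obtain ⟨i, hi, rfl⟩ := (hL.mem_iff v).1 hv
    refine mem_filter.2 ⟨hv, h.mark_par i ?_ (by omega) (mem_filter.1 h1).2⟩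
    by_contra hc
    obtain rfl : i = 0 := by omega
    exact hvr (hL.root hS)

end

end FastCauchy

/-! ### Balance of the marked branch, and the programs that mark and collect vertices. -/

namespace FastCauchy

open RealRAM Finset

section

variable {N : ℕ} {par : ℕ → ℕ} {W : ℕ → ℝ} {D : ℕ → ℕ → ℝ} {S : Finset ℕ} {r p m : ℕ} {σ : State}
  {a s an : ℕ → ℕ} {j : ℕ} {d : ℕ → ℝ} {mk : ℕ → ℕ} {A : ℕ}

/-- `A` is between roughly a quarter and three quarters of `m`. From `m = 12` on, the slack between
`3 / 4` and `4 / 5` absorbs the rounding; smaller values are checked one by one. -/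
theorem balanced_of_le {A m : ℕ} (h₁ : m ≤ 4 * A) (h₂ : 4 * A ≤ m - 1 + 4 * (m / 2))
    (h₃ : 3 ≤ m) : 1 ≤ A ∧ A + 2 ≤ m ∧ 5 * A ≤ 4 * (m - 1) ∧ 5 * (m - 1 - A) ≤ 4 * (m - 1) := by
  by_cases h : m < 12
  · interval_cases m <;> omega
  · omega

/-- If the marked branches had less than a quarter of the vertices, all child branches of `p` would
have been taken, so that `s p ≤ A + 1`. As `2 * s p > m`, this is impossible for `m ≥ 3`. The upper
bound is part of the invariant. -/
theorem MarkInv.balanced (h : MarkInv par D S p m a s an (m - 1) d mk A) (hL : Lists a m S)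
    (hS : IsSubtree N par S r) (hr : an r = 1) (hp : p ∈ S) (hm : 3 ≤ m)
    (hs : ∀ v ∈ S, s v = 1 + ∑ x ∈ S.erase r with par x = v, s x) (hps : m < s p + s p) :
    1 ≤ (S.filter fun v => mk v = 1).card ∧ (S.filter fun v => mk v = 1).card + 2 ≤ m ∧
      5 * (S.filter fun v => mk v = 1).card ≤ 4 * (m - 1) ∧
      5 * (m - 1 - (S.filter fun v => mk v = 1).card) ≤ 4 * (m - 1) := by
  have hcard : (S.filter fun v => mk v = 1).card = A := by
    rw [← (h.branch hL hS hr).card hS hp hs, h.sum, filter_filter]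
  have hlow : m ≤ 4 * A := by
    by_contra hc
    have h1 : ∑ x ∈ S.erase r with par x = p, s x ≤ A := by
      rw [h.sum]
      refine sum_le_sum_of_subset fun x hx => ?_
      rw [mem_filter, mem_erase] at hx
      obtain ⟨i, hi, rfl⟩ := (hL.mem_iff x).1 hx.1.2
      refine mem_filter.2 ⟨hx.1.2, h.full (by omega) i ?_ (by omega) hx.2, hx.2⟩
      by_contra h0
      obtain rfl : i = 0 := by omega
      exact hx.1.1 (hL.root hS)
    have := hs p hp
    omega
  rw [hcard]
  exact balanced_of_le hlow h.le hm

/-- Compute the distances from the pivot, and mark a branch of suitable size. -/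
def markProg : Prog :=
  .seq (.nset 115 (.const 0))
  (forLoop 116 118 (.seq (.nset 113 (.get 112 (.add (.reg 116) (.const 1))))
    (.cond (.neq (.get 114 (.reg 113)) (.const 1)) .skip
      (.seq (.rput 110 (.reg 113) (.add (.get 110 (.get 100 (.reg 113))) (.get 100 (.reg 113))))
      (.cond (.neq (.get 100 (.reg 113)) (.reg 114))
        (.cond (.nlt (.add (.add (.reg 115) (.reg 115)) (.add (.reg 115) (.reg 115))) (.reg 112))
          (.seq (.nput 115 (.reg 113) (.const 1))
            (.nset 115 (.add (.reg 115) (.get 113 (.reg 113)))))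
          (.nput 115 (.reg 113) (.const 0)))
        (.nput 115 (.reg 113) (.get 115 (.get 100 (.reg 113)))))))))

/-- Child branches of `p` are taken while `4 * A < m`, and each has size at most `m / 2`; this gives
the upper bound in `MarkInv.le`. Every other vertex that is no ancestor of `p` inherits the mark of
its parent. -/
theorem runsWithin_markProg (hσ : Loaded N par S r m σ) (hT : RootedTree N par W D)
    (h118 : σ.nreg 118 = m - 1) (hW : σ.rarr 100 = W) (hp : σ.nreg 114 = p) (hpS : p ∈ S)
    (hA : Ancestors par S r p (σ.narr 114)) (hd : ∀ v ∈ S, σ.narr 114 v = 1 → σ.rarr 110 v = D p v)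
    (h0 : ∀ v ∈ S, σ.narr 115 v = 0)
    (hsm : ∀ v ∈ S, p < v → σ.narr 113 v + σ.narr 113 v ≤ m) :
    RunsWithin markProg σ (m * 70 + 20) fun τ => ∃ A,
      MarkInv par D S p m (σ.narr 112) (σ.narr 113) (σ.narr 114) (m - 1) (τ.rarr 110)
        (τ.narr 115) A := by
  have hm := hσ.pos
  have hL := hσ.lists
  have hr := hA.root hσ.sub hpS hT.par_lt
  refine RunsWithin.andThen (RunsWithin.straight (Q := fun τ => τ.nreg 115 = 0) 2 rfl le_rfl
    (by simp [Prog.run, NExpr.eval])) fun σ₁ h₁ hf₁ => ?_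
  refine (RunsWithin.forLoopF (n := m - 1) (C := 50) (fun j τ => MarkInv par D S p m (σ.narr 112)
    (σ.narr 113) (σ.narr 114) j (τ.rarr 110) (τ.narr 115) (τ.nreg 115))
    ((hf₁.n 118).trans h118) ?_ fun j τ hj hJ hf hI => ?_).mono (by omega)
    fun τ ⟨hτ, _⟩ => ⟨_, hτ⟩
  · have e1 : upd σ₁.nreg 116 0 115 = 0 := by simp [upd, h₁]
    change MarkInv par D S p m _ _ _ 0 (σ₁.rarr 110) (σ₁.narr 115) (upd σ₁.nreg 116 0 115)
    rw [e1, hf₁.ra 110, hf₁.na 115]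
    refine ⟨fun v hv h => hd v hv ?_, fun v hv h => ?_, fun i hi hi' => by omega, ?_,
      fun _ i hi hi' => by omega, by omega⟩
    · rcases h with h | ⟨i, hi, rfl⟩
      · exact h
      · rw [Nat.le_zero.1 hi, hL.root hσ.sub, hr]
    · rw [h0 v hv] at h; omega
    · rw [eq_comm]
      refine sum_eq_zero fun x hx => ?_
      rw [mem_filter] at hx
      rw [h0 x hx.1] at hx
      omega
  · obtain ⟨x, hxe⟩ : ∃ x, σ.narr 112 (j + 1) = x := ⟨_, rfl⟩
    have hj' : j + 1 < m := by omega
    have hx : x ∈ S := hxe ▸ hL.mem hj'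
    have hxr : x ≠ r := hxe ▸ hL.ne_root hσ.sub hj' (by omega)
    have hx0 := hσ.sub.par_mem _ hx hxr
    have hpx := hT.par_lt x (by omega) (hσ.sub.lt _ hx)
    have e112 : τ.narr 112 = σ.narr 112 := by rw [hf.na 112, hf₁.na 112]
    have e113 : τ.narr 113 = σ.narr 113 := by rw [hf.na 113, hf₁.na 113]
    have e114 : τ.narr 114 = σ.narr 114 := by rw [hf.na 114, hf₁.na 114]
    have e100 : τ.narr 100 = par := by rw [hf.na 100, hf₁.na 100, hσ.par_eq]
    have eW : τ.rarr 100 = W := by rw [hf.ra 100, hf₁.ra 100, hW]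
    have em : τ.nreg 112 = m := by rw [hf.n 112, hf₁.n 112, hσ.size]
    have ep : τ.nreg 114 = p := by rw [hf.n 114, hf₁.n 114, hp]
    refine RunsWithin.straight 50 rfl (by decide) ?_
    by_cases c1 : σ.narr 114 x = 1
    · have := hI.skip hL hσ.sub hA hj' hT.par_lt (hxe ▸ c1)
      simpa only [Prog.run, Test.Holds, NExpr.eval, RExpr.eval, upd, hJ, e112, e114, if_true, hxe,
        c1, show (115 : ℕ) ≠ 113 by decide, show (115 : ℕ) ≠ 116 by decide, if_false] using this
    · have key := fun {b A'} => hI.next (b := b) (A' := A') hT hL hσ.sub hA hpS hj' hxe c1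
      have hle := hI.le
      have hpM : τ.narr 115 p ≠ 1 := fun h => (hI.mark p hpS h).1 hA.self
      by_cases c2 : par x = p
      · have hpx' : p < x := c2 ▸ hpx
        by_cases c3 : τ.nreg 115 + τ.nreg 115 + (τ.nreg 115 + τ.nreg 115) < m
        · have hsx := hsm x hx hpx'
          have := key (b := 1) (A' := τ.nreg 115 + σ.narr 113 x) (fun _ => ⟨hpx', Or.inr c2⟩)
            (fun _ => rfl) (by simp [c2]) (fun _ _ => rfl) (by omega)
          simpa [Prog.run, Test.Holds, NExpr.eval, RExpr.eval, upd, hJ, e112, e114, e113, hxe,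
            c1, e100, eW, em, ep, c2, c3] using this
        · have := key (b := 0) (A' := τ.nreg 115) (fun h => by omega)
            (fun h => absurd (c2 ▸ h) hpM) (by simp) (fun h => by omega) (by omega)
          simpa [Prog.run, Test.Holds, NExpr.eval, RExpr.eval, upd, hJ, e112, e114, e113, hxe,
            c1, e100, eW, em, ep, c2, c3] using this
      · have := key (b := τ.narr 115 (par x)) (A' := τ.nreg 115) (fun h => ⟨?_, Or.inl h⟩)
          (fun h => h) (by simp [c2]) (fun _ h => absurd h c2) hle
        · simpa [Prog.run, Test.Holds, NExpr.eval, RExpr.eval, upd, hJ, e112, e114, e113, hxe,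
            c1, e100, eW, em, ep, c2] using this
        · exact ((hI.mark _ hx0.2 h).2.2.1).trans hpx

/-- Append those vertices of the loaded subtree for which `b` holds to the array `d`. -/
def collectProg (b : Test) (d : ℕ) : Prog :=
  forLoop 116 112 (.seq (.nset 113 (.get 112 (.reg 116)))
    (.cond b (.seq (.nput d (.reg 117) (.reg 113)) (.nset 117 (.add (.reg 117) (.const 1)))) .skip))

theorem runsWithin_collectProg (b : Test) (d : ℕ) (P : ℕ → Prop) [DecidablePred P]
    (hσ : Loaded N par S r m σ)
    (hb : ∀ τ, Frame (collectProg b d) σ τ → τ.nreg 113 ∈ S → (b.Holds τ ↔ P (τ.nreg 113)))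
    (hl : b.cost ≤ 12 := by decide) (hd : d ≠ 112 := by decide) :
    RunsWithin (collectProg b d) σ (m * 40 + 6) fun τ =>
      τ.nreg 117 = σ.nreg 117 + (S.filter P).card ∧
      Lists (fun i => τ.narr d (σ.nreg 117 + i)) (S.filter P).card (S.filter P) ∧
      ∀ i < σ.nreg 117, τ.narr d i = σ.narr d i := by
  have hL := hσ.lists
  have hS : S = (range m).image (σ.narr 112) := hL.eq_image
  have hwna : ∀ k, k ≠ d → k ∉ (collectProg b d).wna := fun k hk => by
    simp [collectProg, forLoop, Prog.wna, hk]
  refine (RunsWithin.forLoopF (n := m) (C := 24) (fun j τ =>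
    τ.nreg 117 = σ.nreg 117 + (((range j).image (σ.narr 112)).filter P).card ∧
      Lists (fun i => τ.narr d (σ.nreg 117 + i)) (((range j).image (σ.narr 112)).filter P).card
        (((range j).image (σ.narr 112)).filter P) ∧
      ∀ i < σ.nreg 117, τ.narr d i = σ.narr d i) hσ.size ⟨by simp [upd], ?_, fun _ _ => rfl⟩
    fun j τ hj hJ hf hI => ?_).mono (by omega) fun τ ⟨hτ, _⟩ => ?_
  · simpa using Lists.empty _
  · obtain ⟨h₁, h₂, h₃⟩ := hI
    have e112 : τ.narr 112 = σ.narr 112 := hf.narr 112 (hwna 112 (Ne.symm hd))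
    obtain ⟨x, hxe⟩ : ∃ x, σ.narr 112 j = x := ⟨_, rfl⟩
    have hx : x ∈ S := hxe ▸ hL.mem hj
    have hins : ((range (j + 1)).image (σ.narr 112)).filter P =
        if P x then insert x (((range j).image (σ.narr 112)).filter P)
        else ((range j).image (σ.narr 112)).filter P := by
      rw [range_add_one, image_insert, filter_insert, hxe]
    have hlt : ∀ u ∈ ((range j).image (σ.narr 112)).filter P, u < x := by
      intro u hu
      obtain ⟨i, hi, rfl⟩ := mem_image.1 (mem_filter.1 hu).1
      exact hxe ▸ hL.lt i j (mem_range.1 hi) hj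
    refine RunsWithin.andThen (RunsWithin.straight (Q := fun ρ =>
      ρ = { τ with nreg := upd τ.nreg 113 x }) 3 rfl le_rfl
      (by simp [Prog.run, NExpr.eval, hJ, e112, hxe])) fun ρ hρ hfρ => ?_
    have hbρ := hb ρ (hf.trans ⟨fun k hk => hfρ.nreg k fun h => hk ?_, fun k _ => hfρ.r k rfl,
      fun k _ => hfρ.na k rfl, fun k _ => hfρ.ra k rfl⟩) (by simpa [hρ] using hx)
    swap
    · simp only [Prog.wn, List.mem_singleton] at h
      simp [forLoop, Prog.wn, h]
    have e113 : ρ.nreg 113 = x := by rw [hρ]; exact upd_same τ.nreg 113 x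
    have e117 : ρ.nreg 117 = τ.nreg 117 := hfρ.n 117
    have e116 : ρ.nreg 116 = j := (hfρ.n 116).trans hJ
    have ed : ρ.narr d = τ.narr d := hfρ.na d
    rw [e113] at hbρ
    have hcard : P x → (insert x (((range j).image (σ.narr 112)).filter P)).card =
        (((range j).image (σ.narr 112)).filter P).card + 1 := fun _ =>
      card_insert_of_notMem fun h => (hlt x h).false
    refine (RunsWithin.cond (T := 7) (fun hh => ?_) fun hh => ?_).le (by omega)
    · rw [hbρ] at hh
      refine RunsWithin.straight 7 rfl le_rfl ?_
      rw [hins, if_pos hh, hcard hh]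
      simp only [Prog.run, NExpr.eval, upd, e113, e117, ed, if_true,
        show (117 : ℕ) ≠ 116 by decide, if_false]
      refine ⟨by omega, h₂.snoc hlt (fun i hi => if_neg (by omega)) (if_pos (by omega)),
        fun i hi => ?_⟩
      rw [if_neg (by omega)]
      exact h₃ i hi
    · rw [hbρ] at hh
      refine RunsWithin.straight 7 rfl (by decide) ?_
      rw [hins, if_neg hh]
      refine ⟨?_, ?_, ?_⟩
      · simpa [Prog.run, upd, e117] using h₁
      · simpa [Prog.run, ed] using h₂
      · simpa [Prog.run, ed] using h₃
  · rw [hS]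
    exact hτ

end

end FastCauchy

/-! ### Splitting a subtree at the pivot. -/

namespace FastCauchy

open RealRAM Finset

theorem Lists.cons {a : ℕ → ℕ} {n v : ℕ} {S : Finset ℕ} (h : Lists (fun i => a (1 + i)) n S)
    (h0 : a 0 = v) (hv : ∀ u ∈ S, v < u) : Lists a (n + 1) (insert v S) where
  lt j k hj hk := by
    obtain ⟨k, rfl⟩ : ∃ k', k = 1 + k' := ⟨k - 1, by omega⟩
    rcases Nat.eq_zero_or_pos j with rfl | hj0
    · rw [h0]; exact hv _ (h.mem (show k < n by omega))
    · obtain ⟨j, rfl⟩ : ∃ j', j = 1 + j' := ⟨j - 1, by omega⟩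
      exact h.lt j k (by omega) (by omega)
  mem_iff u := by
    rw [mem_insert, h.mem_iff]
    constructor
    · rintro (rfl | ⟨j, hj, rfl⟩)
      · exact ⟨0, by omega, h0⟩
      · exact ⟨1 + j, by omega, rfl⟩
    · rintro ⟨j, hj, rfl⟩
      rcases Nat.eq_zero_or_pos j with rfl | hj0
      · exact Or.inl h0
      · exact Or.inr ⟨j - 1, by omega, by rw [show 1 + (j - 1) = j by omega]⟩

/-- Two lists `A`, `B` of vertices of `S`, and numbers whose sums are the distances between
them. -/
structure CutData (D : ℕ → ℕ → ℝ) (S A B : Finset ℕ) (m : ℕ) (τ : State) : Prop where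
  listsA : Lists (τ.narr 116) (τ.nreg 120) A
  listsB : Lists (τ.narr 117) (τ.nreg 121) B
  subA : A ⊆ S
  subB : B ⊆ S
  posA : 0 < τ.nreg 120
  posB : 0 < τ.nreg 121
  le : τ.nreg 120 + τ.nreg 121 ≤ m
  dist : ∀ i ∈ A, ∀ j ∈ B, D i j = τ.rarr 110 i + τ.rarr 110 j

/-- Two sets of vertices have been pushed to a stack with `t` entries that ends at `o`. -/
structure Pushed (t o : ℕ) (T₁ T₂ : Finset ℕ) (σ τ : State) : Prop where
  top : τ.nreg 110 = t + 2
  start₁ : τ.narr 111 (t + 1) = o + T₁.card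
  start₂ : τ.narr 111 (t + 2) = o + T₁.card + T₂.card
  start : ∀ i ≤ t, τ.narr 111 i = σ.narr 111 i
  stack : ∀ i < o, τ.narr 110 i = σ.narr 110 i
  lists₁ : Lists (fun i => τ.narr 110 (o + i)) T₁.card T₁
  lists₂ : Lists (fun i => τ.narr 110 (o + T₁.card + i)) T₂.card T₂

/-- The test whether a vertex is marked. -/
def isMarked : Test := .neq (.get 115 (.reg 113)) (.const 1)

/-- Push the two parts of the subtree to the stack. -/
def pushProg : Prog :=
  .seq (.nset 117 (.reg 111)) (.seq (collectProg (.not isMarked) 110)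
  (.seq (.seq (.nput 111 (.add (.reg 110) (.const 1)) (.reg 117))
    (.seq (.nput 110 (.reg 117) (.reg 114)) (.nset 117 (.add (.reg 117) (.const 1)))))
  (.seq (collectProg isMarked 110)
    (.seq (.nput 111 (.add (.reg 110) (.const 2)) (.reg 117))
      (.nset 110 (.add (.reg 110) (.const 2)))))))

/-- List the vertices on the two sides of the pivot. -/
def sidesProg : Prog :=
  .seq (.nset 117 (.const 0))
  (.seq (collectProg (.and (.not isMarked) (.not (.neq (.reg 113) (.reg 114)))) 116)
  (.seq (.seq (.nset 120 (.reg 117)) (.nset 117 (.const 0)))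
  (.seq (collectProg isMarked 117) (.nset 121 (.reg 117)))))

/-- Split a subtree with at least three vertices. -/
def splitProg : Prog :=
  .seq sizesProg (.seq pivotProg (.seq ancestorProg (.seq markProg (.seq pushProg sidesProg))))

section

variable {N : ℕ} {par : ℕ → ℕ} {W : ℕ → ℝ} {D : ℕ → ℕ → ℝ} {S : Finset ℕ} {r p m : ℕ} {σ : State}

theorem isMarked_holds {τ : State} : isMarked.Holds τ ↔ τ.narr 115 (τ.nreg 113) = 1 := by
  simp [isMarked, Test.Holds, NExpr.eval]

/-- The second list starts with `p` itself; by `hM` all marked vertices come after `p`, so the list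
is increasing. -/
theorem runsWithin_pushProg {t o : ℕ} (hσ : Loaded N par S r m σ) (ht : σ.nreg 110 = t)
    (ho : σ.nreg 111 = o) (hp : σ.nreg 114 = p)
    (hM : ∀ v ∈ S, σ.narr 115 v = 1 → p < v) :
    RunsWithin pushProg σ (m * 80 + 50) fun τ => Pushed t o (S.filter fun v => ¬ σ.narr 115 v = 1)
      (insert p (S.filter fun v => σ.narr 115 v = 1)) σ τ := by
  refine RunsWithin.andThen (RunsWithin.straight (Q := fun τ => τ.nreg 117 = o) 2 rfl le_rfl
    (by simp [Prog.run, NExpr.eval, ho])) fun σ₁ h₁ hf₁ => ?_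
  have hσ₁ := hσ.frame hf₁
  refine RunsWithin.andThen (runsWithin_collectProg (.not isMarked) 110
    (fun v => ¬ σ.narr 115 v = 1) hσ₁ fun τ hf _ => ?_) fun σ₂ ⟨h₂, h₂', h₂''⟩ hf₂ => ?_
  · rw [Test.Holds, isMarked_holds, hf.na 115, hf₁.na 115]
  have hσ₂ := hσ₁.frame hf₂
  rw [h₁] at h₂ h₂' h₂''
  obtain ⟨n, hn⟩ : ∃ n, (S.filter fun v => ¬ σ.narr 115 v = 1).card = n := ⟨_, rfl⟩
  rw [hn] at h₂ h₂'
  have t₂ : σ₂.nreg 110 = t := by rw [hf₂.n 110, hf₁.n 110, ht]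
  have p₂ : σ₂.nreg 114 = p := by rw [hf₂.n 114, hf₁.n 114, hp]
  refine RunsWithin.andThen (RunsWithin.straight (Q := fun τ => τ.nreg 117 = o + n + 1 ∧
    τ.narr 111 = upd (σ₂.narr 111) (t + 1) (o + n) ∧
    τ.narr 110 = upd (σ₂.narr 110) (o + n) p) 12 rfl (by decide)
    (by simp [Prog.run, NExpr.eval, upd, h₂, t₂, p₂])) fun σ₃ ⟨h₃, h₃', h₃''⟩ hf₃ => ?_
  have hσ₃ := hσ₂.frame hf₃
  refine RunsWithin.andThen (runsWithin_collectProg isMarked 110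
    (fun v => σ.narr 115 v = 1) hσ₃ fun τ hf _ => ?_) fun σ₄ ⟨h₄, h₄', h₄''⟩ hf₄ => ?_
  · rw [isMarked_holds, hf.na 115, hf₃.na 115, hf₂.na 115, hf₁.na 115]
  rw [h₃] at h₄ h₄' h₄''
  have hcard : (insert p (S.filter fun v => σ.narr 115 v = 1)).card =
      (S.filter fun v => σ.narr 115 v = 1).card + 1 :=
    card_insert_of_notMem fun h => (hM p (mem_filter.1 h).1 (mem_filter.1 h).2).false
  have t₄ : σ₄.nreg 110 = t := by rw [hf₄.n 110, hf₃.n 110, t₂]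
  have a₄ : σ₄.narr 111 = upd (σ.narr 111) (t + 1) (o + n) := by
    rw [hf₄.na 111, h₃', hf₂.na 111, hf₁.na 111]
  refine (RunsWithin.straight (Q := fun τ => τ.nreg 110 = t + 2 ∧
    τ.narr 111 = upd (σ₄.narr 111) (t + 2)
      (o + n + 1 + (S.filter fun v => σ.narr 115 v = 1).card) ∧ τ.narr 110 = σ₄.narr 110) 9
    rfl (by decide) (by simp [Prog.run, NExpr.eval, upd, h₄, t₄])).mono (by omega)
    fun τ ⟨k₁, k₂, k₃⟩ => ⟨k₁, ?_, ?_, fun i hi => ?_, fun i hi => ?_, ?_, ?_⟩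
  · rw [k₂, upd_ne _ _ (by omega), a₄, upd_same, hn]
  · rw [k₂, upd_same, hn, hcard]; ring
  · rw [k₂, upd_ne _ _ (by omega), a₄, upd_ne _ _ (by omega)]
  · rw [k₃, h₄'' i (by omega), h₃'', upd_ne _ _ (by omega), h₂'' i hi, hf₁.na 110]
  · rw [hn, k₃]
    exact h₂'.congr fun j hj => by rw [h₄'' _ (by omega), h₃'', upd_ne _ _ (by omega)]
  · rw [hn, k₃, hcard]
    refine Lists.cons (h₄'.congr fun j hj => ?_) ?_ fun u hu =>
      hM u (mem_filter.1 hu).1 (mem_filter.1 hu).2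
    · rw [← add_assoc]
    · rw [h₄'' _ (by omega), h₃'']
      exact upd_same _ _ _

theorem runsWithin_sidesProg (hσ : Loaded N par S r m σ) (hp : σ.nreg 114 = p) :
    RunsWithin sidesProg σ (m * 80 + 50) fun τ =>
      Lists (τ.narr 116) (τ.nreg 120) ((S.filter fun v => ¬ σ.narr 115 v = 1).erase p) ∧
      Lists (τ.narr 117) (τ.nreg 121) (S.filter fun v => σ.narr 115 v = 1) := by
  refine RunsWithin.andThen (RunsWithin.straight (Q := fun τ => τ.nreg 117 = 0) 2 rfl le_rfl
    (by simp [Prog.run, NExpr.eval])) fun σ₁ h₁ hf₁ => ?_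
  have hσ₁ := hσ.frame hf₁
  refine RunsWithin.andThen (runsWithin_collectProg
    (.and (.not isMarked) (.not (.neq (.reg 113) (.reg 114)))) 116
    (fun v => ¬ σ.narr 115 v = 1 ∧ v ≠ p) hσ₁ fun τ hf _ => ?_) fun σ₂ ⟨h₂, h₂', _⟩ hf₂ => ?_
  · simp only [Test.Holds, isMarked_holds, hf.na 115, hf₁.na 115, NExpr.eval, hf.n 114, hf₁.n 114,
      hp, ne_eq]
  have hσ₂ := hσ₁.frame hf₂
  simp only [h₁, zero_add] at h₂ h₂'
  refine RunsWithin.andThen (RunsWithin.straight (Q := fun τ => τ.nreg 117 = 0 ∧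
    τ.nreg 120 = (S.filter fun v => ¬ σ.narr 115 v = 1 ∧ v ≠ p).card) 4 rfl le_rfl
    (by simp [Prog.run, NExpr.eval, upd, h₂])) fun σ₃ ⟨h₃, h₃'⟩ hf₃ => ?_
  have hσ₃ := hσ₂.frame hf₃
  refine RunsWithin.andThen (runsWithin_collectProg isMarked 117
    (fun v => σ.narr 115 v = 1) hσ₃ fun τ hf _ => ?_) fun σ₄ ⟨h₄, h₄', _⟩ hf₄ => ?_
  · rw [isMarked_holds, hf.na 115, hf₃.na 115, hf₂.na 115, hf₁.na 115]
  simp only [h₃, zero_add] at h₄ h₄'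
  refine (RunsWithin.straight (Q := fun τ => τ.nreg 121 = σ₄.nreg 117) 2 rfl le_rfl
    (by simp [Prog.run, NExpr.eval])).frame.mono (by omega) fun τ ⟨k, hf₅⟩ => ⟨?_, ?_⟩
  · have : (S.filter fun v => ¬ σ.narr 115 v = 1).erase p =
        S.filter fun v => ¬ σ.narr 115 v = 1 ∧ v ≠ p := by
      ext v
      simp only [mem_erase, mem_filter]
      tauto
    rw [this, hf₅.n 120, hf₄.n 120, h₃', hf₅.na 116, hf₄.na 116, hf₃.na 116]
    exact h₂'
  · rw [k, h₄, hf₅.na 117]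
    exact h₄'

/-- Both parts contain the pivot, so that numbers of edges, not of vertices, add up: `(|T₁| - 1) +
(|T₂| - 1) = m - 1`. All size bounds are therefore stated for edges. -/
theorem runsWithin_splitProg {t o : ℕ} (hσ : Loaded N par S r m σ) (hT : RootedTree N par W D)
    (hW : σ.rarr 100 = W) (hm : 3 ≤ m) (ht : σ.nreg 110 = t) (ho : σ.nreg 111 = o) :
    RunsWithin splitProg σ (m * 450) fun τ => ∃ A B T₁ T₂ r₁ r₂, CutData D S A B m τ ∧
      Pushed t o T₁ T₂ σ τ ∧ IsSubtree N par T₁ r₁ ∧ IsSubtree N par T₂ r₂ ∧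
      2 ≤ T₁.card ∧ 2 ≤ T₂.card ∧ T₁.card + T₂.card = m + 1 ∧
      5 * (T₁.card - 1) ≤ 4 * (m - 1) ∧ 5 * (T₂.card - 1) ≤ 4 * (m - 1) ∧
      ∀ g i, rest g S i = cross g A B i + cross g B A i + (rest g T₁ i + rest g T₂ i) := by
  refine RunsWithin.andThen (runsWithin_sizesProg hσ hT.par_lt) fun σ₁ ⟨h118, hs, han, hmk⟩ hf₁ => ?_
  have hσ₁ := hσ.frame hf₁
  have hL : Lists (σ₁.narr 112) m S := hσ₁.lists
  refine RunsWithin.andThen (runsWithin_pivotProg hσ₁ (by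
    rw [size_root hσ.sub hs, hL.card])) fun σ₂ ⟨hp, hp2, hps⟩ hf₂ => ?_
  have hσ₂ := hσ₁.frame hf₂
  obtain ⟨p, hpe⟩ : ∃ p, σ₂.nreg 114 = p := ⟨_, rfl⟩
  rw [hpe] at hp hp2 hps
  refine RunsWithin.andThen (runsWithin_ancestorProg (p := p) hσ₂ hT ((hf₂.n 118).trans h118)
    (by rw [hf₂.ra 100, hf₁.ra 100, hW]) hpe hp (by rw [hf₂.na 114]; exact han))
    fun σ₃ ⟨ha, ha', ha''⟩ hf₃ => ?_
  have hσ₃ := hσ₂.frame hf₃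
  have hA : Ancestors par S r p (σ₃.narr 114) := ⟨ha, ha', fun v hv h => (ha'' v hv h).1⟩
  have p₃ : σ₃.nreg 114 = p := by rw [hf₃.n 114, hpe]
  have e113 : σ₃.narr 113 = σ₁.narr 113 := by rw [hf₃.na 113, hf₂.na 113]
  have e112 : σ₃.narr 112 = σ₁.narr 112 := by rw [hf₃.na 112, hf₂.na 112]
  refine RunsWithin.andThen (runsWithin_markProg hσ₃ hT (by rw [hf₃.n 118, hf₂.n 118, h118])
    (by rw [hf₃.ra 100, hf₂.ra 100, hf₁.ra 100, hW]) p₃ hp hA (fun v hv h => (ha'' v hv h).2)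
    (by rw [hf₃.na 115, hf₂.na 115]; exact hmk) (by rw [e113]; exact hps))
    fun σ₄ ⟨Am, hI⟩ hf₄ => ?_
  have hσ₄ := hσ₃.frame hf₄
  rw [e112, e113] at hI
  have hr := hA.root hσ.sub hp hT.par_lt
  have hB := hI.branch hL hσ.sub hr
  have hbal := hI.balanced hL hσ.sub hr hp hm hs hp2
  have p₄ : σ₄.nreg 114 = p := by rw [hf₄.n 114, p₃]
  have hd : ∀ v ∈ S, σ₄.rarr 110 v = D p v := fun v hv => by
    obtain ⟨i, hi, rfl⟩ := (hL.mem_iff v).1 hv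
    exact hI.dist _ hv (Or.inr ⟨i, by omega, rfl⟩)
  refine RunsWithin.andThen (runsWithin_pushProg (t := t) (o := o) hσ₄
    (by rw [hf₄.n 110, hf₃.n 110, hf₂.n 110, hf₁.n 110, ht])
    (by rw [hf₄.n 111, hf₃.n 111, hf₂.n 111, hf₁.n 111, ho]) p₄
    fun v hv h => (hB.par_mem v (mem_filter.2 ⟨hv, h⟩)).1) fun σ₅ hP hf₅ => ?_
  have hσ₅ := hσ₄.frame hf₅
  have e115 : σ₅.narr 115 = σ₄.narr 115 := hf₅.na 115
  refine (runsWithin_sidesProg (p := p) hσ₅ (by rw [hf₅.n 114, p₄])).frame.mono (by omega)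
    fun τ ⟨⟨k₁, k₂⟩, hf₆⟩ => ?_
  rw [e115] at k₁ k₂
  obtain ⟨M, hMe⟩ : ∃ M, S.filter (fun v => σ₄.narr 115 v = 1) = M := ⟨_, rfl⟩
  have hsd : S.filter (fun v => ¬ σ₄.narr 115 v = 1) = S \ M := by
    rw [← hMe]; ext v; simp only [mem_filter, mem_sdiff]; tauto
  rw [hMe] at hB hbal hP k₂
  rw [hsd] at hP k₁
  have hpT : p ∈ S \ M := mem_sdiff.2 ⟨hp, hB.notMem⟩
  have hcS : S.card = m := hL.card
  have c₁ : (S \ M).card = m - M.card := by rw [card_sdiff_of_subset hB.subset, hcS]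
  have c₂ : (insert p M).card = M.card + 1 := card_insert_of_notMem hB.notMem
  have cA : ((S \ M).erase p).card = m - M.card - 1 := by rw [card_erase_of_mem hpT, c₁]
  refine ⟨(S \ M).erase p, M, S \ M, insert p M, r, p,
    ⟨k₁, k₂, (erase_subset _ _).trans sdiff_subset, hB.subset, ?_, ?_, ?_, fun i hi j hj => ?_⟩,
    ⟨?_, ?_, ?_, fun i hi => ?_, fun i hi => ?_, ?_, ?_⟩, hσ.sub.sdiff hp hB,
    hσ.sub.insert hp hB,
    by omega, by omega, by omega, by omega,
    by omega,
    fun g i => rest_split g hB.subset hp hB.notMem i⟩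
  · rw [← k₁.card]; omega
  · rw [← k₂.card]; omega
  · rw [← k₁.card, ← k₂.card]; omega
  · have hi' := mem_sdiff.1 (mem_of_mem_erase hi)
    rw [hf₆.ra 110, hf₅.ra 110, hd i hi'.1, hd j (hB.subset hj)]
    exact hT.dist_branch hσ.sub hp hB hi'.1 hi'.2 hj
  · rw [hf₆.n 110, hP.top]
  · rw [hf₆.na 111, hP.start₁]
  · rw [hf₆.na 111, hP.start₂]
  · rw [hf₆.na 111, hP.start i hi, hf₄.na 111, hf₃.na 111, hf₂.na 111, hf₁.na 111]
  · rw [hf₆.na 110, hP.stack i hi, hf₄.na 110, hf₃.na 110, hf₂.na 110, hf₁.na 110]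
  · rw [hf₆.na 110]; exact hP.lists₁
  · rw [hf₆.na 110]; exact hP.lists₂

end

end FastCauchy

/-! ### Contributions across a cut, and the stack of subtrees. -/

namespace FastCauchy

open RealRAM Finset

theorem Lists.single {a : ℕ → ℕ} {u : ℕ} (h : a 0 = u) : Lists a 1 {u} :=
  (Lists.empty a).snoc (by simp) (by simp) h

/-- Add to the result the contribution of the vertices listed in `B` to those listed in `A`. -/
noncomputable def crossProg (lam c : ℝ) (A nA B nB : ℕ) : Prog :=
  .seq (.seq (.nset 20 (.reg nA)) (.nset 21 (.reg nB)))
  (.seq (fill 20 20 (.get 110 (.get A (.reg 33)))) (.seq (fill 21 21 (.get 110 (.get B (.reg 33))))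
  (.seq (fill 21 22 (.get 101 (.get B (.reg 33)))) (.seq (mulProg lam c)
  (forLoop 116 20 (.rput 102 (.get A (.reg 116))
    (.add (.get 102 (.get A (.reg 116))) (.get 23 (.reg 116)))))))))

/-- What a crossing does not change. -/
structure CrossKept (σ τ : State) : Prop where
  nreg : ∀ k, 50 ≤ k → k ≠ 116 → τ.nreg k = σ.nreg k
  narr : ∀ k, 50 ≤ k → τ.narr k = σ.narr k
  rarr : ∀ k, 50 ≤ k → k ≠ 102 → τ.rarr k = σ.rarr k

theorem runsWithin_crossProg {lam c : ℝ} {A nA B nB a b : ℕ} {SA SB : Finset ℕ} {σ : State}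
    (ha : σ.nreg nA = a) (hb : σ.nreg nB = b) (hA : Lists (σ.narr A) a SA)
    (hB : Lists (σ.narr B) b SB) (ha1 : 0 < a) (hb1 : 0 < b) (hA' : 50 ≤ A)
    (hne : ∀ i ∈ SA, ∀ j ∈ SB, σ.rarr 110 i + σ.rarr 110 j ≠ -c) (hnB : nB ≠ 20 := by decide) :
    RunsWithin (crossProg lam c A nA B nB) σ (8200 * (a + b) * (Nat.log 2 (a + b) + 1) ^ 2)
      fun τ => CrossKept σ τ ∧ ∀ v, τ.rarr 102 v = σ.rarr 102 v +
        cross (fun i j => Real.exp (lam * (σ.rarr 110 i + σ.rarr 110 j)) /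
          (σ.rarr 110 i + σ.rarr 110 j + c) * σ.rarr 101 j) SA SB v := by
  have hbound : 180 * (a + b) + 8000 * (a + b) * (Nat.log 2 (a + b) + 1) ^ 2 ≤
      8200 * (a + b) * (Nat.log 2 (a + b) + 1) ^ 2 := by
    have : 200 * (a + b) * 1 ≤ 200 * (a + b) * (Nat.log 2 (a + b) + 1) ^ 2 :=
      Nat.mul_le_mul_left _ (Nat.one_le_pow _ _ (Nat.succ_pos _))
    have e : 8200 * (a + b) * (Nat.log 2 (a + b) + 1) ^ 2 = 200 * (a + b) *
      (Nat.log 2 (a + b) + 1) ^ 2 + 8000 * (a + b) * (Nat.log 2 (a + b) + 1) ^ 2 := by ring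
    omega
  refine RunsWithin.andThen (RunsWithin.straight (Q := fun τ => τ.nreg 20 = a ∧ τ.nreg 21 = b)
    4 rfl le_rfl (by simp [Prog.run, NExpr.eval, upd, ha, hb, hnB])) fun σ₁ ⟨h20, h21⟩ hf₁ => ?_
  have d₁ : σ₁.rarr 110 = σ.rarr 110 := hf₁.ra 110
  have x₁ : σ₁.rarr 101 = σ.rarr 101 := hf₁.ra 101
  have n₁ : ∀ k, σ₁.narr k = σ.narr k := fun k => hf₁.na k
  refine RunsWithin.andThen (runsWithin_fill 20 20 (.get 110 (.get A (.reg 33))) a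
    (fun j => σ.rarr 110 (σ.narr A j)) h20
    fun j X _ => by simp [RExpr.eval, NExpr.eval, upd, d₁, n₁]) fun σ₂ h₂ hf₂ => ?_
  refine RunsWithin.andThen (runsWithin_fill 21 21 (.get 110 (.get B (.reg 33))) b
    (fun j => σ.rarr 110 (σ.narr B j)) ((hf₂.n 21).trans h21)
    fun j X _ => by simp [RExpr.eval, NExpr.eval, upd, d₁, n₁, hf₂.ra 110, hf₂.na B])
    fun σ₃ h₃ hf₃ => ?_
  refine RunsWithin.andThen (runsWithin_fill 21 22 (.get 101 (.get B (.reg 33))) b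
    (fun j => σ.rarr 101 (σ.narr B j)) (by rw [hf₃.n 21, hf₂.n 21, h21])
    fun j X _ => by simp [RExpr.eval, NExpr.eval, upd, x₁, n₁, hf₃.ra 101, hf₃.na B, hf₂.ra 101,
      hf₂.na B])
    fun σ₄ h₄ hf₄ => ?_
  have hx : ∀ i < a, σ₄.rarr 20 i = σ.rarr 110 (σ.narr A i) := fun i hi => by
    rw [hf₄.ra 20, hf₃.ra 20, h₂.1 i hi]
  have hy : ∀ j < b, σ₄.rarr 21 j = σ.rarr 110 (σ.narr B j) := fun j hj => by
    rw [hf₄.ra 21, h₃.1 j hj]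
  refine RunsWithin.andThen (runsWithin_mulProg (lam := lam) (c := c) (a := a) (b := b)
    (by rw [hf₄.n 20, hf₃.n 20, hf₂.n 20, h20]) (by rw [hf₄.n 21, hf₃.n 21, hf₂.n 21, h21])
    ha1 hb1 ?_) fun σ₅ h₅ hf₅ => ?_
  · intro i j hi hj
    rw [hx i hi, hy j hj]
    exact hne _ (hA.mem hi) _ (hB.mem hj)
  have hk := Kept.of_frame hf₅
  have hout : σ₅.rarr 102 = σ.rarr 102 := by
    rw [hk.rarr 102 (by omega), hf₄.ra 102, hf₃.ra 102, hf₂.ra 102, hf₁.ra 102]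
  have hAr : ∀ k, 50 ≤ k → σ₅.narr k = σ.narr k := fun k hk' => by
    rw [hk.narr k (by omega), hf₄.na k, hf₃.na k, hf₂.na k, n₁]
  refine (RunsWithin.forLoopF (n := a) (C := 9) (fun j τ =>
    (∀ i < a, τ.rarr 102 (σ.narr A i) = σ.rarr 102 (σ.narr A i) +
      if i < j then σ₅.rarr 23 i else 0) ∧ ∀ v, v ∉ SA → τ.rarr 102 v = σ.rarr 102 v)
    (by rw [hk.nreg 20 (by omega), hf₄.n 20, hf₃.n 20, hf₂.n 20, h20])
    ⟨fun i _ => by simp [hout], fun v _ => by simp [hout]⟩ fun j τ hj hJ hf hI => ?_).frame.mono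
    (by omega) fun τ ⟨⟨⟨k₁, k₂⟩, _⟩, hf₆⟩ => ⟨⟨fun k h h' => ?_, fun k h => ?_, fun k h h' => ?_⟩,
      fun v => ?_⟩
  · have eA : τ.narr A = σ.narr A := by rw [hf.na A, hAr A hA']
    have e23 : τ.rarr 23 = σ₅.rarr 23 := hf.ra 23
    refine RunsWithin.straight 9 rfl le_rfl ⟨fun i hi => ?_, fun v hv => ?_⟩
    · simp only [Prog.run, RExpr.eval, NExpr.eval, hJ, eA, e23, upd_same]
      by_cases hij : i = j
      · subst hij
        rw [upd_same, hI.1 i hi, if_neg (lt_irrefl _), if_pos (Nat.lt_succ_self _), add_zero]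
      · rw [upd_ne _ _ fun e => hij (hA.inj hi hj e), hI.1 i hi]
        congr 1
        exact if_congr (by omega) rfl rfl
    · simp only [Prog.run, NExpr.eval, hJ, eA, upd_same]
      rw [upd_ne _ _ fun e => hv (by rw [e]; exact hA.mem hj)]
      exact hI.2 v hv
  · rw [hf₆.nreg k (by simp [forLoop, Prog.wn, h']), hk.nreg k (by omega),
      hf₄.nreg k (by simp [fill, mapR, forLoop, Prog.wn]; omega),
      hf₃.nreg k (by simp [fill, mapR, forLoop, Prog.wn]; omega),
      hf₂.nreg k (by simp [fill, mapR, forLoop, Prog.wn]; omega),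
      hf₁.nreg k (by simp [Prog.wn]; omega)]
  · rw [hf₆.na k, hAr k h]
  · rw [hf₆.rarr k (by simp [forLoop, Prog.wra, h']), hk.rarr k (by omega),
      hf₄.rarr k (by simp [fill, mapR, forLoop, Prog.wra]; omega),
      hf₃.rarr k (by simp [fill, mapR, forLoop, Prog.wra]; omega),
      hf₂.rarr k (by simp [fill, mapR, forLoop, Prog.wra]; omega), hf₁.ra k]
  · rw [cross]
    split_ifs with hv
    · obtain ⟨i, hi, rfl⟩ := (hA.mem_iff v).1 hv
      rw [k₁ i hi, if_pos hi, h₅ i hi, hB.sum]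
      congr 1
      refine sum_congr rfl fun j hj => ?_
      have hj := mem_range.1 hj
      rw [hx i hi, hy j hj, h₄.1 j hj]
    · rw [k₂ v hv, add_zero]

/-- Remove the last subtree from the stack, and load it. -/
def popProg : Prog :=
  .seq (.seq (.nset 110 (.sub (.reg 110) (.const 1))) (.seq (.nset 111 (.get 111 (.reg 110)))
    (.nset 112 (.sub (.get 111 (.add (.reg 110) (.const 1))) (.reg 111)))))
  (mapN 116 112 112 (.reg 116) (.get 110 (.add (.reg 111) (.reg 116))))

/-- The two sides of a single edge. -/
def edgeProg : Prog :=
  .seq (.nput 116 (.const 0) (.get 112 (.const 0))) (.seq (.nput 117 (.const 0) (.get 112 (.const 1)))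
  (.seq (.nset 120 (.const 1)) (.seq (.nset 121 (.const 1))
  (.seq (.rput 110 (.get 112 (.const 0)) (.const 0))
    (.rput 110 (.get 112 (.const 1)) (.get 100 (.get 112 (.const 1))))))))

/-- Treat the last subtree of the stack. -/
noncomputable def roundProg (lam c : ℝ) : Prog :=
  .seq popProg (.seq (.cond (.neq (.reg 112) (.const 2)) edgeProg splitProg)
    (.seq (crossProg lam c 116 120 117 121) (crossProg lam c 117 121 116 120)))

/-- The state of the computation with `t` subtrees `S k` on the stack: the results still lack the
sums within these subtrees. -/
structure StackInv (N : ℕ) (par : ℕ → ℕ) (W : ℕ → ℝ) (x : ℕ → ℝ) (g : ℕ → ℕ → ℝ) (total : ℕ → ℝ)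
    (t : ℕ) (S : ℕ → Finset ℕ) (h : ℕ → ℕ) (τ : State) : Prop where
  par_eq : τ.narr 100 = par
  weight : τ.rarr 100 = W
  field : τ.rarr 101 = x
  top : τ.nreg 110 = t
  start : ∀ k < t, τ.narr 111 (k + 1) = τ.narr 111 k + (S k).card
  lists : ∀ k < t, Lists (fun i => τ.narr 110 (τ.narr 111 k + i)) (S k).card (S k)
  sub : ∀ k < t, ∃ r, IsSubtree N par (S k) r
  two : ∀ k < t, 2 ≤ (S k).card
  height : ∀ k < t, ((S k).card - 1) * 4 ^ h k ≤ 5 ^ h k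
  sum : ∀ i < N, τ.rarr 102 i + ∑ k ∈ range t, rest g (S k) i = total i

section

variable {N : ℕ} {par : ℕ → ℕ} {W : ℕ → ℝ} {D : ℕ → ℕ → ℝ} {x : ℕ → ℝ} {g : ℕ → ℕ → ℝ}
  {total : ℕ → ℝ} {t : ℕ} {S : ℕ → Finset ℕ} {h : ℕ → ℕ} {σ : State}

theorem StackInv.start_le (hI : StackInv N par W x g total t S h σ) {k l : ℕ} (hkl : k ≤ l)
    (hl : l ≤ t) : σ.narr 111 k ≤ σ.narr 111 l := by
  induction l, hkl using Nat.le_induction with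
  | base => exact le_rfl
  | succ l _ ih =>
    have := hI.start l (by omega)
    have := ih (by omega)
    omega

theorem runsWithin_popProg (hI : StackInv N par W x g total (t + 1) S h σ) {r : ℕ}
    (hr : IsSubtree N par (S t) r) :
    RunsWithin popProg σ ((S t).card * 15 + 30) fun τ => Loaded N par (S t) r (S t).card τ ∧
      τ.nreg 110 = t ∧ τ.nreg 111 = σ.narr 111 t := by
  refine RunsWithin.andThen (RunsWithin.straight (Q := fun τ => τ.nreg 110 = t ∧
    τ.nreg 111 = σ.narr 111 t ∧ τ.nreg 112 = (S t).card) 15 rfl (by decide) ?_)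
    fun σ₁ ⟨h₁, h₁', h₁''⟩ hf₁ => ?_
  · simp [Prog.run, NExpr.eval, upd, hI.top, hI.start t (Nat.lt_succ_self t)]
  refine (RunsWithin.mapN (S t).card 0 (fun j => σ.narr 110 (σ.narr 111 t + j)) (by decide) h₁''
    (fun j X => by simp [NExpr.eval]) fun j X hj _ => ?_).frame.mono ?_ fun τ ⟨hτ, hf⟩ => ?_
  · simp [NExpr.eval, upd, h₁', hf₁.na 110]
  · simp only [NExpr.cost]; omega
  · refine ⟨⟨(hf.n 112).trans h₁'', ?_, ?_, hr, ?_⟩, (hf.n 110).trans h₁, (hf.n 111).trans h₁'⟩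
    · rw [hf.na 100, hf₁.na 100, hI.par_eq]
    · exact (hI.lists t (Nat.lt_succ_self t)).congr fun j hj => by simpa using hτ.1 j hj
    · have := hI.two t (Nat.lt_succ_self t); omega

/-- A single edge is a cut between two single vertices: recording `0` for the root and the weight
for the other vertex makes the recorded numbers add up to the distance. -/
theorem runsWithin_edgeProg {r : ℕ} {E : Finset ℕ} (hσ : Loaded N par E r 2 σ)
    (hT : RootedTree N par W D) (hW : σ.rarr 100 = W) :
    RunsWithin edgeProg σ 30 fun τ => ∃ A B, CutData D E A B 2 τ ∧
      ∀ g i, rest g E i = cross g A B i + cross g B A i := by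
  obtain ⟨u, hu⟩ : ∃ u, σ.narr 112 0 = u := ⟨_, rfl⟩
  obtain ⟨v, hv⟩ : ∃ v, σ.narr 112 1 = v := ⟨_, rfl⟩
  have hL := hσ.lists
  have huv : u < v := hu ▸ hv ▸ hL.lt 0 1 Nat.zero_lt_one Nat.one_lt_two
  have huE : u ∈ E := hu ▸ hL.mem Nat.zero_lt_two
  have hvE : v ∈ E := hv ▸ hL.mem Nat.one_lt_two
  have hE : E = {u, v} := by
    rw [hL.eq_image, show range 2 = {0, 1} from rfl, image_insert, image_singleton, hu, hv]
  have hur : u = r := hu ▸ hL.root hσ.sub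
  have hvN := hσ.sub.lt v hvE
  have hp := hσ.sub.par_mem v hvE (by omega)
  have hpu : par v = u := by
    have h1 := hT.par_lt v (by omega) hvN
    have h2 := hp.2
    rw [hE, mem_insert, mem_singleton] at h2
    omega
  have hD : D u v = W v := by
    rw [hT.symm, hT.step v u huv hvN, hpu, hT.self, add_zero]
  refine RunsWithin.straight 30 rfl (by decide) ⟨{u}, {v}, ⟨?_, ?_, by simpa using huE,
    by simpa using hvE, ?_, ?_, ?_, ?_⟩, fun g i => ?_⟩
  · rw [show (edgeProg.run σ).nreg 120 = 1 by simp [edgeProg, Prog.run, NExpr.eval, upd]]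
    exact Lists.single (by simp [edgeProg, Prog.run, NExpr.eval, upd, hu])
  · rw [show (edgeProg.run σ).nreg 121 = 1 by simp [edgeProg, Prog.run, NExpr.eval, upd]]
    exact Lists.single (by simp [edgeProg, Prog.run, NExpr.eval, upd, hv])
  · simp [edgeProg, Prog.run, NExpr.eval, upd]
  · simp [edgeProg, Prog.run, NExpr.eval, upd]
  · simp [edgeProg, Prog.run, NExpr.eval, upd]
  · simp [edgeProg, Prog.run, NExpr.eval, RExpr.eval, upd, hu, hv, hW, hD, huv.ne]
  · rw [hE]
    by_cases h1 : i = u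
    · subst h1
      simp [rest, cross, huv.ne]
    · by_cases h2 : i = v
      · subst h2
        have : ({u, i} : Finset ℕ).erase i = {u} := by
          ext z; simp only [mem_erase, mem_insert, mem_singleton]; omega
        simp [rest, cross, huv.ne', this]
      · simp [rest, cross, h1, h2]

end

end FastCauchy

/-! ### A round of the decomposition and its potential. -/

namespace FastCauchy

open RealRAM Finset

section

variable {N : ℕ} {par : ℕ → ℕ} {W : ℕ → ℝ} {D : ℕ → ℕ → ℝ} {x : ℕ → ℝ} {g : ℕ → ℕ → ℝ}
  {total : ℕ → ℝ} {t : ℕ} {S : ℕ → Finset ℕ} {h : ℕ → ℕ} {σ τ : State} {lam c : ℝ}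

theorem cross_congr {f g : ℕ → ℕ → ℝ} {A B : Finset ℕ} (h : ∀ i ∈ A, ∀ j ∈ B, f i j = g i j)
    (i : ℕ) : cross f A B i = cross g A B i := by
  rw [cross, cross]
  split_ifs with hi
  · exact sum_congr rfl fun j hj => h i hi j hj
  · rfl

theorem StackInv.add (hI : StackInv N par W x g total t S h σ) (hk : CrossKept σ τ) (e : ℕ → ℝ)
    (he : ∀ v, τ.rarr 102 v = σ.rarr 102 v + e v) :
    StackInv N par W x g (fun i => total i + e i) t S h τ where
  par_eq := (hk.narr 100 (by omega)).trans hI.par_eq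
  weight := (hk.rarr 100 (by omega) (by omega)).trans hI.weight
  field := (hk.rarr 101 (by omega) (by omega)).trans hI.field
  top := (hk.nreg 110 (by omega) (by omega)).trans hI.top
  start := by rw [hk.narr 111 (by omega)]; exact hI.start
  lists := by rw [hk.narr 111 (by omega), hk.narr 110 (by omega)]; exact hI.lists
  sub := hI.sub
  two := hI.two
  height := hI.height
  sum i hi := by rw [he, ← hI.sum i hi]; ring

/-- The potential of a stack. -/
def potential (t : ℕ) (S : ℕ → Finset ℕ) (h : ℕ → ℕ) : ℕ :=
  ∑ k ∈ range t, ((S k).card - 1) * (h k + 1)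

theorem StackInv.edge (hI : StackInv N par W x g total (t + 1) S h σ) {A B : Finset ℕ}
    (h100 : τ.narr 100 = σ.narr 100) (h100' : τ.rarr 100 = σ.rarr 100)
    (h101 : τ.rarr 101 = σ.rarr 101) (h102 : τ.rarr 102 = σ.rarr 102) (h110 : τ.nreg 110 = t)
    (h111 : τ.narr 111 = σ.narr 111) (h110' : τ.narr 110 = σ.narr 110)
    (hr : ∀ i, rest g (S t) i = cross g A B i + cross g B A i) :
    StackInv N par W x g (fun i => total i - cross g A B i - cross g B A i) t S h τ where
  par_eq := h100.trans hI.par_eq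
  weight := h100'.trans hI.weight
  field := h101.trans hI.field
  top := h110
  start k hk := by rw [h111]; exact hI.start k (by omega)
  lists k hk := by rw [h111, h110']; exact hI.lists k (by omega)
  sub k hk := hI.sub k (by omega)
  two k hk := hI.two k (by omega)
  height k hk := hI.height k (by omega)
  sum i hi := by
    have := hI.sum i hi
    rw [sum_range_succ, hr] at this
    rw [h102]
    linarith

/-- The height bounds the logarithm to base `5 / 4` of the number of edges, so a part with at most
`4 / 5` of the edges may have a height smaller by one. -/
theorem height_step {e e' h : ℕ} (hh : e * 4 ^ (h + 1) ≤ 5 ^ (h + 1)) (he : 5 * e' ≤ 4 * e) :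
    e' * 4 ^ h ≤ 5 ^ h := by
  have h1 := Nat.mul_le_mul_right (4 ^ h) he
  have h2 : e * 4 ^ (h + 1) = 4 * e * 4 ^ h := by ring
  have h3 : (5 : ℕ) ^ (h + 1) = 5 * 5 ^ h := by ring
  have h4 : 5 * e' * 4 ^ h = 5 * (e' * 4 ^ h) := by ring
  omega

/-- Edges are distributed among the two parts while their height drops by one, so the potential
falls by exactly the number of edges of the subtree that is split. -/
theorem StackInv.split (hI : StackInv N par W x g total (t + 1) S h σ) {A B T₁ T₂ : Finset ℕ}
    {r₁ r₂ : ℕ} (h100 : τ.narr 100 = σ.narr 100) (h100' : τ.rarr 100 = σ.rarr 100)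
    (h101 : τ.rarr 101 = σ.rarr 101) (h102 : τ.rarr 102 = σ.rarr 102)
    (hP : Pushed t (σ.narr 111 t) T₁ T₂ σ τ) (hs₁ : IsSubtree N par T₁ r₁)
    (hs₂ : IsSubtree N par T₂ r₂) (hT₁ : 2 ≤ T₁.card) (hT₂ : 2 ≤ T₂.card)
    (hadd : T₁.card + T₂.card = (S t).card + 1)
    (hb₁ : 5 * (T₁.card - 1) ≤ 4 * ((S t).card - 1)) (hb₂ : 5 * (T₂.card - 1) ≤ 4 * ((S t).card - 1))
    (hr : ∀ i, rest g (S t) i =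
      cross g A B i + cross g B A i + (rest g T₁ i + rest g T₂ i)) :
    StackInv N par W x g (fun i => total i - cross g A B i - cross g B A i) (t + 2)
        (upd (upd S t T₁) (t + 1) T₂) (upd (upd h t (h t - 1)) (t + 1) (h t - 1)) τ ∧
      potential (t + 2) (upd (upd S t T₁) (t + 1) T₂) (upd (upd h t (h t - 1)) (t + 1) (h t - 1)) +
        ((S t).card - 1) = potential (t + 1) S h := by
  -- Height `0` would allow only one edge, but the two parts have at least one edge each.
  obtain ⟨h', hh'⟩ : ∃ h', h t = h' + 1 := by
    refine ⟨h t - 1, ?_⟩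
    have := hI.height t (Nat.lt_succ_self t)
    by_contra hc
    have h0 : h t = 0 := by omega
    rw [h0] at this
    simp only [pow_zero, mul_one] at this
    omega
  have hht := hI.height t (Nat.lt_succ_self t)
  rw [hh'] at hht
  rw [hh', Nat.add_sub_cancel]
  have hcase : ∀ k < t + 2, k < t ∨ k = t ∨ k = t + 1 := fun k hk => by omega
  have s0 : ∀ k < t, upd (upd S t T₁) (t + 1) T₂ k = S k := fun k hk => by
    rw [upd_ne _ _ (by omega), upd_ne _ _ (by omega)]
  have s1 : upd (upd S t T₁) (t + 1) T₂ t = T₁ := by rw [upd_ne _ _ (by omega), upd_same]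
  have s2 : upd (upd S t T₁) (t + 1) T₂ (t + 1) = T₂ := upd_same _ _ _
  have h0 : ∀ k < t, upd (upd h t h') (t + 1) h' k = h k := fun k hk => by
    rw [upd_ne _ _ (by omega), upd_ne _ _ (by omega)]
  have h1 : upd (upd h t h') (t + 1) h' t = h' := by rw [upd_ne _ _ (by omega), upd_same]
  have h2 : upd (upd h t h') (t + 1) h' (t + 1) = h' := upd_same _ _ _
  refine ⟨⟨h100.trans hI.par_eq, h100'.trans hI.weight, h101.trans hI.field, hP.top,
    fun k hk => ?_, fun k hk => ?_, fun k hk => ?_, fun k hk => ?_, fun k hk => ?_,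
    fun i hi => ?_⟩, ?_⟩
  · rcases hcase k hk with hk | rfl | rfl
    · rw [s0 k hk, hP.start k hk.le, hP.start (k + 1) hk, hI.start k (by omega)]
    · rw [s1, hP.start₁, hP.start k le_rfl]
    · rw [s2, hP.start₂, hP.start₁]
  · rcases hcase k hk with hk | rfl | rfl
    · rw [s0 k hk, hP.start k hk.le]
      refine (hI.lists k (by omega)).congr fun j hj => hP.stack _ ?_
      have := hI.start_le (show k + 1 ≤ t by omega) (by omega)
      rw [hI.start k (by omega)] at this
      omega
    · rw [s1, hP.start k le_rfl]; exact hP.lists₁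
    · rw [s2, hP.start₁]; exact hP.lists₂
  · rcases hcase k hk with hk | rfl | rfl
    · rw [s0 k hk]; exact hI.sub k (by omega)
    · rw [s1]; exact ⟨_, hs₁⟩
    · rw [s2]; exact ⟨_, hs₂⟩
  · rcases hcase k hk with hk | rfl | rfl
    · rw [s0 k hk]; exact hI.two k (by omega)
    · rwa [s1]
    · rwa [s2]
  · rcases hcase k hk with hk | rfl | rfl
    · rw [s0 k hk, h0 k hk]; exact hI.height k (by omega)
    · rw [s1, h1]; exact height_step hht hb₁
    · rw [s2, h2]; exact height_step hht hb₂
  · have := hI.sum i hi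
    rw [sum_range_succ, hr] at this
    rw [h102, sum_range_succ, sum_range_succ, s1, s2,
      sum_congr rfl fun k hk => by rw [s0 k (mem_range.1 hk)]]
    linarith
  · rw [potential, potential, sum_range_succ, sum_range_succ, sum_range_succ, s1, s2, h1, h2, hh',
      sum_congr rfl fun k hk => by rw [s0 k (mem_range.1 hk), h0 k (mem_range.1 hk)]]
    have : (S t).card - 1 = (T₁.card - 1) + (T₂.card - 1) := by omega
    rw [this]
    ring

/-- A cut is crossed in both directions, which costs two multiplications of total size at most `m`.
The distances used are distances of the tree, so `hc` keeps all denominators nonzero. -/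
theorem runsWithin_roundProg (hT : RootedTree N par W D) (hc : ∀ i < N, ∀ j < N, D i j ≠ -c)
    (hI : StackInv N par W x (fun i j => Real.exp (lam * D i j) / (D i j + c) * x j) total (t + 1)
      S h σ) :
    RunsWithin (roundProg lam c) σ (34000 * ((S t).card - 1) * (Nat.log 2 N + 1) ^ 2) fun τ =>
      ∃ t' S' h', StackInv N par W x (fun i j => Real.exp (lam * D i j) / (D i j + c) * x j)
        total t' S' h' τ ∧ potential t' S' h' + ((S t).card - 1) ≤ potential (t + 1) S h := by
  obtain ⟨r, hr⟩ := hI.sub t (Nat.lt_succ_self t)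
  obtain ⟨m, hm⟩ : ∃ m, (S t).card = m := ⟨_, rfl⟩
  have hm2 : 2 ≤ m := hm ▸ hI.two t (Nat.lt_succ_self t)
  have hmN : m ≤ N := by
    rw [← hm, ← card_range N]
    exact card_le_card fun v hv => mem_range.2 (hr.lt v hv)
  obtain ⟨g, hg⟩ : ∃ g : ℕ → ℕ → ℝ, (fun i j => Real.exp (lam * D i j) / (D i j + c) * x j) = g :=
    ⟨_, rfl⟩
  rw [hg] at hI ⊢
  obtain ⟨ℓ, hℓ⟩ : ∃ ℓ, Nat.log 2 N + 1 = ℓ := ⟨_, rfl⟩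
  rw [hℓ, hm]
  have hℓ1 : 1 ≤ ℓ ^ 2 := Nat.one_le_pow _ _ (by omega)
  -- The bound is stated in edges, for which the potential pays; `m ≤ 2 * (m - 1)` converts from
  -- vertices.
  have hbound : 16400 * (m * ℓ ^ 2) + 600 * m ≤ 34000 * (m - 1) * ℓ ^ 2 := by
    have e1 : m * 1 ≤ m * ℓ ^ 2 := Nat.mul_le_mul_left _ hℓ1
    have e2 : 17000 * (m * ℓ ^ 2) ≤ 34000 * (m - 1) * ℓ ^ 2 := by
      rw [← mul_assoc]
      exact Nat.mul_le_mul_right _ (by omega)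
    omega
  have hcost : ∀ a b, a + b ≤ m →
      8200 * (a + b) * (Nat.log 2 (a + b) + 1) ^ 2 ≤ 8200 * (m * ℓ ^ 2) := fun a b hab => by
    rw [mul_assoc]
    refine Nat.mul_le_mul_left _ (Nat.mul_le_mul hab (Nat.pow_le_pow_left ?_ 2))
    rw [← hℓ]
    exact Nat.succ_le_succ (Nat.log_mono_right (hab.trans hmN))
  have hpop := runsWithin_popProg hI hr
  rw [hm] at hpop
  refine RunsWithin.andThen hpop fun σ₁ ⟨hl, h110, h111⟩ hf₁ => ?_
  have hW₁ : σ₁.rarr 100 = W := (hf₁.ra 100).trans hI.weight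
  have hmid : RunsWithin (.cond (.neq (.reg 112) (.const 2)) edgeProg splitProg) σ₁ (450 * m + 34)
      fun τ => ∃ A B t' S' h', CutData D (S t) A B m τ ∧
        StackInv N par W x g (fun i => total i - cross g A B i - cross g B A i) t' S' h' τ ∧
        potential t' S' h' + (m - 1) ≤ potential (t + 1) S h := by
    refine (RunsWithin.cond (T := 450 * m + 30) (fun hb => ?_) fun hb => ?_).le
      (by simp only [Test.cost, NExpr.cost]; omega)
    · simp only [Test.Holds, NExpr.eval, hl.size] at hb
      subst hb
      refine (runsWithin_edgeProg hl hT hW₁).frame.mono (by omega)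
        fun τ ⟨⟨A, B, hcut, hrest⟩, hf⟩ => ⟨A, B, t, S, h, hcut, hI.edge ?_ ?_ ?_ ?_ ?_ ?_ ?_
          (hrest g), ?_⟩
      · rw [hf.na 100, hf₁.na 100]
      · rw [hf.ra 100, hf₁.ra 100]
      · rw [hf.ra 101, hf₁.ra 101]
      · rw [hf.ra 102, hf₁.ra 102]
      · rw [hf.n 110, h110]
      · rw [hf.na 111, hf₁.na 111]
      · rw [hf.na 110, hf₁.na 110]
      · rw [potential, potential, sum_range_succ, hm]
        exact Nat.add_le_add_left (Nat.le_mul_of_pos_right _ (Nat.succ_pos _)) _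
    · simp only [Test.Holds, NExpr.eval, hl.size] at hb
      refine (runsWithin_splitProg hl hT hW₁ (by omega) h110 h111).frame.mono (by omega)
        fun τ ⟨⟨A, B, T₁, T₂, r₁, r₂, hcut, hP, hs₁, hs₂, hT₁, hT₂, hadd, hb₁, hb₂, hrest⟩, hf⟩ => ?_
      have hP' : Pushed t (σ.narr 111 t) T₁ T₂ σ τ := ⟨hP.top, hP.start₁, hP.start₂,
        fun i hi => by rw [hP.start i hi, hf₁.na 111],
        fun i hi => by rw [hP.stack i hi, hf₁.na 110], hP.lists₁, hP.lists₂⟩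
      have := hI.split (A := A) (B := B) (by rw [hf.na 100, hf₁.na 100])
        (by rw [hf.ra 100, hf₁.ra 100]) (by rw [hf.ra 101, hf₁.ra 101])
        (by rw [hf.ra 102, hf₁.ra 102]) hP' hs₁ hs₂ hT₁ hT₂ (by rw [hm, hadd]) (by rw [hm]; exact hb₁)
        (by rw [hm]; exact hb₂) (hrest g)
      exact ⟨A, B, _, _, _, hcut, this.1, by rw [← hm]; exact this.2.le⟩
  refine RunsWithin.andThen hmid fun σ₂ ⟨A, B, t', S', h', hcut, hI₂, hpot⟩ _ => ?_
  have hdA : ∀ i ∈ A, ∀ j ∈ B, σ₂.rarr 110 i + σ₂.rarr 110 j = D i j :=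
    fun i hi j hj => (hcut.dist i hi j hj).symm
  have hdB : ∀ j ∈ B, ∀ i ∈ A, σ₂.rarr 110 j + σ₂.rarr 110 i = D j i :=
    fun j hj i hi => by rw [add_comm, hdA i hi j hj, hT.symm]
  have hlt : ∀ v ∈ S t, v < N := hr.lt
  refine RunsWithin.andThen ((runsWithin_crossProg (lam := lam) (c := c) (A := 116) (nA := 120)
    (B := 117) (nB := 121) rfl rfl hcut.listsA hcut.listsB hcut.posA hcut.posB (by omega)
    fun i hi j hj => ?_).le (hcost _ _ hcut.le)) fun σ₃ ⟨hk, h₃⟩ _ => ?_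
  · rw [hdA i hi j hj]
    exact hc i (hlt i (hcut.subA hi)) j (hlt j (hcut.subB hj))
  have hI₃ := hI₂.add hk _ h₃
  have e110 : σ₃.rarr 110 = σ₂.rarr 110 := hk.rarr 110 (by omega) (by omega)
  have e101 : σ₃.rarr 101 = x := hI₃.field
  have n120 : σ₃.nreg 120 = σ₂.nreg 120 := hk.nreg 120 (by omega) (by omega)
  have n121 : σ₃.nreg 121 = σ₂.nreg 121 := hk.nreg 121 (by omega) (by omega)
  refine (runsWithin_crossProg (lam := lam) (c := c) (A := 117) (nA := 121)
    (B := 116) (nB := 120) (SA := B) (SB := A) n121 n120 (by rw [hk.narr 117 (by omega)]; exact hcut.listsB)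
    (by rw [hk.narr 116 (by omega)]; exact hcut.listsA) hcut.posB hcut.posA (by omega)
    fun j hj i hi => ?_).mono ?_ fun τ ⟨hk', h₄⟩ => ⟨t', S', h', ?_, hpot⟩
  · rw [e110, hdB j hj i hi]
    exact hc j (hlt j (hcut.subB hj)) i (hlt i (hcut.subA hi))
  · have := hcost _ _ ((add_comm _ _).trans_le hcut.le)
    omega
  · have hI₄ := hI₃.add hk' _ h₄
    refine ⟨hI₄.par_eq, hI₄.weight, hI₄.field, hI₄.top, hI₄.start, hI₄.lists, hI₄.sub, hI₄.two,
      hI₄.height, fun i hi => ?_⟩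
    rw [hI₄.sum i hi, e110, e101, hI₂.field]
    rw [cross_congr (f := fun i j => Real.exp (lam * (σ₂.rarr 110 i + σ₂.rarr 110 j)) /
        (σ₂.rarr 110 i + σ₂.rarr 110 j + c) * x j) (A := A) (B := B) (g := g)
        fun i hi j hj => by rw [hdA i hi j hj, ← hg],
      cross_congr (f := fun i j => Real.exp (lam * (σ₂.rarr 110 i + σ₂.rarr 110 j)) /
        (σ₂.rarr 110 i + σ₂.rarr 110 j + c) * x j) (A := B) (B := A) (g := g)
        fun j hj i hi => by rw [hdB j hj i hi, ← hg]]
    ring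

end

end FastCauchy

/-! ### Integration of a vector on a rooted tree. -/

namespace FastCauchy

open RealRAM Finset

/-- Integration of a vector on a rooted tree. -/
noncomputable def vecProg (lam c : ℝ) : Prog :=
  .seq (fill 0 102 (.mul (.const (Real.exp (lam * 0) / (0 + c))) (.get 101 (.reg 33))))
  (.seq (mapN 116 0 110 (.reg 116) (.reg 116))
  (.seq (.seq (.nput 111 (.const 0) (.const 0)) (.seq (.nput 111 (.const 1) (.reg 0))
    (.cond (.nlt (.const 1) (.reg 0)) (.nset 110 (.const 1)) (.nset 110 (.const 0)))))
  (.loop (.nlt (.const 0) (.reg 110)) (roundProg lam c))))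

section

variable {N : ℕ} {par : ℕ → ℕ} {W : ℕ → ℝ} {D : ℕ → ℕ → ℝ} {x : ℕ → ℝ} {σ τ : State} {lam c : ℝ}

theorem RootedTree.isSubtree (hT : RootedTree N par W D) (hN : 0 < N) :
    IsSubtree N par (range N) 0 where
  root_mem := mem_range.2 hN
  lt _ hv := mem_range.1 hv
  par_mem v hv hv0 := ⟨Nat.pos_of_ne_zero hv0, mem_range.2
    ((hT.par_lt v (Nat.pos_of_ne_zero hv0) (mem_range.1 hv)).trans (mem_range.1 hv))⟩

/-- `N` is less than `2 ^ (Nat.log 2 N + 1)`, and `2 * 4 ^ 4 = 512 ≤ 625 = 5 ^ 4`: four units of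
height pay for each binary digit. -/
theorem initial_height (N : ℕ) :
    (N - 1) * 4 ^ (4 * (Nat.log 2 N + 1)) ≤ 5 ^ (4 * (Nat.log 2 N + 1)) := by
  have h1 : N < 2 ^ (Nat.log 2 N + 1) := Nat.lt_pow_succ_log_self one_lt_two N
  rw [pow_mul, pow_mul]
  calc _ ≤ 2 ^ (Nat.log 2 N + 1) * (4 ^ 4) ^ (Nat.log 2 N + 1) :=
        Nat.mul_le_mul_right _ (by omega)
    _ = 512 ^ (Nat.log 2 N + 1) := by rw [← mul_pow]; norm_num
    _ ≤ _ := Nat.pow_le_pow_left (by norm_num) _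

/-- The result starts with the diagonal terms; the stack starts with the whole tree, or empty for a
single vertex. The initial potential is at most `5 N (log₂ N + 1)`, and a unit of it pays for time
of order `log² N`. -/
theorem runsWithin_vecProg (hT : RootedTree N par W D) (hc : ∀ i < N, ∀ j < N, D i j ≠ -c)
    (hN : σ.nreg 0 = N) (hN1 : 0 < N) (hpar : σ.narr 100 = par) (hW : σ.rarr 100 = W)
    (hx : σ.rarr 101 = x) :
    RunsWithin (vecProg lam c) σ (200000 * N * (Nat.log 2 N + 1) ^ 3) fun τ => ∀ i < N,
      τ.rarr 102 i = ∑ j ∈ range N, Real.exp (lam * D i j) / (D i j + c) * x j := by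
  obtain ⟨ℓ, hℓ⟩ : ∃ ℓ, Nat.log 2 N + 1 = ℓ := ⟨_, rfl⟩
  have hh := initial_height N
  rw [hℓ] at hh ⊢
  have hℓ1 : 1 ≤ ℓ := by omega
  have hℓ2 : 1 ≤ ℓ ^ 2 := Nat.one_le_pow _ _ hℓ1
  have hℓ3 : 1 ≤ ℓ ^ 3 := Nat.one_le_pow _ _ hℓ1
  refine RunsWithin.andThen (runsWithin_fill 0 102 _ N
    (fun j => Real.exp (lam * 0) / (0 + c) * x j) hN fun j X _ => by
      simp [RExpr.eval, NExpr.eval, upd, hx]) fun σ₁ h₁ hf₁ => ?_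
  refine RunsWithin.andThen (RunsWithin.mapN N 0 (fun j => j) (by decide) ((hf₁.n 0).trans hN)
    (fun j X => by simp [NExpr.eval]) fun j X _ _ => by simp [NExpr.eval]) fun σ₂ h₂ hf₂ => ?_
  have hN₂ : σ₂.nreg 0 = N := by rw [hf₂.n 0, hf₁.n 0, hN]
  refine RunsWithin.andThen (RunsWithin.straight (Q := fun τ => τ.narr 111 0 = 0 ∧
    τ.narr 111 1 = N ∧ τ.nreg 110 = if 1 < N then 1 else 0) 15 rfl (by decide) ?_)
    fun σ₃ ⟨h₃, h₃', h₃''⟩ hf₃ => ?_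
  · by_cases h1 : 1 < N <;> simp [Prog.run, Test.Holds, NExpr.eval, upd, hN₂, h1]
  obtain ⟨g, hg⟩ : ∃ g : ℕ → ℕ → ℝ, (fun i j => Real.exp (lam * D i j) / (D i j + c) * x j) = g :=
    ⟨_, rfl⟩
  have hgi : ∀ i j, Real.exp (lam * D i j) / (D i j + c) * x j = g i j := fun i j => by rw [← hg]
  simp only [hgi]
  have hout : ∀ i < N, σ₃.rarr 102 i = g i i := fun i hi => by
    rw [hf₃.ra 102, hf₂.ra 102, h₁.1 i hi, ← hgi, hT.self]
  have hinit : StackInv N par W x g (fun i => ∑ j ∈ range N, g i j) (if 1 < N then 1 else 0)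
      (fun _ => range N) (fun _ => 4 * ℓ) σ₃ := by
    refine ⟨by rw [hf₃.na 100, hf₂.na 100, hf₁.na 100, hpar],
      by rw [hf₃.ra 100, hf₂.ra 100, hf₁.ra 100, hW],
      by rw [hf₃.ra 101, hf₂.ra 101, hf₁.ra 101, hx], h₃'', fun k hk => ?_, fun k hk => ?_,
      fun k _ => ⟨0, hT.isSubtree hN1⟩, fun k hk => ?_, fun k _ => by rw [card_range]; exact hh,
      fun i hi => ?_⟩
    · obtain rfl : k = 0 := by split_ifs at hk <;> omega
      rw [h₃, h₃', card_range, zero_add]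
    · obtain rfl : k = 0 := by split_ifs at hk <;> omega
      rw [h₃, card_range]
      have : ∀ j < N, σ₃.narr 110 (0 + j) = j := fun j hj => by
        rw [hf₃.na 110]; exact h₂.1 j hj
      refine Lists.congr (a := fun j => j) ⟨fun j k hjk _ => hjk, fun v => by simp⟩ this
    · split_ifs at hk with h1
      · rw [card_range]; exact h1
      · omega
    · rw [hout i hi]
      split_ifs with h1
      · rw [sum_range_one, rest, if_pos (mem_range.2 hi), add_sum_erase _ _ (mem_range.2 hi)]
      · obtain rfl : N = 1 := by omega
        obtain rfl : i = 0 := by omega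
        simp
  have key := RunsWithin.loop (p := roundProg lam c) (b := .nlt (.const 0) (.reg 110)) (σ := σ₃)
    (G := ℕ × (ℕ → Finset ℕ) × (ℕ → ℕ))
    (fun G τ => StackInv N par W x g (fun i => ∑ j ∈ range N, g i j) G.1 G.2.1 G.2.2 τ)
    -- `34000` pays for a round and `4` for the test of the loop.
    (fun G => 34004 * ℓ ^ 2 * potential G.1 G.2.1 G.2.2) ?_
    (if 1 < N then 1 else 0, fun _ => range N, fun _ => 4 * ℓ) hinit
  · have hpot : potential (if 1 < N then 1 else 0) (fun _ => range N) (fun _ => 4 * ℓ) ≤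
        N * (5 * ℓ) := by
      rw [potential]
      split_ifs
      · rw [sum_range_one, card_range]
        exact Nat.mul_le_mul (Nat.sub_le _ _) (by omega)
      · simp
    refine key.mono ?_ fun τ ⟨⟨t, S, h⟩, hI, hn⟩ i hi => ?_
    · have e1 : 34004 * ℓ ^ 2 * (N * (5 * ℓ)) = 170020 * (N * ℓ ^ 3) := by ring
      have e2 := Nat.mul_le_mul_left (34004 * ℓ ^ 2) hpot
      have e3 : 200000 * N * ℓ ^ 3 = 200000 * (N * ℓ ^ 3) := by ring
      have e4 : N * 1 ≤ N * ℓ ^ 3 := Nat.mul_le_mul_left _ hℓ3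
      simp only [Test.cost, NExpr.cost]
      omega
    · have ht : t = 0 := by
        have := hI.top
        simp only [Test.Holds, NExpr.eval] at hn
        simp only at this
        omega
      subst ht
      have := hI.sum i hi
      simpa using this
  · rintro ⟨t, S, h⟩ τ hI hb
    have ht := hI.top
    simp only [Test.Holds, NExpr.eval] at hb
    obtain ⟨t, rfl⟩ : ∃ t', t = t' + 1 := ⟨t - 1, by simp only at ht; omega⟩
    have hI' := hI
    simp only [← hg] at hI'
    refine ⟨_, (runsWithin_roundProg (lam := lam) hT hc hI').imp fun τ' ⟨t', S', h', hS, hp⟩ =>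
      ⟨(t', S', h'), by rw [← hg]; exact hS, ?_⟩⟩
    have h2 := hI.two t (Nat.lt_succ_self t)
    simp only at h2
    have e1 := Nat.mul_le_mul_left (34004 * ℓ ^ 2) hp
    have e2 : 1 * 1 ≤ ((S t).card - 1) * ℓ ^ 2 := Nat.mul_le_mul (by omega) hℓ2
    have e3 : 34004 * ℓ ^ 2 * (potential t' S' h' + ((S t).card - 1)) =
      34004 * ℓ ^ 2 * potential t' S' h' + 34004 * (((S t).card - 1) * ℓ ^ 2) := by ring
    have e4 : 34000 * ((S t).card - 1) * ℓ ^ 2 = 34000 * (((S t).card - 1) * ℓ ^ 2) := by ring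
    rw [hℓ]
    simp only [Test.cost, NExpr.cost]
    omega

/-- What an integration does not change. -/
structure VecKept (σ τ : State) : Prop where
  nreg : ∀ k, k < 20 ∨ 200 ≤ k → τ.nreg k = σ.nreg k
  narr : ∀ k, k < 20 ∨ 50 ≤ k ∧ k < 110 → τ.narr k = σ.narr k
  rarr : ∀ k, k < 20 ∨ 50 ≤ k ∧ k < 102 → τ.rarr k = σ.rarr k

set_option maxRecDepth 100000 in
theorem VecKept.of_frame (h : Frame (vecProg lam c) σ τ) : VecKept σ τ := by
  have h₁ : (vecProg lam c).wn.all (fun k => decide (20 ≤ k) && decide (k < 200)) = true := by rfl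
  have h₂ : (vecProg lam c).wna.all (fun k => decide (20 ≤ k) &&
    (decide (k < 50) || decide (110 ≤ k))) = true := by rfl
  have h₃ : (vecProg lam c).wra.all (fun k => decide (20 ≤ k) &&
    (decide (k < 50) || decide (102 ≤ k))) = true := by rfl
  rw [List.all_eq_true] at h₁ h₂ h₃
  refine ⟨fun k hk => h.nreg k fun hm => ?_, fun k hk => h.narr k fun hm => ?_,
    fun k hk => h.rarr k fun hm => ?_⟩
  · have := h₁ k hm; simp at this; omega
  · have := h₂ k hm; simp at this; omega
  · have := h₃ k hm; simp at this; omega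

end

end FastCauchy

/-! ### Shortest-path distances and orderings of a weighted tree. -/

namespace FastCauchy

open Finset

theorem sum_map_le_of_subset {α : Type} [DecidableEq α] (w : α → ℝ) {l₁ l₂ : List α}
    (h₁ : l₁.Nodup) (h : l₁ ⊆ l₂) (hw : ∀ a ∈ l₂, 0 ≤ w a) : (l₁.map w).sum ≤ (l₂.map w).sum := by
  induction l₁ generalizing l₂ with
  | nil => exact List.sum_nonneg (by simpa using hw)
  | cons a l ih =>
    rw [List.nodup_cons] at h₁
    have ha : a ∈ l₂ := h (by simp)
    have hp := (List.perm_cons_erase ha).map w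
    rw [hp.sum_eq, List.map_cons, List.sum_cons, List.map_cons, List.sum_cons]
    refine add_le_add le_rfl (ih h₁.2 (fun b hb => ?_) fun b hb => hw b (List.mem_of_mem_erase hb))
    exact (List.mem_erase_of_ne fun e : b = a => h₁.1 (e ▸ hb)).2 (h (List.mem_cons_of_mem _ hb))

/-- Removing the detours of a walk gives a path whose edges are among those of the walk. In a tree
it is the given path, and positive weights make its sum the smallest. -/
theorem dist_eq_of_isPath {N : ℕ} (G : WeightedTree N) {i j : Fin N} (p : G.graph.Walk i j)
    (hp : p.IsPath) : G.dist i j = (p.edges.map G.weight).sum := by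
  classical
  have : IsLeast (Set.range fun p : G.graph.Walk i j => (p.edges.map G.weight).sum)
      (p.edges.map G.weight).sum := by
    refine ⟨⟨p, rfl⟩, ?_⟩
    rintro _ ⟨q, rfl⟩
    have e : p = q.bypass := (G.isTree.existsUnique_path i j).unique hp q.bypass_isPath
    rw [e]
    exact sum_map_le_of_subset _ q.bypass_isPath.isTrail.edges_nodup q.edges_bypass_subset_edges
      fun e he => (G.weight_pos e (q.edges_subset_edgeSet he)).le
  exact this.csInf_eq

theorem WeightedTree.dist_self' {N : ℕ} (G : WeightedTree N) (i : Fin N) : G.dist i i = 0 := by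
  rw [dist_eq_of_isPath G SimpleGraph.Walk.nil SimpleGraph.Walk.IsPath.nil]
  simp

theorem WeightedTree.dist_symm' {N : ℕ} (G : WeightedTree N) (i j : Fin N) :
    G.dist i j = G.dist j i := by
  obtain ⟨p, hp, -⟩ := G.isTree.existsUnique_path i j
  rw [dist_eq_of_isPath G p hp, dist_eq_of_isPath G p.reverse hp.reverse,
    SimpleGraph.Walk.edges_reverse, List.map_reverse, List.sum_reverse]

/-- The enumeration `ord` of the vertices, in which every vertex except the first one is adjacent
to a predecessor. -/
structure IsOrdering {N : ℕ} (G : WeightedTree N) (ord par : ℕ → ℕ) (W : ℕ → ℝ) : Prop where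
  lt : ∀ k < N, ord k < N
  inj : ∀ k < N, ∀ l < N, ord k = ord l → k = l
  par_lt : ∀ k, 0 < k → k < N → par k < k
  adj : ∀ k, 0 < k → k < N → ∃ (h : ord k < N) (h' : ord (par k) < N),
    G.graph.Adj ⟨ord k, h⟩ ⟨ord (par k), h'⟩ ∧ W k = G.weight s(⟨ord k, h⟩, ⟨ord (par k), h'⟩)

section

variable {N : ℕ} {G : WeightedTree N} {ord par : ℕ → ℕ} {W : ℕ → ℝ}

/-- The first vertices of the ordering are joined by paths among themselves. A later vertex is not
on such a path, so putting the edge to its parent in front gives a path again. -/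
theorem IsOrdering.exists_path (h : IsOrdering G ord par W) {k : ℕ} (hk : k < N) :
    ∀ i j (hi : i ≤ k) (hj : j ≤ k), ∃ p : G.graph.Walk ⟨ord i, h.lt i (hi.trans_lt hk)⟩
      ⟨ord j, h.lt j (hj.trans_lt hk)⟩, p.IsPath ∧ ∀ v ∈ p.support, ∃ l ≤ k, v = ord l := by
  induction k with
  | zero =>
    intro i j hi hj
    obtain rfl := Nat.le_zero.1 hi
    obtain rfl := Nat.le_zero.1 hj
    exact ⟨SimpleGraph.Walk.nil, SimpleGraph.Walk.IsPath.nil, by simp⟩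
  | succ k ih =>
    have ih := ih (by omega)
    have hlast : ∀ j (hj : j ≤ k), ∃ p : G.graph.Walk ⟨ord (k + 1), h.lt _ hk⟩
        ⟨ord j, h.lt j (by omega)⟩, p.IsPath ∧ ∀ v ∈ p.support, ∃ l ≤ k + 1, v = ord l := by
      intro j hj
      have hpar := h.par_lt (k + 1) (Nat.succ_pos _) hk
      obtain ⟨h₁, h₂, hadj, -⟩ := h.adj (k + 1) (Nat.succ_pos _) hk
      obtain ⟨p, hp, hs⟩ := ih (par (k + 1)) j (by omega) hj
      refine ⟨SimpleGraph.Walk.cons hadj p, hp.cons fun hm => ?_, fun v hv => ?_⟩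
      · obtain ⟨l, hl, e⟩ := hs _ hm
        have := h.inj (k + 1) hk l (by omega) e
        omega
      · rw [SimpleGraph.Walk.support_cons, List.mem_cons] at hv
        rcases hv with rfl | hv
        · exact ⟨k + 1, le_rfl, rfl⟩
        · obtain ⟨l, hl, e⟩ := hs v hv
          exact ⟨l, by omega, e⟩
    intro i j hi hj
    rcases Nat.le_succ_iff.1 hi with hi' | rfl
    · rcases Nat.le_succ_iff.1 hj with hj' | rfl
      · obtain ⟨p, hp, hs⟩ := ih i j hi' hj'
        exact ⟨p, hp, fun v hv => (hs v hv).imp fun l hl => ⟨by omega, hl.2⟩⟩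
      · obtain ⟨p, hp, hs⟩ := hlast i hi'
        exact ⟨p.reverse, hp.reverse, fun v hv => hs v (by simpa using hv)⟩
    · rcases Nat.le_succ_iff.1 hj with hj' | rfl
      · exact hlast j hj'
      · exact ⟨SimpleGraph.Walk.nil, SimpleGraph.Walk.IsPath.nil, fun v hv => ⟨k + 1, le_rfl, by
          simp at hv; rw [hv]⟩⟩

/-- The distance of the vertices `ord i`, `ord j`. -/
noncomputable def ordDist (G : WeightedTree N) (ord : ℕ → ℕ) (i j : ℕ) : ℝ :=
  if h : ord i < N ∧ ord j < N then G.dist ⟨ord i, h.1⟩ ⟨ord j, h.2⟩ else 0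

theorem IsOrdering.rootedTree (h : IsOrdering G ord par W) :
    RootedTree N par W (ordDist G ord) where
  par_lt := h.par_lt
  symm i j := by
    rw [ordDist, ordDist]
    by_cases hij : ord i < N ∧ ord j < N
    · rw [dif_pos hij, dif_pos hij.symm, WeightedTree.dist_symm']
    · rw [dif_neg hij, dif_neg fun h' => hij h'.symm]
  self i := by
    rw [ordDist]
    split_ifs with hi
    · exact WeightedTree.dist_self' G _
    · rfl
  step v j hjv hv := by
    have hpar := h.par_lt v (by omega) hv
    obtain ⟨h₁, h₂, hadj, hW⟩ := h.adj v (by omega) hv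
    have hj := h.lt j (by omega)
    obtain ⟨p, hp, hs⟩ := h.exists_path (show v - 1 < N by omega) (par v) j (by omega) (by omega)
    have hq : (SimpleGraph.Walk.cons hadj p).IsPath := hp.cons fun hm => by
      obtain ⟨l, hl, e⟩ := hs _ hm
      have := h.inj v hv l (by omega) e
      omega
    rw [ordDist, ordDist, dif_pos ⟨h₁, hj⟩, dif_pos ⟨h₂, hj⟩, dist_eq_of_isPath G _ hq,
      dist_eq_of_isPath G p hp, SimpleGraph.Walk.edges_cons, List.map_cons, List.sum_cons, hW]

end

end FastCauchy

/-! ### Leaves, degrees and sums over neighbours. -/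

namespace FastCauchy

open Finset

open Classical in
/-- The neighbours of the vertex number `v`. -/
noncomputable def nbrs {N : ℕ} (G : WeightedTree N) (v : ℕ) : Finset ℕ :=
  (range N).filter fun u => ∃ (h : v < N) (h' : u < N), G.graph.Adj ⟨v, h⟩ ⟨u, h'⟩

/-- The weight of the edge between the vertices number `v` and `u`. -/
noncomputable def edgeWeight {N : ℕ} (G : WeightedTree N) (v u : ℕ) : ℝ :=
  if h : v < N ∧ u < N then G.weight s(⟨v, h.1⟩, ⟨u, h.2⟩) else 0

/-- The set `S` of vertices induces a tree. -/
structure IsAlive {N : ℕ} (G : WeightedTree N) (S : Finset ℕ) : Prop where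
  lt : ∀ v ∈ S, v < N
  cut : ∀ A ⊆ S, A.Nonempty → A ≠ S → ∃ a ∈ A, ∃ b ∈ S, b ∉ A ∧ b ∈ nbrs G a
  deg : ∑ v ∈ S, (nbrs G v ∩ S).card + 2 = 2 * S.card

section

variable {N : ℕ} {G : WeightedTree N} {S : Finset ℕ}

open Classical in
theorem mem_nbrs {v u : ℕ} : u ∈ nbrs G v ↔
    ∃ (h : v < N) (h' : u < N), G.graph.Adj ⟨v, h⟩ ⟨u, h'⟩ := by
  rw [nbrs, mem_filter, mem_range]
  exact ⟨fun h => h.2, fun h => ⟨h.2.1, h⟩⟩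

theorem mem_nbrs_fin {v u : Fin N} : (u : ℕ) ∈ nbrs G v ↔ G.graph.Adj v u := by
  rw [mem_nbrs]
  exact ⟨fun ⟨_, _, h⟩ => h, fun h => ⟨v.2, u.2, h⟩⟩

theorem lt_of_mem_nbrs {v u : ℕ} (h : u ∈ nbrs G v) : u < N := (mem_nbrs.1 h).2.1

theorem mem_nbrs_symm {v u : ℕ} (h : u ∈ nbrs G v) : v ∈ nbrs G u := by
  obtain ⟨h₁, h₂, h⟩ := mem_nbrs.1 h
  exact mem_nbrs.2 ⟨h₂, h₁, h.symm⟩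

theorem ne_of_mem_nbrs {v u : ℕ} (h : u ∈ nbrs G v) : u ≠ v := by
  obtain ⟨h₁, h₂, h⟩ := mem_nbrs.1 h
  rintro rfl
  exact G.graph.loopless.irrefl _ h

theorem IsAlive.one_le_card (hS : IsAlive G S) (h2 : 2 ≤ S.card) {v : ℕ} (hv : v ∈ S) :
    1 ≤ (nbrs G v ∩ S).card := by
  obtain ⟨a, ha, b, hb, -, hab⟩ := hS.cut {v} (by simpa using hv) (by simp) fun h => by
    rw [← h, card_singleton] at h2; omega
  rw [mem_singleton] at ha
  subst ha
  exact Finset.card_pos.2 ⟨b, mem_inter.2 ⟨hab, hb⟩⟩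

/-- The degrees sum to `2 * |S| - 2`, so not all of them can be at least `2`. -/
theorem IsAlive.exists_leaf (hS : IsAlive G S) :
    ∃ v ∈ S, (nbrs G v ∩ S).card < 2 := by
  by_contra! hc
  have := sum_le_sum hc
  rw [sum_const, smul_eq_mul] at this
  have := hS.deg
  omega

/-- For connectivity, a set `A` containing the neighbour `p` of the leaf is enlarged by the leaf
before the cut property is applied; otherwise the edge that is found cannot lead to the leaf. The
degree sum loses one at the leaf and one at `p`. -/
theorem IsAlive.erase (hS : IsAlive G S) {v p : ℕ} (hv : v ∈ S) (hp : nbrs G v ∩ S = {p}) :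
    IsAlive G (S.erase v) where
  lt u hu := hS.lt u (mem_of_mem_erase hu)
  cut A hA hne hneq := by
    have hpS : p ∈ nbrs G v ∩ S := hp ▸ mem_singleton_self p
    rw [mem_inter] at hpS
    have hvA : v ∉ A := fun h => (mem_erase.1 (hA h)).1 rfl
    have hAS : A ⊆ S := hA.trans (erase_subset _ _)
    have honly : ∀ u ∈ S, u ∈ nbrs G v → u = p := fun u hu h => by
      rw [← mem_singleton, ← hp]; exact mem_inter.2 ⟨h, hu⟩
    by_cases hpA : p ∈ A
    · obtain ⟨a, ha, b, hb, hbA, hab⟩ := hS.cut (insert v A) (insert_subset hv hAS) (by simp)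
        fun h => hneq (by rw [← h, erase_insert hvA])
      rw [mem_insert, not_or] at hbA
      rcases mem_insert.1 ha with rfl | ha
      · exact absurd hpA (honly b hb hab ▸ hbA.2)
      · exact ⟨a, ha, b, mem_erase.2 ⟨hbA.1, hb⟩, hbA.2, hab⟩
    · obtain ⟨a, ha, b, hb, hbA, hab⟩ := hS.cut A hAS hne fun h => hvA (h ▸ hv)
      refine ⟨a, ha, b, mem_erase.2 ⟨?_, hb⟩, hbA, hab⟩
      rintro rfl
      exact hpA (honly a (hAS ha) (mem_nbrs_symm hab) ▸ ha)
  deg := by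
    have h := hS.deg
    have hpS : p ∈ nbrs G v ∩ S := hp ▸ mem_singleton_self p
    have hpv : p ∈ S.erase v := mem_erase.2 ⟨ne_of_mem_nbrs (mem_inter.1 hpS).1, (mem_inter.1 hpS).2⟩
    have hcard : ∀ u ∈ S.erase v, (nbrs G u ∩ S).card =
        (nbrs G u ∩ S.erase v).card + if u = p then 1 else 0 := fun u hu => by
      rw [inter_erase]
      split_ifs with hup
      · subst hup
        rw [card_erase_of_mem (mem_inter.2 ⟨mem_nbrs_symm (mem_inter.1 hpS).1, hv⟩)]
        have := Finset.card_pos.2 ⟨v, mem_inter.2 ⟨mem_nbrs_symm (mem_inter.1 hpS).1, hv⟩⟩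
        omega
      · rw [erase_eq_of_notMem, add_zero]
        intro hm
        refine hup ?_
        rw [← mem_singleton, ← hp]
        exact mem_inter.2 ⟨mem_nbrs_symm (mem_inter.1 hm).1, mem_of_mem_erase hu⟩
    rw [← add_sum_erase _ _ hv, hp, card_singleton, sum_congr rfl hcard, sum_add_distrib,
      sum_ite_eq' (S.erase v) p, if_pos hpv] at h
    rw [card_erase_of_mem hv]
    omega

theorem edgeList_length {E : List (Fin N × Fin N)} (hE : G.IsEdgeList E) : E.length + 1 = N := by
  classical
  have h := G.isTree.card_edgeFinset
  rw [Fintype.card_fin] at h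
  refine Eq.trans ?_ h
  congr 1
  rw [← List.length_map (fun e : Fin N × Fin N => s(e.1, e.2)), ← List.toFinset_card_of_nodup hE.1]
  congr 1
  ext e
  rw [List.mem_toFinset, hE.2, SimpleGraph.mem_edgeFinset]

/-- The sum of the values of `h` at the neighbours of `v`, computed from a list of the edges. -/
theorem sum_nbrs {E : List (Fin N × Fin N)} (hE : G.IsEdgeList E) {β : Type} [AddCommMonoid β]
    (h : ℕ → β) (v : ℕ) :
    ∑ m : Fin E.length, ((if ((E.get m).1 : ℕ) = v then h (E.get m).2 else 0) +
      if ((E.get m).2 : ℕ) = v then h (E.get m).1 else 0) = ∑ u ∈ nbrs G v, h u := by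
  classical
  have hadj : ∀ m : Fin E.length, G.graph.Adj (E.get m).1 (E.get m).2 := fun m => by
    have := (hE.2 s((E.get m).1, (E.get m).2)).1
      (List.mem_map.2 ⟨E.get m, List.get_mem E m, rfl⟩)
    exact this
  -- Each neighbour of `v` comes from exactly one entry of the list, in one of the two orientations.
  have hinner : ∀ u ∈ nbrs G v, ∑ m : Fin E.length,
      (if ((E.get m).1 : ℕ) = v ∧ ((E.get m).2 : ℕ) = u ∨
        ((E.get m).2 : ℕ) = v ∧ ((E.get m).1 : ℕ) = u then h u else 0) = h u := by
    intro u hu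
    obtain ⟨hv, hu', hvu⟩ := mem_nbrs.1 hu
    have hiff : ∀ e : Fin N × Fin N, ((e.1 : ℕ) = v ∧ (e.2 : ℕ) = u ∨ (e.2 : ℕ) = v ∧ (e.1 : ℕ) = u) ↔
        s(e.1, e.2) = s((⟨v, hv⟩ : Fin N), ⟨u, hu'⟩) := fun e => by
      rw [Sym2.eq_iff]
      simp only [Fin.ext_iff]
      tauto
    obtain ⟨e, he, hes⟩ := List.mem_map.1 ((hE.2 s((⟨v, hv⟩ : Fin N), ⟨u, hu'⟩)).2 hvu)
    obtain ⟨m, rfl⟩ := List.mem_iff_get.1 he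
    rw [sum_eq_single m]
    · rw [if_pos ((hiff _).2 hes)]
    · intro m' _ hne
      refine if_neg fun hc => hne ?_
      rw [hiff, ← hes] at hc
      have hinj := List.nodup_iff_injective_get.1 hE.1
      have := @hinj ⟨m', by simp⟩ ⟨m, by simp⟩ (by simpa using hc)
      simpa [Fin.ext_iff] using this
    · exact fun hm => absurd (mem_univ m) hm
  rw [← sum_congr rfl hinner, sum_comm]
  refine sum_congr rfl fun m _ => ?_
  have hne : ((E.get m).1 : ℕ) ≠ (E.get m).2 := fun e => (hadj m).ne (Fin.ext e)
  by_cases h1 : ((E.get m).1 : ℕ) = v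
  · have h2 : ((E.get m).2 : ℕ) ≠ v := fun e => hne (h1.trans e.symm)
    have hm : ((E.get m).2 : ℕ) ∈ nbrs G v := by rw [← h1]; exact mem_nbrs_fin.2 (hadj m)
    simp only [h1, h2, true_and, false_and, or_false, if_true, if_false, add_zero]
    rw [sum_ite_eq, if_pos hm]
  · by_cases h2 : ((E.get m).2 : ℕ) = v
    · have hm : ((E.get m).1 : ℕ) ∈ nbrs G v := by rw [← h2]; exact mem_nbrs_fin.2 (hadj m).symm
      simp only [h1, h2, true_and, false_and, false_or, if_true, if_false, zero_add]
      rw [sum_ite_eq, if_pos hm]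
    · simp only [h1, h2, false_and, or_false, if_false, add_zero]
      rw [sum_const_zero]

theorem sum_card_nbrs {E : List (Fin N × Fin N)} (hE : G.IsEdgeList E) :
    ∑ v ∈ range N, (nbrs G v).card = 2 * E.length := by
  have : ∀ v ∈ range N, (nbrs G v).card = ∑ m : Fin E.length,
      ((if ((E.get m).1 : ℕ) = v then 1 else 0) + if ((E.get m).2 : ℕ) = v then 1 else 0) :=
    fun v _ => by rw [sum_nbrs hE (fun _ => 1) v, card_eq_sum_ones]
  rw [sum_congr rfl this, sum_comm]
  have : ∀ m : Fin E.length, ∑ v ∈ range N, ((if ((E.get m).1 : ℕ) = v then 1 else 0) +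
      if ((E.get m).2 : ℕ) = v then 1 else 0) = 2 := fun m => by
    rw [sum_add_distrib, sum_ite_eq, sum_ite_eq, if_pos (mem_range.2 (E.get m).1.2),
      if_pos (mem_range.2 (E.get m).2.2)]
  rw [sum_congr rfl fun m _ => this m, sum_const, card_univ, Fintype.card_fin, smul_eq_mul,
    mul_comm]

theorem isAlive_range {E : List (Fin N × Fin N)} (hE : G.IsEdgeList E) : IsAlive G (range N) where
  lt v hv := mem_range.1 hv
  cut A hA hne hneq := by
    obtain ⟨a, ha⟩ := hne
    obtain ⟨b, hb, hbA⟩ : ∃ b ∈ range N, b ∉ A := by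
      by_contra! hc
      exact hneq (hA.antisymm hc)
    have haN := mem_range.1 (hA ha)
    have hbN := mem_range.1 hb
    obtain ⟨p⟩ := G.isTree.connected.preconnected ⟨a, haN⟩ ⟨b, hbN⟩
    obtain ⟨d, -, h1, h2⟩ := p.exists_boundary_dart {v | (v : ℕ) ∈ A} ha hbA
    exact ⟨d.fst, h1, d.snd, mem_range.2 d.snd.2, h2, mem_nbrs_fin.2 d.adj⟩
  deg := by
    have h1 := sum_card_nbrs hE
    have h2 := edgeList_length hE
    have : ∀ v ∈ range N, (nbrs G v ∩ range N).card = (nbrs G v).card := fun v _ => by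
      rw [inter_eq_left.2 fun u hu => mem_range.2 (lt_of_mem_nbrs hu)]
    rw [sum_congr rfl this, h1, card_range]
    omega

end

end FastCauchy

/-! ### The invariant of the removal of leaves. -/

namespace FastCauchy

open RealRAM Finset

/-- The vertices that are not among `q 0, …, q (i - 1)`. -/
def alive (N i : ℕ) (q : ℕ → ℕ) : Finset ℕ := range N \ (range i).image q

/-- The invariant of the removal of leaves: `i` vertices have been removed, `q 0, …, q (tail - 1)` are
the removed vertices and the present leaves, `dg`, `ns`, `ws` contain the number of neighbours, the
sum of the neighbours and the sum of the weights of the edges, `P`, `ww` the neighbours of the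
removed vertices and the distances from them. -/
structure StripInv {N : ℕ} (G : WeightedTree N) (i : ℕ) (q : ℕ → ℕ) (tail : ℕ) (dg ns : ℕ → ℕ)
    (ws : ℕ → ℝ) (P : ℕ → ℕ) (ww : ℕ → ℝ) : Prop where
  tree : IsAlive G (alive N i q)
  le : i ≤ tail
  lt : ∀ j < tail, q j < N
  inj : ∀ j < tail, ∀ k < tail, q j = q k → j = k
  deg : ∀ v ∈ alive N i q, dg v = (nbrs G v ∩ alive N i q).card
  sum : ∀ v ∈ alive N i q, ns v = ∑ u ∈ nbrs G v ∩ alive N i q, u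
  weight : ∀ v ∈ alive N i q, ws v = ∑ u ∈ nbrs G v ∩ alive N i q, edgeWeight G v u
  queue : ∀ v ∈ alive N i q, (∃ j, i ≤ j ∧ j < tail ∧ q j = v) ↔ dg v < 2
  removed : ∀ k < i, P k ∈ nbrs G (q k) ∧ P k ∉ (range (k + 1)).image q ∧
    ww k = edgeWeight G (q k) (P k)

section

variable {N : ℕ} {G : WeightedTree N} {i tail : ℕ} {q : ℕ → ℕ} {dg ns : ℕ → ℕ}
    {ws : ℕ → ℝ} {P : ℕ → ℕ} {ww : ℕ → ℝ}

theorem image_range_congr {q' : ℕ → ℕ} {i : ℕ} (h : ∀ j < i, q' j = q j) :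
    (range i).image q' = (range i).image q :=
  image_congr fun j hj => h j (by simpa using hj)

theorem edgeWeight_symm (v u : ℕ) : edgeWeight G v u = edgeWeight G u v := by
  rw [edgeWeight, edgeWeight]
  by_cases h : v < N ∧ u < N
  · rw [dif_pos h, dif_pos h.symm, Sym2.eq_swap]
  · rw [dif_neg h, dif_neg fun h' => h h'.symm]

theorem StripInv.card_alive (h : StripInv G i q tail dg ns ws P ww) :
    (alive N i q).card = N - i := by
  rw [alive, card_sdiff_of_subset, card_range, card_image_of_injOn, card_range]
  · intro j hj k hk e
    have := h.le
    exact h.inj j (by simp at hj; omega) k (by simp at hk; omega) e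
  · intro v hv
    obtain ⟨j, hj, rfl⟩ := mem_image.1 hv
    exact mem_range.2 (h.lt j ((mem_range.1 hj).trans_le h.le))

/-- A leaf of the remaining tree is always present, and leaves are in the queue. -/
theorem StripInv.lt_tail (h : StripInv G i q tail dg ns ws P ww) : i < tail := by
  obtain ⟨v, hv, hd⟩ := h.tree.exists_leaf
  rw [← h.deg v hv, ← h.queue v hv] at hd
  obtain ⟨j, h₁, h₂, -⟩ := hd
  omega

theorem StripInv.mem_alive (h : StripInv G i q tail dg ns ws P ww) : q i ∈ alive N i q := by
  have ht := h.lt_tail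
  refine mem_sdiff.2 ⟨mem_range.2 (h.lt i ht), fun hm => ?_⟩
  obtain ⟨j, hj, e⟩ := mem_image.1 hm
  rw [mem_range] at hj
  have := h.inj j (hj.trans ht) i ht e
  omega

/-- When one neighbour is left, the sum of the neighbours is this neighbour and the sum of the
weights is the weight of its edge; no adjacency lists are required. -/
theorem StripInv.nbrs_eq (h : StripInv G i q tail dg ns ws P ww) (hi : i + 1 < N) :
    nbrs G (q i) ∩ alive N i q = {ns (q i)} ∧ ws (q i) = edgeWeight G (q i) (ns (q i)) := by
  have hm := h.mem_alive
  have h1 := (h.queue _ hm).1 ⟨i, le_rfl, h.lt_tail, rfl⟩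
  have h2 := h.tree.one_le_card (by rw [h.card_alive]; omega) hm
  rw [h.deg _ hm] at h1
  obtain ⟨p, hp⟩ := card_eq_one.1 (show (nbrs G (q i) ∩ alive N i q).card = 1 by omega)
  have hs := h.sum _ hm
  have hw := h.weight _ hm
  rw [hp, sum_singleton] at hs hw
  rw [hs]
  exact ⟨hp, hw⟩

/-- Only `p` loses a neighbour. It is queued when its degree becomes exactly `1`; if the degree
drops to `0`, then `p` was a leaf before and is in the queue already, so nothing is queued twice. -/
theorem StripInv.step (h : StripInv G i q tail dg ns ws P ww) (hi : i + 1 < N) {q' : ℕ → ℕ}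
    {tail' cur p : ℕ} (hcur : q i = cur) (hpe : ns cur = p) (hq : ∀ j < tail, q' j = q j)
    (h₁ : dg p - 1 = 1 → tail' = tail + 1 ∧ q' tail = p) (h₂ : dg p - 1 ≠ 1 → tail' = tail) :
    StripInv G (i + 1) q' tail' (upd dg p (dg p - 1)) (upd ns p (ns p - cur))
      (upd ws p (ws p - ws cur)) (upd P i p) (upd ww i (ws cur)) := by
  obtain ⟨hp, hw⟩ := h.nbrs_eq hi
  have hm := h.mem_alive
  have ht := h.lt_tail
  rw [hcur] at hp hw hm
  rw [hpe] at hp hw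
  have hpS : p ∈ nbrs G cur ∩ alive N i q := hp ▸ mem_singleton_self p
  rw [mem_inter] at hpS
  have hpc : p ≠ cur := ne_of_mem_nbrs hpS.1
  have hS : alive N (i + 1) q' = (alive N i q).erase cur := by
    rw [alive, alive, image_range_congr (q := q) fun j hj => hq j (by omega), range_add_one,
      image_insert, hcur, sdiff_insert]
  have herase : ∀ v ∈ (alive N i q).erase cur, v ≠ p →
      nbrs G v ∩ (alive N i q).erase cur = nbrs G v ∩ alive N i q := fun v hv hvp => by
    rw [inter_erase, erase_eq_of_notMem]
    intro hc
    refine hvp ?_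
    rw [← mem_singleton, ← hp]
    exact mem_inter.2 ⟨mem_nbrs_symm (mem_inter.1 hc).1, mem_of_mem_erase hv⟩
  have hcp : cur ∈ nbrs G p ∩ alive N i q := mem_inter.2 ⟨mem_nbrs_symm hpS.1, hm⟩
  have htail : tail ≤ tail' := by
    by_cases hd : dg p - 1 = 1
    · rw [(h₁ hd).1]; omega
    · rw [h₂ hd]
  have hpq : ∀ j < i, q j ≠ p := fun j hj e =>
    (mem_sdiff.1 hpS.2).2 (mem_image.2 ⟨j, mem_range.2 hj, e⟩)
  have hnew : ∀ j < tail', j < tail ∨ j = tail ∧ q' j = p ∧ dg p = 2 := fun j hj => by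
    by_cases hd : dg p - 1 = 1
    · obtain ⟨e₁, e₂⟩ := h₁ hd
      rcases Nat.lt_or_ge j tail with hj' | hj'
      · exact Or.inl hj'
      · obtain rfl : j = tail := by omega
        exact Or.inr ⟨rfl, e₂, by omega⟩
    · rw [h₂ hd] at hj
      exact Or.inl hj
  have hpnot : dg p = 2 → ∀ j < tail, q j ≠ p := fun hd j hj e => by
    rcases Nat.lt_or_ge j i with hj' | hj'
    · exact hpq j hj' e
    · have := (h.queue p hpS.2).1 ⟨j, hj', hj, e⟩
      omega
  refine ⟨hS ▸ h.tree.erase hm hp, by omega, fun j hj => ?_, fun j hj k hk e => ?_,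
    fun v hv => ?_, fun v hv => ?_, fun v hv => ?_, fun v hv => ?_, fun k hk => ?_⟩
  · rcases hnew j hj with hj' | ⟨-, e, -⟩
    · rw [hq j hj']; exact h.lt j hj'
    · rw [e]; exact h.tree.lt p hpS.2
  · rcases hnew j hj with hj' | ⟨e₁, e₂, e₃⟩ <;> rcases hnew k hk with hk' | ⟨e₄, e₅, e₆⟩
    · rw [hq j hj', hq k hk'] at e; exact h.inj j hj' k hk' e
    · rw [hq j hj', e₅] at e; exact absurd e (hpnot e₆ j hj')
    · rw [hq k hk', e₂] at e; exact absurd e.symm (hpnot e₃ k hk')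
    · omega
  · rw [hS] at hv ⊢
    by_cases hvp : v = p
    · subst hvp
      rw [upd_same, h.deg v hpS.2, inter_erase, card_erase_of_mem hcp]
    · rw [upd_ne _ _ hvp, herase v hv hvp, h.deg v (mem_of_mem_erase hv)]
  · rw [hS] at hv ⊢
    by_cases hvp : v = p
    · subst hvp
      rw [upd_same, h.sum v hpS.2, inter_erase, ← add_sum_erase _ _ hcp, Nat.add_sub_cancel_left]
    · rw [upd_ne _ _ hvp, herase v hv hvp, h.sum v (mem_of_mem_erase hv)]
  · rw [hS] at hv ⊢
    by_cases hvp : v = p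
    · subst hvp
      rw [upd_same, h.weight v hpS.2, inter_erase, ← add_sum_erase _ _ hcp, hw,
        edgeWeight_symm cur v]
      ring
    · rw [upd_ne _ _ hvp, herase v hv hvp, h.weight v (mem_of_mem_erase hv)]
  · rw [hS] at hv
    have hvS := mem_of_mem_erase hv
    have hvc : v ≠ cur := (mem_erase.1 hv).1
    have hold := h.queue v hvS
    by_cases hvp : v = p
    · subst hvp
      rw [upd_same]
      constructor
      · rintro ⟨j, hj₁, hj₂, e⟩
        rcases hnew j hj₂ with hj' | ⟨-, -, hd⟩
        · rw [hq j hj'] at e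
          have := hold.1 ⟨j, by omega, hj', e⟩
          omega
        · omega
      · intro hd
        by_cases hd' : dg v - 1 = 1
        · obtain ⟨e₁, e₂⟩ := h₁ hd'
          exact ⟨tail, by omega, by omega, e₂⟩
        · obtain ⟨j, hj₁, hj₂, e⟩ := hold.2 (by omega)
          have : j ≠ i := fun e' => hvc (by rw [← e, e', hcur])
          exact ⟨j, by omega, by omega, by rw [hq j hj₂, e]⟩
    · rw [upd_ne _ _ hvp, ← hold]
      constructor
      · rintro ⟨j, hj₁, hj₂, e⟩
        rcases hnew j hj₂ with hj' | ⟨-, e', -⟩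
        · rw [hq j hj'] at e
          exact ⟨j, by omega, hj', e⟩
        · exact absurd (e.symm.trans e') hvp
      · rintro ⟨j, hj₁, hj₂, e⟩
        have : j ≠ i := fun e' => hvc (by rw [← e, e', hcur])
        exact ⟨j, by omega, by omega, by rw [hq j hj₂, e]⟩
  · rw [image_range_congr (q := q) fun j hj => hq j (by omega), hq k (by omega)]
    rcases Nat.lt_succ_iff_lt_or_eq.1 hk with hk' | rfl
    · rw [upd_ne _ _ hk'.ne, upd_ne _ _ hk'.ne]
      exact h.removed k hk'
    · rw [upd_same, upd_same, hcur]
      refine ⟨hpS.1, ?_, hw⟩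
      rw [range_add_one, image_insert, mem_insert, not_or, hcur]
      exact ⟨hpc, (mem_sdiff.1 hpS.2).2⟩

end

end FastCauchy

/-! ### The programs that compute an ordering of the vertices. -/

namespace FastCauchy

open RealRAM Finset

/-- Add up, for every vertex, the number of neighbours, the neighbours, and the weights of the edges. -/
def countProg : Prog := forLoop 133 134
  (.seq (.seq (.nset 131 (.get 0 (.reg 133))) (.nset 132 (.get 1 (.reg 133))))
  (.seq (.seq (.nput 120 (.reg 131) (.add (.get 120 (.reg 131)) (.const 1)))
    (.nput 120 (.reg 132) (.add (.get 120 (.reg 132)) (.const 1))))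
  (.seq (.seq (.nput 121 (.reg 131) (.add (.get 121 (.reg 131)) (.reg 132)))
    (.nput 121 (.reg 132) (.add (.get 121 (.reg 132)) (.reg 131))))
  (.seq (.rput 120 (.reg 131) (.add (.get 120 (.reg 131)) (.get 0 (.reg 133))))
    (.rput 120 (.reg 132) (.add (.get 120 (.reg 132)) (.get 0 (.reg 133))))))))

/-- Put the leaves into the queue. -/
def leafProg : Prog := .seq (.nset 130 (.const 0)) (forLoop 133 0
  (.cond (.nlt (.get 120 (.reg 133)) (.const 2))
    (.seq (.nput 122 (.reg 130) (.reg 133)) (.nset 130 (.add (.reg 130) (.const 1)))) .skip))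

/-- Remove leaves until one vertex is left. -/
def stripProg : Prog := forLoop 133 134
  (.seq (.seq (.nset 131 (.get 122 (.reg 133))) (.nset 132 (.get 121 (.reg 131))))
  (.seq (.seq (.nput 123 (.reg 133) (.reg 132)) (.rput 121 (.reg 133) (.get 120 (.reg 131))))
  (.seq (.nput 120 (.reg 132) (.sub (.get 120 (.reg 132)) (.const 1)))
  (.seq (.nput 121 (.reg 132) (.sub (.get 121 (.reg 132)) (.reg 131)))
  (.seq (.rput 120 (.reg 132) (.sub (.get 120 (.reg 132)) (.get 120 (.reg 131))))
  (.cond (.neq (.get 120 (.reg 132)) (.const 1))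
    (.seq (.nput 122 (.reg 130) (.reg 132)) (.nset 130 (.add (.reg 130) (.const 1)))) .skip))))))

/-- Number the vertices in the order opposite to that of their removal. -/
def relabelProg : Prog :=
  .seq (forLoop 133 0 (.seq (.nput 101 (.sub (.reg 134) (.reg 133)) (.get 122 (.reg 133)))
    (.nput 124 (.get 122 (.reg 133)) (.sub (.reg 134) (.reg 133)))))
  (forLoop 133 134 (.seq (.nput 100 (.sub (.reg 134) (.reg 133)) (.get 124 (.get 123 (.reg 133))))
    (.rput 100 (.sub (.reg 134) (.reg 133)) (.get 121 (.reg 133)))))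

/-- Compute an enumeration of the vertices of a tree. -/
def rootProg : Prog := .seq (.nset 134 (.sub (.reg 0) (.const 1)))
  (.seq countProg (.seq leafProg (.seq stripProg relabelProg)))

section

variable {N : ℕ} {G : WeightedTree N} {E : List (Fin N × Fin N)} {σ : State}

theorem upd_add_upd_add {α : Type} [AddCommMonoid α] (X : ℕ → α) (u v : ℕ) (a b : α) (z : ℕ) :
    upd (upd X u (X u + a)) v (upd X u (X u + a) v + b) z =
      X z + ((if u = z then a else 0) + if v = z then b else 0) := by
  by_cases h₁ : z = u <;> by_cases h₂ : z = v
  · subst h₁; subst h₂; simp [add_assoc]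
  · subst h₁; simp [upd, h₂, Ne.symm h₂]
  · subst h₂; simp [upd, h₁, Ne.symm h₁]
  · simp [upd, h₁, h₂, Ne.symm h₁, Ne.symm h₂]

theorem runsWithin_countProg {n : ℕ} (hn : σ.nreg 134 = n) (h₁ : σ.narr 120 = fun _ => 0)
    (h₂ : σ.narr 121 = fun _ => 0) (h₃ : σ.rarr 120 = fun _ => 0) :
    RunsWithin countProg σ (n * 68 + 6) fun τ => ∀ z,
      τ.narr 120 z = ∑ m ∈ range n, ((if σ.narr 0 m = z then 1 else 0) +
        if σ.narr 1 m = z then 1 else 0) ∧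
      τ.narr 121 z = ∑ m ∈ range n, ((if σ.narr 0 m = z then σ.narr 1 m else 0) +
        if σ.narr 1 m = z then σ.narr 0 m else 0) ∧
      τ.rarr 120 z = ∑ m ∈ range n, ((if σ.narr 0 m = z then σ.rarr 0 m else 0) +
        if σ.narr 1 m = z then σ.rarr 0 m else 0) := by
  refine (RunsWithin.forLoopF (n := n) (C := 60) (fun j τ => ∀ z,
      τ.narr 120 z = ∑ m ∈ range j, ((if σ.narr 0 m = z then 1 else 0) +
        if σ.narr 1 m = z then 1 else 0) ∧
      τ.narr 121 z = ∑ m ∈ range j, ((if σ.narr 0 m = z then σ.narr 1 m else 0) +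
        if σ.narr 1 m = z then σ.narr 0 m else 0) ∧
      τ.rarr 120 z = ∑ m ∈ range j, ((if σ.narr 0 m = z then σ.rarr 0 m else 0) +
        if σ.narr 1 m = z then σ.rarr 0 m else 0)) hn (fun z => by simp [h₁, h₂, h₃])
    fun j τ hj hJ hf hI => ?_).imp fun τ h => h.1
  have e₁ : τ.narr 0 = σ.narr 0 := hf.na 0
  have e₂ : τ.narr 1 = σ.narr 1 := hf.na 1
  have e₃ : τ.rarr 0 = σ.rarr 0 := hf.ra 0
  refine RunsWithin.straight 60 rfl (by decide) fun z => ?_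
  obtain ⟨i₁, i₂, i₃⟩ := hI z
  rw [sum_range_succ, sum_range_succ, sum_range_succ, ← i₁, ← i₂, ← i₃, ← upd_add_upd_add,
    ← upd_add_upd_add, ← upd_add_upd_add]
  refine ⟨?_, ?_, ?_⟩ <;>
  simp [Prog.run, NExpr.eval, RExpr.eval, upd, hJ, e₁, e₂, e₃]

theorem runsWithin_leafProg (hN : σ.nreg 0 = N) :
    RunsWithin leafProg σ (N * 20 + 8) fun τ => (∀ k < τ.nreg 130, τ.narr 122 k < N) ∧
      (∀ k < τ.nreg 130, ∀ l < τ.nreg 130, τ.narr 122 k = τ.narr 122 l → k = l) ∧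
      ∀ v < N, (∃ k < τ.nreg 130, τ.narr 122 k = v) ↔ σ.narr 120 v < 2 := by
  refine RunsWithin.andThen (RunsWithin.straight (Q := fun τ => τ.nreg 130 = 0) 2 rfl le_rfl
    (by simp [Prog.run, NExpr.eval])) fun σ₁ h₁ hf₁ => ?_
  refine (RunsWithin.forLoopF (n := N) (C := 12) (fun j τ => (∀ k < τ.nreg 130, τ.narr 122 k < j) ∧
      (∀ k < τ.nreg 130, ∀ l < τ.nreg 130, τ.narr 122 k = τ.narr 122 l → k = l) ∧
      ∀ v < j, (∃ k < τ.nreg 130, τ.narr 122 k = v) ↔ σ.narr 120 v < 2) ((hf₁.n 0).trans hN)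
      (by simp [upd, h₁])
    fun j τ hj hJ hf ⟨i₁, i₂, i₃⟩ => ?_).mono (by omega) fun τ h => h.1
  have e₁ : τ.narr 120 = σ.narr 120 := by rw [hf.na 120, hf₁.na 120]
  refine RunsWithin.straight 12 rfl (by decide) ?_
  by_cases hd : σ.narr 120 j < 2
  · have hold : ∀ k < τ.nreg 130, upd (τ.narr 122) (τ.nreg 130) j k = τ.narr 122 k :=
      fun k hk => upd_ne _ _ (by omega)
    simp only [Prog.run, Test.Holds, NExpr.eval, hJ, e₁, hd, if_true, upd_same]
    simp only [upd_ne _ _ (show (130 : ℕ) ≠ 133 by decide), upd_same]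
    refine ⟨fun k hk => ?_, fun k hk l hl e => ?_, fun v hv => ⟨?_, fun h => ?_⟩⟩
    · rcases Nat.lt_succ_iff_lt_or_eq.1 hk with hk | rfl
      · rw [hold k hk]; exact (i₁ k hk).trans (Nat.lt_succ_self _)
      · rw [upd_same]; exact Nat.lt_succ_self _
    · rcases Nat.lt_succ_iff_lt_or_eq.1 hk with hk | rfl <;>
      rcases Nat.lt_succ_iff_lt_or_eq.1 hl with hl | rfl
      · rw [hold k hk, hold l hl] at e; exact i₂ k hk l hl e
      · rw [hold k hk, upd_same] at e; have := i₁ k hk; omega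
      · rw [hold l hl, upd_same] at e; have := i₁ l hl; omega
      · rfl
    · rintro ⟨k, hk, e⟩
      rcases Nat.lt_succ_iff_lt_or_eq.1 hk with hk | rfl
      · rw [hold k hk] at e
        exact (i₃ v (e ▸ i₁ k hk)).1 ⟨k, hk, e⟩
      · rw [upd_same] at e; exact e ▸ hd
    · rcases Nat.lt_succ_iff_lt_or_eq.1 hv with hv | rfl
      · obtain ⟨k, hk, e⟩ := (i₃ v hv).2 h
        exact ⟨k, hk.trans (Nat.lt_succ_self _), by rw [hold k hk, e]⟩
      · exact ⟨_, Nat.lt_succ_self _, upd_same _ _ _⟩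
  · simp only [Prog.run, Test.Holds, NExpr.eval, hJ, e₁, hd, if_false,
      upd_ne _ _ (show (130 : ℕ) ≠ 133 by decide)]
    refine ⟨fun k hk => (i₁ k hk).trans (Nat.lt_succ_self _), i₂, fun v hv => ?_⟩
    rcases Nat.lt_succ_iff_lt_or_eq.1 hv with hv | rfl
    · exact i₃ v hv
    · refine ⟨fun ⟨k, hk, e⟩ => ?_, fun h => absurd h hd⟩
      have := i₁ k hk
      omega

theorem runsWithin_stripProg {n : ℕ} (hn : σ.nreg 134 = n) (hnN : n + 1 = N)
    (h : StripInv G 0 (σ.narr 122) (σ.nreg 130) (σ.narr 120) (σ.narr 121) (σ.rarr 120) (σ.narr 123)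
      (σ.rarr 121)) :
    RunsWithin stripProg σ (n * 58 + 6) fun τ => StripInv G n (τ.narr 122) (τ.nreg 130)
      (τ.narr 120) (τ.narr 121) (τ.rarr 120) (τ.narr 123) (τ.rarr 121) := by
  refine (RunsWithin.forLoopF (n := n) (C := 50) (fun j τ => StripInv G j (τ.narr 122) (τ.nreg 130)
      (τ.narr 120) (τ.narr 121) (τ.rarr 120) (τ.narr 123) (τ.rarr 121)) hn (by simpa [upd] using h)
    fun j τ hj hJ hf hI => ?_).imp fun τ h => h.1
  refine RunsWithin.straight 50 rfl (by decide) ?_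
  obtain ⟨cur, hcur⟩ : ∃ cur, τ.narr 122 j = cur := ⟨_, rfl⟩
  obtain ⟨p, hp⟩ : ∃ p, τ.narr 121 cur = p := ⟨_, rfl⟩
  by_cases hd : τ.narr 120 p - 1 = 1
  · have := hI.step (q' := upd (τ.narr 122) (τ.nreg 130) p) (tail' := τ.nreg 130 + 1) (by omega)
      hcur hp (fun k hk => upd_ne _ _ (by omega)) (fun _ => ⟨rfl, upd_same _ _ _⟩)
      fun h => absurd hd h
    convert this using 1 <;>
    simp [Prog.run, Test.Holds, NExpr.eval, RExpr.eval, upd, hJ, hcur, hp, hd]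
  · have := hI.step (q' := τ.narr 122) (tail' := τ.nreg 130) (by omega)
      hcur hp (fun k hk => rfl) (fun h => absurd h hd) fun _ => rfl
    convert this using 1 <;>
    simp [Prog.run, Test.Holds, NExpr.eval, RExpr.eval, upd, hJ, hcur, hp, hd]

/-- The vertex removed in step `k` gets the number `n - k`. Its remaining neighbour is removed
later, and so has a smaller number, as a parent must. -/
theorem runsWithin_relabelProg {n tail : ℕ} {q : ℕ → ℕ} (hN : σ.nreg 0 = N) (hn : σ.nreg 134 = n)
    (hnN : n + 1 = N) (hq : σ.narr 122 = q) {dg ns : ℕ → ℕ} {ws : ℕ → ℝ}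
    (h : StripInv G n q tail dg ns ws (σ.narr 123) (σ.rarr 121)) :
    RunsWithin relabelProg σ (N * 50 + 20) fun τ =>
      IsOrdering G (τ.narr 101) (τ.narr 100) (τ.rarr 100) := by
  have ht := h.lt_tail
  have hlt : ∀ k < N, q k < N := fun k hk => h.lt k (by omega)
  have hinj : ∀ k < N, ∀ l < N, q k = q l → k = l := fun k hk l hl =>
    h.inj k (by omega) l (by omega)
  refine RunsWithin.andThen (RunsWithin.forLoopF (n := N) (C := 15) (fun j τ => ∀ k < j,
    τ.narr 101 (n - k) = q k ∧ τ.narr 124 (q k) = n - k) hN (fun k hk => absurd hk (by omega))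
    fun j τ hj hJ hf hI => ?_) fun σ₁ ⟨h₁, _⟩ hf₁ => ?_
  · have e₁ : τ.narr 122 = q := by rw [hf.na 122, hq]
    have e₂ : τ.nreg 134 = n := by rw [hf.n 134, hn]
    refine RunsWithin.straight 15 rfl (by decide) fun k hk => ?_
    simp only [Prog.run, NExpr.eval, hJ, e₁, e₂, upd_same, upd_ne _ _ (show (122 : ℕ) ≠ 101 by decide),
      upd_ne _ _ (show (101 : ℕ) ≠ 124 by decide), upd_ne _ _ (show (124 : ℕ) ≠ 101 by decide)]
    by_cases hkj : k = j
    · subst hkj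
      simp
    · rw [upd_ne _ _ (by omega), upd_ne _ _ fun e => hkj (hinj k (by omega) j hj e)]
      exact hI k (by omega)
  · have hn₁ : σ₁.nreg 134 = n := by rw [hf₁.n 134, hn]
    refine (RunsWithin.forLoopF (n := n) (C := 15) (fun j τ => ∀ k < j,
      τ.narr 100 (n - k) = σ₁.narr 124 (σ.narr 123 k) ∧ τ.rarr 100 (n - k) = σ.rarr 121 k) hn₁
      (fun k hk => absurd hk (by omega)) fun j τ hj hJ hf hI => ?_).frame.mono (by omega)
      fun τ ⟨⟨h₂, _⟩, hf₂⟩ => ?_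
    · have e₁ : τ.narr 123 = σ.narr 123 := by rw [hf.na 123, hf₁.na 123]
      have e₂ : τ.nreg 134 = n := by rw [hf.n 134, hn₁]
      have e₃ : τ.rarr 121 = σ.rarr 121 := by rw [hf.ra 121, hf₁.ra 121]
      have e₄ : τ.narr 124 = σ₁.narr 124 := hf.na 124
      refine RunsWithin.straight 15 rfl (by decide) fun k hk => ?_
      simp only [Prog.run, NExpr.eval, RExpr.eval, hJ, e₁, e₂, e₃, e₄, upd_same]
      by_cases hkj : k = j
      · subst hkj
        simp
      · rw [upd_ne _ _ (by omega), upd_ne _ _ (by omega)]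
        exact hI k (by omega)
    have hord : ∀ k < N, τ.narr 101 k = q (n - k) := fun k hk => by
      rw [hf₂.na 101, ← (h₁ (n - k) (by omega)).1]
      congr 1
      omega
    -- The queue holds `N` different vertices, hence all of them.
    have hsurj : ∀ v < N, ∃ l < N, q l = v := fun v hv => by
      have : (range N).image q = range N := by
        refine eq_of_subset_of_card_le (fun v hv => ?_) ?_
        · obtain ⟨k, hk, rfl⟩ := mem_image.1 hv
          exact mem_range.2 (hlt k (mem_range.1 hk))
        · rw [card_image_of_injOn]
          intro k hk l hl e
          exact hinj k (by simpa using hk) l (by simpa using hl) e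
      obtain ⟨l, hl, e⟩ := mem_image.1 (this.symm ▸ mem_range.2 hv : v ∈ (range N).image q)
      exact ⟨l, mem_range.1 hl, e⟩
    have hpar : ∀ k, 0 < k → k < N → ∃ l < N, n - k < l ∧ q l = σ.narr 123 (n - k) ∧
        τ.narr 100 k = n - l := fun k hk hkN => by
      obtain ⟨r₁, r₂, -⟩ := h.removed (n - k) (by omega)
      obtain ⟨l, hl, e⟩ := hsurj _ (lt_of_mem_nbrs r₁)
      refine ⟨l, hl, ?_, e, ?_⟩
      · by_contra hc
        exact r₂ (mem_image.2 ⟨l, mem_range.2 (by omega), e⟩)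
      · rw [← (h₁ l hl).2, e, ← (h₂ (n - k) (by omega)).1]
        congr 1
        omega
    refine ⟨fun k hk => hord k hk ▸ hlt _ (by omega), fun k hk l hl e => ?_, fun k hk hkN => ?_,
      fun k hk hkN => ?_⟩
    · rw [hord k hk, hord l hl] at e
      have := hinj _ (by omega) _ (by omega) e
      omega
    · obtain ⟨l, hl, hl', -, e⟩ := hpar k hk hkN
      omega
    · obtain ⟨l, hl, hl', e₁, e₂⟩ := hpar k hk hkN
      obtain ⟨r₁, -, r₃⟩ := h.removed (n - k) (by omega)
      have e₃ : τ.narr 101 (τ.narr 100 k) = σ.narr 123 (n - k) := by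
        rw [e₂, hord _ (by omega), ← e₁]
        congr 1
        omega
      have e₄ : τ.rarr 100 k = σ.rarr 121 (n - k) := by
        rw [← (h₂ (n - k) (by omega)).2]
        congr 1
        omega
      obtain ⟨a₁, a₂, a₃⟩ := mem_nbrs.1 r₁
      simp only [e₃, e₄, hord k hkN]
      exact ⟨a₁, a₂, a₃, by rw [r₃, edgeWeight, dif_pos ⟨a₁, a₂⟩]⟩

theorem runsWithin_rootProg (hE : G.IsEdgeList E) (hN : σ.nreg 0 = N)
    (hU : ∀ m : Fin E.length, σ.narr 0 m = (E.get m).1)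
    (hV : ∀ m : Fin E.length, σ.narr 1 m = (E.get m).2)
    (hw : ∀ m : Fin E.length, σ.rarr 0 m = G.weight s((E.get m).1, (E.get m).2))
    (z₁ : σ.narr 120 = fun _ => 0) (z₂ : σ.narr 121 = fun _ => 0) (z₃ : σ.rarr 120 = fun _ => 0) :
    RunsWithin rootProg σ (N * 250) fun τ =>
      IsOrdering G (τ.narr 101) (τ.narr 100) (τ.rarr 100) := by
  have hl := edgeList_length hE
  refine RunsWithin.andThen (RunsWithin.straight (Q := fun τ => τ.nreg 134 = E.length ∧
    τ.narr = σ.narr ∧ τ.rarr = σ.rarr) 4 rfl le_rfl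
    ⟨by simp [Prog.run, NExpr.eval, hN]; omega, rfl, rfl⟩) fun σ₁ ⟨h₁, a₁, r₁⟩ hf₁ => ?_
  refine RunsWithin.andThen (runsWithin_countProg h₁ (by rw [a₁, z₁]) (by rw [a₁, z₂])
    (by rw [r₁, z₃])) fun σ₂ h₂ hf₂ => ?_
  have hdg : ∀ v, σ₂.narr 120 v = (nbrs G v).card := fun v => by
    rw [(h₂ v).1, card_eq_sum_ones, ← sum_nbrs hE, sum_range]
    simp only [a₁, hU, hV]
  have hns : ∀ v, σ₂.narr 121 v = ∑ u ∈ nbrs G v, u := fun v => by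
    rw [(h₂ v).2.1, ← sum_nbrs hE, sum_range]
    simp only [a₁, hU, hV]
  have hws : ∀ v, σ₂.rarr 120 v = ∑ u ∈ nbrs G v, edgeWeight G v u := fun v => by
    rw [(h₂ v).2.2, ← sum_nbrs hE, sum_range]
    refine sum_congr rfl fun m _ => ?_
    rw [a₁, r₁, hU, hV, hw]
    congr 1
    · split_ifs with e
      · rw [← e, edgeWeight, dif_pos ⟨Fin.isLt _, Fin.isLt _⟩]
      · rfl
    · split_ifs with e
      · rw [← e, edgeWeight_symm, edgeWeight, dif_pos ⟨Fin.isLt _, Fin.isLt _⟩]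
      · rfl
  refine RunsWithin.andThen (runsWithin_leafProg (N := N) (by rw [hf₂.n 0, hf₁.n 0, hN]))
    fun σ₃ ⟨q₁, q₂, q₃⟩ hf₃ => ?_
  have hal : alive N 0 (σ₃.narr 122) = range N := by simp [alive]
  have hinter : ∀ v, nbrs G v ∩ range N = nbrs G v := fun v =>
    inter_eq_left.2 fun u hu => mem_range.2 (lt_of_mem_nbrs hu)
  have hinv : StripInv G 0 (σ₃.narr 122) (σ₃.nreg 130) (σ₃.narr 120) (σ₃.narr 121) (σ₃.rarr 120)
      (σ₃.narr 123) (σ₃.rarr 121) := by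
    refine ⟨hal ▸ isAlive_range hE, Nat.zero_le _, q₁, q₂, fun v _ => ?_, fun v _ => ?_,
      fun v _ => ?_, fun v hv => ?_, fun k hk => absurd hk (by omega)⟩
    · rw [hal, hinter, hf₃.na 120, hdg]
    · rw [hal, hinter, hf₃.na 121, hns]
    · rw [hal, hinter, hf₃.ra 120, hws]
    · rw [hf₃.na 120, ← q₃ v (mem_range.1 (hal ▸ hv))]
      exact ⟨fun ⟨j, _, h⟩ => ⟨j, h⟩, fun ⟨j, h⟩ => ⟨j, Nat.zero_le _, h⟩⟩
  refine RunsWithin.andThen (runsWithin_stripProg (n := E.length) (by rw [hf₃.n 134, hf₂.n 134, h₁]) hl hinv)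
    fun σ₄ h₄ hf₄ => ?_
  exact (runsWithin_relabelProg (n := E.length)
    (by rw [hf₄.n 0, hf₃.n 0, hf₂.n 0, hf₁.n 0, hN])
    (by rw [hf₄.n 134, hf₃.n 134, hf₂.n 134, h₁]) hl rfl h₄).le (by omega)

end

end FastCauchy

/-! ### Tensor fields, one component at a time. -/

namespace FastCauchy

open RealRAM Finset

/-- Compute where the entries of the tensor field stand. -/
def baseProg (D : ℕ) : Prog := .seq (.nset 210 (.const 0)) (forLoop 211 0
  (.seq (.nput 102 (.reg 211) (.reg 210)) (.nset 210 (.add (.reg 210) (.const D)))))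

/-- Integrate one component of the tensor field. -/
noncomputable def componentProg (lam c : ℝ) : Prog :=
  .seq (fill 0 101 (.get 1 (.add (.get 102 (.get 101 (.reg 33))) (.reg 200))))
  (.seq (vecProg lam c)
  (forLoop 133 0 (.rput 2 (.add (.get 102 (.get 101 (.reg 133))) (.reg 200)) (.get 102 (.reg 133)))))

/-- Integration of a tensor field with `D` components. -/
noncomputable def integrationProg (lam c : ℝ) (D : ℕ) : Prog :=
  .seq rootProg (.seq (baseProg D) (.seq (.nset 201 (.const D))
    (forLoop 200 201 (componentProg lam c))))

section

variable {N D : ℕ} {G : WeightedTree N} {σ : State} {lam c : ℝ}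

/-- Indices cannot be multiplied, so the multiples of `D` are tabulated by repeated addition. -/
theorem runsWithin_baseProg (hN : σ.nreg 0 = N) :
    RunsWithin (baseProg D) σ (N * 20 + 8) fun τ => ∀ v < N, τ.narr 102 v = v * D := by
  refine RunsWithin.andThen (RunsWithin.straight (Q := fun τ => τ.nreg 210 = 0) 2 rfl le_rfl
    (by simp [Prog.run, NExpr.eval])) fun σ₁ h₁ hf₁ => ?_
  refine (RunsWithin.forLoopF (n := N) (C := 12) (fun j τ => τ.nreg 210 = j * D ∧
    ∀ v < j, τ.narr 102 v = v * D) ((hf₁.n 0).trans hN) (by simp [upd, h₁])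
    fun j τ hj hJ hf ⟨i₁, i₂⟩ => ?_).mono (by omega) fun τ h => h.1.2
  refine RunsWithin.straight 12 rfl (by simp [Prog.wcost, NExpr.cost]) ⟨?_, fun v hv => ?_⟩
  · simp [Prog.run, NExpr.eval, upd, i₁, add_mul]
  · simp only [Prog.run, NExpr.eval, upd_same, hJ, i₁]
    rcases Nat.lt_succ_iff_lt_or_eq.1 hv with hv | rfl
    · rw [upd_ne _ _ (by omega)]; exact i₂ v hv
    · rw [upd_same]

theorem sum_comp_injOn {ord : ℕ → ℕ} (hlt : ∀ k < N, ord k < N)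
    (hinj : ∀ k < N, ∀ l < N, ord k = ord l → k = l) (g : ℕ → ℝ) :
    ∑ j ∈ range N, g (ord j) = ∑ u ∈ range N, g u := by
  have hi : Set.InjOn ord (range N) := fun k hk l hl e =>
    hinj k (by simpa using hk) l (by simpa using hl) e
  have : (range N).image ord = range N := by
    refine eq_of_subset_of_card_le (fun v hv => ?_) (card_image_of_injOn hi).ge
    obtain ⟨k, hk, rfl⟩ := mem_image.1 hv
    exact mem_range.2 (hlt k (mem_range.1 hk))
  rw [← sum_image hi, this]

theorem exists_eq_of_injOn {ord : ℕ → ℕ} (hlt : ∀ k < N, ord k < N)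
    (hinj : ∀ k < N, ∀ l < N, ord k = ord l → k = l) {v : ℕ} (hv : v < N) :
    ∃ k < N, ord k = v := by
  by_contra! h
  have := sum_comp_injOn hlt hinj fun u => if u = v then 1 else 0
  rw [sum_ite_eq', if_pos (mem_range.2 hv), sum_eq_zero] at this
  · exact zero_ne_one this
  · intro k hk
    rw [if_neg (h k (mem_range.1 hk))]

/-- What the integration of one component relies on. -/
structure Rooted (G : WeightedTree N) (D : ℕ) (X : ℕ → ℝ) (σ : State) : Prop where
  size : σ.nreg 0 = N
  ordering : IsOrdering G (σ.narr 101) (σ.narr 100) (σ.rarr 100)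
  base : ∀ v < N, σ.narr 102 v = v * D
  field : σ.rarr 1 = X

theorem Rooted.congr {X : ℕ → ℝ} {τ : State} (h : Rooted G D X σ) (h₁ : τ.nreg 0 = σ.nreg 0)
    (h₂ : ∀ k, 100 ≤ k → k < 103 → τ.narr k = σ.narr k) (h₃ : τ.rarr 100 = σ.rarr 100)
    (h₄ : τ.rarr 1 = σ.rarr 1) : Rooted G D X τ where
  size := h₁.trans h.size
  ordering := by
    rw [h₂ 101 (by omega) (by omega), h₂ 100 (by omega) (by omega), h₃]; exact h.ordering
  base := by rw [h₂ 102 (by omega) (by omega)]; exact h.base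
  field := h₄.trans h.field

theorem eq_of_mul_add_eq {v u q p : ℕ} (hq : q < D) (hp : p < D) (h : v * D + q = u * D + p) :
    v = u ∧ q = p := by
  have h₁ := congrArg (· % D) h
  simp only [Nat.mul_add_mod_self_right, Nat.mod_eq_of_lt hq, Nat.mod_eq_of_lt hp] at h₁
  subst h₁
  exact ⟨Nat.eq_of_mul_eq_mul_right (by omega) (Nat.add_right_cancel h), rfl⟩

/-- The integration works with the numbers of the ordering, while input and output are indexed by
the original vertices. Reading and writing through `ord` converts between the two; since `ord`
permutes the vertices, the sums agree. -/
theorem runsWithin_componentProg {X : ℕ → ℝ} {q : ℕ} (hσ : Rooted G D X σ) (hN : 0 < N)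
    (hc : ∀ i j, G.dist i j ≠ -c) (h200 : σ.nreg 200 = q) (hq : q < D) :
    RunsWithin (componentProg lam c) σ (200100 * N * (Nat.log 2 N + 1) ^ 3) fun τ =>
      Rooted G D X τ ∧
      (∀ v < N, τ.rarr 2 (v * D + q) = ∑ u ∈ range N, Real.exp (lam * ordDist G id v u) /
        (ordDist G id v u + c) * X (u * D + q)) ∧
      ∀ v p, p < D → p ≠ q → τ.rarr 2 (v * D + p) = σ.rarr 2 (v * D + p) := by
  have hL : 1 ≤ (Nat.log 2 N + 1) ^ 3 := Nat.one_le_pow _ _ (Nat.succ_pos _)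
  have e1 : 100 * N * 1 ≤ 100 * N * (Nat.log 2 N + 1) ^ 3 := Nat.mul_le_mul_left _ hL
  have e2 : 200100 * N * (Nat.log 2 N + 1) ^ 3 = 100 * N * (Nat.log 2 N + 1) ^ 3 +
    200000 * N * (Nat.log 2 N + 1) ^ 3 := by ring
  obtain ⟨ord, hord⟩ : ∃ ord, σ.narr 101 = ord := ⟨_, rfl⟩
  have hO := hσ.ordering
  rw [hord] at hO
  have hbase : ∀ j < N, σ.narr 102 (ord j) = ord j * D := fun j hj => hσ.base _ (hO.lt j hj)
  refine RunsWithin.andThen (runsWithin_fill 0 101 _ N (fun j => X (ord j * D + q)) hσ.size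
    fun j Y hj => ?_) fun σ₁ h₁ hf₁ => ?_
  · simp [RExpr.eval, NExpr.eval, upd, hord, hbase j hj, h200, hσ.field]
  have hc' : ∀ i < N, ∀ j < N, ordDist G ord i j ≠ -c := fun i hi j hj => by
    rw [ordDist, dif_pos ⟨hO.lt i hi, hO.lt j hj⟩]; exact hc _ _
  refine RunsWithin.andThen (runsWithin_vecProg (lam := lam) hO.rootedTree hc'
    ((hf₁.n 0).trans hσ.size) hN (hf₁.na 100) (hf₁.ra 100) rfl) fun σ₂ h₂ hf₂ => ?_
  have hk := VecKept.of_frame hf₂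
  have hσ₂ : Rooted G D X σ₂ := hσ.congr (by rw [hk.nreg 0 (by omega), hf₁.n 0])
    (fun k _ _ => by rw [hk.narr k (by omega), hf₁.na k])
    (by rw [hk.rarr 100 (by omega), hf₁.ra 100]) (by rw [hk.rarr 1 (by omega), hf₁.ra 1])
  have ho₂ : σ₂.narr 101 = ord := by rw [hk.narr 101 (by omega), hf₁.na 101, hord]
  have hq₂ : σ₂.nreg 200 = q := by rw [hk.nreg 200 (by omega), hf₁.n 200, h200]
  have hr₂ : σ₂.rarr 2 = σ.rarr 2 := by rw [hk.rarr 2 (by omega), hf₁.ra 2]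
  refine (RunsWithin.forLoopF (n := N) (C := 11) (fun j τ =>
    (∀ k < j, τ.rarr 2 (ord k * D + q) = σ₂.rarr 102 k) ∧
    ∀ v p, p < D → p ≠ q → τ.rarr 2 (v * D + p) = σ.rarr 2 (v * D + p)) hσ₂.size
    ⟨fun k hk => absurd hk (by omega), fun v p _ _ => by rw [hr₂]⟩
    fun j τ hj hJ hf hI => ?_).frame.mono (by omega) fun τ ⟨⟨⟨i₁, i₂⟩, _⟩, hf₃⟩ => ⟨?_, ?_, i₂⟩
  · have f₁ : τ.narr 101 = ord := by rw [hf.na 101, ho₂]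
    have f₂ : τ.narr 102 (ord j) = ord j * D := by rw [hf.na 102, hσ₂.base _ (hO.lt j hj)]
    have f₃ : τ.nreg 200 = q := by rw [hf.n 200, hq₂]
    have f₄ : τ.rarr 102 = σ₂.rarr 102 := hf.ra 102
    refine RunsWithin.straight 11 rfl (by decide) ⟨fun k hk => ?_, fun v p hp hpq => ?_⟩
    · simp only [Prog.run, NExpr.eval, RExpr.eval, hJ, f₁, f₂, f₃, f₄, upd_same]
      by_cases hkj : k = j
      · subst hkj; rw [upd_same]
      · rw [upd_ne _ _ fun e => hkj (hO.inj k (by omega) j hj (eq_of_mul_add_eq hq hq e).1)]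
        exact hI.1 k (by omega)
    · simp only [Prog.run, NExpr.eval, RExpr.eval, hJ, f₁, f₂, f₃, f₄, upd_same]
      rw [upd_ne _ _ fun e => hpq (eq_of_mul_add_eq hp hq e).2]
      exact hI.2 v p hp hpq
  · exact hσ₂.congr (hf₃.n 0) (fun k _ _ => hf₃.na k) (hf₃.ra 100) (hf₃.ra 1)
  · intro v hv
    obtain ⟨i, hi, rfl⟩ := exists_eq_of_injOn hO.lt hO.inj hv
    rw [i₁ i hi, h₂ i hi, ← sum_comp_injOn hO.lt hO.inj fun u => Real.exp (lam * ordDist G id (ord i) u) /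
      (ordDist G id (ord i) u + c) * X (u * D + q)]
    refine sum_congr rfl fun j hj => ?_
    rw [h₁.1 j (mem_range.1 hj)]
    rfl

set_option maxRecDepth 100000 in
theorem runsWithin_integrationProg {E : List (Fin N × Fin N)} {X : ℕ → ℝ} (hE : G.IsEdgeList E)
    (hc : ∀ i j, G.dist i j ≠ -c) (hN : σ.nreg 0 = N)
    (hU : ∀ m : Fin E.length, σ.narr 0 m = (E.get m).1)
    (hV : ∀ m : Fin E.length, σ.narr 1 m = (E.get m).2)
    (hw : ∀ m : Fin E.length, σ.rarr 0 m = G.weight s((E.get m).1, (E.get m).2))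
    (z₁ : σ.narr 120 = fun _ => 0) (z₂ : σ.narr 121 = fun _ => 0) (z₃ : σ.rarr 120 = fun _ => 0)
    (hX : σ.rarr 1 = X) :
    RunsWithin (integrationProg lam c D) σ
      ((200110 * D + 300) * N * (Nat.log 2 N + 1) ^ 3) fun τ =>
      ∀ v < N, ∀ q < D, τ.rarr 2 (v * D + q) = ∑ u ∈ range N,
        Real.exp (lam * ordDist G id v u) / (ordDist G id v u + c) * X (u * D + q) := by
  have hN1 : 0 < N := by have := edgeList_length hE; omega
  have hL : 1 ≤ (Nat.log 2 N + 1) ^ 3 := Nat.one_le_pow _ _ (Nat.succ_pos _)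
  obtain ⟨L, hL'⟩ : ∃ L, (Nat.log 2 N + 1) ^ 3 = L := ⟨_, rfl⟩
  have e1 : N * 1 ≤ N * L := Nat.mul_le_mul_left _ (hL' ▸ hL)
  have e2 : D * (200100 * N * L + 8) = 200100 * (D * (N * L)) + 8 * (D * 1) := by ring
  have e3 : D * 1 ≤ D * (N * L) := Nat.mul_le_mul_left _ (by omega)
  have e4 : (200110 * D + 300) * N * L = 200110 * (D * (N * L)) + 300 * (N * L) := by ring
  refine RunsWithin.andThen (runsWithin_rootProg hE hN hU hV hw z₁ z₂ z₃) fun σ₁ h₁ hf₁ => ?_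
  refine RunsWithin.andThen (runsWithin_baseProg (D := D) ((hf₁.n 0).trans hN))
    fun σ₂ h₂ hf₂ => ?_
  refine RunsWithin.andThen (RunsWithin.straight (Q := fun τ => τ.nreg 201 = D) 2 rfl le_rfl
    (by simp [Prog.run, NExpr.eval])) fun σ₃ h₃ hf₃ => ?_
  have hσ₃ : Rooted G D X σ₃ := by
    refine ⟨by rw [hf₃.n 0, hf₂.n 0, hf₁.n 0, hN], ?_, ?_, by rw [hf₃.ra 1, hf₂.ra 1, hf₁.ra 1, hX]⟩
    · rw [hf₃.na 101, hf₂.na 101, hf₃.na 100, hf₂.na 100, hf₃.ra 100, hf₂.ra 100]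
      exact h₁
    · rw [hf₃.na 102]; exact h₂
  refine (RunsWithin.forLoopF (n := D) (C := 200100 * N * L) (fun j τ => Rooted G D X τ ∧
    ∀ v < N, ∀ q < j, τ.rarr 2 (v * D + q) = ∑ u ∈ range N,
        Real.exp (lam * ordDist G id v u) / (ordDist G id v u + c) * X (u * D + q)) h₃
    ⟨hσ₃.congr (by simp [upd]) (fun _ _ _ => rfl) rfl rfl, fun v _ q hq => absurd hq (by omega)⟩
    fun j τ hj hJ hf hI => ?_).mono (by rw [hL']; omega) fun τ h => h.1.2
  refine (runsWithin_componentProg (lam := lam) hI.1 hN1 hc hJ hj).mono (by rw [hL'])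
    fun τ' ⟨k₁, k₂, k₃⟩ => ⟨k₁.congr (by simp [upd]) (fun _ _ _ => rfl) rfl rfl, fun v hv q hq => ?_⟩
  rcases Nat.lt_succ_iff_lt_or_eq.1 hq with hq | rfl
  · exact (k₃ v q (hq.trans hj) hq.ne).trans (hI.2 v hv q hq)
  · exact k₂ v hv

theorem store_flatten {s : ℕ} {d : Fin s → ℕ} (X : TensorField N d) (u : Fin N)
    (q : Fin (∏ k, d k)) : store X.flatten (u * (∏ k, d k) + q) = X u (finPiFinEquiv.symm q) := by
  have h : (u * (∏ k, d k) + q : ℕ) = (finProdFinEquiv (u, q) : Fin (N * ∏ k, d k)) := by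
    rw [finProdFinEquiv_apply_val, mul_comm, add_comm]
  rw [h, store_val, TensorField.flatten, Equiv.symm_apply_apply]

/-- The number of components belongs to the program text, so repeating the integration for each
component changes only the constant. -/
theorem integrationInTimeOn (lam c : ℝ) :
    IntegrationInTimeOn (fun z => Real.exp (lam * z) / (z + c)) {z : ℝ | z ≠ -c}
      (fun N => (N : ℝ) * Real.log N ^ 3) := by
  intro s d
  refine ⟨integrationProg lam c (∏ k, d k), fun N => (200110 * (∏ k, d k) + 300) * N *
    (Nat.log 2 N + 1) ^ 3, isBigO_log_pow _ _, fun N G E X hE hc => ?_⟩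
  refine (runsWithin_integrationProg (X := store X.flatten) hE hc rfl (fun m => ?_) (fun m => ?_)
    (fun m => ?_) rfl rfl rfl rfl).imp fun τ h m => ?_
  · exact store_val (fun m : Fin E.length => ((E.get m).1 : ℕ)) m
  · exact store_val (fun m : Fin E.length => ((E.get m).2 : ℕ)) m
  · exact store_val (fun m : Fin E.length => G.weight s((E.get m).1, (E.get m).2)) m
  · obtain ⟨⟨v, q⟩, rfl⟩ := finProdFinEquiv.surjective m
    rw [finProdFinEquiv_apply_val, add_comm, mul_comm, h v v.2 q q.2, TensorField.flatten,
      Equiv.symm_apply_apply, fIntegral, sum_range]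
    refine sum_congr rfl fun u _ => ?_
    rw [store_flatten, ordDist, dif_pos ⟨v.2, u.2⟩]
    rfl

end

end FastCauchy

theorem mainTheorem5 (lam c : ℝ) :
    (∀ (a b : ℕ) (x : Fin a → ℝ) (y : Fin b → ℝ), (∀ i j, x i + y j ∈ {z : ℝ | z ≠ -c}) →
      IsCauchyLike (fun i => x i + c / 2) (fun j => -(y j + c / 2)) 1
        (sumMatrix (fun z => Real.exp (lam * z) / (z + c)) x y)) ∧
    IsCordialOn (fun z => Real.exp (lam * z) / (z + c)) {z : ℝ | z ≠ -c} 2 ∧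
    IntegrationInTimeOn (fun z => Real.exp (lam * z) / (z + c)) {z : ℝ | z ≠ -c}
      (fun N => (N : ℝ) * Real.log N ^ 3) := by
  exact ⟨fun a b x y h => FastCauchy.isCauchyLike_sumMatrix lam c x y h,
    FastCauchy.isCordialOn lam c, FastCauchy.integrationInTimeOn lam c⟩
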